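/- **Setting.** Let $d\ge 1$. A $d$-dimensional Lipschitz manifold $M$ is a connected, second countable Hausdorff space with a countable atlas $(U_\alpha,\Phi_\alpha)_{\alpha\in A}$, where the open sets $U_\alpha$ cover $M$, each $\Phi_\alpha$ is a homeomorphism from $U_\alpha$ onto an open subset of $\mathbb R^d$ or of a closed half-space of $\mathbb R^d$, and all transition maps $\Phi_{\alpha'}\circ\Phi_\alpha^{-1}$ are locally Lipschitz. A chart of $M$ is any $(U,\Phi)$ of this kind whose transition maps to and from the charts of the atlas are locally Lipschitz. A Lipschitz Riemannian metric $g=(g_\alpha)$ is a family of scalar products $g_\alpha$ on $\Phi_\alpha(U_\alpha)$ with Borel coefficients that are a.e. compatible with the transition maps and satisfy, for some $\lambda_\alpha\ge1$, $\lambda_\alpha^{-1}|\xi|^2\le g_\alpha(\xi,\xi)\le\lambda_\alpha|\xi|^2$ a.e. on $\Phi_\alpha(U_\alpha)$ for all $\xi\in\mathbb R^d$. Thus $M$ may have a boundary and need not be complete. Let $\mathrm{vol}$ be the volume measure, given by $\sqrt{\det g_\alpha}\,dz$ in charts. Let $\mathsf d$ be the path distance $$\mathsf d(x,y)=\sup_{\mathrm{vol}(B)=0}\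 \inf_\gamma\ \mathrm{length}(\gamma),$$ where $\gamma:[0,1]\to M$ runs through the Lipschitz curves from $x$ to $y$ that have a well-defined length and spend zero time in $B$, and let $\mathsf B_r(x)$ be its open balls. Let $W^{1,2}(M)$ be the space of all $f\in L^2(M,\mathrm{vol})$ with a distributional differential $df$ such that $|df|_g\in L^2$; let $\mathcal E(f,h)=\frac12\int_M\langle df,dh\rangle_g\,d\mathrm{vol}$ on $W^{1,2}(M)$, and let $\Delta/2$ be its generator. The heat kernel $\mathsf p(t,x,y)$ is the jointly continuous integral kernel, with respect to $\mathrm{vol}$, of the heat flow $e^{t\Delta/2}$ on $L^2$, for $t>0$. For $b>1$ and $x\in M$, the Euclidean radius $r_E(x,b)\in[0,\infty]$ is the supremum (with $\sup\emptyset=0$) of all $r>0$ such that $\mathsf B_r(x)$ is relatively compact and contained in the domain of a chart $(U,\Phi)$ around $x$ in which $b^{-1}|\xi|^2\le g^U(\xi,\xi)\le b|\xi|^2$ a.e. on $\Phi(\mathsf B_r(x))$ for all $\xi\in\mathbb R^d$, where $g^U$ is the metric in this chart. **Theorem.** For every $d\ge1$ and $b>1$ there is a constant $C>0$, depending only on $b$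 and $d$, such that the following holds for every $d$-dimensional Lipschitz Riemannian manifold $(M,g)$, every $\varepsilon_1>0$ and every $\varepsilon_2>1$. Set $R(x)=\min\{r_E(x,b),\varepsilon_1\}/\varepsilon_2$. Then $0\le R\le\varepsilon_1/\varepsilon_2$; the function $R$ is Lipschitz with constant $1/\varepsilon_2$ with respect to $\mathsf d$; $R(x)>0$ whenever there is a chart $(U,\Phi)$ around $x$ with $b^{-1}|\xi|^2\le g^U(\xi,\xi)\le b|\xi|^2$ a.e. on $\Phi(U)$ for all $\xi$; and $$\mathsf p(t,x,y)\le C\,\min\{t,R(x)^2\}^{-d/2}\qquad\text{for all }x,y\in M\text{ and all }t>0,$$ where the right-hand side is $+\infty$ if $R(x)=0$. -/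

import Mathlib

open Set MeasureTheory Filter Topology
open scoped ENNReal NNReal ContDiff Matrix

universe u v

noncomputable section

namespace LipRiem

/-- Euclidean space of dimension `d`. -/
abbrev Euc (d : ℕ) : Type := EuclideanSpace ℝ (Fin d)

/-- The closed half-space; as in Mathlib's `EuclideanHalfSpace`, the distinguished coordinate is
the one with index `0`. -/
def halfSpace (d : ℕ) [NeZero d] : Set (Euc d) := {z | 0 ≤ z 0}

/-- A topological chart: a homeomorphism from an open set `source` of `M` onto an open subset
`target` of the Euclidean space or of the closed half-space. Only the values of the two maps on
`source` and on `target` matter. -/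
structure ModelChart (M : Type u) [TopologicalSpace M] (d : ℕ) [NeZero d] extends
    PartialEquiv M (Euc d) where
  open_source : IsOpen source
  open_target : ∃ O : Set (Euc d), IsOpen O ∧ (target = O ∨ target = O ∩ halfSpace d)
  continuousOn_toFun : ContinuousOn toFun source
  continuousOn_invFun : ContinuousOn invFun target

section Charts

variable {M : Type u} [TopologicalSpace M] {d : ℕ} [NeZero d]

/-- The image under `c` of the intersection of the domains of the charts `c` and `c'`. -/
def overlap (c c' : ModelChart M d) : Set (Euc d) :=
  c.target ∩ c.invFun ⁻¹' c'.source

/-- The transition map from `c` to `c'`, meaningful on `overlap c c'`. -/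
def transition (c c' : ModelChart M d) : Euc d → Euc d :=
  fun z => c'.toFun (c.invFun z)

end Charts

/-- A Lipschitz atlas: the domains cover and all transition maps are locally Lipschitz. -/
structure LipschitzAtlas (ι : Type v) (M : Type u) [TopologicalSpace M] (d : ℕ) [NeZero d] where
  chart : ι → ModelChart M d
  cover : ∀ x : M, ∃ i, x ∈ (chart i).source
  lipschitz : ∀ i j, LocallyLipschitzOn (overlap (chart i) (chart j))
    (transition (chart i) (chart j))

/-- The value of the bilinear form with matrix `G` at two vectors. -/
def bil {d : ℕ} (G : Matrix (Fin d) (Fin d) ℝ) (ξ η : Euc d) : ℝ :=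
  ξ.ofLp ⬝ᵥ (G *ᵥ η.ofLp)

variable {ι : Type v} {M : Type u} [TopologicalSpace M] {d : ℕ} [NeZero d]

/-- `c` is a chart of the Lipschitz manifold: it is Lipschitz compatible with the atlas. -/
def LipschitzAtlas.IsChart (A : LipschitzAtlas ι M d) (c : ModelChart M d) : Prop :=
  ∀ i, LocallyLipschitzOn (overlap c (A.chart i)) (transition c (A.chart i)) ∧
    LocallyLipschitzOn (overlap (A.chart i) c) (transition (A.chart i) c)

/-- A Lipschitz Riemannian metric, given by its matrices in the charts of the atlas: a family of
scalar products with Borel coefficients, compatible a.e. with the transition maps, and uniformly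
elliptic in every chart. -/
structure LRMetric (A : LipschitzAtlas ι M d) where
  coeff : ι → Euc d → Matrix (Fin d) (Fin d) ℝ
  measurable : ∀ i k l, Measurable fun z => coeff i z k l
  posDef : ∀ i, ∀ z ∈ (A.chart i).target, (coeff i z).PosDef
  compat : ∀ i j, ∀ᵐ z ∂(volume.restrict (overlap (A.chart i) (A.chart j))), ∀ ξ η : Euc d,
    bil (coeff j (transition (A.chart i) (A.chart j) z))
      (fderiv ℝ (transition (A.chart i) (A.chart j)) z ξ)
      (fderiv ℝ (transition (A.chart i) (A.chart j)) z η) = bil (coeff i z) ξ η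
  elliptic : ∀ i, ∃ lam : ℝ, 1 ≤ lam ∧
    ∀ᵐ z ∂(volume.restrict (A.chart i).target), ∀ ξ : Euc d,
      lam⁻¹ * ‖ξ‖ ^ 2 ≤ bil (coeff i z) ξ ξ ∧ bil (coeff i z) ξ ξ ≤ lam * ‖ξ‖ ^ 2

/-- A `1`-form: Borel covector fields in the charts of the atlas (covectors of the Euclidean space
are written as vectors), each of which is a.e. the pull-back of the others under the transition
maps. -/
structure OneForm (A : LipschitzAtlas ι M d) where
  coeff : ι → Euc d → Euc d
  measurable : ∀ i, Measurable (coeff i)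
  compat : ∀ i j, ∀ᵐ z ∂(volume.restrict (overlap (A.chart i) (A.chart j))), ∀ ξ : Euc d,
    inner ℝ (coeff j (transition (A.chart i) (A.chart j) z))
      (fderiv ℝ (transition (A.chart i) (A.chart j)) z ξ) = inner ℝ (coeff i z) ξ

/-- `θ` is the distributional differential of `f`: in every chart it is locally square integrable,
and it satisfies the integration by parts formula against all smooth functions with compact support
in the interior of the image of the chart. -/
def IsDifferential {A : LipschitzAtlas ι M d} (f : M → ℝ) (θ : OneForm A) : Prop :=
  ∀ i, LocallyIntegrableOn (fun z => ‖θ.coeff i z‖ ^ 2) (A.chart i).target ∧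
    ∀ φ : Euc d → ℝ, ContDiff ℝ ∞ φ → HasCompactSupport φ →
      tsupport φ ⊆ interior (A.chart i).target → ∀ ξ : Euc d,
        ∫ z in interior (A.chart i).target, f ((A.chart i).invFun z) * fderiv ℝ φ z ξ =
          - ∫ z in interior (A.chart i).target, inner ℝ (θ.coeff i z) ξ * φ z

namespace LRMetric

variable {A : LipschitzAtlas ι M d}

/-- `q` is the pointwise scalar product on `M` of the `1`-forms `θ` and `η`, taken with respect to
the co-metric, whose matrices are the inverses of those of the metric. For `η = θ` this is the
square of the pointwise norm of `θ`. -/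
def IsPairing (g : LRMetric A) (θ η : OneForm A) (q : M → ℝ) : Prop :=
  ∀ i, ∀ᵐ z ∂(volume.restrict (A.chart i).target),
    q ((A.chart i).invFun z) = bil (g.coeff i z)⁻¹ (θ.coeff i z) (η.coeff i z)

section Volume

variable [MeasurableSpace M]

/-- The volume measure inside the `i`-th chart: the push-forward to `M` of the measure with density
`√(det g_i)` on the image of the chart. -/
def chartVol (g : LRMetric A) (i : ι) : Measure M :=
  Measure.map (A.chart i).invFun
    ((volume.restrict (A.chart i).target).withDensity
      fun z => ENNReal.ofReal (Real.sqrt (g.coeff i z).det))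

/-- The Riemannian volume measure: the smallest measure that dominates the volume measures inside
the charts. As these agree on overlaps, it is the unique measure that restricts to each of them on
the domain of the chart. -/
def vol (g : LRMetric A) : Measure M := ⨆ i, g.chartVol i

end Volume

section Distance

/-- A curve `γ : [0,1] → M` (only its values on `[0,1]` matter) that is Lipschitz in charts. -/
def IsLipCurve (A : LipschitzAtlas ι M d) (γ : ℝ → M) : Prop :=
  ContinuousOn γ (Icc 0 1) ∧
    ∀ (i : ι) (a b : ℝ), 0 ≤ a → a ≤ b → b ≤ 1 → MapsTo γ (Icc a b) (A.chart i).source →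
      ∃ K : ℝ≥0, LipschitzOnWith K (fun t => (A.chart i).toFun (γ t)) (Icc a b)

/-- `s` is the speed of `γ`, computed in whichever chart. That such an `s` exists means that the
length of `γ` is well defined, independently of the charts in which it is computed. -/
def IsSpeed (g : LRMetric A) (γ : ℝ → M) (s : ℝ → ℝ) : Prop :=
  ∀ i, ∀ᵐ t ∂(volume.restrict (Icc (0 : ℝ) 1)), γ t ∈ (A.chart i).source →
    s t = Real.sqrt (bil (g.coeff i ((A.chart i).toFun (γ t)))
      (deriv (fun r => (A.chart i).toFun (γ r)) t) (deriv (fun r => (A.chart i).toFun (γ r)) t))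

variable [MeasurableSpace M]

/-- The infimum of the lengths of the Lipschitz curves from `x` to `y` that have a well-defined
length and are transversal to `B`, i.e. spend no time in `B`. -/
def distAvoiding (g : LRMetric A) (B : Set M) (x y : M) : ℝ≥0∞ :=
  ⨅ (γ : ℝ → M) (s : ℝ → ℝ) (_ : IsLipCurve A γ ∧ γ 0 = x ∧ γ 1 = y ∧
      volume (Icc (0 : ℝ) 1 ∩ γ ⁻¹' B) = 0 ∧ g.IsSpeed γ s),
    ∫⁻ t in Icc (0 : ℝ) 1, ENNReal.ofReal (s t)

/-- The path distance: the supremum of `distAvoiding g B` over all null sets `B`. Every null set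
is contained in one for which all transversal Lipschitz curves have a well-defined length, and
`distAvoiding g B` is monotone in `B`. -/
def pathDist (g : LRMetric A) (x y : M) : ℝ≥0∞ :=
  ⨆ (B : Set M) (_ : g.vol B = 0), g.distAvoiding B x y

/-- The open ball of the path distance. -/
def ball (g : LRMetric A) (x : M) (r : ℝ) : Set M := {y | g.pathDist x y < ENNReal.ofReal r}

/-- In the chart `c` the metric lies between `b⁻¹` and `b` times the Euclidean metric, a.e. on the
image of `S`. The matrix of the metric in the chart `c` is the pull-back of `g.coeff i` under the
transition map from `c` to the `i`-th chart of the atlas. -/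
def IsQuasiEuclideanOn (g : LRMetric A) (c : ModelChart M d) (b : ℝ) (S : Set M) : Prop :=
  ∀ i, ∀ᵐ z ∂(volume.restrict (overlap c (A.chart i))), c.invFun z ∈ S → ∀ ξ : Euc d,
    b⁻¹ * ‖ξ‖ ^ 2 ≤ bil (g.coeff i (transition c (A.chart i) z))
        (fderiv ℝ (transition c (A.chart i)) z ξ) (fderiv ℝ (transition c (A.chart i)) z ξ) ∧
      bil (g.coeff i (transition c (A.chart i) z))
        (fderiv ℝ (transition c (A.chart i)) z ξ) (fderiv ℝ (transition c (A.chart i)) z ξ) ≤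
        b * ‖ξ‖ ^ 2

/-- The radii over which the supremum in the definition of the Euclidean radius is taken. (A chart
maps every open subset of its domain homeomorphically onto an open subset of the Euclidean space or
of the half-space, so that this need not be asked of the ball separately.) -/
def IsEuclideanRadius (g : LRMetric A) (x : M) (b r : ℝ) : Prop :=
  0 < r ∧ IsCompact (closure (g.ball x r)) ∧
    ∃ c : ModelChart M d, A.IsChart c ∧ x ∈ c.source ∧ g.ball x r ⊆ c.source ∧
      g.IsQuasiEuclideanOn c b (g.ball x r)

/-- The Euclidean radius at `x`, with values in `[0, ∞]`. -/
def euclideanRadius (g : LRMetric A) (x : M) (b : ℝ) : ℝ≥0∞ :=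
  ⨆ (r : ℝ) (_ : g.IsEuclideanRadius x b r), ENNReal.ofReal r

/-- The truncated and rescaled Euclidean radius. -/
def radius (g : LRMetric A) (b ε₁ ε₂ : ℝ) (x : M) : ℝ≥0∞ :=
  min (g.euclideanRadius x b) (ENNReal.ofReal ε₁) / ENNReal.ofReal ε₂

end Distance

section HeatFlow

variable [MeasurableSpace M]

/-- The Sobolev space `W^{1,2}(M)`: the square integrable functions with a distributional
differential whose pointwise norm is square integrable. -/
def MemW12 (g : LRMetric A) (f : Lp ℝ 2 g.vol) : Prop :=
  ∃ θ : OneForm A, IsDifferential f θ ∧ ∃ q : M → ℝ, g.IsPairing θ θ q ∧ Integrable q g.vol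

/-- `e` is the value at `f, h ∈ W^{1,2}(M)` of the Dirichlet form `½ ∫ ⟨df, dh⟩ dvol`. -/
def IsFormValue (g : LRMetric A) (f h : Lp ℝ 2 g.vol) (e : ℝ) : Prop :=
  g.MemW12 f ∧ g.MemW12 h ∧ ∃ θ η : OneForm A, IsDifferential f θ ∧ IsDifferential h η ∧
    ∃ q : M → ℝ, g.IsPairing θ η q ∧ Integrable q g.vol ∧ e = 1 / 2 * ∫ x, q x ∂g.vol

/-- `f` lies in the domain of the generator `Δ/2` of the Dirichlet form, and `(Δ/2) f = v`. -/
def IsHalfLaplacian (g : LRMetric A) (f v : Lp ℝ 2 g.vol) : Prop :=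
  g.MemW12 f ∧ ∀ h : Lp ℝ 2 g.vol, g.MemW12 h → g.IsFormValue f h (-inner ℝ v h)

/-- `u` is the solution in `L²` of the heat equation `∂u/∂t = (Δ/2) u` with initial value `f`, i.e.
`u t = exp(tΔ/2) f` for `t ≥ 0`. -/
def IsHeatSolution (g : LRMetric A) (f : Lp ℝ 2 g.vol) (u : ℝ → Lp ℝ 2 g.vol) : Prop :=
  ContinuousOn u (Ici 0) ∧ u 0 = f ∧
    ∀ t : ℝ, 0 < t → ∃ v : Lp ℝ 2 g.vol, g.IsHalfLaplacian (u t) v ∧ HasDerivAt u v t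

/-- `p` is the heat kernel: the jointly continuous function on `(0, ∞) × M × M` that is the integral
kernel, with respect to the volume measure, of the heat flow on `L²`. -/
def IsHeatKernel (g : LRMetric A) (p : ℝ → M → M → ℝ) : Prop :=
  ContinuousOn (fun q : ℝ × M × M => p q.1 q.2.1 q.2.2) (Ioi 0 ×ˢ univ) ∧
    ∀ f : Lp ℝ 2 g.vol, ∃ u : ℝ → Lp ℝ 2 g.vol, g.IsHeatSolution f u ∧
      ∀ t : ℝ, 0 < t → ∀ᵐ x ∂g.vol,
        Integrable (fun y => p t x y * f y) g.vol ∧ u t x = ∫ y, p t x y * f y ∂g.vol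

end HeatFlow

end LRMetric

end LipRiem

end

noncomputable section

set_option linter.unusedSectionVars false

namespace LipRiem

section

variable {d : ℕ} [NeZero d]

/-! ### Model sets -/

/-! The kernel bound is local. It rests on a mean value inequality for the heat flow in a single
quasi-Euclidean chart: if `u` solves the heat equation with bounded integrable initial value `f`,
then on the Euclidean ball of radius `r` in the chart `|u t| ≤ C r^{-d} ‖f‖₁` for all `t ≥ r²`, with
`C` depending only on `b` and `d` (`IsHeatSolution.ae_abs_le_of_integral_le`). If `f` is the
indicator of a small neighbourhood of `y`, joint continuity of the kernel turns this into `p t x y ≤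
C r^{-d}` (`IsEuclideanRadius.kernel_le`); here `r` is a fixed fraction of `min (√t) (R x)`.

The mean value inequality has three sources. (1) A super-Poincaré (Nash type) inequality `∫ f² ≤ A
ε² ∫ |df|² + B ε^{-d} (∫ |f|)²` for all `ε > 0` and all Sobolev functions supported in a compact
part of the chart. On the whole space or a half-space it follows by averaging `f(z)² ≤ (f(z+h) -
f(z))² + 2 |f(z)| |f(z+h)|` over a ball of shifts `h` of size `ε` (`superPoincare`); the chart
distorts energy and volume by powers of `b` only. (2) Caccioppoli's inequality: testing the equation
with `η² u^{2p-1}` bounds the derivative of `∫ η² u^{2p}` by `-∫ |d(η u^p)|² + ∫ u^{2p} |dη|²`.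
Together with (1), Grönwall's inequality and an absorption of the cut-off term, it gives a reverse
Hölder inequality: `∫ u^{2p}` on a smaller ball at later times is at most a constant times the
square of a time-uniform bound of `∫ |u|^p` on a larger ball (`IsHeatSolution.reverse_holder`). This
is iterated along `p = 2^k`. (3) The start `p = 1`: the flow is symmetric and contractive in the sup
norm, hence contractive in `L¹` by duality.

The geometric input is an upper bound: the path distance is at most `√b` times the Euclidean length
of a coordinate segment (`LRMetric.pathDist_le_of_segment`). Thus a segment from `x` of Euclidean
length at most `r / (2 √b)` cannot leave the ball of radius `r`; as this ball is relatively compact,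
the chart image contains a full Euclidean ball, or its intersection with the half-space. The
Lipschitz property of `R` is the inclusion of the ball of radius `r - δ` around `y` in the ball of
radius `r` around `x` when `d(x,y) ≤ δ`. Positivity holds because path balls form neighbourhood
bases of the given topology (`LRMetric.exists_ball_subset`).

Boundary points cause no extra work. Differentials are tested only in the interior, but mollifiers
and translations are directed into the half-space, so weakly differentiable functions are
approximated by smooth ones up to the boundary without any extension operator. -/

/-- The two closed model spaces. -/
def IsModelSpace (H : Set (Euc d)) : Prop := H = univ ∨ H = halfSpace d

/-- The sets onto which charts are allowed to map. -/
def IsModelSet (T : Set (Euc d)) : Prop :=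
  ∃ O : Set (Euc d), IsOpen O ∧ (T = O ∨ T = O ∩ halfSpace d)

theorem isClosed_halfSpace : IsClosed (halfSpace d) :=
  isClosed_le continuous_const (EuclideanSpace.proj (𝕜 := ℝ) (0 : Fin d)).continuous

theorem volume_hyperplane : volume {z : Euc d | z 0 = 0} = 0 := by
  have h := Measure.addHaar_submodule (volume : Measure (Euc d))
    (LinearMap.ker (EuclideanSpace.proj (𝕜 := ℝ) (0 : Fin d)).toLinearMap) (by
      intro h
      have : (EuclideanSpace.single (0 : Fin d) (1 : ℝ)) ∈
          LinearMap.ker (EuclideanSpace.proj (𝕜 := ℝ) (0 : Fin d)).toLinearMap := by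
        rw [h]; trivial
      simp at this)
  convert h using 2
  ext z
  simp

theorem mem_interior_halfSpace {z : Euc d} (hz : 0 < z 0) : z ∈ interior (halfSpace d) :=
  interior_maximal (s := halfSpace d) (t := {z : Euc d | 0 < z 0}) (fun z (h : 0 < z 0) => show 0 ≤ z 0 from h.le)
    (isOpen_lt continuous_const (EuclideanSpace.proj (𝕜 := ℝ) (0 : Fin d)).continuous) hz

namespace IsModelSpace

variable {H : Set (Euc d)}

theorem isClosed (h : IsModelSpace H) : IsClosed H := by
  rcases h with rfl | rfl
  · exact isClosed_univ
  · exact isClosed_halfSpace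

theorem convex (h : IsModelSpace H) : Convex ℝ H := by
  rcases h with rfl | rfl
  · exact convex_univ
  · exact convex_halfSpace_ge (EuclideanSpace.proj (𝕜 := ℝ) (0 : Fin d)).toLinearMap.isLinear 0

/-- Increasing the coordinate `0` moves every point of a model space into its interior. Mollifiers
and shifts below always point in this direction. -/
theorem mem_interior (h : IsModelSpace H) {z y : Euc d} (hz : z ∈ H) (hy : z 0 < y 0) :
    y ∈ interior H := by
  rcases h with rfl | rfl
  · simp
  · exact mem_interior_halfSpace (lt_of_le_of_lt hz hy)

theorem add_mem (h : IsModelSpace H) {z y : Euc d} (hz : z ∈ H) (hy : 0 ≤ y 0) : z + y ∈ H := by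
  rcases h with rfl | rfl
  · simp
  · have : 0 ≤ z 0 := hz
    change 0 ≤ (z + y) 0
    simpa using add_nonneg this hy

theorem volume_diff_interior (h : IsModelSpace H) : volume (H \ interior H) = 0 := by
  rcases h with rfl | rfl
  · simp
  · refine measure_mono_null ?_ (volume_hyperplane (d := d))
    rintro z ⟨hz, hz'⟩
    by_contra hne
    exact hz' (mem_interior_halfSpace (lt_of_le_of_ne hz (Ne.symm hne)))

end IsModelSpace

theorem isModelSet_iff {T : Set (Euc d)} :
    IsModelSet T ↔ ∃ O H : Set (Euc d), IsOpen O ∧ IsModelSpace H ∧ T = O ∩ H := by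
  constructor
  · rintro ⟨O, hO, rfl | rfl⟩
    · exact ⟨T, univ, hO, Or.inl rfl, by simp⟩
    · exact ⟨O, _, hO, Or.inr rfl, rfl⟩
  · rintro ⟨O, H, hO, rfl | rfl, rfl⟩
    · exact ⟨O, hO, Or.inl (by simp)⟩
    · exact ⟨O, hO, Or.inr rfl⟩

namespace IsModelSet

variable {T : Set (Euc d)}

theorem measurableSet (h : IsModelSet T) : MeasurableSet T := by
  obtain ⟨O, H, hO, hH, rfl⟩ := isModelSet_iff.1 h
  exact hO.measurableSet.inter hH.isClosed.measurableSet

theorem volume_diff_interior (h : IsModelSet T) : volume (T \ interior T) = 0 := by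
  obtain ⟨O, H, hO, hH, rfl⟩ := isModelSet_iff.1 h
  refine measure_mono_null ?_ hH.volume_diff_interior
  rw [interior_inter, hO.interior_eq]
  rintro z ⟨⟨h1, h2⟩, h3⟩
  exact ⟨h2, fun h4 => h3 ⟨h1, h4⟩⟩

theorem interior_ae_eq (h : IsModelSet T) : (interior T : Set (Euc d)) =ᵐ[volume] T :=
  (interior_subset.eventuallyLE).antisymm (ae_le_set.2 h.volume_diff_interior)

theorem restrict_interior (h : IsModelSet T) :
    (volume : Measure (Euc d)).restrict (interior T) = volume.restrict T :=
  Measure.restrict_congr_set h.interior_ae_eq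

theorem inter_open (h : IsModelSet T) {O : Set (Euc d)} (hO : IsOpen O) : IsModelSet (T ∩ O) := by
  obtain ⟨O', H, hO', hH, rfl⟩ := isModelSet_iff.1 h
  exact isModelSet_iff.2 ⟨O' ∩ O, H, hO'.inter hO, hH, by ac_rfl⟩

/-- A compact subset of a model set has a compact neighbourhood in it. -/
theorem exists_cthickening (h : IsModelSet T) {K : Set (Euc d)} (hK : IsCompact K) (hKT : K ⊆ T) :
    ∃ H : Set (Euc d), IsModelSpace H ∧ T ⊆ H ∧ interior H ∩ T ⊆ interior T ∧
      ∃ δ > 0, Metric.cthickening δ K ∩ H ⊆ T := by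
  obtain ⟨O, H, hO, hH, rfl⟩ := isModelSet_iff.1 h
  obtain ⟨δ, hδ, hs⟩ := hK.exists_cthickening_subset_open hO (hKT.trans inter_subset_left)
  refine ⟨H, hH, inter_subset_right, ?_, δ, hδ, inter_subset_inter_left _ hs⟩
  rw [interior_inter, hO.interior_eq]
  rintro z ⟨h1, h2, -⟩
  exact ⟨h2, h1⟩

end IsModelSet

/-! ### Volumes of Lipschitz images -/

/-- Lebesgue measure is a multiple of the `d`-dimensional Hausdorff measure, for which the estimate
is immediate, even for non-measurable `s`. -/
theorem volume_image_le_of_lipschitzOnWith {K : ℝ≥0} {f : Euc d → Euc d} {s : Set (Euc d)}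
    (hf : LipschitzOnWith K f s) : volume (f '' s) ≤ (K : ℝ≥0∞) ^ d * volume s := by
  have hH : (Measure.hausdorffMeasure (d : ℝ) : Measure (Euc d)).IsAddHaarMeasure := by
    simpa using MeasureTheory.isAddHaarMeasure_hausdorffMeasure (E := Euc d)
  have h := Measure.isAddLeftInvariant_eq_smul (volume : Measure (Euc d))
    (Measure.hausdorffMeasure (d : ℝ))
  rw [h]
  have h1 := hf.hausdorffMeasure_image_le (d := d) (by positivity)
  simp only [ENNReal.rpow_natCast] at h1
  simp only [Measure.smul_apply]
  calc _ ≤ _ • ((K : ℝ≥0∞) ^ d * Measure.hausdorffMeasure (d : ℝ) s) := by gcongr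
    _ = _ := by simp only [ENNReal.smul_def, smul_eq_mul]; ring

/-- By the Lindelöf property, countably many pieces on which `f` is Lipschitz cover `N`. -/
theorem volume_image_eq_zero_of_locallyLipschitzOn {f : Euc d → Euc d} {s N : Set (Euc d)}
    (hf : LocallyLipschitzOn s f) (hN : N ⊆ s) (h0 : volume N = 0) : volume (f '' N) = 0 := by
  have hloc : ∀ x ∈ N, ∃ u ∈ 𝓝[N] x, volume (f '' (u ∩ N)) = 0 := by
    intro x hx
    obtain ⟨K, u, hu, hK⟩ := hf (hN hx)
    refine ⟨u, nhdsWithin_mono _ hN hu, ?_⟩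
    have h1 := volume_image_le_of_lipschitzOnWith (hK.mono (inter_subset_left (t := N)))
    rw [measure_mono_null inter_subset_right h0, mul_zero] at h1
    exact le_antisymm h1 bot_le
  choose! u hu hu0 using hloc
  obtain ⟨t, htN, htc, hcov⟩ := TopologicalSpace.countable_cover_nhdsWithin hu
  have : f '' N ⊆ ⋃ x ∈ t, f '' (u x ∩ N) := by
    rintro _ ⟨z, hz, rfl⟩
    obtain ⟨x, hx, hzx⟩ := mem_iUnion₂.1 (hcov hz)
    exact mem_iUnion₂.2 ⟨x, hx, z, ⟨hzx, hz⟩, rfl⟩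
  exact measure_mono_null this ((measure_biUnion_null_iff htc).2 fun x hx => hu0 x (htN hx))

theorem ae_differentiableAt_of_locallyLipschitzOn {E : Type*} [NormedAddCommGroup E]
    [NormedSpace ℝ E] [FiniteDimensional ℝ E] {f : Euc d → E} {s : Set (Euc d)}
    (hf : LocallyLipschitzOn s f) :
    ∀ᵐ z ∂(volume : Measure (Euc d)), z ∈ interior s → DifferentiableAt ℝ f z := by
  have hloc : ∀ x ∈ interior s, ∃ u ∈ 𝓝[interior s] x, IsOpen u ∧
      ∃ K, LipschitzOnWith K f (u ∩ interior s) := by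
    intro x hx
    obtain ⟨K, u, hu, hK⟩ := hf (interior_subset hx)
    obtain ⟨v, hv, hxv, hvu⟩ := mem_nhdsWithin.1 hu
    exact ⟨v, mem_nhdsWithin_of_mem_nhds (hv.mem_nhds hxv), hv, K,
      hK.mono fun z hz => hvu ⟨hz.1, interior_subset hz.2⟩⟩
  choose! u hu huo K hK using hloc
  obtain ⟨t, htN, htc, hcov⟩ := TopologicalSpace.countable_cover_nhdsWithin hu
  have h : ∀ᵐ z ∂(volume : Measure (Euc d)), ∀ x ∈ t, z ∈ u x ∩ interior s →
      DifferentiableWithinAt ℝ f (u x ∩ interior s) z :=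
    (ae_ball_iff htc).2 fun x hx => (hK x (htN hx)).ae_differentiableWithinAt_of_mem
  filter_upwards [h] with z hz hzs
  obtain ⟨x, hx, hzx⟩ := mem_iUnion₂.1 (hcov hzs)
  exact (hz x hx ⟨hzx, hzs⟩).differentiableAt
    (((huo x (htN hx)).inter isOpen_interior).mem_nhds ⟨hzx, hzs⟩)

/-- The hypothesis says that the inverse of `τ` on its image is `L`-Lipschitz, so the estimate for
Lipschitz images applies to it. -/
theorem measure_preimage_le_of_expanding {S A : Set (Euc d)} {τ : Euc d → Euc d} {L : ℝ≥0}
    (hτ : ∀ x ∈ S, ∀ y ∈ S, dist x y ≤ L * dist (τ x) (τ y)) :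
    volume (S ∩ τ ⁻¹' A) ≤ (L : ℝ≥0∞) ^ d * volume A := by
  have hinj : InjOn τ S := by
    intro x hx y hy hxy
    have := hτ x hx y hy
    rw [hxy, dist_self, mul_zero] at this
    exact dist_le_zero.1 this
  have hlip : LipschitzOnWith L (Function.invFunOn τ S) (τ '' S ∩ A) := by
    apply LipschitzOnWith.of_dist_le_mul
    rintro _ ⟨⟨x, hx, rfl⟩, -⟩ _ ⟨⟨y, hy, rfl⟩, -⟩
    rw [hinj.leftInvOn_invFunOn hx, hinj.leftInvOn_invFunOn hy]
    exact hτ x hx y hy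
  have hsub : S ∩ τ ⁻¹' A ⊆ Function.invFunOn τ S '' (τ '' S ∩ A) := by
    rintro x ⟨hx, hxA⟩
    exact ⟨τ x, ⟨⟨x, hx, rfl⟩, hxA⟩, hinj.leftInvOn_invFunOn hx⟩
  calc _ ≤ _ := measure_mono hsub
    _ ≤ _ := volume_image_le_of_lipschitzOnWith hlip
    _ ≤ _ := by gcongr; exact inter_subset_right

theorem map_restrict_le_of_expanding {S : Set (Euc d)} {τ : Euc d → Euc d} {L : ℝ≥0}
    (hS : MeasurableSet S) (hc : ContinuousOn τ S)
    (hτ : ∀ x ∈ S, ∀ y ∈ S, dist x y ≤ L * dist (τ x) (τ y)) :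
    Measure.map τ (volume.restrict S) ≤ (L : ℝ≥0∞) ^ d • volume := by
  refine Measure.le_iff.2 fun A hA => ?_
  rw [Measure.map_apply_of_aemeasurable (hc.aemeasurable hS) hA, Measure.restrict_apply' hS,
    inter_comm]
  exact measure_preimage_le_of_expanding hτ

theorem lintegral_comp_le_of_expanding {S : Set (Euc d)} {τ : Euc d → Euc d} {L : ℝ≥0}
    (hS : MeasurableSet S) (hc : ContinuousOn τ S)
    (hτ : ∀ x ∈ S, ∀ y ∈ S, dist x y ≤ L * dist (τ x) (τ y)) {F : Euc d → ℝ≥0∞}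
    (hF : AEMeasurable F) :
    ∫⁻ z in S, F (τ z) ≤ (L : ℝ≥0∞) ^ d * ∫⁻ z, F z := by
  have hm : AEMeasurable τ (volume.restrict S) := hc.aemeasurable hS
  have hle := map_restrict_le_of_expanding hS hc hτ
  have hF' : AEMeasurable F (Measure.map τ (volume.restrict S)) :=
    (hF.smul_measure ((L : ℝ≥0∞) ^ d)).mono_measure hle
  rw [← lintegral_map' hF' hm]
  calc _ ≤ ∫⁻ z, F z ∂((L : ℝ≥0∞) ^ d • volume) := lintegral_mono' hle le_rfl
    _ = _ := by rw [lintegral_smul_measure, smul_eq_mul]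

/-! ### One-sided mollifiers -/

/-- A smooth mollifier of scale `a` that averages over points further inside the half-space. -/
def mollifier (d : ℕ) [NeZero d] (a : ℝ) : Euc d → ℝ :=
  if ha : 0 < a then
    (⟨a / 4, a / 2, by positivity, by linarith⟩ :
      ContDiffBump (-(a • EuclideanSpace.single (0 : Fin d) (1 : ℝ)))).normed volume
  else 0

section Mollifier

variable {a : ℝ}

theorem contDiff_mollifier : ContDiff ℝ ∞ (mollifier d a) := by
  unfold mollifier
  split_ifs with ha
  · exact ContDiffBump.contDiff_normed _
  · exact contDiff_const

theorem mollifier_nonneg (z : Euc d) : 0 ≤ mollifier d a z := by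
  unfold mollifier
  split_ifs with ha
  · exact ContDiffBump.nonneg_normed _ z
  · exact le_rfl

theorem tsupport_mollifier (ha : 0 < a) : tsupport (mollifier d a) =
    Metric.closedBall (-(a • EuclideanSpace.single (0 : Fin d) (1 : ℝ))) (a / 2) := by
  unfold mollifier
  rw [dif_pos ha]
  exact ContDiffBump.tsupport_normed_eq _

theorem hasCompactSupport_mollifier : HasCompactSupport (mollifier d a) := by
  unfold mollifier
  split_ifs with ha
  · exact ContDiffBump.hasCompactSupport_normed _
  · exact HasCompactSupport.zero

theorem integral_mollifier (ha : 0 < a) : ∫ z, mollifier d a z = 1 := by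
  unfold mollifier
  rw [dif_pos ha]
  exact ContDiffBump.integral_normed _

theorem integrable_mollifier : Integrable (mollifier d a) :=
  contDiff_mollifier.continuous.integrable_of_hasCompactSupport hasCompactSupport_mollifier

theorem mem_tsupport_mollifier (ha : 0 < a) {y : Euc d} (hy : y ∈ tsupport (mollifier d a)) :
    ‖y‖ ≤ 2 * a ∧ y 0 < 0 := by
  rw [tsupport_mollifier ha, mem_closedBall_iff_norm, sub_neg_eq_add] at hy
  constructor
  · have h1 : y = (y + a • EuclideanSpace.single (0 : Fin d) (1 : ℝ)) -
        a • EuclideanSpace.single (0 : Fin d) (1 : ℝ) := by abel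
    have h2 : ‖a • EuclideanSpace.single (0 : Fin d) (1 : ℝ)‖ = a := by
      simp [norm_smul, abs_of_pos ha]
    have h3 := norm_sub_le (y + a • EuclideanSpace.single (0 : Fin d) (1 : ℝ))
      (a • EuclideanSpace.single (0 : Fin d) (1 : ℝ))
    rw [← h1, h2] at h3
    linarith
  · have h1 := (PiLp.norm_apply_le (y + a • EuclideanSpace.single (0 : Fin d) (1 : ℝ)) 0).trans hy
    simp at h1
    have := (abs_le.1 h1).2
    linarith

/-- The mollification of a function. -/
def mollify {E : Type*} [NormedAddCommGroup E] [NormedSpace ℝ E] (a : ℝ) (f : Euc d → E)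
    (z : Euc d) : E :=
  ∫ y, mollifier d a y • f (z - y)

variable {E : Type*} [NormedAddCommGroup E] [NormedSpace ℝ E]

theorem mollify_eq_convolution (f : Euc d → E) :
    mollify a f = convolution (mollifier d a) f (ContinuousLinearMap.lsmul ℝ ℝ) volume := rfl

theorem contDiff_mollify [CompleteSpace E] {f : Euc d → E} (hf : LocallyIntegrable f) :
    ContDiff ℝ ∞ (mollify a f) := by
  rw [mollify_eq_convolution]
  exact hasCompactSupport_mollifier.contDiff_convolution_left _ contDiff_mollifier hf

theorem hasCompactSupport_mollify {f : Euc d → E} (hf : HasCompactSupport f) :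
    HasCompactSupport (mollify a f) := by
  rw [mollify_eq_convolution]
  exact hasCompactSupport_mollifier.convolution _ hf

/-- Continuity of translations in `L¹`, as a case of the continuity of composition with measure
preserving maps. -/
theorem tendsto_lintegral_translate_sub [CompleteSpace E] {f : Euc d → E} (hf : Integrable f) :
    Tendsto (fun y : Euc d => ∫⁻ z, ‖f (z - y) - f z‖ₑ) (𝓝 0) (𝓝 0) := by
  have hmp : ∀ y : Euc d, MeasurePreserving (fun z : Euc d => z - y) volume volume :=
    fun y => measurePreserving_sub_right volume y
  let g : Euc d → C(Euc d, Euc d) := fun y => ⟨fun z => z - y, by fun_prop⟩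
  have hg : Continuous g := by
    apply ContinuousMap.continuous_of_continuous_uncurry
    change Continuous fun p : Euc d × Euc d => p.2 - p.1
    fun_prop
  have hfm : MemLp f 1 := memLp_one_iff_integrable.2 hf
  let F : Lp E 1 (volume : Measure (Euc d)) := hfm.toLp
  have h1 : Tendsto (fun y => Lp.compMeasurePreserving (g y) (hmp y) F) (𝓝 0)
      (𝓝 (Lp.compMeasurePreserving (g 0) (hmp 0) F)) :=
    Tendsto.compMeasurePreservingLp tendsto_const_nhds hg.continuousAt _ _ (by simp)
  rw [tendsto_iff_edist_tendsto_0] at h1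
  refine h1.congr fun y => ?_
  rw [Lp.edist_def, eLpNorm_one_eq_lintegral_enorm]
  refine lintegral_congr_ae ?_
  have hF := hfm.coeFn_toLp
  filter_upwards [Lp.coeFn_compMeasurePreserving F (hmp y),
    Lp.coeFn_compMeasurePreserving F (hmp 0), (hmp y).quasiMeasurePreserving.ae_eq_comp hF,
    (hmp 0).quasiMeasurePreserving.ae_eq_comp hF] with z h1 h2 h3 h4
  rw [Pi.sub_apply]
  erw [h1, h2, h3, h4]
  simp

/-- The mollifier has mass `1`, so `mollify a f - f` is an average of differences `f (· - y) - f`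
with `‖y‖ ≤ 2 a`; Tonelli moves the average outside the norm. -/
theorem lintegral_mollify_sub_le [CompleteSpace E] {f : Euc d → E} (ha : 0 < a)
    (hf : Integrable f) {c : ℝ≥0∞}
    (hc : ∀ y : Euc d, ‖y‖ ≤ 2 * a → ∫⁻ z, ‖f (z - y) - f z‖ₑ ≤ c) :
    ∫⁻ z, ‖mollify a f z - f z‖ₑ ≤ c := by
  have hpt : ∀ z, ‖mollify a f z - f z‖ₑ ≤
      ∫⁻ y, ‖mollifier d a y‖ₑ * ‖f (z - y) - f z‖ₑ := by
    intro z
    have hex := (hasCompactSupport_mollifier (d := d) (a := a)).convolutionExists_left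
      (L := ContinuousLinearMap.lsmul ℝ ℝ) contDiff_mollifier.continuous
      hf.locallyIntegrable z
    have h1 : Integrable fun y => mollifier d a y • f (z - y) := hex
    have h2 : Integrable fun y => mollifier d a y • f z := integrable_mollifier.smul_const _
    have h3 : mollify a f z - f z = ∫ y, mollifier d a y • (f (z - y) - f z) := by
      simp_rw [smul_sub]
      rw [integral_sub h1 h2, integral_smul_const, integral_mollifier ha, one_smul]
      rfl
    rw [h3]
    refine (enorm_integral_le_lintegral_enorm _).trans (le_of_eq ?_)
    simp_rw [enorm_smul]
  calc _ ≤ ∫⁻ z, ∫⁻ y, ‖mollifier d a y‖ₑ * ‖f (z - y) - f z‖ₑ := lintegral_mono hpt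
    _ = ∫⁻ y, ∫⁻ z, ‖mollifier d a y‖ₑ * ‖f (z - y) - f z‖ₑ := by
      refine lintegral_lintegral_swap ?_
      have hm : AEMeasurable (fun p : Euc d × Euc d => mollifier d a p.2)
          (volume.prod volume) :=
        (contDiff_mollifier.continuous.comp continuous_snd).aemeasurable
      have hq : Measure.QuasiMeasurePreserving (fun p : Euc d × Euc d => p.1 - p.2)
          (volume.prod volume) volume :=
        quasiMeasurePreserving_sub volume volume
      have h1 : AEStronglyMeasurable (fun p : Euc d × Euc d => f (p.1 - p.2))
          (volume.prod volume) := hf.aestronglyMeasurable.comp_quasiMeasurePreserving hq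
      have h2 : AEStronglyMeasurable (fun p : Euc d × Euc d => f p.1)
          (volume.prod volume) := hf.aestronglyMeasurable.comp_fst
      exact hm.enorm.mul (h1.sub h2).enorm
    _ = ∫⁻ y, ‖mollifier d a y‖ₑ * ∫⁻ z, ‖f (z - y) - f z‖ₑ := by
      refine lintegral_congr fun y => ?_
      rw [lintegral_const_mul' _ _ enorm_ne_top]
    _ ≤ ∫⁻ y, ‖mollifier d a y‖ₑ * c := by
      refine lintegral_mono fun y => ?_
      by_cases hy : y ∈ tsupport (mollifier d a)
      · exact mul_le_mul_right (hc y (mem_tsupport_mollifier ha hy).1) _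
      · simp [image_eq_zero_of_notMem_tsupport hy]
    _ = c := by
      have h1 : ∫⁻ y, ‖mollifier d a y‖ₑ = 1 := by
        rw [← ofReal_integral_norm_eq_lintegral_enorm integrable_mollifier]
        simp_rw [Real.norm_of_nonneg (mollifier_nonneg _)]
        rw [integral_mollifier ha, ENNReal.ofReal_one]
      rw [lintegral_mul_const'' _ (contDiff_mollifier.continuous.enorm.aemeasurable), h1, one_mul]

theorem tendsto_lintegral_mollify_sub [CompleteSpace E] {f : Euc d → E} (hf : Integrable f) :
    Tendsto (fun a => ∫⁻ z, ‖mollify a f z - f z‖ₑ) (𝓝[>] 0) (𝓝 0) := by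
  have h := tendsto_lintegral_translate_sub hf
  rw [ENNReal.tendsto_nhds_zero] at h ⊢
  intro ε hε
  obtain ⟨δ, hδ, hs⟩ := Metric.eventually_nhds_iff.1 (h ε hε)
  have : ∀ᶠ a : ℝ in 𝓝[>] 0, a < δ / 2 :=
    mem_nhdsWithin_of_mem_nhds (Iio_mem_nhds (by positivity))
  filter_upwards [this, self_mem_nhdsWithin] with a ha ha0
  refine lintegral_mollify_sub_le ha0 hf fun y hy => hs ?_
  rw [dist_zero_right]
  linarith

end Mollifier

end

section

variable {d : ℕ} [NeZero d]

/-! ### Weak gradients -/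

/-- `θ` is the weak gradient of `f` in `U`. -/
def HasWeakGrad (f : Euc d → ℝ) (θ : Euc d → Euc d) (U : Set (Euc d)) : Prop :=
  ∀ φ : Euc d → ℝ, ContDiff ℝ ∞ φ → HasCompactSupport φ → tsupport φ ⊆ U → ∀ ξ : Euc d,
    ∫ z, f z * fderiv ℝ φ z ξ = - ∫ z, inner ℝ (θ z) ξ * φ z

theorem fderiv_apply_eq_zero_of_notMem {φ : Euc d → ℝ} {z : Euc d} (hz : z ∉ tsupport φ)
    (ξ : Euc d) : fderiv ℝ φ z ξ = 0 := by
  have : fderiv ℝ φ z = 0 := by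
    by_contra h
    exact hz (support_fderiv_subset ℝ h)
  rw [this]; rfl

theorem setIntegral_mul_fderiv {f φ : Euc d → ℝ} {U : Set (Euc d)} (h : tsupport φ ⊆ U)
    (ξ : Euc d) : ∫ z in U, f z * fderiv ℝ φ z ξ = ∫ z, f z * fderiv ℝ φ z ξ :=
  setIntegral_eq_integral_of_forall_compl_eq_zero fun z hz => by
    rw [fderiv_apply_eq_zero_of_notMem (fun h' => hz (h h')), mul_zero]

theorem setIntegral_mul_of_tsupport {f φ : Euc d → ℝ} {U : Set (Euc d)} (h : tsupport φ ⊆ U) :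
    ∫ z in U, f z * φ z = ∫ z, f z * φ z :=
  setIntegral_eq_integral_of_forall_compl_eq_zero fun z hz => by
    rw [image_eq_zero_of_notMem_tsupport (fun h' => hz (h h')), mul_zero]

namespace HasWeakGrad

variable {f f' : Euc d → ℝ} {θ θ' : Euc d → Euc d} {U V : Set (Euc d)}

theorem mono (h : HasWeakGrad f θ U) (hV : V ⊆ U) : HasWeakGrad f θ V :=
  fun φ h1 h2 h3 ξ => h φ h1 h2 (h3.trans hV) ξ

theorem congr_ae (h : HasWeakGrad f θ U) (hf : ∀ᵐ z, z ∈ U → f z = f' z)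
    (hθ : ∀ᵐ z, z ∈ U → θ z = θ' z) : HasWeakGrad f' θ' U := by
  intro φ h1 h2 h3 ξ
  have e1 : ∫ z, f' z * fderiv ℝ φ z ξ = ∫ z, f z * fderiv ℝ φ z ξ := by
    refine integral_congr_ae ?_
    filter_upwards [hf] with z hz
    by_cases hzs : z ∈ tsupport φ
    · rw [hz (h3 hzs)]
    · simp [fderiv_apply_eq_zero_of_notMem hzs]
  have e2 : ∫ z, inner ℝ (θ' z) ξ * φ z = ∫ z, inner ℝ (θ z) ξ * φ z := by
    refine integral_congr_ae ?_
    filter_upwards [hθ] with z hz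
    by_cases hzs : z ∈ tsupport φ
    · simp only [hz (h3 hzs)]
    · simp [image_eq_zero_of_notMem_tsupport hzs]
  rw [e1, e2]
  exact h φ h1 h2 h3 ξ

/-- The reflected mollifier `y ↦ mollifier d a (z - y)` is itself an admissible test function. Only
the points `z - y` have to lie in `U`, not `z`; this is how boundary points `z` are reached. -/
theorem fderiv_mollify {a : ℝ} (h : HasWeakGrad f θ U) (hf : LocallyIntegrable f)
    (hθ : LocallyIntegrable θ) {z : Euc d} (hz : ∀ y ∈ tsupport (mollifier d a), z - y ∈ U)
    (ξ : Euc d) : fderiv ℝ (mollify a f) z ξ = inner ℝ (mollify a θ z) ξ := by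
  have h1 := (hasCompactSupport_mollifier (d := d) (a := a)).hasFDerivAt_convolution_left
    (ContinuousLinearMap.lsmul ℝ ℝ) (contDiff_mollifier.of_le (by simp)) hf z
  rw [mollify_eq_convolution, h1.fderiv]
  have hsw : ∀ F : Euc d → Euc d → ℝ, ∫ y, F y (z - y) = ∫ y, F (z - y) y := by
    intro F
    rw [← integral_sub_left_eq_self _ _ z]
    simp
  let φ : Euc d → ℝ := fun y => mollifier d a (z - y)
  have hφ1 : ContDiff ℝ ∞ φ := contDiff_mollifier.comp (contDiff_const.sub contDiff_id)
  have hφs : tsupport φ ⊆ {y | z - y ∈ tsupport (mollifier d a)} := by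
    refine closure_minimal ?_ ((isClosed_tsupport _).preimage (by fun_prop))
    intro y hy
    exact subset_tsupport _ hy
  have hφ2 : HasCompactSupport φ :=
    hasCompactSupport_mollifier.comp_homeomorph (Homeomorph.subLeft z)
  have hφ3 : tsupport φ ⊆ U := fun y hy => by
    have := hz _ (hφs hy)
    rwa [sub_sub_cancel] at this
  have hφd : ∀ y, fderiv ℝ φ y ξ = - fderiv ℝ (mollifier d a) (z - y) ξ := by
    intro y
    have e1 : HasFDerivAt (mollifier d a) (fderiv ℝ (mollifier d a) (z - y)) (z - y) :=
      (contDiff_mollifier.differentiable (by simp) _).hasFDerivAt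
    have e2 : HasFDerivAt (fun y : Euc d => z - y) (-(ContinuousLinearMap.id ℝ (Euc d))) y := by
      simpa using (hasFDerivAt_id (𝕜 := ℝ) y).const_sub z
    have := (e1.comp y e2).fderiv
    change fderiv ℝ (mollifier d a ∘ fun y : Euc d => z - y) y ξ = _
    rw [this]
    simp
  have hw := h φ hφ1 hφ2 hφ3 ξ
  simp_rw [hφd, mul_neg, integral_neg, neg_inj] at hw
  have hexc : ConvolutionExistsAt (fderiv ℝ (mollifier d a)) f z
      ((ContinuousLinearMap.lsmul ℝ ℝ).precompL (Euc d)) volume :=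
    (hasCompactSupport_mollifier.fderiv ℝ).convolutionExists_left _
      (contDiff_mollifier.continuous_fderiv (by simp)) hf z
  rw [convolution_def, ContinuousLinearMap.integral_apply hexc]
  have e3 : ∀ y, (((ContinuousLinearMap.lsmul ℝ ℝ).precompL (Euc d))
      (fderiv ℝ (mollifier d a) y) (f (z - y))) ξ = f (z - y) * fderiv ℝ (mollifier d a) y ξ := by
    intro y
    simp [mul_comm]
  simp_rw [e3]
  rw [hsw fun y x => f x * fderiv ℝ (mollifier d a) y ξ, hw]
  have hexθ : Integrable fun y => mollifier d a y • θ (z - y) :=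
    hasCompactSupport_mollifier.convolutionExists_left (L := ContinuousLinearMap.lsmul ℝ ℝ)
      contDiff_mollifier.continuous hθ z
  have e4 : inner ℝ (mollify a θ z) ξ = ∫ y, inner ℝ (θ (z - y)) ξ * mollifier d a y := by
    rw [real_inner_comm]
    change inner ℝ ξ (∫ y, mollifier d a y • θ (z - y)) = _
    rw [← integral_inner hexθ]
    refine integral_congr_ae (Eventually.of_forall fun y => ?_)
    simp only [inner_smul_right, real_inner_comm ξ]
    ring
  rw [e4, hsw fun y x => inner ℝ (θ x) ξ * mollifier d a y]

/-- Weakly differentiable functions on a model set are approximated, up to the boundary, by smooth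
functions. -/
theorem exists_smooth_approx {T K : Set (Euc d)} (hT : IsModelSet T)
    (hf : LocallyIntegrableOn f T) (hθ : LocallyIntegrableOn θ T)
    (h : HasWeakGrad f θ (interior T)) (hK : IsCompact K) (hKT : K ⊆ T) :
    ∃ (g : ℕ → Euc d → ℝ) (G : ℕ → Euc d → Euc d), (∀ n, ContDiff ℝ ∞ (g n)) ∧
      (∀ n, HasCompactSupport (g n)) ∧ (∀ n, Continuous (G n)) ∧
      (∀ n, ∀ z ∈ K, ∀ ξ, fderiv ℝ (g n) z ξ = inner ℝ (G n z) ξ) ∧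
      Tendsto (fun n => ∫⁻ z in K, ‖g n z - f z‖ₑ) atTop (𝓝 0) ∧
      Tendsto (fun n => ∫⁻ z in K, ‖G n z - θ z‖ₑ) atTop (𝓝 0) ∧
      ∀ᵐ z ∂(volume.restrict K), Tendsto (fun n => g n z) atTop (𝓝 (f z)) := by
  obtain ⟨H, hH, hTH, hHT, δ, hδ, hδT⟩ := hT.exists_cthickening hK hKT
  -- Near `K` the set `T` coincides with the model space `H`, so `K'` is a compact part of `T`.
  -- Cutting `f` and `θ` off outside `K'` makes them integrable and does not change them near the
  -- points where they will be averaged.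
  set K' := Metric.cthickening δ K ∩ H with hK'
  have hK'c : IsCompact K' := hK.cthickening.inter_right hH.isClosed
  have hKK' : K ⊆ K' := fun z hz => ⟨Metric.self_subset_cthickening K hz, hTH (hKT hz)⟩
  set U := Metric.thickening δ K ∩ interior H with hU
  have hUo : IsOpen U := Metric.isOpen_thickening.inter isOpen_interior
  have hUK' : U ⊆ K' := inter_subset_inter (Metric.thickening_subset_cthickening δ K)
    interior_subset
  have hUT : U ⊆ interior T := interior_maximal (hUK'.trans hδT) hUo
  have hfi : Integrable (K'.indicator f) :=
    (integrable_indicator_iff hK'c.measurableSet).2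
      (hf.integrableOn_compact_subset hδT hK'c)
  have hθi : Integrable (K'.indicator θ) :=
    (integrable_indicator_iff hK'c.measurableSet).2
      (hθ.integrableOn_compact_subset hδT hK'c)
  have hw : HasWeakGrad (K'.indicator f) (K'.indicator θ) U :=
    (h.mono hUT).congr_ae
      (Eventually.of_forall fun z hz => (indicator_of_mem (hUK' hz) f).symm)
      (Eventually.of_forall fun z hz => (indicator_of_mem (hUK' hz) θ).symm)
  -- The average at a point of `K`, possibly a boundary point, involves only points of the open set
  -- `U`, on which the weak gradient is known.
  have hpt : ∀ a, 0 < a → 2 * a < δ → ∀ z ∈ K, ∀ y ∈ tsupport (mollifier d a), z - y ∈ U := by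
    intro a ha haδ z hz y hy
    obtain ⟨h1, h2⟩ := mem_tsupport_mollifier ha hy
    refine ⟨Metric.mem_thickening_iff.2 ⟨z, hz, ?_⟩, hH.mem_interior (hTH (hKT hz)) ?_⟩
    · rw [dist_eq_norm, sub_sub_cancel_left, norm_neg]
      linarith
    · simp only [PiLp.sub_apply]; linarith
  let a : ℕ → ℝ := fun n => δ / 4 * (1 / ((n : ℝ) + 1))
  have ha0 : ∀ n, 0 < a n := fun n => by positivity
  have haδ : ∀ n, 2 * a n < δ := fun n => by
    have : 1 / ((n : ℝ) + 1) ≤ 1 := by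
      rw [div_le_one (by positivity)]; linarith [(Nat.cast_nonneg n : (0 : ℝ) ≤ n)]
    have h2 : a n ≤ δ / 4 * 1 := mul_le_mul_of_nonneg_left this (by positivity)
    linarith
  have hat : Tendsto a atTop (𝓝[>] 0) := by
    refine tendsto_nhdsWithin_iff.2 ⟨?_, Eventually.of_forall fun n => ha0 n⟩
    simpa only [mul_zero] using
      (tendsto_one_div_add_atTop_nhds_zero_nat (𝕜 := ℝ)).const_mul (δ / 4)
  have hconv : ∀ {E : Type} [NormedAddCommGroup E] [NormedSpace ℝ E] [CompleteSpace E]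
      (q : Euc d → E), Integrable (K'.indicator q) →
      Tendsto (fun n => ∫⁻ z in K, ‖mollify (a n) (K'.indicator q) z - q z‖ₑ) atTop (𝓝 0) := by
    intro E _ _ _ q hq
    refine tendsto_of_tendsto_of_tendsto_of_le_of_le tendsto_const_nhds
      ((tendsto_lintegral_mollify_sub hq).comp hat) (fun n => bot_le) fun n => ?_
    calc _ = ∫⁻ z in K, ‖mollify (a n) (K'.indicator q) z - K'.indicator q z‖ₑ := by
          refine setLIntegral_congr_fun hK.measurableSet fun z hz => ?_
          simp only [indicator_of_mem (hKK' hz)]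
      _ ≤ _ := setLIntegral_le_lintegral _ _
  have hfc := hconv f hfi
  -- Convergence in `L¹` gives convergence almost everywhere along a subsequence; the chain rule
  -- needs the latter.
  have hmeas : TendstoInMeasure (volume.restrict K) (fun n => mollify (a n) (K'.indicator f))
      atTop f := by
    refine tendstoInMeasure_of_tendsto_eLpNorm one_ne_zero
      (fun n => (contDiff_mollify hfi.locallyIntegrable).continuous.aestronglyMeasurable)
      ((hf.integrableOn_compact_subset hKT hK).aestronglyMeasurable) ?_
    simpa only [eLpNorm_one_eq_lintegral_enorm, Pi.sub_apply] using hfc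
  obtain ⟨ns, hns, hae⟩ := hmeas.exists_seq_tendsto_ae
  have hsupp : HasCompactSupport (K'.indicator f) :=
    HasCompactSupport.intro hK'c fun z hz => indicator_of_notMem hz f
  refine ⟨fun n => mollify (a (ns n)) (K'.indicator f), fun n => mollify (a (ns n))
    (K'.indicator θ), fun n => contDiff_mollify hfi.locallyIntegrable,
    fun n => hasCompactSupport_mollify hsupp,
    fun n => (contDiff_mollify hθi.locallyIntegrable).continuous, ?_,
    hfc.comp hns.tendsto_atTop, (hconv θ hθi).comp hns.tendsto_atTop, hae⟩
  intro n z hz ξ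
  exact hw.fderiv_mollify hfi.locallyIntegrable hθi.locallyIntegrable
    (hpt _ (ha0 _) (haδ _) z hz) ξ

end HasWeakGrad

/-- By Rademacher's theorem the derivatives are line derivatives almost everywhere, for which
integration by parts between Lipschitz functions is available. -/
theorem integral_mul_fderiv_of_lipschitz {F ψ : Euc d → ℝ} {C D : ℝ≥0} (hF : LipschitzWith C F)
    (hψ : LipschitzWith D ψ) (hs : HasCompactSupport ψ) (ξ : Euc d) :
    ∫ z, F z * fderiv ℝ ψ z ξ = - ∫ z, fderiv ℝ F z ξ * ψ z := by
  have h := LipschitzWith.integral_lineDeriv_mul_eq (μ := (volume : Measure (Euc d))) hF hψ hs (-ξ)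
  rw [neg_neg] at h
  have e1 : ∫ z, F z * fderiv ℝ ψ z ξ = ∫ z, lineDeriv ℝ ψ z ξ * F z := by
    refine integral_congr_ae ?_
    filter_upwards [hψ.ae_differentiableAt] with z hz
    rw [hz.lineDeriv_eq_fderiv, mul_comm]
  have e2 : ∫ z, lineDeriv ℝ F z (-ξ) * ψ z = - ∫ z, fderiv ℝ F z ξ * ψ z := by
    rw [← integral_neg]
    refine integral_congr_ae ?_
    filter_upwards [hF.ae_differentiableAt] with z hz
    rw [hz.lineDeriv_eq_fderiv, map_neg, neg_mul]
  rw [e1, ← h, e2]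

theorem tendsto_setIntegral_mul {K : Set (Euc d)} {f b : Euc d → ℝ} {g : ℕ → Euc d → ℝ} {C : ℝ}
    (hf : IntegrableOn f K) (hg : ∀ n, IntegrableOn (g n) K)
    (h : Tendsto (fun n => ∫⁻ z in K, ‖g n z - f z‖ₑ) atTop (𝓝 0))
    (hb : AEStronglyMeasurable b (volume.restrict K)) (hbC : ∀ z, |b z| ≤ C) :
    Tendsto (fun n => ∫ z in K, g n z * b z) atTop (𝓝 (∫ z in K, f z * b z)) := by
  have hbC' : ∀ᵐ z ∂(volume.restrict K), ‖b z‖ ≤ C := Eventually.of_forall hbC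
  refine tendsto_integral_of_L1 _ (hf.mul_bdd hb hbC').aestronglyMeasurable
    (Eventually.of_forall fun n => (hg n).mul_bdd hb hbC') ?_
  have h2 : Tendsto (fun n => (∫⁻ z in K, ‖g n z - f z‖ₑ) * ENNReal.ofReal C) atTop (𝓝 0) := by
    simpa using ENNReal.Tendsto.mul_const h (Or.inr ENNReal.ofReal_ne_top)
  refine tendsto_of_tendsto_of_tendsto_of_le_of_le tendsto_const_nhds h2 (fun n => bot_le)
    fun n => ?_
  calc _ ≤ ∫⁻ z in K, ‖g n z - f z‖ₑ * ENNReal.ofReal C := by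
        refine lintegral_mono fun z => ?_
        simp only
        rw [← sub_mul, enorm_mul]
        gcongr
        rw [Real.enorm_eq_ofReal_abs]
        exact ENNReal.ofReal_le_ofReal (hbC z)
    _ = _ := lintegral_mul_const' _ _ ENNReal.ofReal_ne_top

theorem lintegral_inner_sub_le {K : Set (Euc d)} (G θ : Euc d → Euc d) (ξ : Euc d) :
    ∫⁻ z in K, ‖inner ℝ (G z) ξ - inner ℝ (θ z) ξ‖ₑ ≤ (∫⁻ z in K, ‖G z - θ z‖ₑ) * ‖ξ‖ₑ := by
  rw [← lintegral_mul_const' _ _ enorm_ne_top]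
  refine lintegral_mono fun z => ?_
  rw [← inner_sub_left, ← enorm_norm (G z - θ z), ← enorm_norm ξ, ← enorm_mul]
  refine enorm_le_iff_norm_le.2 ?_
  rw [Real.norm_of_nonneg (by positivity : 0 ≤ ‖G z - θ z‖ * ‖ξ‖)]
  exact norm_inner_le_norm _ _

theorem tendsto_lintegral_inner_sub {K : Set (Euc d)} {G : ℕ → Euc d → Euc d}
    {θ : Euc d → Euc d} (h : Tendsto (fun n => ∫⁻ z in K, ‖G n z - θ z‖ₑ) atTop (𝓝 0))
    (ξ : Euc d) :
    Tendsto (fun n => ∫⁻ z in K, ‖inner ℝ (G n z) ξ - inner ℝ (θ z) ξ‖ₑ) atTop (𝓝 0) := by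
  have h2 : Tendsto (fun n => (∫⁻ z in K, ‖G n z - θ z‖ₑ) * ‖ξ‖ₑ) atTop (𝓝 0) := by
    simpa using ENNReal.Tendsto.mul_const h (Or.inr enorm_ne_top)
  exact tendsto_of_tendsto_of_tendsto_of_le_of_le tendsto_const_nhds h2 (fun n => bot_le)
    fun n => lintegral_inner_sub_le _ _ _

end

/-! ### Calculus of weak gradients: Lipschitz test functions, uniqueness, locality, chain and
product rules -/

section

variable {d : ℕ} [NeZero d]

theorem integrable_mul_of_tsupport {f b : Euc d → ℝ} {U : Set (Euc d)}
    (hf : LocallyIntegrableOn f U) (hb : Continuous b) (hbc : HasCompactSupport b)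
    (hbU : tsupport b ⊆ U) : Integrable fun z => f z * b z := by
  obtain ⟨C, hC⟩ := hbc.exists_bound_of_continuous hb
  have h1 : IntegrableOn (fun z => f z * b z) (tsupport b) :=
    (hf.integrableOn_compact_subset hbU hbc).mul_bdd hb.aestronglyMeasurable
      (Eventually.of_forall hC)
  refine (integrableOn_iff_integrable_of_support_subset ?_).1 h1
  intro z hz
  by_contra h
  exact hz (by simp [image_eq_zero_of_notMem_tsupport h])

theorem locallyIntegrableOn_inner {θ : Euc d → Euc d} {U : Set (Euc d)}
    (hθ : LocallyIntegrableOn θ U) (ξ : Euc d) :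
    LocallyIntegrableOn (fun z => (inner ℝ (θ z) ξ : ℝ)) U := by
  intro z hz
  obtain ⟨s, hs, hi⟩ := hθ z hz
  exact ⟨s, hs, hi.inner_const ξ⟩

/-- If one point lies in the support, the other is either in the compact `1`-neighbourhood, where
`ψ` is uniformly Lipschitz, or at distance more than `1`, where the sup bound serves as a Lipschitz
bound. -/
theorem exists_lipschitzWith_of_hasCompactSupport {ψ : Euc d → ℝ} (h : LocallyLipschitz ψ)
    (hs : HasCompactSupport ψ) : ∃ C, LipschitzWith C ψ := by
  set B := Metric.cthickening 1 (tsupport ψ)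
  have hB : IsCompact B := hs.isCompact.cthickening
  obtain ⟨C, hC⟩ := (h.locallyLipschitzOn (s := B)).exists_lipschitzOnWith_of_compact hB
  obtain ⟨M, hM⟩ := hs.exists_bound_of_continuous h.continuous
  have hM0 : 0 ≤ M := (norm_nonneg _).trans (hM 0)
  have hsB : tsupport ψ ⊆ B := Metric.self_subset_cthickening _
  have key : ∀ x ∈ tsupport ψ, ∀ y, dist (ψ x) (ψ y) ≤ max C M.toNNReal * dist x y := by
    intro x hx y
    by_cases hy : y ∈ B
    · exact (hC.dist_le_mul x (hsB hx) y hy).trans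
        (mul_le_mul_of_nonneg_right (by exact_mod_cast le_max_left C M.toNNReal) dist_nonneg)
    · have h1 : 1 < dist x y := by
        by_contra hle
        refine hy (Metric.mem_cthickening_of_dist_le y x 1 _ hx ?_)
        rw [dist_comm]; exact not_lt.1 hle
      rw [image_eq_zero_of_notMem_tsupport (fun h' => hy (hsB h')), dist_zero_right]
      calc ‖ψ x‖ ≤ M := hM x
        _ ≤ M * dist x y := le_mul_of_one_le_right hM0 h1.le
        _ ≤ _ := mul_le_mul_of_nonneg_right (by
          have : (M.toNNReal : ℝ) = M := Real.coe_toNNReal M hM0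
          calc M = (M.toNNReal : ℝ) := this.symm
            _ ≤ _ := by exact_mod_cast le_max_right C M.toNNReal) dist_nonneg
  refine ⟨max C M.toNNReal, LipschitzWith.of_dist_le_mul fun x y => ?_⟩
  by_cases hx : x ∈ tsupport ψ
  · exact key x hx y
  by_cases hy : y ∈ tsupport ψ
  · rw [dist_comm (ψ x), dist_comm x]; exact key y hy x
  rw [image_eq_zero_of_notMem_tsupport hx, image_eq_zero_of_notMem_tsupport hy, dist_self]
  positivity

theorem locallyLipschitz_mul_of_tsupport {η φ : Euc d → ℝ} {T : Set (Euc d)}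
    (hη : LocallyLipschitzOn T η) (hφ : LocallyLipschitz φ) (hs : tsupport φ ⊆ interior T) :
    LocallyLipschitz fun z => η z * φ z := by
  intro z
  by_cases hz : z ∈ tsupport φ
  · obtain ⟨K, u, hu, hK⟩ := hη (interior_subset (hs hz))
    obtain ⟨L, v, hv, hL⟩ := hφ z
    rw [nhdsWithin_eq_nhds.2 (mem_interior_iff_mem_nhds.1 (hs hz))] at hu
    obtain ⟨r, hr, hB⟩ := Metric.nhds_basis_closedBall.mem_iff.1 (inter_mem hu hv)
    have hηb : LipschitzOnWith K η (Metric.closedBall z r) := hK.mono (hB.trans inter_subset_left)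
    have hφb : LipschitzOnWith L φ (Metric.closedBall z r) := hL.mono (hB.trans inter_subset_right)
    obtain ⟨M, hM⟩ := (isCompact_closedBall z r).exists_bound_of_continuousOn hηb.continuousOn
    obtain ⟨N, hN⟩ := (isCompact_closedBall z r).exists_bound_of_continuousOn hφb.continuousOn
    have hM0 : 0 ≤ M := (norm_nonneg _).trans (hM z (Metric.mem_closedBall_self hr.le))
    have hN0 : 0 ≤ N := (norm_nonneg _).trans (hN z (Metric.mem_closedBall_self hr.le))
    refine ⟨M.toNNReal * L + N.toNNReal * K, _, Metric.closedBall_mem_nhds z hr,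
      LipschitzOnWith.of_dist_le_mul fun x hx y hy => ?_⟩
    have h1 := hηb.dist_le_mul x hx y hy
    have h2 := hφb.dist_le_mul x hx y hy
    rw [Real.dist_eq] at h1 h2 ⊢
    have e : η x * φ x - η y * φ y = η x * (φ x - φ y) + φ y * (η x - η y) := by ring
    push_cast
    rw [e, Real.coe_toNNReal M hM0, Real.coe_toNNReal N hN0, add_mul, mul_assoc, mul_assoc]
    refine (abs_add_le _ _).trans (add_le_add ?_ ?_)
    · rw [abs_mul]
      exact mul_le_mul (hM x hx) h2 (abs_nonneg _) hM0
    · rw [abs_mul]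
      exact mul_le_mul (hN y hy) h1 (abs_nonneg _) hN0
  · refine ⟨0, (tsupport φ)ᶜ, (isClosed_tsupport φ).isOpen_compl.mem_nhds hz,
      LipschitzOnWith.of_dist_le_mul fun x hx y hy => ?_⟩
    simp [image_eq_zero_of_notMem_tsupport hx, image_eq_zero_of_notMem_tsupport hy]

theorem tsupport_mul_subset_right' {η φ : Euc d → ℝ} :
    tsupport (fun z => η z * φ z) ⊆ tsupport φ :=
  closure_mono fun z hz => by
    intro h
    exact hz (by simp [h])

namespace HasWeakGrad

variable {f : Euc d → ℝ} {θ θ' : Euc d → Euc d} {U T : Set (Euc d)}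

/-- It is `f`, not the test function, that is smoothed: the smooth approximants satisfy the formula
for Lipschitz `ψ`, and both sides converge because `ψ` and its derivative are bounded. -/
theorem integral_lipschitz (hT : IsModelSet T) (hf : LocallyIntegrableOn f T)
    (hθ : LocallyIntegrableOn θ T) (h : HasWeakGrad f θ (interior T)) {ψ : Euc d → ℝ} {C : ℝ≥0}
    (hψ : LipschitzWith C ψ) (hs : HasCompactSupport ψ) (hsT : tsupport ψ ⊆ interior T)
    (ξ : Euc d) : ∫ z, f z * fderiv ℝ ψ z ξ = - ∫ z, inner ℝ (θ z) ξ * ψ z := by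
  set K := tsupport ψ
  have hKT : K ⊆ T := hsT.trans interior_subset
  obtain ⟨g, G, hg, hgs, hGc, hgG, hgf, hGθ, -⟩ := h.exists_smooth_approx hT hf hθ hs hKT
  have hfK := hf.integrableOn_compact_subset hKT hs
  have hθK := hθ.integrableOn_compact_subset hKT hs
  obtain ⟨M, hM⟩ := hs.exists_bound_of_continuous hψ.continuous
  have l1 : Tendsto (fun n => ∫ z in K, g n z * fderiv ℝ ψ z ξ) atTop
      (𝓝 (∫ z in K, f z * fderiv ℝ ψ z ξ)) := by
    refine tendsto_setIntegral_mul hfK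
      (fun n => (hg n).continuous.continuousOn.integrableOn_compact hs) hgf
      (measurable_fderiv_apply_const ℝ ψ ξ).aestronglyMeasurable (C := C * ‖ξ‖) fun z => ?_
    exact ((fderiv ℝ ψ z).le_opNorm ξ).trans
      (mul_le_mul_of_nonneg_right (norm_fderiv_le_of_lipschitz ℝ hψ) (norm_nonneg _))
  have l2 : Tendsto (fun n => ∫ z in K, inner ℝ (G n z) ξ * ψ z) atTop
      (𝓝 (∫ z in K, inner ℝ (θ z) ξ * ψ z)) := by
    refine tendsto_setIntegral_mul (hθK.inner_const ξ)
      (fun n => ((hGc n).continuousOn.integrableOn_compact hs).inner_const ξ)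
      (tendsto_lintegral_inner_sub hGθ ξ) hψ.continuous.aestronglyMeasurable (C := M) hM
  rw [setIntegral_mul_fderiv le_rfl] at l1
  rw [setIntegral_mul_of_tsupport le_rfl] at l2
  refine tendsto_nhds_unique l1 (l2.neg.congr fun n => ?_)
  obtain ⟨D, hD⟩ := ContDiff.lipschitzWith_of_hasCompactSupport (hgs n) (hg n) (by simp)
  rw [setIntegral_mul_fderiv le_rfl, integral_mul_fderiv_of_lipschitz hD hψ hs ξ,
    ← setIntegral_mul_of_tsupport (U := K) le_rfl]
  congr 1
  exact setIntegral_congr_fun hs.isCompact.measurableSet fun z hz => by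
    simp only [hgG n z hz ξ]

theorem unique (hU : IsOpen U) (hθ : LocallyIntegrableOn θ U) (hθ' : LocallyIntegrableOn θ' U)
    (h : HasWeakGrad f θ U) (h' : HasWeakGrad f θ' U) : ∀ᵐ z, z ∈ U → θ z = θ' z := by
  have h0 : ∀ᵐ z, z ∈ U → (θ - θ') z = 0 := by
    refine hU.ae_eq_zero_of_integral_contDiff_smul_eq_zero (hθ.sub hθ') ?_
    intro φ h1 h2 h3
    have hint : ∀ {τ : Euc d → Euc d}, LocallyIntegrableOn τ U →
        Integrable fun z => φ z • τ z := by
      intro τ hτ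
      obtain ⟨C, hC⟩ := h2.exists_bound_of_continuous h1.continuous
      have : IntegrableOn (fun z => φ z • τ z) (tsupport φ) :=
        (hτ.integrableOn_compact_subset h3 h2).bdd_smul _ h1.continuous.aestronglyMeasurable
          (Eventually.of_forall hC)
      refine (integrableOn_iff_integrable_of_support_subset ?_).1 this
      intro z hz
      by_contra h
      exact hz (by simp [image_eq_zero_of_notMem_tsupport h])
    have e : ∀ {τ : Euc d → Euc d}, LocallyIntegrableOn τ U → ∀ ξ,
        inner ℝ ξ (∫ z, φ z • τ z) = ∫ z, inner ℝ (τ z) ξ * φ z := by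
      intro τ hτ ξ
      rw [← integral_inner (hint hτ)]
      refine integral_congr_ae (Eventually.of_forall fun y => ?_)
      simp only [inner_smul_right, real_inner_comm ξ]
      ring
    simp only [Pi.sub_apply, smul_sub]
    rw [integral_sub (hint hθ) (hint hθ')]
    refine ext_inner_left ℝ fun ξ => ?_
    rw [inner_sub_right, e hθ, e hθ', inner_zero_right]
    linarith [h φ h1 h2 h3 ξ, h' φ h1 h2 h3 ξ]
  filter_upwards [h0] with z hz hzU
  exact sub_eq_zero.1 (hz hzU)

/-- A test function is split by a smooth partition of unity subordinate to finitely many of the sets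
`V`. -/
theorem of_locally (hf : LocallyIntegrableOn f U) (hθ : LocallyIntegrableOn θ U)
    (h : ∀ z ∈ U, ∃ V, IsOpen V ∧ z ∈ V ∧ HasWeakGrad f θ V) : HasWeakGrad f θ U := by
  intro φ h1 h2 h3 ξ
  choose! V hVo hzV hV using h
  obtain ⟨t, ht⟩ := h2.isCompact.elim_nhds_subcover' (fun z hz => V z)
    (fun z hz => (hVo z (h3 hz)).mem_nhds (hzV z (h3 hz)))
  obtain ⟨ρ, hρ⟩ := SmoothPartitionOfUnity.exists_isSubordinate (modelWithCornersSelf ℝ (Euc d))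
    (isClosed_tsupport φ) (fun i : t => V (i : tsupport φ))
    (fun i => hVo _ (h3 (i : tsupport φ).2)) (by
      intro z hz
      obtain ⟨i, hi, hz⟩ := mem_iUnion₂.1 (ht hz)
      exact mem_iUnion.2 ⟨⟨i, hi⟩, hz⟩)
  have hρd : ∀ i, ContDiff ℝ ∞ (ρ i) := fun i => (ρ i).contMDiff.contDiff
  have hφi : ∀ i, ContDiff ℝ ∞ (fun z => ρ i z * φ z) := fun i => (hρd i).mul h1
  have hsi : ∀ i, HasCompactSupport (fun z => ρ i z * φ z) := fun i => h2.mul_left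
  have hsub : ∀ i, tsupport (fun z => ρ i z * φ z) ⊆ U := fun i =>
    tsupport_mul_subset_right'.trans h3
  have hsum : ∀ z, φ z = ∑ i, ρ i z * φ z := by
    intro z
    by_cases hz : z ∈ tsupport φ
    · rw [← Finset.sum_mul, ← finsum_eq_sum_of_fintype, ρ.sum_eq_one hz, one_mul]
    · simp [image_eq_zero_of_notMem_tsupport hz]
  have hi : ∀ i, ∫ z, f z * fderiv ℝ (fun z => ρ i z * φ z) z ξ =
      - ∫ z, inner ℝ (θ z) ξ * (ρ i z * φ z) := by
    intro i
    refine hV _ (h3 (i : tsupport φ).2) _ (hφi i) (hsi i) ?_ ξ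
    refine Subset.trans ?_ (hρ i)
    refine closure_mono fun z hz h => hz (by simp [h])
  have hfd : ∀ z, fderiv ℝ φ z ξ = ∑ i, fderiv ℝ (fun z => ρ i z * φ z) z ξ := by
    intro z
    have : φ = fun z => ∑ i, ρ i z * φ z := funext hsum
    conv_lhs => rw [this]
    rw [fderiv_fun_sum fun i _ => (hφi i).differentiable (by simp) z]
    simp
  simp_rw [hfd, Finset.mul_sum]
  rw [integral_finsetSum]
  · simp_rw [hi]
    rw [Finset.sum_neg_distrib, ← integral_finsetSum]
    · congr 1
      refine integral_congr_ae (Eventually.of_forall fun z => ?_)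
      simp only
      rw [← Finset.mul_sum, ← hsum]
    · intro i _
      exact integrable_mul_of_tsupport (locallyIntegrableOn_inner hθ ξ) (hφi i).continuous (hsi i)
        (hsub i)
  · intro i _
    refine integrable_mul_of_tsupport hf
      (((hφi i).continuous_fderiv (by simp)).clm_apply continuous_const)
      (((hsi i).fderiv ℝ).mono' ?_) ?_
    · intro z hz
      refine subset_tsupport _ ?_
      intro h
      exact hz (by simp [h])
    · refine Subset.trans (closure_minimal ?_ (isClosed_tsupport _)) (hsub i)
      intro z hz
      by_contra h
      exact hz (fderiv_apply_eq_zero_of_notMem h ξ)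

/-- The classical chain rule for the smooth approximants `g n` of `f` passes to the limit. -/
theorem comp (hT : IsModelSet T) (hf : LocallyIntegrableOn f T) (hθ : LocallyIntegrableOn θ T)
    (h : HasWeakGrad f θ (interior T)) {q q' : ℝ → ℝ} {C : ℝ≥0}
    (hq : ∀ s, HasDerivAt q (q' s) s) (hq' : Continuous q') (hC : ∀ s, |q' s| ≤ C) :
    HasWeakGrad (fun z => q (f z)) (fun z => q' (f z) • θ z) (interior T) := by
  intro φ h1 h2 h3 ξ
  set K := tsupport φ
  have hK : IsCompact K := h2
  have hKT : K ⊆ T := h3.trans interior_subset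
  obtain ⟨g, G, hg, hgs, hGc, hgG, hgf, hGθ, hae⟩ := h.exists_smooth_approx hT hf hθ h2 hKT
  have hfK := hf.integrableOn_compact_subset hKT h2
  have hθK := hθ.integrableOn_compact_subset hKT h2
  have hθξ : IntegrableOn (fun z => (inner ℝ (θ z) ξ : ℝ)) K := hθK.inner_const ξ
  have hGξ : ∀ n, IntegrableOn (fun z => (inner ℝ (G n z) ξ : ℝ)) K := fun n =>
    ((hGc n).continuousOn.integrableOn_compact hK).inner_const ξ
  have hqL : LipschitzWith C q :=
    lipschitzWith_of_nnnorm_deriv_le (fun s => (hq s).differentiableAt) fun s => by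
      rw [(hq s).deriv, ← NNReal.coe_le_coe, coe_nnnorm]; exact hC s
  obtain ⟨M, hM⟩ := h2.exists_bound_of_continuous h1.continuous
  obtain ⟨D, hD⟩ := ContDiff.lipschitzWith_of_hasCompactSupport h2 h1 (by simp)
  have l1 : Tendsto (fun n => ∫ z in K, q (g n z) * fderiv ℝ φ z ξ) atTop
      (𝓝 (∫ z in K, q (f z) * fderiv ℝ φ z ξ)) := by
    have hfin : IsFiniteMeasure (volume.restrict K) := ⟨by simpa using hK.measure_lt_top⟩
    refine tendsto_setIntegral_mul ?_
      (fun n => (hqL.continuous.comp (hg n).continuous).continuousOn.integrableOn_compact hK) ?_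
      (measurable_fderiv_apply_const ℝ φ ξ).aestronglyMeasurable (C := D * ‖ξ‖) fun z => ?_
    · refine Integrable.mono' (g := fun z => ‖q 0‖ + C * ‖f z‖)
        ((integrable_const _).add (hfK.norm.const_mul _))
        (hqL.continuous.comp_aestronglyMeasurable hfK.aestronglyMeasurable)
        (Eventually.of_forall fun z => ?_)
      have := hqL.dist_le_mul (f z) 0
      rw [dist_eq_norm, dist_zero_right] at this
      calc ‖q (f z)‖ = ‖q 0 + (q (f z) - q 0)‖ := by congr 1; ring
        _ ≤ _ := (norm_add_le _ _).trans (add_le_add le_rfl this)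
    · have h2 : Tendsto (fun n => (C : ℝ≥0∞) * ∫⁻ z in K, ‖g n z - f z‖ₑ) atTop (𝓝 0) := by
        simpa using ENNReal.Tendsto.const_mul hgf (Or.inr (ENNReal.coe_ne_top (r := C)))
      refine tendsto_of_tendsto_of_tendsto_of_le_of_le tendsto_const_nhds h2 (fun n => bot_le)
        fun n => ?_
      rw [← lintegral_const_mul' _ _ ENNReal.coe_ne_top]
      refine lintegral_mono fun z => ?_
      have := hqL (g n z) (f z)
      rwa [edist_eq_enorm_sub, edist_eq_enorm_sub] at this
    · exact ((fderiv ℝ φ z).le_opNorm ξ).trans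
        (mul_le_mul_of_nonneg_right (norm_fderiv_le_of_lipschitz ℝ hD) (norm_nonneg _))
  -- Two limits are taken separately in `q' (g n) G n`: replacing `G n` by `θ` costs an `L¹` error
  -- times a bounded factor, and then `q' (g n) θ` converges by domination, using the almost
  -- everywhere convergence of `g n`.
  have l2 : Tendsto (fun n => ∫ z in K, inner ℝ (G n z) ξ * (q' (g n z) * φ z) -
      inner ℝ (θ z) ξ * (q' (g n z) * φ z)) atTop (𝓝 0) := by
    have hlim : Tendsto (fun n => (∫⁻ z in K, ‖(inner ℝ (G n z) ξ : ℝ) - inner ℝ (θ z) ξ‖ₑ) *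
        ENNReal.ofReal (C * M)) atTop (𝓝 0) := by
      simpa using ENNReal.Tendsto.mul_const (tendsto_lintegral_inner_sub hGθ ξ)
        (Or.inr (ENNReal.ofReal_ne_top (r := C * M)))
    rw [tendsto_zero_iff_enorm_tendsto_zero]
    refine tendsto_of_tendsto_of_tendsto_of_le_of_le tendsto_const_nhds hlim (fun n => bot_le)
      fun n => ?_
    refine (enorm_integral_le_lintegral_enorm _).trans ?_
    rw [← lintegral_mul_const' _ _ ENNReal.ofReal_ne_top]
    refine lintegral_mono fun z => ?_
    simp only
    rw [← sub_mul, enorm_mul]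
    gcongr
    rw [Real.enorm_eq_ofReal_abs, abs_mul]
    exact ENNReal.ofReal_le_ofReal (mul_le_mul (hC _) (hM z) (abs_nonneg _) C.2)
  have hb : ∀ n, IntegrableOn (fun z => (inner ℝ (θ z) ξ : ℝ) * (q' (g n z) * φ z)) K := fun n =>
    hθξ.mul_bdd (c := C * M)
      ((hq'.comp (hg n).continuous).mul h1.continuous).aestronglyMeasurable
      (Eventually.of_forall fun z => by
        rw [norm_mul]; exact mul_le_mul (hC _) (hM z) (norm_nonneg _) C.2)
  have hb' : ∀ n, IntegrableOn (fun z => (inner ℝ (G n z) ξ : ℝ) * (q' (g n z) * φ z)) K :=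
    fun n => (hGξ n).mul_bdd (c := C * M)
      ((hq'.comp (hg n).continuous).mul h1.continuous).aestronglyMeasurable
      (Eventually.of_forall fun z => by
        rw [norm_mul]; exact mul_le_mul (hC _) (hM z) (norm_nonneg _) C.2)
  have l3 : Tendsto (fun n => ∫ z in K, inner ℝ (θ z) ξ * (q' (g n z) * φ z)) atTop
      (𝓝 (∫ z in K, inner ℝ (θ z) ξ * (q' (f z) * φ z))) := by
    refine tendsto_integral_of_dominated_convergence
      (fun z => ‖(inner ℝ (θ z) ξ : ℝ)‖ * (C * M)) (fun n => (hb n).aestronglyMeasurable)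
      (hθξ.norm.mul_const _) (fun n => Eventually.of_forall fun z => ?_) ?_
    · rw [norm_mul, norm_mul]
      gcongr
      · exact hC _
      · exact hM z
    · filter_upwards [hae] with z hz
      exact tendsto_const_nhds.mul (((hq'.tendsto _).comp hz).mul tendsto_const_nhds)
  have l4 := l2.add l3
  rw [zero_add] at l4
  rw [setIntegral_mul_fderiv le_rfl] at l1
  have e : ∫ z, inner ℝ (q' (f z) • θ z) ξ * φ z =
      ∫ z in K, inner ℝ (θ z) ξ * (q' (f z) * φ z) := by
    rw [← setIntegral_mul_of_tsupport (U := K) le_rfl]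
    congr 1
    ext z
    rw [inner_smul_left]
    simp only [conj_trivial]; ring
  rw [e]
  refine tendsto_nhds_unique l1 (l4.neg.congr fun n => ?_)
  obtain ⟨D', hD'⟩ := ContDiff.lipschitzWith_of_hasCompactSupport (hgs n) (hg n) (by simp)
  rw [setIntegral_mul_fderiv le_rfl,
    integral_mul_fderiv_of_lipschitz (F := fun z => q (g n z)) (hqL.comp hD') hD h2 ξ,
    ← setIntegral_mul_of_tsupport (U := K) le_rfl, integral_sub (hb' n) (hb n), sub_add_cancel]
  congr 1
  refine setIntegral_congr_fun hK.measurableSet fun z hz => ?_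
  have : fderiv ℝ (fun z => q (g n z)) z ξ = q' (g n z) * inner ℝ (G n z) ξ := by
    rw [← hgG n z hz ξ]
    have h5 := (hq (g n z)).comp_hasFDerivAt z
      (((hg n).differentiable (by simp) z).hasFDerivAt)
    change fderiv ℝ (q ∘ g n) z ξ = _
    rw [h5.fderiv]
    simp
  simp only [this]
  ring

theorem const (c : ℝ) : HasWeakGrad (fun _ => c) (fun _ => (0 : Euc d)) U := by
  intro φ h1 h2 h3 ξ
  obtain ⟨D, hD⟩ := ContDiff.lipschitzWith_of_hasCompactSupport h2 h1 (by simp)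
  have := integral_mul_fderiv_of_lipschitz (F := fun _ => c) (LipschitzWith.const (α := Euc d) c)
    hD h2 ξ
  rw [this]
  simp

/-- The weak gradient of `f` is tested with the Lipschitz function `η φ`. -/
theorem mul_locallyLipschitz (hT : IsModelSet T) (hf : LocallyIntegrableOn f T)
    (hθ : LocallyIntegrableOn θ T) (h : HasWeakGrad f θ (interior T)) {η : Euc d → ℝ}
    (hη : LocallyLipschitzOn T η) :
    HasWeakGrad (fun z => η z * f z) (fun z => η z • θ z + f z • gradient η z) (interior T) := by
  intro φ h1 h2 h3 ξ
  obtain ⟨D, hD⟩ := ContDiff.lipschitzWith_of_hasCompactSupport h2 h1 (by simp)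
  set K := tsupport φ
  have hK : IsCompact K := h2
  have hKT : K ⊆ T := h3.trans interior_subset
  have hψl := locallyLipschitz_mul_of_tsupport hη hD.locallyLipschitz h3
  have hψs : HasCompactSupport fun z => η z * φ z := h2.mul_left
  obtain ⟨C, hC⟩ := exists_lipschitzWith_of_hasCompactSupport hψl hψs
  have hw := h.integral_lipschitz hT hf hθ hC hψs (tsupport_mul_subset_right'.trans h3) ξ
  have hfK := hf.integrableOn_compact_subset hKT h2
  have hηc : ContinuousOn η K := hη.continuousOn.mono hKT
  obtain ⟨M, hM⟩ := hK.exists_bound_of_continuousOn hηc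
  have hfd : ∀ᵐ z, fderiv ℝ (fun z => η z * φ z) z ξ =
      η z * fderiv ℝ φ z ξ + inner ℝ (gradient η z) ξ * φ z := by
    filter_upwards [ae_differentiableAt_of_locallyLipschitzOn hη] with z hz
    by_cases hzK : z ∈ K
    · rw [fderiv_fun_mul (hz (h3 hzK)) (h1.differentiable (by simp) z), inner_gradient_left]
      simp [mul_comm]
    · rw [fderiv_apply_eq_zero_of_notMem hzK, image_eq_zero_of_notMem_tsupport hzK,
        fderiv_apply_eq_zero_of_notMem (fun h' => hzK (tsupport_mul_subset_right' h'))]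
      simp
  have i1 : Integrable fun z => f z * fderiv ℝ (fun z => η z * φ z) z ξ := by
    refine (integrableOn_iff_integrable_of_support_subset (s := K) ?_).1
      (hfK.mul_bdd (c := C * ‖ξ‖) (measurable_fderiv_apply_const ℝ _ ξ).aestronglyMeasurable
        (Eventually.of_forall fun z => ?_))
    · intro z hz
      by_contra hzK
      exact hz (by
        simp only
        rw [fderiv_apply_eq_zero_of_notMem (fun h' => hzK (tsupport_mul_subset_right' h')),
          mul_zero])
    · exact ((fderiv ℝ _ z).le_opNorm ξ).trans
        (mul_le_mul_of_nonneg_right (norm_fderiv_le_of_lipschitz ℝ hC) (norm_nonneg _))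
  have i2 : Integrable fun z => η z * f z * fderiv ℝ φ z ξ := by
    have hb : AEStronglyMeasurable (fun z => η z * fderiv ℝ φ z ξ) (volume.restrict K) :=
      (hηc.aestronglyMeasurable hK.measurableSet).mul
        (measurable_fderiv_apply_const ℝ _ ξ).aestronglyMeasurable
    have hbd : ∀ᵐ z ∂(volume.restrict K), ‖η z * fderiv ℝ φ z ξ‖ ≤ M * (D * ‖ξ‖) := by
      filter_upwards [ae_restrict_mem hK.measurableSet] with z hz
      rw [norm_mul]
      refine mul_le_mul (hM z hz) (((fderiv ℝ φ z).le_opNorm ξ).trans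
        (mul_le_mul_of_nonneg_right (norm_fderiv_le_of_lipschitz ℝ hD) (norm_nonneg _)))
        (norm_nonneg _) ((norm_nonneg _).trans (hM z hz))
    have : IntegrableOn (fun z => η z * f z * fderiv ℝ φ z ξ) K := by
      have h5 := hfK.mul_bdd hb hbd
      refine h5.congr (Eventually.of_forall fun z => ?_)
      simp only; ring
    refine (integrableOn_iff_integrable_of_support_subset ?_).1 this
    intro z hz
    by_contra hzK
    exact hz (by simp only [fderiv_apply_eq_zero_of_notMem hzK, mul_zero])
  -- Integrability of this term is inherited from the other two terms of the product rule, so the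
  -- gradient of `η` need not be estimated.
  have i3 : Integrable fun z => f z * (inner ℝ (gradient η z) ξ * φ z) := by
    refine (i1.sub i2).congr ?_
    filter_upwards [hfd] with z hz
    simp only [Pi.sub_apply]
    rw [hz]; ring
  have i4 : Integrable fun z => (inner ℝ (θ z) ξ : ℝ) * (η z * φ z) :=
    integrable_mul_of_tsupport (locallyIntegrableOn_inner (hθ.mono_set interior_subset) ξ)
      hψl.continuous hψs (tsupport_mul_subset_right'.trans h3)
  have e1 : ∫ z, f z * fderiv ℝ (fun z => η z * φ z) z ξ =
      (∫ z, η z * f z * fderiv ℝ φ z ξ) + ∫ z, f z * (inner ℝ (gradient η z) ξ * φ z) := by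
    rw [← integral_add i2 i3]
    refine integral_congr_ae ?_
    filter_upwards [hfd] with z hz
    rw [hz]; ring
  have e2 : ∫ z, inner ℝ (η z • θ z + f z • gradient η z) ξ * φ z =
      (∫ z, inner ℝ (θ z) ξ * (η z * φ z)) + ∫ z, f z * (inner ℝ (gradient η z) ξ * φ z) := by
    rw [← integral_add i4 i3]
    refine integral_congr_ae (Eventually.of_forall fun z => ?_)
    simp only [inner_add_left, inner_smul_left, conj_trivial]
    ring
  rw [e2]
  linarith

/-- The product rule with the constant function `1` as second factor. -/
theorem of_locallyLipschitz (hT : IsModelSet T) {η : Euc d → ℝ} (hη : LocallyLipschitzOn T η) :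
    HasWeakGrad η (gradient η) (interior T) := by
  have h := (const (U := interior T) (d := d) 1).mul_locallyLipschitz hT
    ((locallyIntegrable_const _).locallyIntegrableOn T)
    ((locallyIntegrable_const _).locallyIntegrableOn T) hη
  exact h.congr_ae (by simp) (by simp)

end HasWeakGrad

end

section

variable {d : ℕ} [NeZero d]

/-! ### Change of coordinates for weak gradients -/

section ChangeOfCoordinates

variable {f : Euc d → ℝ} {θ : Euc d → Euc d} {T S V : Set (Euc d)} {τ : Euc d → Euc d}
  {L C : ℝ≥0}

theorem integrableOn_comp_of_expanding {E : Type*} [NormedAddCommGroup E] {q : Euc d → E}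
    (hS : IsCompact S) (hc : ContinuousOn τ S)
    (hτ : ∀ x ∈ S, ∀ y ∈ S, dist x y ≤ L * dist (τ x) (τ y)) (hq : IntegrableOn q (τ '' S)) :
    IntegrableOn (fun z => q (τ z)) S := by
  have hK : MeasurableSet (τ '' S) := (hS.image_of_continuousOn hc).measurableSet
  have hm : AEMeasurable τ (volume.restrict S) := hc.aemeasurable hS.measurableSet
  have hi : Integrable ((τ '' S).indicator q) := (integrable_indicator_iff hK).2 hq
  have hle := map_restrict_le_of_expanding hS.measurableSet hc hτ
  have h1 : IntegrableOn (fun z => (τ '' S).indicator q (τ z)) S := by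
    refine ⟨AEStronglyMeasurable.comp_aemeasurable
      ((hi.aestronglyMeasurable.smul_measure ((L : ℝ≥0∞) ^ d)).mono_measure hle) hm, ?_⟩
    have := lintegral_comp_le_of_expanding hS.measurableSet hc hτ
      (F := fun z => ‖(τ '' S).indicator q z‖ₑ) hi.aestronglyMeasurable.enorm
    exact this.trans_lt (ENNReal.mul_lt_top (by finiteness) hi.2)
  exact h1.congr_fun (fun z hz => indicator_of_mem (mem_image_of_mem τ hz) q) hS.measurableSet

theorem setLIntegral_comp_le_of_expanding {F : Euc d → ℝ≥0∞}
    (hS : IsCompact S) (hc : ContinuousOn τ S)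
    (hτ : ∀ x ∈ S, ∀ y ∈ S, dist x y ≤ L * dist (τ x) (τ y))
    (hF : AEMeasurable F (volume.restrict (τ '' S))) :
    ∫⁻ z in S, F (τ z) ≤ (L : ℝ≥0∞) ^ d * ∫⁻ z in τ '' S, F z := by
  have hK : MeasurableSet (τ '' S) := (hS.image_of_continuousOn hc).measurableSet
  have := lintegral_comp_le_of_expanding hS.measurableSet hc hτ (F := (τ '' S).indicator F)
    ((aemeasurable_indicator_iff hK).2 hF)
  rw [lintegral_indicator hK] at this
  refine le_of_eq_of_le ?_ this
  exact setLIntegral_congr_fun hS.measurableSet fun z hz => by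
    simp only [indicator_of_mem (mem_image_of_mem τ hz)]

theorem integrableOn_adjoint_fderiv {E : Set (Euc d)} (hE : IsOpen E) (hτE : LipschitzOnWith C τ E)
    (hi : IntegrableOn (fun z => θ (τ z)) E) :
    IntegrableOn (fun z => ContinuousLinearMap.adjoint (fderiv ℝ τ z) (θ (τ z))) E := by
  refine Integrable.mono' (hi.norm.const_mul C) ?_ ?_
  · have h1 : AEStronglyMeasurable (fun z => ContinuousLinearMap.adjoint (fderiv ℝ τ z))
        (volume.restrict E) :=
      (ContinuousLinearMap.adjoint.continuous.measurable.comp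
        (measurable_fderiv ℝ τ)).aestronglyMeasurable
    have h2 : Continuous fun p : (Euc d →L[ℝ] Euc d) × Euc d => p.1 p.2 :=
      continuous_fst.clm_apply continuous_snd
    exact h2.comp_aestronglyMeasurable (h1.prodMk hi.aestronglyMeasurable)
  · filter_upwards [ae_restrict_mem hE.measurableSet] with z hz
    refine (ContinuousLinearMap.le_opNorm _ _).trans ?_
    gcongr
    rw [LinearIsometryEquiv.norm_map]
    exact norm_fderiv_le_of_lipschitzOn ℝ (hE.mem_nhds hz) hτE

/-- The hypotheses on coordinate changes: locally bi-Lipschitz on an open set. -/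
def IsLocallyBiLipschitz (τ : Euc d → Euc d) (V : Set (Euc d)) : Prop :=
  ∀ z ∈ V, ∃ r > 0, ∃ C L : ℝ≥0, Metric.closedBall z r ⊆ V ∧
    LipschitzOnWith C τ (Metric.closedBall z r) ∧
    ∀ x ∈ Metric.closedBall z r, ∀ y ∈ Metric.closedBall z r, dist x y ≤ L * dist (τ x) (τ y)

namespace IsLocallyBiLipschitz

theorem locallyIntegrableOn_comp (h : IsLocallyBiLipschitz τ V) (hm : MapsTo τ V T)
    (hf : LocallyIntegrableOn f T) : LocallyIntegrableOn (fun z => f (τ z)) V := by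
  intro z hz
  obtain ⟨r, hr, C, L, hV, hC, hL⟩ := h z hz
  refine ⟨_, mem_nhdsWithin_of_mem_nhds (Metric.closedBall_mem_nhds z hr), ?_⟩
  refine integrableOn_comp_of_expanding (isCompact_closedBall z r) hC.continuousOn hL ?_
  refine hf.integrableOn_compact_subset ?_
    ((isCompact_closedBall z r).image_of_continuousOn hC.continuousOn)
  exact (image_mono hV).trans hm.image_subset

theorem locallyIntegrableOn_adjoint (h : IsLocallyBiLipschitz τ V) (hm : MapsTo τ V T)
    (hθ : LocallyIntegrableOn θ T) : LocallyIntegrableOn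
      (fun z => ContinuousLinearMap.adjoint (fderiv ℝ τ z) (θ (τ z))) V := by
  intro z hz
  obtain ⟨r, hr, C, L, hV, hC, hL⟩ := h z hz
  refine ⟨_, mem_nhdsWithin_of_mem_nhds (Metric.ball_mem_nhds z hr), ?_⟩
  refine integrableOn_adjoint_fderiv Metric.isOpen_ball (hC.mono Metric.ball_subset_closedBall) ?_
  refine IntegrableOn.mono_set ?_ Metric.ball_subset_closedBall
  refine integrableOn_comp_of_expanding (isCompact_closedBall z r) hC.continuousOn hL ?_
  refine hθ.integrableOn_compact_subset ?_
    ((isCompact_closedBall z r).image_of_continuousOn hC.continuousOn)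
  exact (image_mono hV).trans hm.image_subset

/-- The chain rule holds for the smooth approximants of `f` composed with the Lipschitz map `τ`, and
the lower Lipschitz bound of `τ` keeps `L¹` convergence under substitution. Since the approximation
is valid up to the boundary of `T`, it is enough that `τ` maps into `T`; invariance of domain is not
needed to exclude boundary values. -/
theorem hasWeakGrad_comp (h : IsLocallyBiLipschitz τ V) (hm : MapsTo τ V T) (hT : IsModelSet T)
    (hf : LocallyIntegrableOn f T) (hθ : LocallyIntegrableOn θ T)
    (hw : HasWeakGrad f θ (interior T)) :
    HasWeakGrad (fun z => f (τ z))
      (fun z => ContinuousLinearMap.adjoint (fderiv ℝ τ z) (θ (τ z))) V := by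
  refine HasWeakGrad.of_locally (h.locallyIntegrableOn_comp hm hf)
    (h.locallyIntegrableOn_adjoint hm hθ) fun z₀ hz₀ => ?_
  obtain ⟨r, hr, C, L, hV, hC, hL⟩ := h z₀ hz₀
  set S := Metric.closedBall z₀ r
  set B := Metric.ball z₀ r
  have hS : IsCompact S := isCompact_closedBall z₀ r
  have hBS : B ⊆ S := Metric.ball_subset_closedBall
  have hBo : IsOpen B := Metric.isOpen_ball
  refine ⟨B, hBo, Metric.mem_ball_self hr, ?_⟩
  intro φ h1 h2 h3 ξ
  set K := τ '' S
  have hK : IsCompact K := hS.image_of_continuousOn hC.continuousOn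
  have hKT : K ⊆ T := (image_mono hV).trans hm.image_subset
  obtain ⟨g, G, hg, hgs, hGc, hgG, hgf, hGθ, -⟩ := hw.exists_smooth_approx hT hf hθ hK hKT
  have hfK := hf.integrableOn_compact_subset hKT hK
  have hθK := hθ.integrableOn_compact_subset hKT hK
  have hcomp : ∀ {E : Type} [NormedAddCommGroup E] {q : Euc d → E}, IntegrableOn q K →
      IntegrableOn (fun z => q (τ z)) B := fun hq =>
    (integrableOn_comp_of_expanding hS hC.continuousOn hL hq).mono_set hBS
  obtain ⟨D, hD⟩ := ContDiff.lipschitzWith_of_hasCompactSupport h2 h1 (by simp)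
  obtain ⟨M, hM⟩ := h2.exists_bound_of_continuous h1.continuous
  have hlim : ∀ {F : ℕ → Euc d → ℝ≥0∞}, (∀ n, AEMeasurable (F n) (volume.restrict K)) →
      Tendsto (fun n => ∫⁻ z in K, F n z) atTop (𝓝 0) →
      Tendsto (fun n => ∫⁻ z in B, F n (τ z)) atTop (𝓝 0) := by
    intro F hF hFl
    have h5 : Tendsto (fun n => (L : ℝ≥0∞) ^ d * ∫⁻ z in K, F n z) atTop (𝓝 0) := by
      simpa using ENNReal.Tendsto.const_mul hFl (Or.inr (by finiteness : (L : ℝ≥0∞) ^ d ≠ ⊤))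
    refine tendsto_of_tendsto_of_tendsto_of_le_of_le tendsto_const_nhds h5 (fun n => bot_le)
      fun n => ?_
    exact (lintegral_mono_set hBS).trans
      (setLIntegral_comp_le_of_expanding hS hC.continuousOn hL (hF n))
  have l1 : Tendsto (fun n => ∫ z in B, g n (τ z) * fderiv ℝ φ z ξ) atTop
      (𝓝 (∫ z in B, f (τ z) * fderiv ℝ φ z ξ)) := by
    refine tendsto_setIntegral_mul (hcomp hfK)
      (fun n => hcomp ((hg n).continuous.continuousOn.integrableOn_compact hK)) ?_
      (measurable_fderiv_apply_const ℝ φ ξ).aestronglyMeasurable (C := D * ‖ξ‖) fun z => ?_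
    · exact hlim (F := fun n z => ‖g n z - f z‖ₑ) (fun n =>
        ((hg n).continuous.aestronglyMeasurable.sub hfK.aestronglyMeasurable).enorm) hgf
    · exact ((fderiv ℝ φ z).le_opNorm ξ).trans
        (mul_le_mul_of_nonneg_right (norm_fderiv_le_of_lipschitz ℝ hD) (norm_nonneg _))
  have hGi : ∀ n, IntegrableOn (fun z => G n (τ z)) B := fun n =>
    hcomp ((hGc n).continuousOn.integrableOn_compact hK)
  have hCB : LipschitzOnWith C τ B := hC.mono hBS
  have l2 : Tendsto (fun n => ∫ z in B,
      inner ℝ (ContinuousLinearMap.adjoint (fderiv ℝ τ z) (G n (τ z))) ξ * φ z) atTop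
      (𝓝 (∫ z in B, inner ℝ (ContinuousLinearMap.adjoint (fderiv ℝ τ z) (θ (τ z))) ξ * φ z)) := by
    refine tendsto_setIntegral_mul ((integrableOn_adjoint_fderiv hBo hCB (hcomp hθK)).inner_const ξ)
      (fun n => (integrableOn_adjoint_fderiv hBo hCB (hGi n)).inner_const ξ)
      ?_ h1.continuous.aestronglyMeasurable (C := M) hM
    refine tendsto_lintegral_inner_sub
      (G := fun n z => ContinuousLinearMap.adjoint (fderiv ℝ τ z) (G n (τ z))) ?_ ξ
    have h5 : Tendsto (fun n => (C : ℝ≥0∞) * ∫⁻ z in B, ‖G n (τ z) - θ (τ z)‖ₑ) atTop (𝓝 0) := by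
      simpa using ENNReal.Tendsto.const_mul (hlim (F := fun n z => ‖G n z - θ z‖ₑ) (fun n =>
        ((hGc n).aestronglyMeasurable.sub hθK.aestronglyMeasurable).enorm) hGθ)
        (Or.inr (ENNReal.coe_ne_top (r := C)))
    refine tendsto_of_tendsto_of_tendsto_of_le_of_le tendsto_const_nhds h5 (fun n => bot_le)
      fun n => ?_
    rw [← lintegral_const_mul' _ _ ENNReal.coe_ne_top]
    refine lintegral_mono_ae ?_
    filter_upwards [ae_restrict_mem hBo.measurableSet] with z hz
    rw [← map_sub]
    have h6 : ‖ContinuousLinearMap.adjoint (fderiv ℝ τ z) (G n (τ z) - θ (τ z))‖ ≤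
        ‖(C : ℝ) * ‖G n (τ z) - θ (τ z)‖‖ := by
      rw [Real.norm_of_nonneg (by positivity)]
      refine (ContinuousLinearMap.le_opNorm _ _).trans ?_
      gcongr
      rw [LinearIsometryEquiv.norm_map]
      exact norm_fderiv_le_of_lipschitzOn ℝ (hBo.mem_nhds hz) hCB
    refine (enorm_le_iff_norm_le.2 h6).trans (le_of_eq ?_)
    rw [enorm_mul, enorm_norm]
    simp
  rw [setIntegral_mul_fderiv h3] at l1
  rw [setIntegral_mul_of_tsupport h3] at l2
  refine tendsto_nhds_unique l1 (l2.neg.congr fun n => ?_)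
  obtain ⟨D', hD'⟩ := ContDiff.lipschitzWith_of_hasCompactSupport (hgs n) (hg n) (by simp)
  have hgτ : LipschitzOnWith (D' * C) (fun z => g n (τ z)) B := hD'.comp_lipschitzOnWith hCB
  -- The composition is Lipschitz only on the ball; a Lipschitz extension to the whole space makes
  -- the global integration by parts applicable, and `φ` does not see the difference.
  obtain ⟨F, hF, hFe⟩ := hgτ.extend_real
  have e1 : ∫ z in B, g n (τ z) * fderiv ℝ φ z ξ = ∫ z, F z * fderiv ℝ φ z ξ := by
    rw [← setIntegral_mul_fderiv h3]
    exact setIntegral_congr_fun hBo.measurableSet fun z hz => by simp only [← hFe hz]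
  rw [e1, integral_mul_fderiv_of_lipschitz hF hD h2 ξ, ← setIntegral_mul_of_tsupport h3]
  congr 1
  refine setIntegral_congr_ae hBo.measurableSet ?_
  filter_upwards [ae_differentiableAt_of_locallyLipschitzOn (s := B) (f := τ) (by
    intro x hx; exact ⟨C, B, self_mem_nhdsWithin, hCB⟩)] with z hz hzB
  have hzτ : DifferentiableAt ℝ τ z := hz (by rwa [hBo.interior_eq])
  have h5 : F =ᶠ[𝓝 z] (g n) ∘ τ := by
    filter_upwards [hBo.mem_nhds hzB] with y hy
    exact (hFe hy).symm
  rw [h5.fderiv_eq, fderiv_comp z ((hg n).differentiable (by simp) _) hzτ,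
    ContinuousLinearMap.adjoint_inner_left, ContinuousLinearMap.comp_apply,
    hgG n _ (mem_image_of_mem τ (hBS hzB))]

end IsLocallyBiLipschitz

end ChangeOfCoordinates

/-- Weak gradients on the members of a countable open cover are glued. -/
theorem exists_glued_weakGrad {ι : Type*} [Countable ι] {f : Euc d → ℝ} {V : ι → Set (Euc d)}
    {θ : ι → Euc d → Euc d} (hV : ∀ i, IsOpen (V i)) (hf : ∀ i, LocallyIntegrableOn f (V i))
    (hθ : ∀ i, LocallyIntegrableOn (θ i) (V i)) (h : ∀ i, HasWeakGrad f (θ i) (V i)) :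
    ∃ Θ : Euc d → Euc d, LocallyIntegrableOn Θ (⋃ i, V i) ∧ HasWeakGrad f Θ (⋃ i, V i) ∧
      ∀ᵐ z, ∀ i, z ∈ V i → Θ z = θ i z := by
  classical
  -- Weak gradients are unique almost everywhere and the cover is countable, so outside one null set
  -- all local gradients agree and any choice among them will do.
  have huniq : ∀ᵐ z, ∀ i j, z ∈ V i ∩ V j → θ i z = θ j z := by
    rw [ae_all_iff]; intro i
    rw [ae_all_iff]; intro j
    exact HasWeakGrad.unique ((hV i).inter (hV j)) ((hθ i).mono_set inter_subset_left)
      ((hθ j).mono_set inter_subset_right) ((h i).mono inter_subset_left)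
      ((h j).mono inter_subset_right)
  let Θ : Euc d → Euc d := fun z => if hz : ∃ i, z ∈ V i then θ hz.choose z else 0
  have hΘ : ∀ᵐ z, ∀ i, z ∈ V i → Θ z = θ i z := by
    filter_upwards [huniq] with z hz i hi
    have hex : ∃ i, z ∈ V i := ⟨i, hi⟩
    simp only [Θ, dif_pos hex]
    exact hz _ _ ⟨hex.choose_spec, hi⟩
  have hΘi : ∀ i, ∀ᵐ z, z ∈ V i → θ i z = Θ z := fun i => by
    filter_upwards [hΘ] with z hz hi
    exact (hz i hi).symm
  have hli : ∀ {E : Type} [NormedAddCommGroup E] (q : Euc d → E),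
      (∀ i, ∃ q' : Euc d → E, LocallyIntegrableOn q' (V i) ∧ ∀ᵐ z, z ∈ V i → q' z = q z) →
      LocallyIntegrableOn q (⋃ i, V i) := by
    intro E _ q hq z hz
    obtain ⟨i, hi⟩ := mem_iUnion.1 hz
    obtain ⟨q', hq', hqe⟩ := hq i
    obtain ⟨s, hs, hint⟩ := hq' z hi
    rw [(hV i).nhdsWithin_eq hi] at hs
    obtain ⟨u, hu, huo, hzu⟩ := mem_nhds_iff.1 (inter_mem hs ((hV i).mem_nhds hi))
    refine ⟨u, mem_nhdsWithin_of_mem_nhds (huo.mem_nhds hzu), ?_⟩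
    refine (hint.mono_set (hu.trans inter_subset_left)).congr ?_
    rw [EventuallyEq, ae_restrict_iff' huo.measurableSet]
    filter_upwards [hqe] with y hy hyu
    exact hy (hu hyu).2
  have hΘl : LocallyIntegrableOn Θ (⋃ i, V i) := hli Θ fun i => ⟨θ i, hθ i, hΘi i⟩
  refine ⟨Θ, hΘl, HasWeakGrad.of_locally (hli f fun i => ⟨f, hf i, by simp⟩) hΘl ?_, hΘ⟩
  intro z hz
  obtain ⟨i, hi⟩ := mem_iUnion.1 hz
  exact ⟨V i, hV i, hi, (h i).congr_ae (by simp) (hΘi i)⟩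

end

section

variable {d : ℕ} [NeZero d]

/-! ### A super-Poincaré inequality on model spaces -/

/-- Cauchy-Schwarz applied to `√k` and `√k F`. -/
theorem lintegral_mul_sq_le {α : Type*} [MeasurableSpace α] {μ : Measure α} {k F : α → ℝ≥0∞}
    (hk : AEMeasurable k μ) (hF : AEMeasurable F μ) :
    (∫⁻ x, k x * F x ∂μ) ^ 2 ≤ (∫⁻ x, k x ∂μ) * ∫⁻ x, k x * F x ^ 2 ∂μ := by
  have h := ENNReal.lintegral_mul_le_Lp_mul_Lq μ Real.HolderConjugate.two_two
    (hk.pow_const (1 / 2 : ℝ)) ((hk.pow_const (1 / 2 : ℝ)).mul hF)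
  have e0 : ∀ x : ℝ≥0∞, (x ^ (1 / 2 : ℝ)) ^ (2 : ℝ) = x := fun x => by
    rw [← ENNReal.rpow_mul]; norm_num
  have e1 : ∀ x, (((fun x => k x ^ (1 / 2 : ℝ)) * ((fun x => k x ^ (1 / 2 : ℝ)) * F)) x) =
      k x * F x := by
    intro x
    simp only [Pi.mul_apply]
    rw [← mul_assoc, ← sq, ← ENNReal.rpow_natCast]
    push_cast
    rw [e0]
  have e2 : ∀ x, (((fun x => k x ^ (1 / 2 : ℝ)) * F) x) ^ (2 : ℝ) = k x * F x ^ 2 := by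
    intro x
    simp only [Pi.mul_apply]
    rw [ENNReal.mul_rpow_of_nonneg _ _ (by norm_num), e0, ENNReal.rpow_two]
  simp only [e1, e2, e0] at h
  calc _ ≤ ((∫⁻ x, k x ∂μ) ^ (1 / 2 : ℝ) * (∫⁻ x, k x * F x ^ 2 ∂μ) ^ (1 / 2 : ℝ)) ^ 2 := by
        gcongr
    _ = _ := by
      rw [← ENNReal.rpow_two, ENNReal.mul_rpow_of_nonneg _ _ (by norm_num), e0, e0]

/-- Jensen's inequality for the probability density `mollifier d a`, then Tonelli and translation
invariance. -/
theorem lintegral_mollify_sq_le {a : ℝ} (ha : 0 < a) {θ : Euc d → Euc d} (hθ : Integrable θ) :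
    ∫⁻ z, ‖mollify a θ z‖ₑ ^ 2 ≤ ∫⁻ z, ‖θ z‖ₑ ^ 2 := by
  have hk : AEMeasurable (fun y => ‖mollifier d a y‖ₑ) :=
    contDiff_mollifier.continuous.enorm.aemeasurable
  have h1 : ∫⁻ y, ‖mollifier d a y‖ₑ = 1 := by
    rw [← ofReal_integral_norm_eq_lintegral_enorm integrable_mollifier]
    simp_rw [Real.norm_of_nonneg (mollifier_nonneg _)]
    rw [integral_mollifier ha, ENNReal.ofReal_one]
  have hpt : ∀ z, ‖mollify a θ z‖ₑ ^ 2 ≤ ∫⁻ y, ‖mollifier d a y‖ₑ * ‖θ (z - y)‖ₑ ^ 2 := by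
    intro z
    have hm : AEMeasurable fun y => ‖θ (z - y)‖ₑ :=
      (hθ.comp_sub_left z).aestronglyMeasurable.enorm
    calc _ ≤ (∫⁻ y, ‖mollifier d a y‖ₑ * ‖θ (z - y)‖ₑ) ^ 2 := by
          gcongr
          refine (enorm_integral_le_lintegral_enorm _).trans (le_of_eq ?_)
          simp_rw [enorm_smul]
      _ ≤ _ := by
          refine (lintegral_mul_sq_le hk hm).trans (le_of_eq ?_)
          rw [h1, one_mul]
  calc _ ≤ ∫⁻ z, ∫⁻ y, ‖mollifier d a y‖ₑ * ‖θ (z - y)‖ₑ ^ 2 := lintegral_mono hpt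
    _ = ∫⁻ y, ∫⁻ z, ‖mollifier d a y‖ₑ * ‖θ (z - y)‖ₑ ^ 2 := by
      refine lintegral_lintegral_swap ?_
      have hm : AEMeasurable (fun p : Euc d × Euc d => mollifier d a p.2)
          (volume.prod volume) :=
        (contDiff_mollifier.continuous.comp continuous_snd).aemeasurable
      have hq : Measure.QuasiMeasurePreserving (fun p : Euc d × Euc d => p.1 - p.2)
          (volume.prod volume) volume :=
        quasiMeasurePreserving_sub volume volume
      have h1 : AEStronglyMeasurable (fun p : Euc d × Euc d => θ (p.1 - p.2))
          (volume.prod volume) := hθ.aestronglyMeasurable.comp_quasiMeasurePreserving hq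
      exact hm.enorm.mul (h1.enorm.pow_const 2)
    _ = ∫⁻ y, ‖mollifier d a y‖ₑ * ∫⁻ z, ‖θ z‖ₑ ^ 2 := by
      refine lintegral_congr fun y => ?_
      rw [lintegral_const_mul' _ _ enorm_ne_top,
        lintegral_sub_right_eq_self (fun z => ‖θ z‖ₑ ^ 2) y]
    _ = _ := by rw [lintegral_mul_const'' _ hk, h1, one_mul]

/-- Translation estimate for smooth functions. -/
theorem enorm_sub_sq_le_lintegral {g : Euc d → ℝ} {G : Euc d → Euc d} (hg : ContDiff ℝ ∞ g)
    (hG : Continuous G) {z h : Euc d}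
    (hgG : ∀ s ∈ Icc (0 : ℝ) 1, fderiv ℝ g (z + s • h) h = inner ℝ (G (z + s • h)) h) :
    ‖g (z + h) - g z‖ₑ ^ 2 ≤ ‖h‖ₑ ^ 2 * ∫⁻ s in Icc (0 : ℝ) 1, ‖G (z + s • h)‖ₑ ^ 2 := by
  have hder : ∀ s ∈ uIcc (0 : ℝ) 1, HasDerivAt (fun s : ℝ => g (z + s • h))
      (inner ℝ (G (z + s • h)) h) s := by
    intro s hs
    rw [uIcc_of_le zero_le_one] at hs
    rw [← hgG s hs]
    have h1 : HasDerivAt (fun s : ℝ => z + s • h) h s := by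
      simpa using ((hasDerivAt_id s).smul_const h).const_add z
    exact (hg.differentiable (by simp) _).hasFDerivAt.comp_hasDerivAt s h1
  have hcont : Continuous fun s : ℝ => (inner ℝ (G (z + s • h)) h : ℝ) := by fun_prop
  have hint := intervalIntegral.integral_eq_sub_of_hasDerivAt hder (hcont.intervalIntegrable 0 1)
  simp only [one_smul, zero_smul, add_zero] at hint
  rw [← hint, intervalIntegral.integral_of_le zero_le_one, ← integral_Icc_eq_integral_Ioc]
  have hGm : AEMeasurable (fun s : ℝ => ‖G (z + s • h)‖ₑ) (volume.restrict (Icc (0 : ℝ) 1)) :=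
    (by fun_prop : Continuous fun s : ℝ => G (z + s • h)).enorm.aemeasurable
  calc _ ≤ (∫⁻ s in Icc (0 : ℝ) 1, ‖h‖ₑ * ‖G (z + s • h)‖ₑ) ^ 2 := by
        gcongr
        refine (enorm_integral_le_lintegral_enorm _).trans (lintegral_mono fun s => ?_)
        rw [← enorm_norm h, ← enorm_norm (G _), ← enorm_mul]
        refine enorm_le_iff_norm_le.2 ?_
        rw [Real.norm_of_nonneg (by positivity : 0 ≤ ‖h‖ * ‖G (z + s • h)‖), mul_comm]
        exact norm_inner_le_norm _ _
    _ ≤ _ := lintegral_mul_sq_le aemeasurable_const hGm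
    _ = _ := by
      rw [lintegral_const_mul' _ _ enorm_ne_top]
      simp only [lintegral_const, Measure.restrict_apply_univ, Real.volume_Icc, sub_zero,
        ENNReal.ofReal_one, mul_one]
      ring

/-- As `0 ≤ h 0`, the segment from `z` to `z + h` stays in `H`. For mollified functions the estimate
is the fundamental theorem of calculus along this segment, integrated over `z`; mollification does
not increase the energy. -/
theorem lintegral_translate_sub_sq_le {H : Set (Euc d)} (hH : IsModelSpace H) {f : Euc d → ℝ}
    {θ : Euc d → Euc d} (hf : IntegrableOn f H) (hθ : IntegrableOn θ H)
    (hw : HasWeakGrad f θ (interior H)) {h : Euc d} (hh : 0 ≤ h 0) :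
    ∫⁻ z in H, ‖f (z + h) - f z‖ₑ ^ 2 ≤ ‖h‖ₑ ^ 2 * ∫⁻ z in H, ‖θ z‖ₑ ^ 2 := by
  have hHm := hH.isClosed.measurableSet
  set f' := H.indicator f
  set θ' := H.indicator θ
  have hfi : Integrable f' := (integrable_indicator_iff hHm).2 hf
  have hθi : Integrable θ' := (integrable_indicator_iff hHm).2 hθ
  have hw' : HasWeakGrad f' θ' (interior H) := hw.congr_ae
    (Eventually.of_forall fun z hz => (indicator_of_mem (interior_subset hz) f).symm)
    (Eventually.of_forall fun z hz => (indicator_of_mem (interior_subset hz) θ).symm)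
  let a : ℕ → ℝ := fun n => 1 / ((n : ℝ) + 1)
  have ha0 : ∀ n, 0 < a n := fun n => by positivity
  have hat : Tendsto a atTop (𝓝[>] 0) :=
    tendsto_nhdsWithin_iff.2 ⟨tendsto_one_div_add_atTop_nhds_zero_nat,
      Eventually.of_forall fun n => ha0 n⟩
  have hmeas : TendstoInMeasure volume (fun n => mollify (a n) f') atTop f' := by
    refine tendstoInMeasure_of_tendsto_eLpNorm one_ne_zero
      (fun n => (contDiff_mollify hfi.locallyIntegrable).continuous.aestronglyMeasurable)
      hfi.aestronglyMeasurable ?_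
    simpa only [eLpNorm_one_eq_lintegral_enorm, Pi.sub_apply, Function.comp_def] using
      (tendsto_lintegral_mollify_sub hfi).comp hat
  obtain ⟨ns, hns, hae⟩ := hmeas.exists_seq_tendsto_ae
  have hae2 : ∀ᵐ z : Euc d, Tendsto (fun n => mollify (a (ns n)) f' (z + h)) atTop
      (𝓝 (f' (z + h))) :=
    (measurePreserving_add_right volume h).quasiMeasurePreserving.ae hae
  have hbound : ∀ n, ∫⁻ z in H, ‖mollify (a (ns n)) f' (z + h) - mollify (a (ns n)) f' z‖ₑ ^ 2 ≤
      ‖h‖ₑ ^ 2 * ∫⁻ z in H, ‖θ z‖ₑ ^ 2 := by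
    intro n
    set b := a (ns n)
    have hGc : Continuous (mollify b θ') := (contDiff_mollify hθi.locallyIntegrable).continuous
    have hmem : ∀ z ∈ H, ∀ s ∈ Icc (0 : ℝ) 1, z + s • h ∈ H := fun z hz s hs =>
      hH.add_mem hz (by simpa using mul_nonneg hs.1 hh)
    calc _ ≤ ∫⁻ z in H, ‖h‖ₑ ^ 2 * ∫⁻ s in Icc (0 : ℝ) 1, ‖mollify b θ' (z + s • h)‖ₑ ^ 2 := by
          refine setLIntegral_mono' hHm fun z hz => ?_
          refine enorm_sub_sq_le_lintegral (contDiff_mollify hfi.locallyIntegrable) hGc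
            fun s hs => ?_
          refine hw'.fderiv_mollify hfi.locallyIntegrable hθi.locallyIntegrable
            (fun y hy => hH.mem_interior (hmem z hz s hs) ?_) h
          have := (mem_tsupport_mollifier (ha0 _) hy).2
          simp only [PiLp.sub_apply]; linarith
      _ = ‖h‖ₑ ^ 2 * ∫⁻ s in Icc (0 : ℝ) 1, ∫⁻ z in H, ‖mollify b θ' (z + s • h)‖ₑ ^ 2 := by
          rw [lintegral_const_mul' _ _ (by finiteness)]
          congr 1
          refine lintegral_lintegral_swap ?_
          have : Continuous fun p : Euc d × ℝ => mollify b θ' (p.1 + p.2 • h) := by fun_prop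
          exact (this.enorm.measurable.pow_const 2).aemeasurable
      _ ≤ ‖h‖ₑ ^ 2 * ∫⁻ s in Icc (0 : ℝ) 1, ∫⁻ z in H, ‖θ z‖ₑ ^ 2 := by
          refine mul_le_mul_right (lintegral_mono fun s => ?_) _
          calc _ ≤ ∫⁻ z, ‖mollify b θ' (z + s • h)‖ₑ ^ 2 := setLIntegral_le_lintegral _ _
            _ = ∫⁻ z, ‖mollify b θ' z‖ₑ ^ 2 :=
              lintegral_add_right_eq_self (fun z => ‖mollify b θ' z‖ₑ ^ 2) _
            _ ≤ ∫⁻ z, ‖θ' z‖ₑ ^ 2 := lintegral_mollify_sq_le (ha0 _) hθi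
            _ = ∫⁻ z in H, ‖θ z‖ₑ ^ 2 := by
              rw [← lintegral_indicator hHm]
              refine lintegral_congr fun z => ?_
              by_cases hz : z ∈ H <;> simp [θ', hz]
      _ = _ := by simp
  -- Fatou's lemma along the almost everywhere convergent subsequence of mollifications.
  calc _ = ∫⁻ z in H, ‖f' (z + h) - f' z‖ₑ ^ 2 := by
        refine setLIntegral_congr_fun hHm fun z hz => ?_
        simp only [f', indicator_of_mem hz, indicator_of_mem (hH.add_mem hz hh)]
    _ = ∫⁻ z in H, liminf (fun n => ‖mollify (a (ns n)) f' (z + h) -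
          mollify (a (ns n)) f' z‖ₑ ^ 2) atTop := by
        refine lintegral_congr_ae (ae_restrict_of_ae ?_)
        filter_upwards [hae, hae2] with z h1 h2
        refine (Tendsto.liminf_eq ?_).symm
        exact ((ENNReal.continuous_pow 2).tendsto _).comp
          ((continuous_enorm.tendsto _).comp (h2.sub h1))
    _ ≤ liminf (fun n => ∫⁻ z in H, ‖mollify (a (ns n)) f' (z + h) -
          mollify (a (ns n)) f' z‖ₑ ^ 2) atTop := by
        refine lintegral_liminf_le fun n => ?_
        have hc := (contDiff_mollify (a := a (ns n)) hfi.locallyIntegrable).continuous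
        exact ((hc.comp (continuous_add_const h)).sub hc).enorm.measurable.pow_const 2
    _ ≤ _ := by
        refine liminf_le_of_le (by isBoundedDefault) fun c hc => ?_
        obtain ⟨n, hn⟩ := hc.exists
        exact hn.trans (hbound n)

/-- The volume of the unit ball. -/
def unitVolume (d : ℕ) : ℝ≥0∞ := volume (Metric.ball (0 : Euc d) 1)

theorem unitVolume_ne_zero : unitVolume d ≠ 0 := (Metric.measure_ball_pos _ _ one_pos).ne'

theorem unitVolume_ne_top : unitVolume d ≠ ⊤ := measure_ball_lt_top.ne

theorem volume_ball_eq (z : Euc d) {r : ℝ} (hr : 0 ≤ r) :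
    volume (Metric.ball z r) = ENNReal.ofReal (r ^ d) * unitVolume d := by
  rw [Measure.addHaar_ball _ _ hr, unitVolume]
  simp

/-- For each shift `h` in the ball `Q`, the square of `f` is controlled by the translation estimate
and the correlation of `f` with its shift. Averaging over `h ∈ Q` bounds the mean correlation by `(∫
|f|)² / volume Q`. -/
theorem superPoincare {H : Set (Euc d)} (hH : IsModelSpace H) {f : Euc d → ℝ}
    {θ : Euc d → Euc d} (hf : IntegrableOn f H) (hθ : IntegrableOn θ H)
    (hw : HasWeakGrad f θ (interior H)) {ε : ℝ} (hε : 0 < ε) :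
    ∫⁻ z in H, ‖f z‖ₑ ^ 2 ≤ ENNReal.ofReal (4 * ε ^ 2) * (∫⁻ z in H, ‖θ z‖ₑ ^ 2) +
      2 * (unitVolume d)⁻¹ * ENNReal.ofReal ((ε ^ d)⁻¹) * (∫⁻ z in H, ‖f z‖ₑ) ^ 2 := by
  have hHm := hH.isClosed.measurableSet
  -- This ball touches the boundary hyperplane from inside: its elements have nonnegative coordinate
  -- `0` and norm at most `2 ε`, whence the factor `4 ε²`.
  set Q := Metric.ball (ε • EuclideanSpace.single (0 : Fin d) (1 : ℝ)) ε with hQ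
  have hQm : MeasurableSet Q := Metric.isOpen_ball.measurableSet
  have hQ0 : ∀ h ∈ Q, 0 ≤ h 0 ∧ ‖h‖ₑ ^ 2 ≤ ENNReal.ofReal (4 * ε ^ 2) := by
    intro h hh
    rw [hQ, mem_ball_iff_norm] at hh
    constructor
    · have h1 := (PiLp.norm_apply_le (h - ε • EuclideanSpace.single (0 : Fin d) (1 : ℝ)) 0).trans
        hh.le
      simp at h1
      linarith [(abs_le.1 h1).1]
    · have h2 : ‖ε • EuclideanSpace.single (0 : Fin d) (1 : ℝ)‖ = ε := by
        simp [norm_smul, abs_of_pos hε]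
      have h3 : ‖h‖ ≤ 2 * ε := by
        have := norm_sub_norm_le h (ε • EuclideanSpace.single (0 : Fin d) (1 : ℝ))
        rw [h2] at this
        linarith
      rw [← ofReal_norm, ← ENNReal.ofReal_pow (norm_nonneg _)]
      refine ENNReal.ofReal_le_ofReal ?_
      nlinarith [norm_nonneg h]
  set f' := H.indicator f
  have hfi : Integrable f' := (integrable_indicator_iff hHm).2 hf
  have hind : ∫⁻ z, ‖f' z‖ₑ = ∫⁻ z in H, ‖f z‖ₑ := by
    rw [← lintegral_indicator hHm]
    refine lintegral_congr fun z => ?_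
    by_cases hz : z ∈ H <;> simp [f', hz]
  set D := ∫⁻ z in H, ‖θ z‖ₑ ^ 2
  set N := ∫⁻ z in H, ‖f z‖ₑ
  -- From `x² = (y - x)² + 2 x y - y²`.
  have hpt : ∀ x y : ℝ, ‖x‖ₑ ^ 2 ≤ ‖y - x‖ₑ ^ 2 + 2 * (‖x‖ₑ * ‖y‖ₑ) := by
    intro x y
    simp only [Real.enorm_eq_ofReal_abs]
    rw [← ENNReal.ofReal_pow (abs_nonneg _), ← ENNReal.ofReal_pow (abs_nonneg _),
      ← ENNReal.ofReal_mul (abs_nonneg _), show (2 : ℝ≥0∞) = ENNReal.ofReal 2 by simp,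
      ← ENNReal.ofReal_mul (by norm_num), ← ENNReal.ofReal_add (by positivity) (by positivity)]
    refine ENNReal.ofReal_le_ofReal ?_
    rw [sq_abs, sq_abs, ← abs_mul]
    nlinarith [le_abs_self (x * y), sq_nonneg y]
  have hfm := hfi.aestronglyMeasurable
  have h1 : ∀ h ∈ Q, ∫⁻ z in H, ‖f z‖ₑ ^ 2 ≤ ENNReal.ofReal (4 * ε ^ 2) * D +
      2 * ∫⁻ z, ‖f' z‖ₑ * ‖f' (z + h)‖ₑ := by
    intro h hh
    have hm : AEMeasurable (fun z => 2 * (‖f' z‖ₑ * ‖f' (z + h)‖ₑ)) (volume.restrict H) :=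
      ((hfm.enorm.mul (hfi.comp_add_right h).aestronglyMeasurable.enorm).const_mul 2).restrict
    calc _ ≤ ∫⁻ z in H, (‖f (z + h) - f z‖ₑ ^ 2 + 2 * (‖f' z‖ₑ * ‖f' (z + h)‖ₑ)) := by
          refine setLIntegral_mono_ae' hHm (Eventually.of_forall fun z hz => ?_)
          simp only [f', indicator_of_mem hz, indicator_of_mem (hH.add_mem hz (hQ0 h hh).1)]
          exact hpt _ _
      _ = (∫⁻ z in H, ‖f (z + h) - f z‖ₑ ^ 2) + ∫⁻ z in H, 2 * (‖f' z‖ₑ * ‖f' (z + h)‖ₑ) :=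
          lintegral_add_right' _ hm
      _ ≤ _ := by
          refine add_le_add ?_ ?_
          · refine (lintegral_translate_sub_sq_le hH hf hθ hw (hQ0 h hh).1).trans ?_
            gcongr
            exact (hQ0 h hh).2
          · rw [← lintegral_const_mul' _ _ (by norm_num)]
            exact setLIntegral_le_lintegral _ _
  have h2 : volume Q * ∫⁻ z in H, ‖f z‖ₑ ^ 2 ≤
      volume Q * (ENNReal.ofReal (4 * ε ^ 2) * D) + 2 * N ^ 2 := by
    calc _ = ∫⁻ h in Q, ∫⁻ z in H, ‖f z‖ₑ ^ 2 := by
          rw [lintegral_const, Measure.restrict_apply_univ, mul_comm]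
      _ ≤ ∫⁻ h in Q, (ENNReal.ofReal (4 * ε ^ 2) * D + 2 * ∫⁻ z, ‖f' z‖ₑ * ‖f' (z + h)‖ₑ) :=
          setLIntegral_mono_ae' hQm (Eventually.of_forall h1)
      _ = volume Q * (ENNReal.ofReal (4 * ε ^ 2) * D) +
          2 * ∫⁻ h in Q, ∫⁻ z, ‖f' z‖ₑ * ‖f' (z + h)‖ₑ := by
          rw [lintegral_add_left measurable_const, lintegral_const, Measure.restrict_apply_univ,
            lintegral_const_mul' _ _ (by norm_num), mul_comm]
      _ ≤ _ := by
          gcongr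
          calc _ ≤ ∫⁻ h, ∫⁻ z, ‖f' z‖ₑ * ‖f' (z + h)‖ₑ := setLIntegral_le_lintegral _ _
            _ = ∫⁻ z, ∫⁻ h, ‖f' z‖ₑ * ‖f' (z + h)‖ₑ := by
              refine lintegral_lintegral_swap ?_
              have hq : Measure.QuasiMeasurePreserving (fun p : Euc d × Euc d => p.2 + p.1)
                  (volume.prod volume) volume :=
                (quasiMeasurePreserving_add_swap volume volume)
              exact hfm.comp_snd.enorm.mul (hfm.comp_quasiMeasurePreserving hq).enorm
            _ = ∫⁻ z, ‖f' z‖ₑ * N := by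
              refine lintegral_congr fun z => ?_
              rw [lintegral_const_mul' _ _ enorm_ne_top,
                lintegral_add_left_eq_self (fun y => ‖f' y‖ₑ) z, hind]
            _ = N ^ 2 := by
              rw [lintegral_mul_const'' _ hfm.enorm, hind, sq]
  have hQv : volume Q = ENNReal.ofReal (ε ^ d) * unitVolume d := volume_ball_eq _ hε.le
  have hQpos : volume Q ≠ 0 := (Metric.measure_ball_pos _ _ hε).ne'
  have hQtop : volume Q ≠ ⊤ := measure_ball_lt_top.ne
  have h3 := mul_le_mul_right h2 (volume Q)⁻¹
  rw [← mul_assoc, ENNReal.inv_mul_cancel hQpos hQtop, one_mul, mul_add, ← mul_assoc _ (volume Q),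
    ENNReal.inv_mul_cancel hQpos hQtop, one_mul] at h3
  refine h3.trans (le_of_eq ?_)
  congr 1
  rw [hQv, ENNReal.mul_inv (Or.inr unitVolume_ne_top) (Or.inr unitVolume_ne_zero),
    ENNReal.ofReal_inv_of_pos (by positivity)]
  ring

end

section

variable {ι : Type v} {M : Type u} [TopologicalSpace M] {d : ℕ} [NeZero d]

/-! ### Charts and transition maps -/

namespace ModelChart

variable (c c' : ModelChart M d)

theorem isModelSet_target : IsModelSet c.target := c.open_target

variable {c c'}

theorem inv_mem {z : Euc d} (hz : z ∈ c.target) : c.invFun z ∈ c.source := c.map_target' hz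

theorem to_mem {x : M} (hx : x ∈ c.source) : c.toFun x ∈ c.target := c.map_source' hx

theorem inv_to {x : M} (hx : x ∈ c.source) : c.invFun (c.toFun x) = x := c.left_inv' hx

theorem to_inv {z : Euc d} (hz : z ∈ c.target) : c.toFun (c.invFun z) = z := c.right_inv' hz

theorem image_inv_eq {S : Set (Euc d)} (hS : S ⊆ c.target) :
    c.invFun '' S = c.source ∩ c.toFun ⁻¹' S := by
  ext x
  constructor
  · rintro ⟨z, hz, rfl⟩
    exact ⟨inv_mem (hS hz), by rw [mem_preimage, to_inv (hS hz)]; exact hz⟩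
  · rintro ⟨hx, hxS⟩
    exact ⟨c.toFun x, hxS, inv_to hx⟩

theorem isModelSet_overlap (c c' : ModelChart M d) : IsModelSet (overlap c c') := by
  obtain ⟨O, hO, h⟩ := continuousOn_iff'.1 c.continuousOn_invFun c'.source c'.open_source
  have : overlap c c' = c.target ∩ O := by
    rw [overlap, inter_comm, h, inter_comm]
  rw [this]
  exact c.isModelSet_target.inter_open hO

theorem isModelSet_image {W : Set M} (hW : IsOpen W) (hWc : W ⊆ c.source) :
    IsModelSet (c.toFun '' W) := by
  obtain ⟨O, hO, h⟩ := continuousOn_iff'.1 c.continuousOn_invFun W hW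
  have : c.toFun '' W = c.target ∩ O := by
    rw [inter_comm, ← h]
    ext z
    constructor
    · rintro ⟨x, hx, rfl⟩
      exact ⟨by rw [mem_preimage, inv_to (hWc hx)]; exact hx, to_mem (hWc hx)⟩
    · rintro ⟨h1, h2⟩
      exact ⟨c.invFun z, h1, to_inv h2⟩
  rw [this]
  exact c.isModelSet_target.inter_open hO

theorem isOpen_image_inv {O : Set (Euc d)} (hO : IsOpen O) :
    IsOpen (c.invFun '' (c.target ∩ O)) := by
  rw [image_inv_eq inter_subset_left]
  have : c.source ∩ c.toFun ⁻¹' (c.target ∩ O) = c.source ∩ c.toFun ⁻¹' O := by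
    ext x
    constructor
    · rintro ⟨h1, -, h2⟩; exact ⟨h1, h2⟩
    · rintro ⟨h1, h2⟩; exact ⟨h1, to_mem h1, h2⟩
  rw [this]
  exact c.continuousOn_toFun.isOpen_inter_preimage c.open_source hO

theorem inv_mem_source_of_overlap {z : Euc d} (hz : z ∈ overlap c c') : c.invFun z ∈ c'.source :=
  hz.2

theorem inv_transition {z : Euc d} (hz : z ∈ overlap c c') :
    c'.invFun (transition c c' z) = c.invFun z := inv_to hz.2

theorem transition_mem {z : Euc d} (hz : z ∈ overlap c c') :
    transition c c' z ∈ overlap c' c := by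
  refine ⟨to_mem hz.2, ?_⟩
  rw [mem_preimage, inv_transition hz]
  exact inv_mem hz.1

theorem transition_transition {z : Euc d} (hz : z ∈ overlap c c') :
    transition c' c (transition c c' z) = z := by
  have := inv_transition hz
  rw [transition, this, to_inv hz.1]

theorem injOn_transition : InjOn (transition c c') (overlap c c') := fun x hx y hy h => by
  rw [← transition_transition hx, h, transition_transition hy]

/-- Lipschitz compatibility of two charts. -/
def Compatible (c c' : ModelChart M d) : Prop :=
  LocallyLipschitzOn (overlap c c') (transition c c') ∧
    LocallyLipschitzOn (overlap c' c) (transition c' c)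

theorem Compatible.symm (h : Compatible c c') : Compatible c' c := ⟨h.2, h.1⟩

/-- The exceptional set for `z` is the image of the exceptional set for `y` under the reverse
transition map, which is locally Lipschitz and so preserves null sets. -/
theorem Compatible.ae_transition (h : Compatible c c') {P : Euc d → Prop}
    (hP : ∀ᵐ y ∂(volume.restrict (overlap c' c)), P y) :
    ∀ᵐ z ∂(volume.restrict (overlap c c')), P (transition c c' z) := by
  rw [ae_restrict_iff' (isModelSet_overlap c' c).measurableSet] at hP
  rw [ae_restrict_iff' (isModelSet_overlap c c').measurableSet]
  rw [ae_iff] at hP ⊢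
  have h0 := volume_image_eq_zero_of_locallyLipschitzOn h.2
    (N := {y | ¬(y ∈ overlap c' c → P y)}) (fun y hy => by
      by_contra hn; exact hy fun h => absurd h hn) hP
  refine measure_mono_null ?_ h0
  intro z hz
  simp only [mem_ofPred_eq, Classical.not_imp] at hz
  refine ⟨transition c c' z, ?_, transition_transition hz.1⟩
  simp only [mem_ofPred_eq, Classical.not_imp]
  exact ⟨transition_mem hz.1, hz.2⟩

theorem Compatible.ae_differentiableAt (h : Compatible c c') :
    ∀ᵐ z ∂(volume.restrict (overlap c c')), DifferentiableAt ℝ (transition c c') z := by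
  rw [← (isModelSet_overlap c c').restrict_interior, ae_restrict_iff' isOpen_interior.measurableSet]
  exact ae_differentiableAt_of_locallyLipschitzOn h.1

theorem ae_mem_interior_overlap (c c' : ModelChart M d) :
    ∀ᵐ z ∂(volume.restrict (overlap c c')), z ∈ interior (overlap c c') := by
  rw [← (isModelSet_overlap c c').restrict_interior]
  exact ae_restrict_mem isOpen_interior.measurableSet

/-- The lower bound is the Lipschitz bound of the reverse transition map near the image point. -/
theorem Compatible.isLocallyBiLipschitz (h : Compatible c c') :
    IsLocallyBiLipschitz (transition c c') (interior (overlap c c')) := by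
  intro z hz
  obtain ⟨C, u, hu, hC⟩ := h.1 (interior_subset hz)
  rw [nhdsWithin_eq_nhds.2 (mem_interior_iff_mem_nhds.1 hz)] at hu
  obtain ⟨L, w, hw, hL⟩ := h.2 (transition_mem (interior_subset hz))
  have hcont : ContinuousAt (transition c c') z :=
    (hC.continuousOn z (mem_of_mem_nhds hu)).continuousAt hu
  have hin : ∀ᶠ y in 𝓝 z, y ∈ interior (overlap c c') := isOpen_interior.mem_nhds hz
  have hpre : ∀ᶠ y in 𝓝 z, transition c c' y ∈ w := by
    have h1 : Tendsto (transition c c') (𝓝 z) (𝓝[overlap c' c] (transition c c' z)) :=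
      tendsto_nhdsWithin_iff.2 ⟨hcont, hin.mono fun y hy => transition_mem (interior_subset hy)⟩
    exact h1 hw
  obtain ⟨r, hr, hB⟩ := Metric.nhds_basis_closedBall.mem_iff.1
    (inter_mem (inter_mem hu hin) hpre)
  refine ⟨r, hr, C, L, fun y hy => (hB hy).1.2, hC.mono fun y hy => (hB hy).1.1, ?_⟩
  intro x hx y hy
  have := hL.dist_le_mul _ (hB hx).2 _ (hB hy).2
  rwa [transition_transition (interior_subset (hB hx).1.2),
    transition_transition (interior_subset (hB hy).1.2)] at this

/-- The change of variables formula requires differentiability everywhere. Points of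
non-differentiability form a null set by Rademacher, and so does their image, so both can be
discarded. -/
theorem Compatible.lintegral_image (h : Compatible c c') {S : Set (Euc d)} (hS : MeasurableSet S)
    (hSo : S ⊆ overlap c c') (F : Euc d → ℝ≥0∞) :
    ∫⁻ y in transition c c' '' S, F y =
      ∫⁻ z in S, ENNReal.ofReal |(fderiv ℝ (transition c c') z).det| * F (transition c c' z) := by
  set τ := transition c c'
  set S' := S ∩ {z | DifferentiableAt ℝ τ z}
  have hS' : MeasurableSet S' := hS.inter (measurableSet_of_differentiableAt ℝ τ)
  have hnull : volume (S \ S') = 0 := by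
    have h1 := h.ae_differentiableAt
    rw [ae_restrict_iff' (isModelSet_overlap c c').measurableSet, ae_iff] at h1
    refine measure_mono_null ?_ h1
    rintro z ⟨hz, hz'⟩
    simp only [mem_ofPred_eq, Classical.not_imp]
    exact ⟨hSo hz, fun hd => hz' ⟨hz, hd⟩⟩
  have hnull2 : volume (τ '' (S \ S')) = 0 :=
    volume_image_eq_zero_of_locallyLipschitzOn h.1 (sdiff_subset.trans hSo) hnull
  have e1 : (τ '' S : Set (Euc d)) =ᵐ[volume] τ '' S' := by
    refine (ae_le_set.2 (measure_mono_null ?_ hnull2)).antisymm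
      (image_mono inter_subset_left).eventuallyLE
    rintro _ ⟨⟨z, hz, rfl⟩, hz'⟩
    exact ⟨z, ⟨hz, fun h' => hz' ⟨z, h', rfl⟩⟩, rfl⟩
  have e2 : (S : Set (Euc d)) =ᵐ[volume] S' :=
    (ae_le_set.2 hnull).antisymm (inter_subset_left (s := S)).eventuallyLE
  rw [setLIntegral_congr e1, setLIntegral_congr e2]
  exact lintegral_image_eq_lintegral_abs_det_fderiv_mul volume hS'
    (fun z hz => hz.2.hasFDerivAt.hasFDerivWithinAt)
    (injOn_transition.mono (inter_subset_left.trans hSo)) F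

end ModelChart

open ModelChart

theorem LipschitzAtlas.compatible (A : LipschitzAtlas ι M d) (i j : ι) :
    Compatible (A.chart i) (A.chart j) := ⟨A.lipschitz i j, A.lipschitz j i⟩

theorem LipschitzAtlas.IsChart.compatible {A : LipschitzAtlas ι M d} {c : ModelChart M d}
    (h : A.IsChart c) (i : ι) : Compatible c (A.chart i) := h i

theorem LipschitzAtlas.isChart_chart (A : LipschitzAtlas ι M d) (i : ι) :
    A.IsChart (A.chart i) := fun j => A.compatible i j

/-! ### Bilinear forms -/

section Bil

variable {d : ℕ} {G G' : Matrix (Fin d) (Fin d) ℝ}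

theorem bil_add_left (ξ ξ' η : Euc d) : bil G (ξ + ξ') η = bil G ξ η + bil G ξ' η := by
  simp [bil, add_dotProduct]

theorem bil_add_right (ξ η η' : Euc d) : bil G ξ (η + η') = bil G ξ η + bil G ξ η' := by
  simp [bil, dotProduct_add, Matrix.mulVec_add]

theorem bil_smul_left (s : ℝ) (ξ η : Euc d) : bil G (s • ξ) η = s * bil G ξ η := by
  simp [bil]

theorem bil_smul_right (s : ℝ) (ξ η : Euc d) : bil G ξ (s • η) = s * bil G ξ η := by
  simp [bil, Matrix.mulVec_smul]

theorem bil_comm (hG : G.IsSymm) (ξ η : Euc d) : bil G ξ η = bil G η ξ := by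
  rw [bil, bil, Matrix.dotProduct_mulVec, ← Matrix.mulVec_transpose, hG.eq, dotProduct_comm]

theorem bil_single (k l : Fin d) :
    bil G (EuclideanSpace.single k 1) (EuclideanSpace.single l 1) = G k l := by
  simp [bil]

theorem eq_of_bil_eq (h : ∀ ξ η : Euc d, bil G ξ η = bil G' ξ η) : G = G' := by
  ext k l
  rw [← bil_single (G := G) k l, h, bil_single]

/-- The matrix of the pull-back of a bilinear form. -/
def pullBack (G : Matrix (Fin d) (Fin d) ℝ) (P : Euc d →L[ℝ] Euc d) : Matrix (Fin d) (Fin d) ℝ :=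
  let B := (EuclideanSpace.basisFun (Fin d) ℝ).toBasis
  (LinearMap.toMatrix B B P.toLinearMap)ᵀ * G * LinearMap.toMatrix B B P.toLinearMap

theorem bil_pullBack (P : Euc d →L[ℝ] Euc d) (ξ η : Euc d) :
    bil (pullBack G P) ξ η = bil G (P ξ) (P η) := by
  have h : ∀ ζ : Euc d, LinearMap.toMatrix (EuclideanSpace.basisFun (Fin d) ℝ).toBasis
      (EuclideanSpace.basisFun (Fin d) ℝ).toBasis P.toLinearMap *ᵥ ζ.ofLp = (P ζ).ofLp := by
    intro ζ
    have := LinearMap.toMatrix_mulVec_repr (EuclideanSpace.basisFun (Fin d) ℝ).toBasis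
      (EuclideanSpace.basisFun (Fin d) ℝ).toBasis P.toLinearMap ζ
    have e : ∀ v : Euc d, ⇑((EuclideanSpace.basisFun (Fin d) ℝ).toBasis.repr v) = v.ofLp := by
      intro v; ext k; simp
    rwa [e, e] at this
  rw [bil, bil, pullBack, ← h, ← h, ← Matrix.mulVec_mulVec, ← Matrix.mulVec_mulVec,
    Matrix.dotProduct_mulVec, Matrix.vecMul_transpose]

theorem det_pullBack (P : Euc d →L[ℝ] Euc d) : (pullBack G P).det = G.det * P.det ^ 2 := by
  rw [pullBack, Matrix.det_mul, Matrix.det_mul, Matrix.det_transpose, LinearMap.det_toMatrix]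
  change _ = _ * LinearMap.det _ ^ 2
  ring

theorem isSymm_pullBack (hG : G.IsSymm) (P : Euc d →L[ℝ] Euc d) : (pullBack G P).IsSymm := by
  rw [Matrix.IsSymm, pullBack, Matrix.transpose_mul, Matrix.transpose_mul,
    Matrix.transpose_transpose, hG.eq, Matrix.mul_assoc]

/-- All eigenvalues lie in `[a, b]`, as is seen by inserting a unit eigenvector. -/
theorem det_bounds (hG : G.IsSymm) {a b : ℝ} (ha : 0 ≤ a)
    (h : ∀ ξ : Euc d, a * ‖ξ‖ ^ 2 ≤ bil G ξ ξ ∧ bil G ξ ξ ≤ b * ‖ξ‖ ^ 2) :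
    a ^ d ≤ G.det ∧ G.det ≤ b ^ d := by
  have hH : G.IsHermitian := by
    rw [Matrix.IsHermitian, Matrix.conjTranspose_eq_transpose_of_trivial]; exact hG.eq
  have hev : ∀ k, a ≤ hH.eigenvalues k ∧ hH.eigenvalues k ≤ b := by
    intro k
    have h1 := h (hH.eigenvectorBasis k)
    have h2 : bil G (hH.eigenvectorBasis k) (hH.eigenvectorBasis k) = hH.eigenvalues k := by
      rw [bil, hH.mulVec_eigenvectorBasis, dotProduct_smul]
      have : (hH.eigenvectorBasis k).ofLp ⬝ᵥ (hH.eigenvectorBasis k).ofLp =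
          inner ℝ (hH.eigenvectorBasis k) (hH.eigenvectorBasis k) := by
        rw [EuclideanSpace.inner_eq_star_dotProduct]; simp
      rw [this, real_inner_self_eq_norm_sq, hH.eigenvectorBasis.norm_eq_one]
      simp
    rw [h2, hH.eigenvectorBasis.norm_eq_one] at h1
    simpa using h1
  have hdet : G.det = ∏ k, hH.eigenvalues k := by
    simpa using hH.det_eq_prod_eigenvalues
  rw [hdet]
  constructor
  · calc a ^ d = ∏ _k : Fin d, a := by simp
      _ ≤ _ := Finset.prod_le_prod (fun _ _ => ha) fun k _ => (hev k).1
  · calc _ ≤ ∏ _k : Fin d, b := Finset.prod_le_prod (fun k _ => ha.trans (hev k).1)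
          fun k _ => (hev k).2
      _ = _ := by simp

theorem isSymm_of_posDef (hG : G.PosDef) : G.IsSymm := by
  have := hG.isHermitian
  rwa [Matrix.IsHermitian, Matrix.conjTranspose_eq_transpose_of_trivial] at this

theorem bil_pos (hG : G.PosDef) {ξ : Euc d} (hξ : ξ ≠ 0) : 0 < bil G ξ ξ := by
  have h := hG.dotProduct_mulVec_pos (x := ξ.ofLp) (by simpa using hξ)
  simpa [bil] using h

theorem bil_nonneg (hG : G.PosDef) (ξ : Euc d) : 0 ≤ bil G ξ ξ := by
  by_cases h : ξ = 0
  · simp [h, bil]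
  · exact (bil_pos hG h).le

theorem bil_cauchy_schwarz (hG : G.PosDef) (ξ η : Euc d) :
    bil G ξ η ^ 2 ≤ bil G ξ ξ * bil G η η := by
  by_cases hη : η = 0
  · simp [hη, bil]
  have hp := bil_pos hG hη
  have h := bil_nonneg hG (ξ + (-(bil G ξ η / bil G η η)) • η)
  simp only [bil_add_left, bil_add_right, bil_smul_left, bil_smul_right] at h
  rw [bil_comm (isSymm_of_posDef hG) η ξ] at h
  rw [show bil G ξ ξ + -(bil G ξ η / bil G η η) * bil G ξ η + (-(bil G ξ η / bil G η η)) *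
    (bil G ξ η + -(bil G ξ η / bil G η η) * bil G η η) = bil G ξ ξ - bil G ξ η ^ 2 / bil G η η by
      field_simp; ring] at h
  rw [sub_nonneg, div_le_iff₀ hp] at h
  exact h

/-- The vector dual to a covector. -/
def sharp (G : Matrix (Fin d) (Fin d) ℝ) (θ : Euc d) : Euc d := WithLp.toLp 2 (G⁻¹ *ᵥ θ.ofLp)

theorem bil_sharp (hG : G.PosDef) (θ ξ : Euc d) : bil G ξ (sharp G θ) = inner ℝ θ ξ := by
  have hu : IsUnit G.det := hG.det_pos.ne'.isUnit
  rw [bil, sharp, WithLp.ofLp_toLp, Matrix.mulVec_mulVec, Matrix.mul_nonsing_inv _ hu,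
    Matrix.one_mulVec, EuclideanSpace.inner_eq_star_dotProduct]
  simp

theorem bil_inv_eq (θ η : Euc d) : bil G⁻¹ θ η = inner ℝ θ (sharp G η) := by
  rw [bil, sharp, EuclideanSpace.inner_eq_star_dotProduct, dotProduct_comm]
  simp

theorem sharp_unique (hG : G.PosDef) {θ X : Euc d} (h : ∀ ξ, bil G ξ X = inner ℝ θ ξ) :
    X = sharp G θ := by
  by_contra hne
  have hp := bil_pos hG (sub_ne_zero.2 hne)
  have : ∀ ξ, bil G ξ (X - sharp G θ) = 0 := by
    intro ξ
    have e : X - sharp G θ = X + (-1 : ℝ) • sharp G θ := by simp [sub_eq_add_neg]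
    rw [e, bil_add_right, bil_smul_right, bil_sharp hG, h]
    ring
  rw [this] at hp
  exact lt_irrefl _ hp

/-- The co-metric is invariant under linear coordinate changes. -/
theorem bil_inv_pullBack {P : Euc d →L[ℝ] Euc d} (hG : G.PosDef) (hG' : G'.PosDef)
    (h : ∀ ξ η, bil G' (P ξ) (P η) = bil G ξ η) {θ θ' η η' : Euc d}
    (hθ : ∀ ξ, inner ℝ θ' (P ξ) = (inner ℝ θ ξ : ℝ))
    (hη : ∀ ξ, inner ℝ η' (P ξ) = (inner ℝ η ξ : ℝ)) :
    bil G'⁻¹ θ' η' = bil G⁻¹ θ η := by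
  have hinj : Function.Injective P := by
    rw [injective_iff_map_eq_zero]
    intro ξ hξ
    by_contra hne
    have := bil_pos hG hne
    rw [← h, hξ] at this
    simp [bil] at this
  have hsurj : Function.Surjective P := (LinearMap.injective_iff_surjective (f := P.toLinearMap)).1 hinj
  have hX : P (sharp G η) = sharp G' η' := by
    refine sharp_unique hG' fun ζ => ?_
    obtain ⟨ξ, rfl⟩ := hsurj ζ
    rw [h, bil_sharp hG, hη]
  rw [bil_inv_eq, bil_inv_eq, ← hX, hθ]

theorem inner_sq_le_bil_inv (hG : G.PosDef) (θ ξ : Euc d) :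
    (inner ℝ θ ξ : ℝ) ^ 2 ≤ bil G⁻¹ θ θ * bil G ξ ξ := by
  rw [bil_inv_eq, ← bil_sharp hG θ ξ, ← bil_sharp hG θ (sharp G θ), mul_comm]
  exact bil_cauchy_schwarz hG _ _

theorem bil_inv_nonneg (hG : G.PosDef) (θ : Euc d) : 0 ≤ bil G⁻¹ θ θ := by
  rw [bil_inv_eq, ← bil_sharp hG]
  exact bil_nonneg hG _

/-- The co-norm is the dual norm, attained at `ξ = sharp G θ`. -/
theorem bil_inv_le_of_inner_sq_le (hG : G.PosDef) {θ : Euc d} {k : ℝ} (hk : 0 ≤ k)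
    (h : ∀ ξ, (inner ℝ θ ξ : ℝ) ^ 2 ≤ k * bil G ξ ξ) : bil G⁻¹ θ θ ≤ k := by
  have h1 := h (sharp G θ)
  rw [bil_sharp hG, ← bil_inv_eq] at h1
  have h0 := bil_inv_nonneg hG θ
  by_contra hlt
  push Not at hlt
  nlinarith

end Bil

end

section

variable {ι : Type v} {M : Type u} [TopologicalSpace M] {d : ℕ} [NeZero d]

/-! ### The volume measure in charts -/

section

variable [MeasurableSpace M] [BorelSpace M]

namespace ModelChart

variable {c c' : ModelChart M d}

theorem measurableSet_image_inv {S : Set (Euc d)} (hS : MeasurableSet S) (hSt : S ⊆ c.target) :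
    MeasurableSet (c.invFun '' S) := by
  rw [image_inv_eq hSt]
  have h1 : Measurable (c.source.domRestrict c.toFun) :=
    (continuousOn_iff_continuous_domRestrict.1 c.continuousOn_toFun).measurable
  have h2 := MeasurableSet.subtype_image c.open_source.measurableSet (h1 hS)
  convert h2 using 1
  ext x
  constructor
  · rintro ⟨h3, h4⟩; exact ⟨⟨x, h3⟩, h4, rfl⟩
  · rintro ⟨⟨y, hy⟩, h4, rfl⟩; exact ⟨hy, h4⟩

theorem measurableSet_inter_preimage_inv {B : Set M} (hB : MeasurableSet B) :
    MeasurableSet (c.target ∩ c.invFun ⁻¹' B) := by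
  have h1 : Measurable (c.target.domRestrict c.invFun) :=
    (continuousOn_iff_continuous_domRestrict.1 c.continuousOn_invFun).measurable
  have h2 := MeasurableSet.subtype_image c.isModelSet_target.measurableSet (h1 hB)
  convert h2 using 1
  ext x
  constructor
  · rintro ⟨h3, h4⟩; exact ⟨⟨x, h3⟩, h4, rfl⟩
  · rintro ⟨⟨y, hy⟩, h4, rfl⟩; exact ⟨hy, h4⟩

theorem image_inter_preimage_inv (B : Set M) :
    c.invFun '' (c.target ∩ c.invFun ⁻¹' B) = B ∩ c.source := by
  ext x
  constructor
  · rintro ⟨z, ⟨h1, h2⟩, rfl⟩; exact ⟨h2, inv_mem h1⟩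
  · rintro ⟨h1, h2⟩
    exact ⟨c.toFun x, ⟨to_mem h2, by rw [mem_preimage, inv_to h2]; exact h1⟩, inv_to h2⟩

theorem preimage_image_inv {S : Set (Euc d)} (hS : S ⊆ c.target) :
    c.target ∩ c.invFun ⁻¹' (c.invFun '' S) = S := by
  ext z
  constructor
  · rintro ⟨h1, w, hw, h2⟩
    rwa [← to_inv h1, ← h2, to_inv (hS hw)]
  · intro hz; exact ⟨hS hz, z, hz, rfl⟩

theorem aemeasurable_inv : AEMeasurable c.invFun (volume.restrict c.target) :=
  c.continuousOn_invFun.aemeasurable c.isModelSet_target.measurableSet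

theorem overlap_image {S : Set (Euc d)} (hS : S ⊆ overlap c c') :
    c'.target ∩ c'.invFun ⁻¹' (c.invFun '' S) = transition c c' '' S := by
  ext y
  constructor
  · rintro ⟨h1, z, hz, h2⟩
    exact ⟨z, hz, by rw [transition, h2, to_inv h1]⟩
  · rintro ⟨z, hz, rfl⟩
    have := hS hz
    exact ⟨(transition_mem this).1, z, hz, (inv_transition this).symm⟩

end ModelChart

open ModelChart

namespace LRMetric

variable {A : LipschitzAtlas ι M d} (g : LRMetric A)

/-- The density of the volume measure in the `i`-th chart. -/
def dens (i : ι) (z : Euc d) : ℝ≥0∞ := ENNReal.ofReal (Real.sqrt (g.coeff i z).det)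

theorem measurable_dens (i : ι) : Measurable (g.dens i) := by
  have h : Measurable fun z => (g.coeff i z).det := by
    simp only [Matrix.det_apply]
    exact Finset.measurable_sum _ fun σ _ => (Finset.measurable_prod _ fun k _ =>
      g.measurable i _ _).const_smul _
  exact (h.sqrt).ennreal_ofReal

theorem dens_ne_zero {i : ι} {z : Euc d} (hz : z ∈ (A.chart i).target) : g.dens i z ≠ 0 := by
  have := (g.posDef i z hz).det_pos
  simp only [dens, ne_eq, ENNReal.ofReal_eq_zero, not_le]
  exact Real.sqrt_pos.2 this

theorem aemeasurable_inv_dens (i : ι) : AEMeasurable (A.chart i).invFun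
    ((volume.restrict (A.chart i).target).withDensity (g.dens i)) :=
  aemeasurable_inv.mono_ac (withDensity_absolutelyContinuous _ _)

theorem chartVol_apply (i : ι) {B : Set M} (hB : MeasurableSet B) :
    g.chartVol i B = ∫⁻ z in (A.chart i).target ∩ (A.chart i).invFun ⁻¹' B, g.dens i z := by
  have hT := (A.chart i).isModelSet_target.measurableSet
  have h1 : g.chartVol i B = ((volume.restrict (A.chart i).target).withDensity (g.dens i))
      ((A.chart i).invFun ⁻¹' B) :=
    Measure.map_apply_of_aemeasurable (g.aemeasurable_inv_dens i) hB
  rw [h1]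
  have h2 : ((A.chart i).invFun ⁻¹' B : Set (Euc d)) =ᵐ[(volume.restrict
      (A.chart i).target).withDensity (g.dens i)]
      ((A.chart i).target ∩ (A.chart i).invFun ⁻¹' B : Set (Euc d)) := by
    refine (withDensity_absolutelyContinuous _ _).ae_le ?_
    filter_upwards [ae_restrict_mem hT] with z hz
    refine propext ⟨fun h => ⟨hz, h⟩, fun h => h.2⟩
  rw [measure_congr h2, withDensity_apply _ (measurableSet_inter_preimage_inv hB),
    Measure.restrict_restrict (measurableSet_inter_preimage_inv hB)]
  congr 2
  rw [inter_eq_left]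
  exact inter_subset_left

/-- The Jacobian of the transition map is absorbed by the density: `√det (Pᵀ G P) = |det P| √det G`.
-/
theorem chartVol_image (i : ι) {c : ModelChart M d} (hc : Compatible c (A.chart i))
    {S : Set (Euc d)} (hS : MeasurableSet S) (hSo : S ⊆ overlap c (A.chart i)) :
    g.chartVol i (c.invFun '' S) = ∫⁻ z in S, ENNReal.ofReal (Real.sqrt
      (pullBack (g.coeff i (transition c (A.chart i) z))
        (fderiv ℝ (transition c (A.chart i)) z)).det) := by
  rw [g.chartVol_apply i (measurableSet_image_inv hS (hSo.trans inter_subset_left)),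
    overlap_image hSo, hc.lintegral_image hS hSo]
  refine lintegral_congr fun z => ?_
  rw [dens, ← ENNReal.ofReal_mul (abs_nonneg _), det_pullBack, mul_comm (Matrix.det _),
    Real.sqrt_mul (sq_nonneg _), Real.sqrt_sq_eq_abs]

theorem ae_pullBack_eq (i j : ι) :
    ∀ᵐ z ∂(volume.restrict (overlap (A.chart i) (A.chart j))),
      pullBack (g.coeff j (transition (A.chart i) (A.chart j) z))
        (fderiv ℝ (transition (A.chart i) (A.chart j)) z) = g.coeff i z := by
  filter_upwards [g.compat i j] with z hz
  exact eq_of_bil_eq fun ξ η => by rw [bil_pullBack, hz]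

theorem chartVol_eq (i j : ι) {B : Set M} (hB : MeasurableSet B) (hi : B ⊆ (A.chart i).source)
    (hj : B ⊆ (A.chart j).source) : g.chartVol j B = g.chartVol i B := by
  set S := (A.chart i).target ∩ (A.chart i).invFun ⁻¹' B
  have hS : MeasurableSet S := measurableSet_inter_preimage_inv hB
  have hSo : S ⊆ overlap (A.chart i) (A.chart j) := fun z hz => ⟨hz.1, hj hz.2⟩
  have hBS : B = (A.chart i).invFun '' S := by
    rw [image_inter_preimage_inv, inter_eq_left.2 hi]
  rw [g.chartVol_apply i hB, hBS, g.chartVol_image j (A.compatible i j) hS hSo, ← hBS]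
  refine setLIntegral_congr_fun_ae hS ?_
  have := g.ae_pullBack_eq i j
  rw [ae_restrict_iff' (isModelSet_overlap _ _).measurableSet] at this
  filter_upwards [this] with z hz hzS
  rw [hz (hSo hzS)]; rfl

theorem chartVol_le_vol (i : ι) : g.chartVol i ≤ g.vol := le_iSup (fun i => g.chartVol i) i

theorem vol_eq_chartVol (i : ι) {B : Set M} (hB : MeasurableSet B) (hi : B ⊆ (A.chart i).source) :
    g.vol B = g.chartVol i B := by
  have hs := (A.chart i).open_source.measurableSet
  refine le_antisymm ?_ (Measure.le_iff'.1 (g.chartVol_le_vol i) B)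
  -- The right-hand side dominates every `g.chartVol j`: on the domain of the `i`-th chart the two
  -- chart volumes agree where both live, and elsewhere `g.vol` dominates by definition. As `g.vol`
  -- is the least such measure, the claim follows.
  have hle : g.vol ≤ (g.chartVol i).restrict (A.chart i).source +
      g.vol.restrict ((A.chart i).source)ᶜ := by
    refine iSup_le fun j => Measure.le_iff.2 fun E hE => ?_
    rw [Measure.add_apply, Measure.restrict_apply hE, Measure.restrict_apply hE,
      ← measure_inter_add_sdiff E hs, sdiff_eq]
    refine add_le_add ?_ (Measure.le_iff'.1 (g.chartVol_le_vol j) _)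
    have hz : ∀ F : Set M, MeasurableSet F → g.chartVol j F =
        g.chartVol j (F ∩ (A.chart j).source) := by
      intro F hF
      rw [g.chartVol_apply j hF, g.chartVol_apply j (hF.inter (A.chart j).open_source.measurableSet)]
      congr 2
      ext z
      exact ⟨fun h => ⟨h.1, h.2, inv_mem h.1⟩, fun h => ⟨h.1, h.2.1⟩⟩
    rw [hz _ (hE.inter hs), g.chartVol_eq i j ((hE.inter hs).inter
      (A.chart j).open_source.measurableSet) (fun x hx => hx.1.2) (fun x hx => hx.2)]
    exact measure_mono inter_subset_left
  have h1 := Measure.le_iff'.1 hle B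
  rw [Measure.add_apply, Measure.restrict_apply hB, Measure.restrict_apply hB,
    inter_eq_left.2 hi] at h1
  have h2 : B ∩ ((A.chart i).source)ᶜ = ∅ := by
    rw [← sdiff_eq, sdiff_eq_empty]; exact hi
  rwa [h2, measure_empty, add_zero] at h1

theorem vol_image_inv_eq_zero (i : ι) {N : Set (Euc d)} (hN : volume N = 0)
    (hNt : N ⊆ (A.chart i).target) : g.vol ((A.chart i).invFun '' N) = 0 := by
  set S := toMeasurable volume N ∩ (A.chart i).target
  have hS : MeasurableSet S :=
    (measurableSet_toMeasurable _ _).inter (A.chart i).isModelSet_target.measurableSet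
  have hS0 : volume S = 0 :=
    measure_mono_null inter_subset_left (by rw [measure_toMeasurable, hN])
  have hm := measurableSet_image_inv (c := A.chart i) hS inter_subset_right
  refine measure_mono_null (t := (A.chart i).invFun '' S)
    (image_mono (subset_inter (subset_toMeasurable volume N) hNt)) ?_
  rw [g.vol_eq_chartVol i hm (by rintro _ ⟨z, hz, rfl⟩; exact inv_mem hz.2),
    g.chartVol_apply i hm, preimage_image_inv inter_subset_right]
  exact setLIntegral_measure_zero _ _ hS0

/-- The densities are positive on the chart images and there are countably many charts, so volume
null sets are those that are Lebesgue null in every chart of the atlas. -/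
theorem ae_vol_iff [Countable ι] {P : M → Prop} : (∀ᵐ x ∂g.vol, P x) ↔
    ∀ i, ∀ᵐ z ∂(volume.restrict (A.chart i).target), P ((A.chart i).invFun z) := by
  constructor
  · intro h i
    have h1 : ∀ᵐ x ∂(g.chartVol i), P x := Measure.absolutelyContinuous_of_le (g.chartVol_le_vol i) h
    have h2 := ae_of_ae_map (g.aemeasurable_inv_dens i) h1
    rw [ae_withDensity_iff (g.measurable_dens i)] at h2
    filter_upwards [h2, ae_restrict_mem (A.chart i).isModelSet_target.measurableSet] with z hz hzt
    exact hz (g.dens_ne_zero hzt)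
  · intro h
    rw [ae_iff]
    have hsub : {x | ¬ P x} ⊆ ⋃ i, (A.chart i).invFun ''
        {z | z ∈ (A.chart i).target ∧ ¬ P ((A.chart i).invFun z)} := by
      intro x hx
      obtain ⟨i, hi⟩ := A.cover x
      refine mem_iUnion.2 ⟨i, (A.chart i).toFun x, ⟨to_mem hi, ?_⟩, inv_to hi⟩
      rw [inv_to hi]; exact hx
    refine measure_mono_null hsub (measure_iUnion_null fun i => ?_)
    refine g.vol_image_inv_eq_zero i ?_ fun z hz => hz.1
    have := h i
    rw [ae_restrict_iff' (A.chart i).isModelSet_target.measurableSet, ae_iff] at this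
    refine measure_mono_null (fun z hz => ?_) this
    simp only [mem_ofPred_eq, Classical.not_imp] at hz ⊢
    exact hz

theorem overlap_subset_target (c c' : ModelChart M d) : overlap c c' ⊆ c.target := inter_subset_left

theorem ae_chart_of_ae_vol [Countable ι] {c : ModelChart M d} (hc : A.IsChart c) {P : M → Prop}
    (h : ∀ᵐ x ∂g.vol, P x) : ∀ᵐ z ∂(volume.restrict c.target), P (c.invFun z) := by
  rw [g.ae_vol_iff] at h
  have h1 : ∀ i, ∀ᵐ z ∂(volume.restrict (overlap c (A.chart i))), P (c.invFun z) := by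
    intro i
    have h2 : ∀ᵐ y ∂(volume.restrict (overlap (A.chart i) c)), P ((A.chart i).invFun y) :=
      ae_mono (Measure.restrict_mono (overlap_subset_target _ _) le_rfl) (h i)
    have h3 := (hc.compatible i).ae_transition h2
    filter_upwards [h3, ae_restrict_mem (isModelSet_overlap _ _).measurableSet] with z hz hzo
    rwa [inv_transition hzo] at hz
  have hcov : c.target = ⋃ i, overlap c (A.chart i) := by
    ext z
    simp only [mem_iUnion]
    constructor
    · intro hz
      obtain ⟨i, hi⟩ := A.cover (c.invFun z)
      exact ⟨i, hz, hi⟩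
    · rintro ⟨i, hi⟩; exact hi.1
  rw [hcov, ae_restrict_iUnion_iff]
  exact h1

theorem ae_vol_of_ae_chart [Countable ι] {c : ModelChart M d} (hc : A.IsChart c) {P : M → Prop}
    (h : ∀ᵐ z ∂(volume.restrict c.target), P (c.invFun z)) :
    ∀ᵐ x ∂g.vol, x ∈ c.source → P x := by
  rw [g.ae_vol_iff]
  intro i
  have h2 : ∀ᵐ y ∂(volume.restrict (overlap c (A.chart i))), P (c.invFun y) :=
    ae_mono (Measure.restrict_mono (overlap_subset_target _ _) le_rfl) h
  have h3 := (hc.compatible i).symm.ae_transition h2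
  rw [ae_restrict_iff' (isModelSet_overlap _ _).measurableSet] at h3
  rw [ae_restrict_iff' (A.chart i).isModelSet_target.measurableSet]
  filter_upwards [h3] with z hz hzt hzs
  have := hz ⟨hzt, hzs⟩
  rwa [inv_transition ⟨hzt, hzs⟩] at this

/-- In a quasi-Euclidean chart, the volume is comparable to the Lebesgue measure. -/
theorem vol_image_bounds [Countable ι] {c : ModelChart M d} (hc : A.IsChart c) {b : ℝ}
    (hb : 1 ≤ b) {T : Set (Euc d)} (hTc : T ⊆ c.target)
    (hq : g.IsQuasiEuclideanOn c b (c.invFun '' T)) {S : Set (Euc d)} (hS : MeasurableSet S)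
    (hST : S ⊆ T) :
    ENNReal.ofReal (Real.sqrt (b⁻¹ ^ d)) * volume S ≤ g.vol (c.invFun '' S) ∧
      g.vol (c.invFun '' S) ≤ ENNReal.ofReal (Real.sqrt (b ^ d)) * volume S := by
  have hb0 : 0 < b := by linarith
  have hloc : ∀ i, ∀ S : Set (Euc d), MeasurableSet S → S ⊆ T → S ⊆ overlap c (A.chart i) →
      ENNReal.ofReal (Real.sqrt (b⁻¹ ^ d)) * volume S ≤ g.vol (c.invFun '' S) ∧
      g.vol (c.invFun '' S) ≤ ENNReal.ofReal (Real.sqrt (b ^ d)) * volume S := by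
    intro i S hS hST hSo
    have hm := measurableSet_image_inv (c := c) hS (hST.trans hTc)
    have hsub : c.invFun '' S ⊆ (A.chart i).source := by
      rintro _ ⟨z, hz, rfl⟩; exact (hSo hz).2
    rw [g.vol_eq_chartVol i hm hsub, g.chartVol_image i (hc.compatible i) hS hSo]
    have hdet : ∀ᵐ z, z ∈ S → b⁻¹ ^ d ≤ (pullBack (g.coeff i (transition c (A.chart i) z))
        (fderiv ℝ (transition c (A.chart i)) z)).det ∧
        (pullBack (g.coeff i (transition c (A.chart i) z))
        (fderiv ℝ (transition c (A.chart i)) z)).det ≤ b ^ d := by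
      have h1 := hq i
      rw [ae_restrict_iff' (isModelSet_overlap _ _).measurableSet] at h1
      filter_upwards [h1] with z hz hzS
      refine det_bounds (isSymm_pullBack (isSymm_of_posDef (g.posDef i _
        (transition_mem (hSo hzS)).1)) _) (by positivity) fun ξ => ?_
      rw [bil_pullBack]
      exact hz (hSo hzS) ⟨z, hST hzS, rfl⟩ ξ
    constructor
    · rw [← setLIntegral_const]
      refine setLIntegral_mono_ae' hS ?_
      filter_upwards [hdet] with z hz hzS
      exact ENNReal.ofReal_le_ofReal (Real.sqrt_le_sqrt (hz hzS).1)
    · rw [← setLIntegral_const]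
      refine setLIntegral_mono_ae' hS ?_
      filter_upwards [hdet] with z hz hzS
      exact ENNReal.ofReal_le_ofReal (Real.sqrt_le_sqrt (hz hzS).2)
  by_cases hem : S = ∅
  · simp [hem]
  obtain ⟨z₀, hz₀⟩ := nonempty_iff_ne_empty.2 hem
  obtain ⟨i₀, -⟩ := A.cover (c.invFun z₀)
  have : Nonempty ι := ⟨i₀⟩
  obtain ⟨e, he⟩ := exists_surjective_nat ι
  -- The bounds are known inside each chart of the atlas. A countable disjoint decomposition of `S`,
  -- each piece lying over one atlas chart, sums them up.
  let E : ℕ → Set (Euc d) := fun n => S ∩ disjointed (fun n => overlap c (A.chart (e n))) n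
  have hEm : ∀ n, MeasurableSet (E n) := fun n =>
    hS.inter (MeasurableSet.disjointed (fun n => (isModelSet_overlap _ _).measurableSet) n)
  have hEd : Pairwise (Function.onFun Disjoint E) := fun m n hmn =>
    (disjoint_disjointed _ hmn).mono inter_subset_right inter_subset_right
  have hEU : ⋃ n, E n = S := by
    rw [← inter_iUnion, iUnion_disjointed, inter_eq_left]
    intro z hz
    obtain ⟨i, hi⟩ := A.cover (c.invFun z)
    obtain ⟨n, rfl⟩ := he i
    exact mem_iUnion.2 ⟨n, hTc (hST hz), hi⟩
  have hEI : c.invFun '' S = ⋃ n, c.invFun '' E n := by rw [← image_iUnion, hEU]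
  have hEId : Pairwise (Function.onFun Disjoint fun n => c.invFun '' E n) := by
    intro m n hmn
    rw [Function.onFun, Set.disjoint_left]
    rintro _ ⟨z, hz, rfl⟩ ⟨w, hw, hzw⟩
    have : w = z := by
      rw [← to_inv (hTc (hST hw.1)), hzw, to_inv (hTc (hST hz.1))]
    exact (Set.disjoint_left.1 (hEd hmn)) hz (this ▸ hw)
  have hEt : ∀ n, E n ⊆ c.target := fun n => inter_subset_left.trans (hST.trans hTc)
  rw [hEI, measure_iUnion hEId fun n => measurableSet_image_inv (hEm n) (hEt n)]
  have hvS : volume S = ∑' n, volume (E n) := by rw [← measure_iUnion hEd hEm, hEU]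
  rw [hvS, ← ENNReal.tsum_mul_left, ← ENNReal.tsum_mul_left]
  have hall := fun n => hloc (e n) (E n) (hEm n) (inter_subset_left.trans hST)
    (inter_subset_right.trans (disjointed_subset _ _))
  exact ⟨ENNReal.tsum_le_tsum fun n => (hall n).1, ENNReal.tsum_le_tsum fun n => (hall n).2⟩

theorem map_inv_le_vol [Countable ι] {c : ModelChart M d} (hc : A.IsChart c) {b : ℝ}
    (hb : 1 ≤ b) {T : Set (Euc d)} (hT : MeasurableSet T) (hTc : T ⊆ c.target)
    (hq : g.IsQuasiEuclideanOn c b (c.invFun '' T)) :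
    Measure.map c.invFun (volume.restrict T) ≤
      ENNReal.ofReal (Real.sqrt (b ^ d)) • g.vol.restrict (c.invFun '' T) := by
  have hb0 : 0 < b := by linarith
  refine Measure.le_iff.2 fun B hB => ?_
  have hS : MeasurableSet (T ∩ c.invFun ⁻¹' B) := by
    have := hT.inter (measurableSet_inter_preimage_inv (c := c) hB)
    rwa [← inter_assoc, inter_eq_left.2 hTc] at this
  have him : c.invFun '' (T ∩ c.invFun ⁻¹' B) = B ∩ c.invFun '' T := by
    rw [inter_comm, image_preimage_inter]
  have h1 := (g.vol_image_bounds hc hb hTc hq hS inter_subset_left).1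
  rw [him] at h1
  rw [Measure.map_apply_of_aemeasurable ((c.continuousOn_invFun.mono hTc).aemeasurable hT) hB,
    Measure.restrict_apply' hT, inter_comm, Measure.smul_apply, Measure.restrict_apply hB,
    smul_eq_mul]
  calc _ = ENNReal.ofReal (Real.sqrt (b ^ d)) *
        (ENNReal.ofReal (Real.sqrt (b⁻¹ ^ d)) * volume (T ∩ c.invFun ⁻¹' B)) := by
        rw [← mul_assoc, ← ENNReal.ofReal_mul (Real.sqrt_nonneg _), ← Real.sqrt_mul (by positivity),
          ← mul_pow, mul_inv_cancel₀ hb0.ne']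
        simp
    _ ≤ _ := by gcongr

theorem vol_le_map_inv [Countable ι] {c : ModelChart M d} (hc : A.IsChart c) {b : ℝ}
    (hb : 1 ≤ b) {T : Set (Euc d)} (hT : MeasurableSet T) (hTc : T ⊆ c.target)
    (hq : g.IsQuasiEuclideanOn c b (c.invFun '' T)) :
    g.vol.restrict (c.invFun '' T) ≤
      ENNReal.ofReal (Real.sqrt (b ^ d)) • Measure.map c.invFun (volume.restrict T) := by
  refine Measure.le_iff.2 fun B hB => ?_
  have hS : MeasurableSet (T ∩ c.invFun ⁻¹' B) := by
    have := hT.inter (measurableSet_inter_preimage_inv (c := c) hB)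
    rwa [← inter_assoc, inter_eq_left.2 hTc] at this
  have him : c.invFun '' (T ∩ c.invFun ⁻¹' B) = B ∩ c.invFun '' T := by
    rw [inter_comm, image_preimage_inter]
  have h1 := (g.vol_image_bounds hc hb hTc hq hS inter_subset_left).2
  rw [him] at h1
  rw [Measure.smul_apply,
    Measure.map_apply_of_aemeasurable ((c.continuousOn_invFun.mono hTc).aemeasurable hT) hB,
    Measure.restrict_apply' hT, inter_comm (c.invFun ⁻¹' B), Measure.restrict_apply hB, smul_eq_mul]
  exact h1

theorem isQuasiEuclideanOn_chart (i : ι) {lam : ℝ}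
    (h : ∀ᵐ z ∂(volume.restrict (A.chart i).target), ∀ ξ : Euc d,
      lam⁻¹ * ‖ξ‖ ^ 2 ≤ bil (g.coeff i z) ξ ξ ∧ bil (g.coeff i z) ξ ξ ≤ lam * ‖ξ‖ ^ 2)
    (S : Set M) : g.IsQuasiEuclideanOn (A.chart i) lam S := by
  intro j
  filter_upwards [g.compat i j,
    ae_mono (Measure.restrict_mono (overlap_subset_target _ _) le_rfl) h] with z hz hz' _ ξ
  rw [hz]
  exact hz' ξ

end LRMetric

/-! ### Full support and local finiteness of the volume measure -/

theorem IsModelSet.volume_pos {T : Set (Euc d)} (hT : IsModelSet T) (hne : T.Nonempty) :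
    volume T ≠ 0 := by
  obtain ⟨O, H, hO, hH, rfl⟩ := isModelSet_iff.1 hT
  obtain ⟨z, hzO, hzH⟩ := hne
  have hcont : Tendsto (fun s : ℝ => z + s • EuclideanSpace.single (0 : Fin d) (1 : ℝ)) (𝓝[>] 0)
      (𝓝 z) := by
    have : Continuous fun s : ℝ => z + s • EuclideanSpace.single (0 : Fin d) (1 : ℝ) := by fun_prop
    exact (this.tendsto' 0 z (by simp)).mono_left nhdsWithin_le_nhds
  have h1 : ∀ᶠ s in 𝓝[>] (0 : ℝ), z + s • EuclideanSpace.single (0 : Fin d) (1 : ℝ) ∈ O :=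
    hcont (hO.mem_nhds hzO)
  have h2 : ∀ᶠ s in 𝓝[>] (0 : ℝ), 0 < s := self_mem_nhdsWithin
  obtain ⟨s, hs, hs0⟩ := (h1.and h2).exists
  have hs0' : 0 < s := hs0
  have hmem : z + s • EuclideanSpace.single (0 : Fin d) (1 : ℝ) ∈ O ∩ interior H :=
    ⟨hs, hH.mem_interior hzH (by simp; exact hs0')⟩
  intro h0
  have := (hO.inter isOpen_interior).measure_pos volume ⟨_, hmem⟩
  exact this.ne' (measure_mono_null (inter_subset_inter_right _ interior_subset) h0)

namespace LRMetric

variable {A : LipschitzAtlas ι M d} (g : LRMetric A) [Countable ι]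

/-- Needed to find, arbitrarily close to a given point, points at which almost everywhere statements
hold. -/
theorem isOpenPosMeasure_vol : g.vol.IsOpenPosMeasure := by
  refine ⟨fun U hU hne h0 => ?_⟩
  obtain ⟨x, hx⟩ := hne
  obtain ⟨i, hi⟩ := A.cover x
  have h1 : ∀ᵐ y ∂g.vol, y ∉ U := by rw [ae_iff]; simpa using h0
  have h2 := g.ae_vol_iff.1 h1 i
  have hW : IsOpen (U ∩ (A.chart i).source) := hU.inter (A.chart i).open_source
  refine (isModelSet_image (c := A.chart i) hW inter_subset_right).volume_pos
    ⟨_, x, ⟨hx, hi⟩, rfl⟩ ?_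
  rw [ae_restrict_iff' (A.chart i).isModelSet_target.measurableSet, ae_iff] at h2
  refine measure_mono_null ?_ h2
  rintro _ ⟨y, hy, rfl⟩
  simp only [mem_ofPred_eq, Classical.not_imp, not_not]
  exact ⟨to_mem hy.2, by rw [inv_to hy.2]; exact hy.1⟩

theorem isLocallyFiniteMeasure_vol : IsLocallyFiniteMeasure g.vol := by
  refine ⟨fun x => ?_⟩
  obtain ⟨i, hi⟩ := A.cover x
  obtain ⟨lam, hlam, h⟩ := g.elliptic i
  set T := (A.chart i).target ∩ Metric.ball ((A.chart i).toFun x) 1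
  refine ⟨(A.chart i).invFun '' T, (isOpen_image_inv Metric.isOpen_ball).mem_nhds
    ⟨_, ⟨to_mem hi, Metric.mem_ball_self one_pos⟩, inv_to hi⟩, ?_⟩
  refine (g.vol_image_bounds (A.isChart_chart i) hlam (T := T) inter_subset_left
    (g.isQuasiEuclideanOn_chart i h _) ((A.chart i).isModelSet_target.measurableSet.inter
      Metric.isOpen_ball.measurableSet) le_rfl).2.trans_lt ?_
  exact ENNReal.mul_lt_top ENNReal.ofReal_lt_top
    ((measure_mono inter_subset_right).trans_lt measure_ball_lt_top)

/-- Square integrable functions are locally square integrable in charts. -/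
theorem memLp_comp_inv (i : ι) {f : M → ℝ} {p : ℝ≥0∞} (hf : MemLp f p g.vol) :
    MemLp (fun z => f ((A.chart i).invFun z)) p (volume.restrict (A.chart i).target) := by
  obtain ⟨lam, hlam, h⟩ := g.elliptic i
  have hle := g.map_inv_le_vol (A.isChart_chart i) hlam (T := (A.chart i).target)
    (A.chart i).isModelSet_target.measurableSet le_rfl (g.isQuasiEuclideanOn_chart i h _)
  have h1 : MemLp f p (Measure.map (A.chart i).invFun (volume.restrict (A.chart i).target)) :=
    (hf.restrict _).of_measure_le_smul ENNReal.ofReal_ne_top hle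
  exact h1.comp_of_map aemeasurable_inv

end LRMetric

end

end

section

variable {ι : Type v} {M : Type u} [TopologicalSpace M] {d : ℕ} [NeZero d]

/-! ### Gradients of locally Lipschitz functions -/

theorem norm_gradient (η : Euc d → ℝ) (z : Euc d) : ‖gradient η z‖ = ‖fderiv ℝ η z‖ := by
  simp [gradient]

theorem inner_gradient (η : Euc d → ℝ) (z ξ : Euc d) :
    (inner ℝ (gradient η z) ξ : ℝ) = fderiv ℝ η z ξ := by
  rw [gradient, InnerProductSpace.toDual_symm_apply]

theorem measurable_gradient (η : Euc d → ℝ) : Measurable (gradient η) := by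
  have h := measurable_fderiv ℝ η
  exact ((InnerProductSpace.toDual ℝ (Euc d)).symm.continuous.measurable).comp h

theorem norm_gradient_le {η : Euc d → ℝ} {K : ℝ≥0} {s : Set (Euc d)} {z : Euc d}
    (h : LipschitzOnWith K η s) (hs : s ∈ 𝓝 z) : ‖gradient η z‖ ≤ K := by
  rw [norm_gradient]
  exact norm_fderiv_le_of_lipschitzOn ℝ hs h

theorem ae_mem_interior_of_isModelSet {T : Set (Euc d)} (hT : IsModelSet T) :
    ∀ᵐ z, z ∈ T → z ∈ interior T := by
  have := hT.volume_diff_interior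
  rw [ae_iff]
  refine measure_mono_null (fun z hz => ?_) this
  simp only [mem_ofPred_eq, Classical.not_imp] at hz
  exact hz

/-- Almost every point of `T` is interior, and there the gradient is bounded by the local Lipschitz
constant. -/
theorem locallyIntegrableOn_mul_gradient_sq {f η : Euc d → ℝ} {T : Set (Euc d)}
    (hT : IsModelSet T) (hη : LocallyLipschitzOn T η)
    (hf : LocallyIntegrableOn (fun z => f z ^ 2) T) :
    LocallyIntegrableOn (fun z => f z ^ 2 * ‖gradient η z‖ ^ 2) T := by
  intro z₀ hz₀
  obtain ⟨K, t, ht, hK⟩ := hη hz₀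
  obtain ⟨t', ht', hi⟩ := hf z₀ hz₀
  obtain ⟨O, hO, hzO, hOt⟩ := mem_nhdsWithin.1 (inter_mem ht ht')
  refine ⟨O ∩ T, mem_nhdsWithin.2 ⟨O, hO, hzO, le_rfl⟩, ?_⟩
  have hm : MeasurableSet (O ∩ T) := hO.measurableSet.inter hT.measurableSet
  refine (hi.mono_set (hOt.trans inter_subset_right)).mul_bdd (c := (K : ℝ) ^ 2)
    ((measurable_gradient η).norm.pow_const 2).aestronglyMeasurable ?_
  rw [ae_restrict_iff' hm]
  filter_upwards [ae_mem_interior_of_isModelSet hT] with z hz hzT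
  have h1 : ‖gradient η z‖ ≤ K := norm_gradient_le (s := O ∩ interior T)
    (hK.mono fun y hy => (hOt ⟨hy.1, interior_subset hy.2⟩).1)
    ((hO.inter isOpen_interior).mem_nhds ⟨hzT.1, hz hzT.2⟩)
  rw [norm_pow, norm_norm]
  gcongr

theorem locallyIntegrableOn_of_sq {E : Type*} [NormedAddCommGroup E] {θ : Euc d → E}
    {T : Set (Euc d)} (hm : AEStronglyMeasurable θ (volume.restrict T))
    (h : LocallyIntegrableOn (fun z => ‖θ z‖ ^ 2) T) : LocallyIntegrableOn θ T := by
  intro z₀ hz₀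
  obtain ⟨t, ht, hi⟩ := h z₀ hz₀
  refine ⟨t ∩ (T ∩ Metric.ball z₀ 1), inter_mem ht
    (inter_mem self_mem_nhdsWithin (mem_nhdsWithin_of_mem_nhds (Metric.ball_mem_nhds _ one_pos))), ?_⟩
  have h1 : IntegrableOn (fun z => 1 + ‖θ z‖ ^ 2) (t ∩ (T ∩ Metric.ball z₀ 1)) := by
    refine Integrable.add ?_ (hi.mono_set inter_subset_left)
    refine integrableOn_const ?_
    exact ((measure_mono (inter_subset_right.trans inter_subset_right)).trans_lt
      measure_ball_lt_top).ne
  refine h1.mono' (hm.mono_measure (Measure.restrict_mono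
    (inter_subset_right.trans inter_subset_left) le_rfl)) (Eventually.of_forall fun z => ?_)
  nlinarith [sq_nonneg (‖θ z‖ - 1), norm_nonneg (θ z)]

section

variable [MeasurableSpace M] [BorelSpace M]

open ModelChart

theorem ModelChart.measurable_indicator_comp_inv (c : ModelChart M d) {a : M → ℝ}
    (ha : Measurable a) : Measurable (c.target.indicator fun z => a (c.invFun z)) := by
  intro B hB
  rw [Set.indicator_preimage, Set.ite]
  have h1 : MeasurableSet ((fun z => a (c.invFun z)) ⁻¹' B ∩ c.target) := by
    rw [inter_comm]
    exact measurableSet_inter_preimage_inv (c := c) (ha hB)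
  exact h1.union ((measurable_const hB).diff c.isModelSet_target.measurableSet)

variable {A : LipschitzAtlas ι M d}

/-! ### Calculus of one-forms -/

namespace OneForm

/-- The product of a Borel function and a one-form. -/
def smul (a : M → ℝ) (ha : Measurable a) (θ : OneForm A) : OneForm A where
  -- Outside `target` the map `invFun` is arbitrary; the indicator makes the coefficient Borel on
  -- the whole space.
  coeff i z := (A.chart i).target.indicator (fun z => a ((A.chart i).invFun z)) z • θ.coeff i z
  measurable i := ((A.chart i).measurable_indicator_comp_inv ha).smul (θ.measurable i)
  compat i j := by
    filter_upwards [θ.compat i j, ae_restrict_mem (isModelSet_overlap _ _).measurableSet]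
      with z hz hzo ξ
    rw [indicator_of_mem (transition_mem hzo).1, indicator_of_mem hzo.1, inv_transition hzo,
      inner_smul_left, inner_smul_left, hz]

theorem smul_coeff {a : M → ℝ} (ha : Measurable a) (θ : OneForm A) {i : ι} {z : Euc d}
    (hz : z ∈ (A.chart i).target) :
    (smul a ha θ).coeff i z = a ((A.chart i).invFun z) • θ.coeff i z := by
  simp only [smul, indicator_of_mem hz]

/-- The sum of two one-forms. -/
def add (θ η : OneForm A) : OneForm A where
  coeff i z := θ.coeff i z + η.coeff i z
  measurable i := (θ.measurable i).add (η.measurable i)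
  compat i j := by
    filter_upwards [θ.compat i j, η.compat i j] with z h1 h2 ξ
    rw [inner_add_left, inner_add_left, h1, h2]

end OneForm

/-- A function that is locally Lipschitz in the charts of the atlas. -/
def IsLocLip (A : LipschitzAtlas ι M d) (η : M → ℝ) : Prop :=
  ∀ i, LocallyLipschitzOn (A.chart i).target fun z => η ((A.chart i).invFun z)

/-- The differential of a locally Lipschitz function. -/
def IsLocLip.diff {η : M → ℝ} (h : IsLocLip A η) : OneForm A where
  coeff i := gradient fun z => η ((A.chart i).invFun z)
  measurable i := measurable_gradient _
  compat i j := by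
    have h1 : ∀ᵐ y ∂(volume.restrict (overlap (A.chart j) (A.chart i))),
        DifferentiableAt ℝ (fun z => η ((A.chart j).invFun z)) y := by
      rw [ae_restrict_iff' (isModelSet_overlap _ _).measurableSet]
      filter_upwards [ae_differentiableAt_of_locallyLipschitzOn (h j),
        ae_mem_interior_of_isModelSet (isModelSet_overlap (A.chart j) (A.chart i))] with y hy hy' hyo
      exact hy (interior_mono inter_subset_left (hy' hyo))
    filter_upwards [(A.compatible i j).ae_transition h1, (A.compatible i j).ae_differentiableAt,
      ae_mem_interior_overlap (A.chart i) (A.chart j)] with z hz hz' hzi ξ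
    rw [inner_gradient, inner_gradient]
    have h2 : (fun z => η ((A.chart i).invFun z)) =ᶠ[𝓝 z]
        (fun z => η ((A.chart j).invFun z)) ∘ transition (A.chart i) (A.chart j) := by
      filter_upwards [mem_interior_iff_mem_nhds.1 hzi] with w hw
      rw [Function.comp, inv_transition hw]
    rw [h2.fderiv_eq, fderiv_comp _ hz hz', ContinuousLinearMap.comp_apply]

/-! ### Differentials in charts -/

theorem isDifferential_iff {f : M → ℝ} {θ : OneForm A} : IsDifferential f θ ↔
    ∀ i, LocallyIntegrableOn (fun z => ‖θ.coeff i z‖ ^ 2) (A.chart i).target ∧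
      HasWeakGrad (fun z => f ((A.chart i).invFun z)) (θ.coeff i)
        (interior (A.chart i).target) := by
  refine forall_congr' fun i => and_congr_right fun _ => ?_
  refine forall_congr' fun φ => forall_congr' fun _ => forall_congr' fun _ =>
    forall_congr' fun hs => forall_congr' fun ξ => ?_
  rw [setIntegral_mul_fderiv hs, setIntegral_mul_of_tsupport hs]

namespace IsDifferential

variable {f : M → ℝ} {θ : OneForm A}

theorem hasWeakGrad (h : IsDifferential f θ) (i : ι) :
    HasWeakGrad (fun z => f ((A.chart i).invFun z)) (θ.coeff i) (interior (A.chart i).target) :=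
  (isDifferential_iff.1 h i).2

theorem locallyIntegrableOn (h : IsDifferential f θ) (i : ι) :
    LocallyIntegrableOn (θ.coeff i) (A.chart i).target :=
  locallyIntegrableOn_of_sq (θ.measurable i).aestronglyMeasurable (h i).1

theorem unique (h : IsDifferential f θ) {θ' : OneForm A} (h' : IsDifferential f θ') (i : ι) :
    ∀ᵐ z ∂(volume.restrict (A.chart i).target), θ.coeff i z = θ'.coeff i z := by
  rw [ae_restrict_iff' (A.chart i).isModelSet_target.measurableSet]
  filter_upwards [HasWeakGrad.unique isOpen_interior
    ((h.locallyIntegrableOn i).mono_set interior_subset)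
    ((h'.locallyIntegrableOn i).mono_set interior_subset) (h.hasWeakGrad i) (h'.hasWeakGrad i),
    ae_mem_interior_of_isModelSet (A.chart i).isModelSet_target] with z hz hz' hzt
  exact hz (hz' hzt)

end IsDifferential

/-- Local integrability in charts. -/
def IsLocInt (A : LipschitzAtlas ι M d) (f : M → ℝ) : Prop :=
  ∀ i, LocallyIntegrableOn (fun z => f ((A.chart i).invFun z)) (A.chart i).target

theorem LocallyIntegrableOn.congr_set {E : Type*} [NormedAddCommGroup E] {f f' : Euc d → E}
    {T : Set (Euc d)} (hT : MeasurableSet T) (h : LocallyIntegrableOn f T)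
    (he : ∀ z ∈ T, f z = f' z) : LocallyIntegrableOn f' T := by
  intro z hz
  obtain ⟨t, ht, hi⟩ := h z hz
  refine ⟨T ∩ t, inter_mem self_mem_nhdsWithin ht, ?_⟩
  have h1 : IntegrableOn f (T ∩ t) := hi.mono_set inter_subset_right
  refine Integrable.congr h1 ?_
  have h2 : ∀ᵐ z ∂(volume.restrict T), f z = f' z := by
    filter_upwards [ae_restrict_mem hT] with z hz using he z hz
  exact ae_mono (Measure.restrict_mono inter_subset_left le_rfl) h2

theorem LocallyIntegrableOn.of_le {E F : Type*} [NormedAddCommGroup E] [NormedAddCommGroup F]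
    {f : Euc d → E} {f' : Euc d → F}
    {T : Set (Euc d)} (hT : MeasurableSet T) (h : LocallyIntegrableOn f T)
    (hm : AEStronglyMeasurable f' (volume.restrict T))
    (he : ∀ z ∈ T, ‖f' z‖ ≤ ‖f z‖) : LocallyIntegrableOn f' T := by
  intro z hz
  obtain ⟨t, ht, hi⟩ := h z hz
  refine ⟨T ∩ t, inter_mem self_mem_nhdsWithin ht, ?_⟩
  have h1 : IntegrableOn f (T ∩ t) := hi.mono_set inter_subset_right
  refine Integrable.mono h1 (hm.mono_measure (Measure.restrict_mono inter_subset_left le_rfl)) ?_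
  have h2 : ∀ᵐ z ∂(volume.restrict T), ‖f' z‖ ≤ ‖f z‖ := by
    filter_upwards [ae_restrict_mem hT] with z hz using he z hz
  exact ae_mono (Measure.restrict_mono inter_subset_left le_rfl) h2

theorem locallyIntegrableOn_const_mul {f : Euc d → ℝ} {T : Set (Euc d)}
    (h : LocallyIntegrableOn f T) (k : ℝ) : LocallyIntegrableOn (fun z => k * f z) T := by
  intro z hz
  obtain ⟨t, ht, hi⟩ := h z hz
  exact ⟨t, ht, Integrable.const_mul hi k⟩

/-- The chain rule. -/
theorem IsDifferential.comp {f : M → ℝ} {θ : OneForm A} (h : IsDifferential f θ)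
    (hf : IsLocInt A f) (hfm : Measurable f) {q q' : ℝ → ℝ} {C : ℝ}
    (hq : ∀ s, HasDerivAt q (q' s) s) (hq' : Continuous q') (hC : ∀ s, |q' s| ≤ C) :
    IsDifferential (fun x => q (f x)) (θ.smul (fun x => q' (f x)) (hq'.measurable.comp hfm)) := by
  rw [isDifferential_iff]
  intro i
  have hT := (A.chart i).isModelSet_target
  constructor
  · refine LocallyIntegrableOn.of_le hT.measurableSet (f := fun z => C ^ 2 * ‖θ.coeff i z‖ ^ 2) ?_
      ((OneForm.measurable _ i).norm.pow_const 2).aestronglyMeasurable fun z hz => ?_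
    · exact locallyIntegrableOn_const_mul (h i).1 (C ^ 2)
    · have : ‖q' (f ((A.chart i).invFun z))‖ ≤ C := hC _
      refine le_trans ?_ (le_abs_self _)
      rw [OneForm.smul_coeff _ _ hz, norm_pow, norm_norm, norm_smul, mul_pow]
      gcongr
  · have h1 := HasWeakGrad.comp (C := C.toNNReal) hT (hf i) (h.locallyIntegrableOn i)
      (h.hasWeakGrad i) hq hq' fun s => (hC s).trans (Real.le_coe_toNNReal C)
    refine h1.congr_ae (Eventually.of_forall fun z _ => rfl) (Eventually.of_forall fun z hz => ?_)
    rw [OneForm.smul_coeff _ _ (interior_subset hz)]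

/-- The product rule. -/
theorem IsDifferential.mul_isLocLip {f : M → ℝ} {θ : OneForm A} (h : IsDifferential f θ)
    (hf : IsLocInt A f) (hf2 : IsLocInt A fun x => f x ^ 2) (hfm : Measurable f) {η : M → ℝ}
    (hη : IsLocLip A η) (hηm : Measurable η) {C : ℝ} (hC : ∀ x, |η x| ≤ C) :
    IsDifferential (fun x => η x * f x) ((θ.smul η hηm).add (hη.diff.smul f hfm)) := by
  rw [isDifferential_iff]
  intro i
  have hT := (A.chart i).isModelSet_target
  constructor
  -- The majorant comes from `(x + y)² ≤ 2 x² + 2 y²` with `|η| ≤ C`.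
  · have h2 := (locallyIntegrableOn_const_mul (h i).1 (2 * C ^ 2)).add
      (locallyIntegrableOn_const_mul (locallyIntegrableOn_mul_gradient_sq hT (hη i) (hf2 i)) 2)
    refine LocallyIntegrableOn.of_le hT.measurableSet h2
      ((OneForm.measurable _ i).norm.pow_const 2).aestronglyMeasurable fun z hz => ?_
    simp only [OneForm.add, OneForm.smul_coeff _ _ hz, IsLocLip.diff, Pi.add_apply]
    rw [Real.norm_of_nonneg (by positivity), Real.norm_of_nonneg (by positivity)]
    have h3 := norm_add_le (η ((A.chart i).invFun z) • θ.coeff i z)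
      (f ((A.chart i).invFun z) • gradient (fun z => η ((A.chart i).invFun z)) z)
    rw [norm_smul, norm_smul] at h3
    have h4 : ‖η ((A.chart i).invFun z)‖ ≤ C := hC _
    have h5 : ‖η ((A.chart i).invFun z)‖ * ‖θ.coeff i z‖ ≤ C * ‖θ.coeff i z‖ := by gcongr
    have h6 := pow_le_pow_left₀ (norm_nonneg _) (h3.trans (add_le_add_left h5 _)) 2
    refine h6.trans ?_
    have h7 : ‖f ((A.chart i).invFun z)‖ ^ 2 = f ((A.chart i).invFun z) ^ 2 := by
      rw [Real.norm_eq_abs, sq_abs]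
    rw [← h7]
    nlinarith [sq_nonneg (C * ‖θ.coeff i z‖ - ‖f ((A.chart i).invFun z)‖ *
      ‖gradient (fun z => η ((A.chart i).invFun z)) z‖)]
  · have h1 := HasWeakGrad.mul_locallyLipschitz hT (hf i) (h.locallyIntegrableOn i)
      (h.hasWeakGrad i) (hη i)
    refine h1.congr_ae (Eventually.of_forall fun z _ => rfl) (Eventually.of_forall fun z hz => ?_)
    simp only [OneForm.add, OneForm.smul_coeff _ _ (interior_subset hz), IsLocLip.diff]

theorem IsLocLip.isDifferential {η : M → ℝ} (hη : IsLocLip A η) : IsDifferential η hη.diff := by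
  rw [isDifferential_iff]
  intro i
  have hT := (A.chart i).isModelSet_target
  refine ⟨?_, HasWeakGrad.of_locallyLipschitz hT (hη i)⟩
  have h1 : LocallyIntegrableOn (fun _ : Euc d => (1 : ℝ) ^ 2) (A.chart i).target :=
    (locallyIntegrable_const _).locallyIntegrableOn _
  have := locallyIntegrableOn_mul_gradient_sq hT (hη i) h1
  simpa [IsLocLip.diff] using this

/-! ### Pairings -/

namespace LRMetric

variable {g : LRMetric A}

namespace IsPairing

variable {θ θ' η η' : OneForm A} {q q' : M → ℝ}

theorem ae_eq [Countable ι] (h : g.IsPairing θ η q) (h' : g.IsPairing θ η q') :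
    q =ᵐ[g.vol] q' := by
  refine g.ae_vol_iff.2 fun i => ?_
  filter_upwards [h i, h' i] with z h1 h2
  rw [h1, h2]

theorem congr_forms (h : g.IsPairing θ η q)
    (hθ : ∀ i, ∀ᵐ z ∂(volume.restrict (A.chart i).target), θ.coeff i z = θ'.coeff i z)
    (hη : ∀ i, ∀ᵐ z ∂(volume.restrict (A.chart i).target), η.coeff i z = η'.coeff i z) :
    g.IsPairing θ' η' q := by
  intro i
  filter_upwards [h i, hθ i, hη i] with z h1 h2 h3
  rw [h1, h2, h3]

theorem symm (h : g.IsPairing θ η q) : g.IsPairing η θ q := by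
  intro i
  filter_upwards [h i, ae_restrict_mem (A.chart i).isModelSet_target.measurableSet] with z h1 hz
  rw [h1, bil_comm (isSymm_of_posDef (g.posDef i z hz).inv)]

theorem smul_left (h : g.IsPairing θ η q) {a : M → ℝ} (ha : Measurable a) :
    g.IsPairing (θ.smul a ha) η fun x => a x * q x := by
  intro i
  filter_upwards [h i, ae_restrict_mem (A.chart i).isModelSet_target.measurableSet] with z h1 hz
  rw [OneForm.smul_coeff ha _ hz, bil_smul_left, h1]

theorem smul_right (h : g.IsPairing θ η q) {a : M → ℝ} (ha : Measurable a) :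
    g.IsPairing θ (η.smul a ha) fun x => a x * q x := (h.symm.smul_left ha).symm

theorem add_left (h : g.IsPairing θ η q) (h' : g.IsPairing θ' η q') :
    g.IsPairing (θ.add θ') η fun x => q x + q' x := by
  intro i
  filter_upwards [h i, h' i] with z h1 h2
  rw [h1, h2, OneForm.add, bil_add_left]

theorem add_right (h : g.IsPairing θ η q) (h' : g.IsPairing θ η' q') :
    g.IsPairing θ (η.add η') fun x => q x + q' x := (h.symm.add_left h'.symm).symm

theorem ae_nonneg [Countable ι] (h : g.IsPairing θ θ q) : ∀ᵐ x ∂g.vol, 0 ≤ q x := by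
  refine g.ae_vol_iff.2 fun i => ?_
  filter_upwards [h i, ae_restrict_mem (A.chart i).isModelSet_target.measurableSet] with z h1 hz
  rw [h1]
  exact bil_inv_nonneg (g.posDef i z hz) _

theorem ae_sq_le [Countable ι] {q₁ q₂ : M → ℝ} (h : g.IsPairing θ η q) (h₁ : g.IsPairing θ θ q₁)
    (h₂ : g.IsPairing η η q₂) : ∀ᵐ x ∂g.vol, q x ^ 2 ≤ q₁ x * q₂ x := by
  refine g.ae_vol_iff.2 fun i => ?_
  filter_upwards [h i, h₁ i, h₂ i,
    ae_restrict_mem (A.chart i).isModelSet_target.measurableSet] with z h1 h2 h3 hz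
  rw [h1, h2, h3]
  exact bil_cauchy_schwarz (g.posDef i z hz).inv _ _

end IsPairing

theorem measurable_coeff_inv (g : LRMetric A) (i : ι) (k l : Fin d) :
    Measurable fun z => (g.coeff i z)⁻¹ k l := by
  have hdet : ∀ N : Euc d → Matrix (Fin d) (Fin d) ℝ, (∀ k l, Measurable fun z => N z k l) →
      Measurable fun z => (N z).det := by
    intro N hN
    simp only [Matrix.det_apply]
    exact Finset.measurable_sum _ fun σ _ => (Finset.measurable_prod _ fun k _ =>
      hN _ _).const_smul _
  simp only [Matrix.inv_def, Matrix.smul_apply, Ring.inverse_eq_inv', smul_eq_mul]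
  refine ((hdet _ (g.measurable i)).inv).mul ?_
  simp only [Matrix.adjugate_apply]
  refine hdet _ fun k' l' => ?_
  by_cases hk : k' = l
  · subst hk
    simp only [Matrix.updateRow_self]; exact measurable_const
  · simp only [Matrix.updateRow_ne hk]; exact g.measurable i _ _

theorem measurable_bil_inv (g : LRMetric A) (i : ι) {X Y : Euc d → Euc d} (hX : Measurable X)
    (hY : Measurable Y) : Measurable fun z => bil (g.coeff i z)⁻¹ (X z) (Y z) := by
  simp only [bil, dotProduct, Matrix.mulVec]
  have h : ∀ k, Measurable fun v : Euc d => v.ofLp k := fun k => by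
    exact (EuclideanSpace.proj (𝕜 := ℝ) k).continuous.measurable
  exact Finset.measurable_sum _ fun k _ => ((h k).comp hX).mul
    (Finset.measurable_sum _ fun l _ => (measurable_coeff_inv g i k l).mul ((h l).comp hY))

theorem IsPairing.aemeasurable [Countable ι] {θ η : OneForm A} {q : M → ℝ}
    (h : g.IsPairing θ η q) : AEMeasurable q g.vol := by
  have hU : (⋃ i, (A.chart i).source) = univ := eq_univ_of_forall fun x =>
    mem_iUnion.2 (A.cover x)
  rw [← Measure.restrict_univ (μ := g.vol), ← hU, aemeasurable_iUnion_iff]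
  intro i
  have hs := (A.chart i).open_source.measurableSet
  have h1 := (measurable_bil_inv g i (θ.measurable i) (η.measurable i)).comp_aemeasurable
    ((A.chart i).continuousOn_toFun.aemeasurable (μ := g.vol) hs)
  refine h1.congr ?_
  have h2 : ∀ᵐ x ∂g.vol, x ∈ (A.chart i).source → q x = bil
      (g.coeff i ((A.chart i).toFun x))⁻¹ (θ.coeff i ((A.chart i).toFun x))
        (η.coeff i ((A.chart i).toFun x)) := by
    refine g.ae_vol_of_ae_chart (A.isChart_chart i) ?_
    filter_upwards [h i, ae_restrict_mem (A.chart i).isModelSet_target.measurableSet] with z h1 hz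
    rw [h1, to_inv hz]
  filter_upwards [(ae_restrict_iff' hs).2 h2] with x hx
  rw [hx]; rfl

/-- At each point the pairing is computed in some chosen chart. By invariance of the co-metric under
coordinate changes and countability of the atlas, the choice matters only on a null set. -/
theorem exists_isPairing [Countable ι] (g : LRMetric A) (θ η : OneForm A) :
    ∃ q, g.IsPairing θ η q := by
  choose I hI using A.cover
  refine ⟨fun x => bil (g.coeff (I x) ((A.chart (I x)).toFun x))⁻¹
    (θ.coeff (I x) ((A.chart (I x)).toFun x)) (η.coeff (I x) ((A.chart (I x)).toFun x)), fun i => ?_⟩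
  have h : ∀ᵐ z ∂(volume.restrict (A.chart i).target), ∀ j, z ∈ overlap (A.chart i) (A.chart j) →
      bil (g.coeff j (transition (A.chart i) (A.chart j) z))⁻¹
        (θ.coeff j (transition (A.chart i) (A.chart j) z))
        (η.coeff j (transition (A.chart i) (A.chart j) z)) =
      bil (g.coeff i z)⁻¹ (θ.coeff i z) (η.coeff i z) := by
    refine ae_all_iff.2 fun j => ae_restrict_of_ae ?_
    have h1 := (g.compat i j).and ((θ.compat i j).and (η.compat i j))
    rw [ae_restrict_iff' (isModelSet_overlap _ _).measurableSet] at h1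
    filter_upwards [h1] with z hz hzo
    obtain ⟨ha, hb, hc⟩ := hz hzo
    exact bil_inv_pullBack (g.posDef i z hzo.1) (g.posDef j _ (transition_mem hzo).1) ha hb hc
  filter_upwards [h, ae_restrict_mem (A.chart i).isModelSet_target.measurableSet] with z hz hzt
  exact hz _ ⟨hzt, hI _⟩

end LRMetric

end

end

section

variable {ι : Type v} {M : Type u} [TopologicalSpace M] {d : ℕ} [NeZero d]

open ModelChart

section

variable [MeasurableSpace M] [BorelSpace M] [Countable ι] {A : LipschitzAtlas ι M d}
  {g : LRMetric A}

/-! ### Differentials in compatible charts -/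

theorem isLocInt_of_memLp (g : LRMetric A) {f : M → ℝ} {p : ℝ≥0∞} (hp : 1 ≤ p)
    (hf : MemLp f p g.vol) : IsLocInt A f := fun i =>
  locallyIntegrableOn_of_locallyIntegrable_restrict ((g.memLp_comp_inv i hf).locallyIntegrable hp)

theorem isLocInt_sq_of_memLp (g : LRMetric A) {f : M → ℝ} (hf : MemLp f 2 g.vol) :
    IsLocInt A fun x => f x ^ 2 :=
  isLocInt_of_memLp g le_rfl (memLp_one_iff_integrable.2 hf.integrable_sq)

theorem iUnion_overlap (A : LipschitzAtlas ι M d) (c : ModelChart M d) :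
    ⋃ i, overlap c (A.chart i) = c.target := by
  ext z
  simp only [mem_iUnion]
  constructor
  · rintro ⟨i, hi⟩; exact hi.1
  · intro hz
    obtain ⟨i, hi⟩ := A.cover (c.invFun z)
    exact ⟨i, hz, hi⟩

theorem interior_target_subset (A : LipschitzAtlas ι M d) (c : ModelChart M d) :
    interior c.target ⊆ ⋃ i, interior (overlap c (A.chart i)) := by
  intro z hz
  obtain ⟨i, hi⟩ := A.cover (c.invFun z)
  refine mem_iUnion.2 ⟨i, mem_interior_iff_mem_nhds.2 ?_⟩
  have h1 : c.target ∈ 𝓝 z := mem_interior_iff_mem_nhds.1 hz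
  have h2 := (c.continuousOn_invFun.continuousAt h1) ((A.chart i).open_source.mem_nhds hi)
  exact inter_mem h1 h2

theorem ae_target_iff (A : LipschitzAtlas ι M d) (c : ModelChart M d) {P : Euc d → Prop} :
    (∀ᵐ z ∂(volume.restrict c.target), P z) ↔
      ∀ i, ∀ᵐ z ∂(volume.restrict (overlap c (A.chart i))), P z := by
  rw [← iUnion_overlap A c, ae_restrict_iUnion_iff]

/-- The components in a compatible chart of the differential of a function. -/
theorem IsDifferential.exists_chart {f : M → ℝ} {θ : OneForm A} (h : IsDifferential f θ)
    (hf : IsLocInt A f) {c : ModelChart M d} (hc : A.IsChart c) :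
    ∃ Θ : Euc d → Euc d, LocallyIntegrableOn Θ (interior c.target) ∧
      HasWeakGrad (fun z => f (c.invFun z)) Θ (interior c.target) ∧
      ∀ i, ∀ᵐ z ∂(volume.restrict (overlap c (A.chart i))), Θ z =
        ContinuousLinearMap.adjoint (fderiv ℝ (transition c (A.chart i)) z)
          (θ.coeff i (transition c (A.chart i) z)) := by
  have hm : ∀ i, MapsTo (transition c (A.chart i)) (interior (overlap c (A.chart i)))
      (A.chart i).target := fun i z hz => (transition_mem (interior_subset hz)).1
  have hbi := fun i => (hc.compatible i).isLocallyBiLipschitz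
  have he : ∀ i, ∀ z ∈ interior (overlap c (A.chart i)),
      f ((A.chart i).invFun (transition c (A.chart i) z)) = f (c.invFun z) := fun i z hz => by
    rw [inv_transition (interior_subset hz)]
  -- The chart `c` need not belong to the atlas: the differential is transported from each atlas
  -- chart to the interior of the overlap, and these local weak gradients are glued.
  obtain ⟨Θ, h1, h2, h3⟩ := exists_glued_weakGrad (f := fun z => f (c.invFun z))
    (V := fun i => interior (overlap c (A.chart i)))
    (θ := fun i z => ContinuousLinearMap.adjoint (fderiv ℝ (transition c (A.chart i)) z)
          (θ.coeff i (transition c (A.chart i) z))) (fun i => isOpen_interior)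
    (fun i => LocallyIntegrableOn.congr_set isOpen_interior.measurableSet
      ((hbi i).locallyIntegrableOn_comp (hm i) (hf i)) (he i))
    (fun i => (hbi i).locallyIntegrableOn_adjoint (hm i) (h.locallyIntegrableOn i))
    (fun i => ((hbi i).hasWeakGrad_comp (hm i) (A.chart i).isModelSet_target (hf i)
      (h.locallyIntegrableOn i) (h.hasWeakGrad i)).congr_ae
        (Eventually.of_forall (he i)) (Eventually.of_forall fun _ _ => rfl))
  have hsub := interior_target_subset A c
  refine ⟨Θ, h1.mono_set hsub, h2.mono hsub, fun i => ?_⟩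
  filter_upwards [ae_restrict_of_ae h3, ae_mem_interior_overlap c (A.chart i)] with z hz hzi
  exact hz i hzi

/-- With `P` the derivative of the transition map, `Θ` is the pull-back of the covector of `θ` by
`P`. Ellipticity between `b⁻¹` and `b` passes to the dual norms with the same constant. -/
theorem norm_sq_bounds {θ : OneForm A} {q : M → ℝ} (hp : g.IsPairing θ θ q) {c : ModelChart M d}
    (hc : A.IsChart c) {b : ℝ} (hb : 0 < b) {S : Set M} (hq : g.IsQuasiEuclideanOn c b S)
    {Θ : Euc d → Euc d} (hΘ : ∀ i, ∀ᵐ z ∂(volume.restrict (overlap c (A.chart i))), Θ z =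
        ContinuousLinearMap.adjoint (fderiv ℝ (transition c (A.chart i)) z)
          (θ.coeff i (transition c (A.chart i) z))) :
    ∀ᵐ z ∂(volume.restrict c.target), c.invFun z ∈ S →
      ‖Θ z‖ ^ 2 ≤ b * q (c.invFun z) ∧ q (c.invFun z) ≤ b * ‖Θ z‖ ^ 2 := by
  rw [ae_target_iff A c]
  intro i
  have h1 : ∀ᵐ y ∂(volume.restrict (overlap (A.chart i) c)), q ((A.chart i).invFun y) =
      bil (g.coeff i y)⁻¹ (θ.coeff i y) (θ.coeff i y) :=
    ae_mono (Measure.restrict_mono inter_subset_left le_rfl) (hp i)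
  filter_upwards [(hc.compatible i).ae_transition h1, hq i, hΘ i,
    ae_restrict_mem (isModelSet_overlap _ _).measurableSet] with z hz hzq hzΘ hzo hzS
  rw [inv_transition hzo] at hz
  have hzq := hzq hzS
  set P := fderiv ℝ (transition c (A.chart i)) z
  set G := g.coeff i (transition c (A.chart i) z)
  set ϑ := θ.coeff i (transition c (A.chart i) z)
  have hG : G.PosDef := g.posDef i _ (transition_mem hzo).1
  have hin : ∀ ξ, (inner ℝ (Θ z) ξ : ℝ) = inner ℝ ϑ (P ξ) := fun ξ => by
    rw [hzΘ, ContinuousLinearMap.adjoint_inner_left]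
  rw [hz]
  constructor
  -- Duality is tested on the vector `P (Θ z)`, whose pairing with the covector is `‖Θ z‖²`.
  · have h2 := inner_sq_le_bil_inv hG ϑ (P (Θ z))
    rw [← hin, real_inner_self_eq_norm_sq] at h2
    have h3 := (hzq (Θ z)).2
    have h4 := mul_le_mul_of_nonneg_left h3 (bil_inv_nonneg hG ϑ)
    by_cases h0 : ‖Θ z‖ = 0
    · rw [h0]
      have := bil_inv_nonneg hG ϑ
      nlinarith [mul_nonneg hb.le this]
    · have h5 : 0 < ‖Θ z‖ ^ 2 := by positivity
      nlinarith
  · have hinj : Function.Injective P := by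
      rw [injective_iff_map_eq_zero]
      intro ξ hξ
      have h6 := (hzq ξ).1
      rw [hξ] at h6
      have h7 : bil G (0 : Euc d) 0 = 0 := by simp [bil]
      rw [h7] at h6
      by_contra h8
      have : 0 < ‖ξ‖ := norm_pos_iff.2 h8
      have : 0 < b⁻¹ * ‖ξ‖ ^ 2 := by positivity
      linarith
    have hsurj : Function.Surjective P :=
      LinearMap.surjective_of_injective (f := (P : Euc d →ₗ[ℝ] Euc d)) hinj
    refine bil_inv_le_of_inner_sq_le hG (by positivity) fun ξ' => ?_
    obtain ⟨ξ, rfl⟩ := hsurj ξ'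
    rw [← hin]
    have h8 := (hzq ξ).1
    have h9 := abs_real_inner_le_norm (Θ z) ξ
    have h10 : (inner ℝ (Θ z) ξ : ℝ) ^ 2 ≤ ‖Θ z‖ ^ 2 * ‖ξ‖ ^ 2 := by
      rw [← sq_abs, ← mul_pow]; gcongr
    refine h10.trans ?_
    rw [inv_mul_le_iff₀ hb] at h8
    calc ‖Θ z‖ ^ 2 * ‖ξ‖ ^ 2 ≤ ‖Θ z‖ ^ 2 * (b * bil G (P ξ) (P ξ)) := by gcongr
      _ = _ := by ring

/-! ### Cut-off functions -/

/-- The function given by `φ` in the chart `c`, extended by zero. -/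
def ModelChart.extend (c : ModelChart M d) (φ : Euc d → ℝ) : M → ℝ :=
  c.source.indicator fun x => φ (c.toFun x)

theorem ModelChart.extend_inv {c : ModelChart M d} {φ : Euc d → ℝ} {z : Euc d}
    (hz : z ∈ c.target) : c.extend φ (c.invFun z) = φ z := by
  rw [extend, indicator_of_mem (inv_mem hz), to_inv hz]

theorem ModelChart.measurable_extend {c : ModelChart M d} {φ : Euc d → ℝ} (hφ : Continuous φ) :
    Measurable (c.extend φ) := by
  classical
  have h := ContinuousOn.measurable_piecewise (f := fun x => φ (c.toFun x))
    (g := (0 : M → ℝ)) (hφ.comp_continuousOn c.continuousOn_toFun) continuousOn_const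
    c.open_source.measurableSet
  rwa [piecewise_eq_indicator] at h

variable [T2Space M] {c : ModelChart M d} {k : Set (Euc d)}

theorem ModelChart.isClosed_image_inv (hk : IsCompact k) (hkc : k ⊆ c.target) :
    IsClosed (c.invFun '' k) :=
  (hk.image_of_continuousOn (c.continuousOn_invFun.mono hkc)).isClosed

theorem ModelChart.extend_eq_zero {φ : Euc d → ℝ} (hφ0 : ∀ z ∈ c.target, z ∉ k → φ z = 0) {x : M}
    (hx : x ∉ c.invFun '' k) : c.extend φ x = 0 := by
  rw [extend, indicator_apply_eq_zero]
  intro hxs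
  exact hφ0 _ (to_mem hxs) fun h => hx ⟨_, h, inv_to hxs⟩

/-- The image of the compact set `k` is closed since `M` is Hausdorff. Hence the extension vanishes
near every point outside the domain of `c`, and inside it the Lipschitz compatibility of `c`
applies. -/
theorem isLocLip_extend (hc : A.IsChart c) (hk : IsCompact k) (hkc : k ⊆ c.target) {φ : Euc d → ℝ}
    {K : ℝ≥0} (hφ : LipschitzWith K φ) (hφ0 : ∀ z ∈ c.target, z ∉ k → φ z = 0) :
    IsLocLip A (c.extend φ) := by
  intro i z hz
  have hcz : ContinuousWithinAt (A.chart i).invFun (A.chart i).target z :=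
    (A.chart i).continuousOn_invFun z hz
  by_cases hs : (A.chart i).invFun z ∈ c.source
  · have hov : overlap (A.chart i) c ∈ 𝓝[(A.chart i).target] z :=
      inter_mem self_mem_nhdsWithin (hcz (c.open_source.mem_nhds hs))
    obtain ⟨K', t, ht, hK'⟩ := (hc i).2 ⟨hz, hs⟩
    have ht' : t ∈ 𝓝[(A.chart i).target] z := by
      refine nhdsWithin_le_of_mem hov ht
    refine ⟨K * K', t ∩ overlap (A.chart i) c, inter_mem ht' hov, ?_⟩
    intro x hx y hy
    have h1 : ∀ w ∈ overlap (A.chart i) c, c.extend φ ((A.chart i).invFun w) =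
        φ (transition (A.chart i) c w) := fun w hw => by
      rw [ModelChart.extend, indicator_of_mem (inv_mem_source_of_overlap hw)]; rfl
    simp only [h1 x hx.2, h1 y hy.2]
    have := (hφ.comp_lipschitzOnWith hK') hx.1 hy.1
    exact this
  · have hcl := isClosed_image_inv hk hkc
    have hn : (A.chart i).invFun z ∈ (c.invFun '' k)ᶜ := by
      rintro ⟨w, hw, hwz⟩
      exact hs (hwz ▸ inv_mem (hkc hw))
    refine ⟨0, _, hcz (hcl.isOpen_compl.mem_nhds hn), ?_⟩
    intro x hx y hy
    simp only [extend_eq_zero hφ0 hx, extend_eq_zero hφ0 hy, edist_self]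
    exact zero_le

/-- Off the closed image of `k` the function vanishes locally, so its differential is zero there. On
it, the differential is the gradient of `φ` in the chart `c`, of norm at most `K`, and the co-metric
costs a factor `b`. -/
theorem ae_pairing_extend_le (hc : A.IsChart c) (hk : IsCompact k) (hkc : k ⊆ c.target)
    {φ : Euc d → ℝ} {K : ℝ≥0} (hφ : LipschitzWith K φ) (hφ0 : ∀ z ∈ c.target, z ∉ k → φ z = 0)
    {b : ℝ} (hb : 0 < b) (hq : g.IsQuasiEuclideanOn c b (c.invFun '' k)) {N : M → ℝ}
    (hN : g.IsPairing (isLocLip_extend hc hk hkc hφ hφ0).diff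
      (isLocLip_extend hc hk hkc hφ hφ0).diff N) :
    ∀ᵐ x ∂g.vol, N x ≤ (c.invFun '' k).indicator (fun _ => b * (K : ℝ) ^ 2) x := by
  set hη := isLocLip_extend hc hk hkc hφ hφ0
  have hcl := isClosed_image_inv hk hkc
  have hout : ∀ᵐ x ∂g.vol, x ∉ c.invFun '' k → N x = 0 := by
    refine g.ae_vol_iff.2 fun i => ?_
    have h0 := ae_mem_interior_of_isModelSet (A.chart i).isModelSet_target
    rw [← ae_restrict_iff' (A.chart i).isModelSet_target.measurableSet] at h0
    filter_upwards [hN i, h0] with z hz hzi hzk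
    have h1 : (A.chart i).target ∈ 𝓝 z := mem_interior_iff_mem_nhds.1 hzi
    have h2 : (fun w => c.extend φ ((A.chart i).invFun w)) =ᶠ[𝓝 z] fun _ => 0 := by
      have := ((A.chart i).continuousOn_invFun.continuousAt h1) (hcl.isOpen_compl.mem_nhds hzk)
      filter_upwards [this] with w hw
      exact extend_eq_zero hφ0 hw
    have h3 : hη.diff.coeff i z = 0 := by
      change gradient _ z = 0
      rw [← norm_eq_zero, norm_gradient, h2.fderiv_eq]
      simp
    rw [hz, h3]
    simp [bil]
  have hin : ∀ᵐ x ∂g.vol, x ∈ c.source → x ∈ c.invFun '' k → N x ≤ b * (K : ℝ) ^ 2 := by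
    obtain ⟨Θ, h1, h2, h3⟩ := hη.isDifferential.exists_chart
      (fun i => (hη i).continuousOn.locallyIntegrableOn
        (A.chart i).isModelSet_target.measurableSet) hc
    refine g.ae_vol_of_ae_chart hc ?_
    have h4 : HasWeakGrad (fun z => c.extend φ (c.invFun z)) (gradient φ) (interior c.target) :=
      (HasWeakGrad.of_locallyLipschitz c.isModelSet_target
        (hφ.locallyLipschitz.locallyLipschitzOn)).congr_ae
        (Eventually.of_forall fun z hz => (extend_inv (interior_subset hz)).symm)
        (Eventually.of_forall fun z _ => rfl)
    have hint : LocallyIntegrableOn (gradient φ) (interior c.target) := by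
      refine LocallyIntegrableOn.of_le isOpen_interior.measurableSet (f := fun _ => (K : ℝ))
        ((locallyIntegrable_const _).locallyIntegrableOn _)
        (measurable_gradient φ).aestronglyMeasurable fun z _ => ?_
      rw [Real.norm_of_nonneg K.coe_nonneg]
      exact norm_gradient_le hφ.lipschitzOnWith univ_mem
    have h5 := HasWeakGrad.unique isOpen_interior h1 hint h2 h4
    have h0 := ae_mem_interior_of_isModelSet c.isModelSet_target
    rw [← ae_restrict_iff' c.isModelSet_target.measurableSet] at h0
    filter_upwards [norm_sq_bounds hN hc hb hq h3, ae_restrict_of_ae h5, h0] with z hz hz5 hzi hzk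
    refine (hz hzk).2.trans ?_
    rw [hz5 hzi]
    have : ‖gradient φ z‖ ≤ K := norm_gradient_le hφ.lipschitzOnWith univ_mem
    gcongr
  filter_upwards [hout, hin] with x h1 h2
  by_cases hx : x ∈ c.invFun '' k
  · rw [indicator_of_mem hx]
    refine h2 ?_ hx
    obtain ⟨z, hz, rfl⟩ := hx
    exact inv_mem (hkc hz)
  · rw [indicator_of_notMem hx, h1 hx]

/-! ### The super-Poincaré inequality in a quasi-Euclidean chart -/

/-- The inequality on the model space is applied to the chart expression extended by zero. Each
comparison of an integral on `M` with one in the chart costs `√(b ^ d)`: one on the left, one for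
the energy, and one for the mean, which is then squared. The co-metric contributes the further
factor `b`. -/
theorem superPoincare_chart (hc : A.IsChart c) (hk : IsCompact k) (hkc : k ⊆ c.target)
    {b : ℝ} (hb : 1 ≤ b) (hq : g.IsQuasiEuclideanOn c b (c.invFun '' k)) {f : M → ℝ}
    (hf : MemLp f 2 g.vol) (hf0 : ∀ x ∉ c.invFun '' k, f x = 0) {θ : OneForm A}
    (hd : IsDifferential f θ) {q : M → ℝ} (hp : g.IsPairing θ θ q) (hqi : Integrable q g.vol)
    {ε : ℝ} (hε : 0 < ε) :
    ∫⁻ x, ‖f x‖ₑ ^ 2 ∂g.vol ≤ ENNReal.ofReal (Real.sqrt (b ^ d)) *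
      (ENNReal.ofReal (4 * ε ^ 2) * (ENNReal.ofReal b * (ENNReal.ofReal (Real.sqrt (b ^ d)) *
        ∫⁻ x, ‖q x‖ₑ ∂g.vol)) + 2 * (unitVolume d)⁻¹ * ENNReal.ofReal ((ε ^ d)⁻¹) *
        (ENNReal.ofReal (Real.sqrt (b ^ d)) * ∫⁻ x, ‖f x‖ₑ ∂g.vol) ^ 2) := by
  have hb0 : 0 < b := by linarith
  set B := ENNReal.ofReal (Real.sqrt (b ^ d))
  have hkm : MeasurableSet k := hk.measurableSet
  have hcl := isClosed_image_inv hk hkc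
  obtain ⟨Θ, h1, h2, h3⟩ := hd.exists_chart (isLocInt_of_memLp g (by norm_num) hf) hc
  have hle := g.map_inv_le_vol hc hb hkm hkc hq
  have hge := g.vol_le_map_inv hc hb hkm hkc hq
  have haem : AEMeasurable c.invFun (volume.restrict k) :=
    (c.continuousOn_invFun.mono hkc).aemeasurable hkm
  -- comparison of integrals
  have hcomp : ∀ F : M → ℝ≥0∞, AEMeasurable F g.vol →
      ∫⁻ z in k, F (c.invFun z) ≤ B * ∫⁻ x, F x ∂g.vol := by
    intro F hF
    have hF' : AEMeasurable F (Measure.map c.invFun (volume.restrict k)) :=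
      (hF.restrict.smul_measure _).mono_measure hle
    rw [← lintegral_map' hF' haem]
    calc _ ≤ ∫⁻ x, F x ∂(B • g.vol.restrict (c.invFun '' k)) := lintegral_mono' hle le_rfl
      _ = B * ∫⁻ x in c.invFun '' k, F x ∂g.vol := by rw [lintegral_smul_measure, smul_eq_mul]
      _ ≤ _ := by gcongr; exact Measure.restrict_le_self
  have hcomp' : ∀ F : M → ℝ≥0∞, AEMeasurable F g.vol → (∀ x ∉ c.invFun '' k, F x = 0) →
      ∫⁻ x, F x ∂g.vol ≤ B * ∫⁻ z in k, F (c.invFun z) := by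
    intro F hF h0
    have hF' : AEMeasurable F (Measure.map c.invFun (volume.restrict k)) :=
      (hF.restrict.smul_measure _).mono_measure hle
    rw [← lintegral_map' hF' haem]
    calc _ = ∫⁻ x in c.invFun '' k, F x ∂g.vol := by
          rw [← lintegral_indicator hcl.measurableSet]
          refine lintegral_congr fun x => ?_
          by_cases hx : x ∈ c.invFun '' k
          · rw [indicator_of_mem hx]
          · rw [indicator_of_notMem hx, h0 x hx]
      _ ≤ ∫⁻ x, F x ∂(B • Measure.map c.invFun (volume.restrict k)) := lintegral_mono' hge le_rfl
      _ = _ := by rw [lintegral_smul_measure, smul_eq_mul]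
  have hT := c.isModelSet_target
  obtain ⟨H, hH, hTH, hHi, δ, hδ, hδT⟩ := hT.exists_cthickening hk hkc
  set W : Euc d → ℝ := k.indicator fun z => f (c.invFun z)
  set Ψ : Euc d → Euc d := k.indicator Θ
  have hWz : ∀ z ∈ c.target, z ∉ k → f (c.invFun z) = 0 := by
    intro z hz hzk
    refine hf0 _ ?_
    rintro ⟨w, hw, hwz⟩
    refine hzk ?_
    rw [← to_inv hz, ← hwz, to_inv (hkc hw)]
    exact hw
  have hkfin : IsFiniteMeasure (volume.restrict k : Measure (Euc d)) :=
    ⟨by rw [Measure.restrict_apply_univ]; exact hk.measure_lt_top⟩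
  have hWk : IntegrableOn (fun z => f (c.invFun z)) k := by
    have h4 : MemLp f 2 (Measure.map c.invFun (volume.restrict k)) :=
      (hf.restrict _).of_measure_le_smul ENNReal.ofReal_ne_top hle
    exact (h4.comp_of_map haem).integrable (by norm_num)
  have hkH : k ⊆ H := hkc.trans hTH
  have hint : ∀ᵐ z, z ∈ k → z ∈ interior c.target := by
    filter_upwards [ae_mem_interior_of_isModelSet hT] with z hz hzk using hz (hkc hzk)
  have hrest : (volume.restrict k : Measure (Euc d)) ≤ volume.restrict (interior c.target) := by
    rw [hT.restrict_interior]
    exact Measure.restrict_mono hkc le_rfl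
  have hbd : ∀ᵐ z ∂(volume.restrict k), ‖Θ z‖ ^ 2 ≤ b * q (c.invFun z) := by
    have h4 := ae_mono (Measure.restrict_mono hkc le_rfl) (norm_sq_bounds hp hc hb0 hq h3)
    filter_upwards [h4, ae_restrict_mem hkm] with z hz hzk
    exact (hz ⟨z, hzk, rfl⟩).1
  have hqk : IntegrableOn (fun z => q (c.invFun z)) k := by
    have h4 : Integrable q (Measure.map c.invFun (volume.restrict k)) :=
      hqi.restrict.of_measure_le_smul ENNReal.ofReal_ne_top hle
    exact h4.comp_aemeasurable haem
  have hΘm : AEStronglyMeasurable Θ (volume.restrict k) :=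
    h1.aestronglyMeasurable.mono_measure hrest
  have hΘk : IntegrableOn Θ k := by
    have h5 : IntegrableOn (fun z => 1 + b * q (c.invFun z)) k :=
      (integrable_const _).add (hqk.const_mul b)
    refine Integrable.mono' h5 hΘm ?_
    filter_upwards [hbd] with z hz
    nlinarith [sq_nonneg (‖Θ z‖ - 1), norm_nonneg (Θ z)]
  have hWi : Integrable W := by rwa [integrable_indicator_iff hkm]
  have hΨi : Integrable Ψ := by rwa [integrable_indicator_iff hkm]
  -- Where the function vanishes on an open set its weak gradient vanishes too, so `Θ` can be cut
  -- off to `k` as well.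
  have hΘ0 : ∀ᵐ z, z ∈ interior c.target \ k → Θ z = 0 := by
    have hop : IsOpen (interior c.target \ k) := isOpen_interior.sdiff hk.isClosed
    refine HasWeakGrad.unique hop (h1.mono_set sdiff_subset)
      ((locallyIntegrable_const _).locallyIntegrableOn _) (h2.mono sdiff_subset) ?_
    exact (HasWeakGrad.const 0).congr_ae (Eventually.of_forall fun z hz =>
      (hWz z (interior_subset hz.1) hz.2).symm) (Eventually.of_forall fun _ _ => rfl)
  -- Near `k` the model space lies in the chart image, and away from `k` everything is zero. These
  -- two kinds of open sets cover the interior of `H`.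
  have hw : HasWeakGrad W Ψ (interior H) := by
    refine HasWeakGrad.of_locally (hWi.locallyIntegrable.locallyIntegrableOn _)
      (hΨi.locallyIntegrable.locallyIntegrableOn _) fun z hz => ?_
    by_cases hzk : z ∈ k
    · refine ⟨Metric.thickening δ k ∩ interior H, Metric.isOpen_thickening.inter isOpen_interior,
        ⟨Metric.self_subset_thickening hδ k hzk, hz⟩, ?_⟩
      have hsub : Metric.thickening δ k ∩ interior H ⊆ interior c.target := fun w hw =>
        hHi ⟨hw.2, hδT ⟨Metric.thickening_subset_cthickening _ _ hw.1, interior_subset hw.2⟩⟩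
      refine (h2.mono hsub).congr_ae (Eventually.of_forall fun w hw => ?_) ?_
      · by_cases hwk : w ∈ k
        · simp only [W, indicator_of_mem hwk]
        · simp only [W, indicator_of_notMem hwk]
          exact hWz w (interior_subset (hsub hw)) hwk
      · filter_upwards [hΘ0] with w hw hwV
        by_cases hwk : w ∈ k
        · simp only [Ψ, indicator_of_mem hwk]
        · simp only [Ψ, indicator_of_notMem hwk]
          exact hw ⟨hsub hwV, hwk⟩
    · refine ⟨interior H \ k, isOpen_interior.sdiff hk.isClosed, ⟨hz, hzk⟩, ?_⟩
      exact (HasWeakGrad.const 0).congr_ae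
        (Eventually.of_forall fun w hw => (indicator_of_notMem hw.2 _).symm)
        (Eventually.of_forall fun w hw => (indicator_of_notMem hw.2 _).symm)
  have hSP := superPoincare hH hWi.integrableOn hΨi.integrableOn hw hε
  have hnorm : ∀ (F : Euc d → ℝ≥0∞) (G : Euc d → ℝ≥0∞), (∀ z ∈ k, F z = G z) →
      (∀ z ∉ k, F z = 0) → ∫⁻ z in H, F z = ∫⁻ z in k, G z := by
    intro F G h4 h5
    have h6 : F = k.indicator G := by
      funext z
      by_cases hz : z ∈ k
      · rw [indicator_of_mem hz, h4 z hz]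
      · rw [indicator_of_notMem hz, h5 z hz]
    rw [h6, lintegral_indicator hkm, Measure.restrict_restrict hkm, inter_eq_left.2 hkH]
  have hfm := hf.1.aemeasurable
  rw [hnorm (fun z => ‖W z‖ₑ ^ 2) (fun z => ‖f (c.invFun z)‖ₑ ^ 2)
      (fun z hz => by simp only [W, indicator_of_mem hz])
      (fun z hz => by simp [W, indicator_of_notMem hz]),
    hnorm (fun z => ‖Ψ z‖ₑ ^ 2) (fun z => ‖Θ z‖ₑ ^ 2)
      (fun z hz => by simp only [Ψ, indicator_of_mem hz])
      (fun z hz => by simp [Ψ, indicator_of_notMem hz]),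
    hnorm (fun z => ‖W z‖ₑ) (fun z => ‖f (c.invFun z)‖ₑ)
      (fun z hz => by simp only [W, indicator_of_mem hz])
      (fun z hz => by simp [W, indicator_of_notMem hz])] at hSP
  have hΘq : ∫⁻ z in k, ‖Θ z‖ₑ ^ 2 ≤ ENNReal.ofReal b * (B * ∫⁻ x, ‖q x‖ₑ ∂g.vol) := by
    calc ∫⁻ z in k, ‖Θ z‖ₑ ^ 2 ≤ ∫⁻ z in k, ENNReal.ofReal b * ‖q (c.invFun z)‖ₑ := by
          refine lintegral_mono_ae ?_
          filter_upwards [hbd] with z hz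
          have hq0 : 0 ≤ q (c.invFun z) := by
            by_contra! h
            nlinarith [sq_nonneg ‖Θ z‖]
          rw [Real.enorm_of_nonneg hq0, ← ofReal_norm, ← ENNReal.ofReal_pow (norm_nonneg _),
            ← ENNReal.ofReal_mul hb0.le]
          exact ENNReal.ofReal_le_ofReal hz
      _ = ENNReal.ofReal b * ∫⁻ z in k, ‖q (c.invFun z)‖ₑ :=
          lintegral_const_mul' _ _ ENNReal.ofReal_ne_top
      _ ≤ _ := by
          gcongr
          exact hcomp (fun x => ‖q x‖ₑ) hqi.1.aemeasurable.enorm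
  have hf1 := hcomp (fun x => ‖f x‖ₑ) hfm.enorm
  refine (hcomp' (fun x => ‖f x‖ₑ ^ 2) (hfm.enorm.pow_const 2) fun x hx => by
    simp [hf0 x hx]).trans ?_
  gcongr
  refine hSP.trans ?_
  gcongr

end

end

section

variable {ι : Type v} {M : Type u} [TopologicalSpace M] {d : ℕ} [NeZero d]

/-! ### Primitives of continuous functions -/

/-- The primitive of `k` that vanishes at `0`. -/
def primitive (k : ℝ → ℝ) (s : ℝ) : ℝ := ∫ r in (0 : ℝ)..s, k r

section

variable {k : ℝ → ℝ}

@[simp] theorem primitive_zero : primitive k 0 = 0 := by simp [primitive]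

theorem hasDerivAt_primitive (hk : Continuous k) (s : ℝ) : HasDerivAt (primitive k) (k s) s :=
  intervalIntegral.integral_hasDerivAt_right (hk.intervalIntegrable _ _)
    hk.stronglyMeasurable.stronglyMeasurableAtFilter hk.continuousAt

theorem continuous_primitive (hk : Continuous k) : Continuous (primitive k) :=
  continuous_iff_continuousAt.2 fun s => (hasDerivAt_primitive hk s).continuousAt

theorem lipschitzWith_primitive (hk : Continuous k) {K : ℝ≥0} (h : ∀ s, |k s| ≤ K) :
    LipschitzWith K (primitive k) := by
  refine lipschitzWith_of_nnnorm_deriv_le (fun s => (hasDerivAt_primitive hk s).differentiableAt)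
    fun s => ?_
  rw [(hasDerivAt_primitive hk s).deriv]
  exact h s

theorem primitive_sub (hk : Continuous k) (a b : ℝ) :
    primitive k b - primitive k a = ∫ r in a..b, k r :=
  intervalIntegral.integral_interval_sub_left (hk.intervalIntegrable _ _)
    (hk.intervalIntegrable _ _)

theorem primitive_lt (hk : Continuous k) {a b : ℝ} (hab : a < b) (h : ∀ r, a < r → 0 < k r) :
    primitive k a < primitive k b := by
  have := intervalIntegral.intervalIntegral_pos_of_pos_on (hk.intervalIntegrable a b)
    (fun r hr => h r hr.1) hab
  rw [← primitive_sub hk] at this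
  linarith

theorem primitive_eq_zero {L : ℝ} (hL : 0 ≤ L) (h : ∀ r ≤ L, k r = 0) {s : ℝ} (hs : s ≤ L) :
    primitive k s = 0 := by
  have : EqOn k (fun _ => 0) (uIcc 0 s) := fun r hr => h r (hr.2.trans (max_le hL hs))
  rw [primitive, intervalIntegral.integral_congr this]
  simp

end

/-- A Taylor estimate. -/
theorem abs_sub_sub_mul_le {Φ ψ : ℝ → ℝ} {K : ℝ≥0} (hΦ : ∀ s, HasDerivAt Φ (ψ s) s)
    (hψ : LipschitzWith K ψ) (a b : ℝ) : |Φ b - Φ a - ψ a * (b - a)| ≤ K * (b - a) ^ 2 := by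
  have h := Convex.norm_image_sub_le_of_norm_hasDerivWithin_le (f := fun s => Φ s - ψ a * s)
    (f' := fun s => ψ s - ψ a) (C := K * |b - a|) (s := uIcc a b) (x := a) (y := b)
    (fun s _ => ((hΦ s).sub ((hasDerivAt_id s).const_mul (ψ a) |>.congr_deriv
      (by simp))).hasDerivWithinAt) (fun s hs => ?_) (convex_uIcc a b) left_mem_uIcc right_mem_uIcc
  · rw [Real.norm_eq_abs, Real.norm_eq_abs, mul_assoc, abs_mul_abs_self] at h
    rw [sq]
    convert h using 2
    ring
  · have h1 := hψ.dist_le_mul s a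
    rw [Real.dist_eq, Real.dist_eq] at h1
    refine h1.trans ?_
    have h2 : |s - a| ≤ |b - a| := abs_sub_left_of_mem_uIcc hs
    gcongr

section

variable [MeasurableSpace M] [BorelSpace M] [Countable ι] {A : LipschitzAtlas ι M d}
  {g : LRMetric A}

theorem IsDifferential.congr_ae {f f' : M → ℝ} {θ : OneForm A} (h : IsDifferential f θ)
    (he : f =ᵐ[g.vol] f') : IsDifferential f' θ := by
  rw [isDifferential_iff] at h ⊢
  intro i
  refine ⟨(h i).1, (h i).2.congr_ae ?_ (Eventually.of_forall fun _ _ => rfl)⟩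
  have := g.ae_vol_iff.1 he i
  rw [ae_restrict_iff' (A.chart i).isModelSet_target.measurableSet] at this
  filter_upwards [this] with z hz hzi using hz (interior_subset hzi)

namespace LRMetric

theorem integral_mul_eq_inner (f h : Lp ℝ 2 g.vol) : ∫ x, f x * h x ∂g.vol = inner ℝ f h := by
  rw [L2.inner_def]
  refine integral_congr_ae (Eventually.of_forall fun x => ?_)
  simp [mul_comm]

theorem memW12_toLp {F : M → ℝ} (hF : MemLp F 2 g.vol) {Θ : OneForm A}
    (hd : IsDifferential F Θ) {q : M → ℝ} (hp : g.IsPairing Θ Θ q) (hq : Integrable q g.vol) :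
    g.MemW12 hF.toLp :=
  ⟨Θ, hd.congr_ae (MemLp.coeFn_toLp hF).symm, q, hp, hq⟩

/-- The weak form of the equation `v = (Δ/2) f`. -/
theorem IsHalfLaplacian.integral_mul_eq {f v : Lp ℝ 2 g.vol} (h : g.IsHalfLaplacian f v)
    {F : M → ℝ} (hF : MemLp F 2 g.vol) {Θ : OneForm A} (hd : IsDifferential F Θ) {q₂ : M → ℝ}
    (hp : g.IsPairing Θ Θ q₂) (hq₂ : Integrable q₂ g.vol) {θ : OneForm A}
    (hθ : IsDifferential f θ) {q : M → ℝ} (hq : g.IsPairing θ Θ q) :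
    Integrable q g.vol ∧ ∫ x, v x * F x ∂g.vol = -(1 / 2 * ∫ x, q x ∂g.vol) := by
  obtain ⟨-, -, θ', η', hθ', hη', q', hq', hqi', he⟩ := h.2 _ (memW12_toLp hF hd hp hq₂)
  have h1 : g.IsPairing θ Θ q' := hq'.congr_forms (fun i => hθ'.unique hθ i)
    (fun i => (hη'.congr_ae (MemLp.coeFn_toLp hF)).unique hd i)
  have h2 := h1.ae_eq hq
  refine ⟨hqi'.congr h2, ?_⟩
  rw [← integral_congr_ae h2, ← he, neg_neg, ← integral_mul_eq_inner]
  refine integral_congr_ae ?_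
  filter_upwards [MemLp.coeFn_toLp hF] with x hx
  rw [hx]

theorem memLp_comp {f : M → ℝ} (hf : MemLp f 2 g.vol) (hfm : Measurable f) {G : ℝ → ℝ} {K : ℝ≥0}
    (hG : LipschitzWith K G) (h0 : G 0 = 0) : MemLp (fun x => G (f x)) 2 g.vol := by
  refine MemLp.of_le_mul (c := K) hf (hG.continuous.measurable.comp hfm).aestronglyMeasurable
    (Eventually.of_forall fun x => ?_)
  have := hG.dist_le_mul (f x) 0
  rwa [h0, dist_zero_right, dist_zero_right] at this

theorem measurable_coe (f : Lp ℝ 2 g.vol) : Measurable f := (Lp.stronglyMeasurable f).measurable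

/-- Testing with functions of the solution. -/
theorem IsHalfLaplacian.integral_mul_comp {f v : Lp ℝ 2 g.vol} (h : g.IsHalfLaplacian f v)
    {θ : OneForm A} (hθ : IsDifferential f θ) {q : M → ℝ} (hq : g.IsPairing θ θ q)
    (hqi : Integrable q g.vol) {ψ k : ℝ → ℝ} (hψ : ∀ s, HasDerivAt ψ (k s) s) (hk : Continuous k)
    {K : ℝ≥0} (hK : ∀ s, |k s| ≤ K) (h0 : ψ 0 = 0) :
    ∫ x, v x * ψ (f x) ∂g.vol = -(1 / 2 * ∫ x, k (f x) * q x ∂g.vol) := by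
  have hfm := measurable_coe f
  have hL : LipschitzWith K ψ := lipschitzWith_of_nnnorm_deriv_le
    (fun s => (hψ s).differentiableAt) fun s => by rw [(hψ s).deriv]; exact hK s
  have hf2 : MemLp f 2 g.vol := Lp.memLp f
  have hd := hθ.comp (isLocInt_of_memLp g (by norm_num) hf2) hfm hψ hk hK
  have hkm : Measurable fun x => k (f x) := hk.measurable.comp hfm
  have hp1 := hq.smul_right hkm
  have hp2 := hp1.smul_left hkm
  refine (h.integral_mul_eq (memLp_comp hf2 hfm hL h0) hd hp2 ?_ hθ hp1).2
  refine (hqi.bdd_mul (c := K) hkm.aestronglyMeasurable (Eventually.of_forall fun x => hK _)).bdd_mul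
    (c := K) hkm.aestronglyMeasurable (Eventually.of_forall fun x => hK _)

/-! ### Evolution of integral functionals -/

section Functional

variable {χ : M → ℝ} {C : ℝ} {Φ ψ : ℝ → ℝ} {K : ℝ≥0}

theorem integrable_functional (hχ : Measurable χ) (hC : ∀ x, |χ x| ≤ C)
    (hΦ : ∀ s, HasDerivAt Φ (ψ s) s) (hψ : LipschitzWith K ψ) (h0 : Φ 0 = 0) (h0' : ψ 0 = 0)
    (f : Lp ℝ 2 g.vol) : Integrable (fun x => χ x * Φ (f x)) g.vol := by
  have hΦc : Continuous Φ := continuous_iff_continuousAt.2 fun s => (hΦ s).continuousAt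
  refine Integrable.bdd_mul (c := C) ?_ hχ.aestronglyMeasurable (Eventually.of_forall fun x => hC x)
  refine Integrable.mono' (g := fun x => K * f x ^ 2) ((Lp.memLp f).integrable_sq.const_mul _)
    (hΦc.measurable.comp (measurable_coe f)).aestronglyMeasurable (Eventually.of_forall fun x => ?_)
  have := abs_sub_sub_mul_le hΦ hψ 0 (f x)
  simpa [h0, h0'] using this

theorem memLp_weight (hχ : Measurable χ) (hC : ∀ x, |χ x| ≤ C) (hψ : LipschitzWith K ψ)
    (h0' : ψ 0 = 0) (f : Lp ℝ 2 g.vol) : MemLp (fun x => χ x * ψ (f x)) 2 g.vol := by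
  refine MemLp.of_le_mul (c := C) (memLp_comp (Lp.memLp f) (measurable_coe f) hψ h0')
    (hχ.mul (hψ.continuous.measurable.comp (measurable_coe f))).aestronglyMeasurable
    (Eventually.of_forall fun x => ?_)
  rw [norm_mul]
  exact mul_le_mul_of_nonneg_right (hC x) (norm_nonneg _)

theorem abs_functional_sub_le (hχ : Measurable χ) (hC : ∀ x, |χ x| ≤ C)
    (hΦ : ∀ s, HasDerivAt Φ (ψ s) s) (hψ : LipschitzWith K ψ) (h0 : Φ 0 = 0) (h0' : ψ 0 = 0)
    (f h : Lp ℝ 2 g.vol) :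
    |∫ x, χ x * Φ (h x) ∂g.vol - ∫ x, χ x * Φ (f x) ∂g.vol -
      inner ℝ (memLp_weight hχ hC hψ h0' f).toLp (h - f)| ≤ C * K * ‖h - f‖ ^ 2 := by
  have hi := integrable_functional (g := g) hχ hC hΦ hψ h0 h0'
  rw [← integral_mul_eq_inner, ← integral_sub (hi h) (hi f)]
  have h1 : ∫ x, ((memLp_weight hχ hC hψ h0' f).toLp : Lp ℝ 2 g.vol) x *
      (h - f : Lp ℝ 2 g.vol) x ∂g.vol =
      ∫ x, χ x * ψ (f x) * (h x - f x) ∂g.vol := by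
    refine integral_congr_ae ?_
    filter_upwards [MemLp.coeFn_toLp (memLp_weight hχ hC hψ h0' f), Lp.coeFn_sub h f] with x h1 h2
    rw [h1, h2, Pi.sub_apply]
  have h2 : Integrable (fun x => χ x * ψ (f x) * (h x - f x)) g.vol :=
    (memLp_weight hχ hC hψ h0' f).integrable_mul ((Lp.memLp h).sub (Lp.memLp f))
  have h2' : Integrable (fun x => χ x * Φ (h x) - χ x * Φ (f x)) g.vol := (hi h).sub (hi f)
  rw [h1, ← integral_sub h2' h2]
  have h3 : ‖h - f‖ ^ 2 = ∫ x, (h x - f x) ^ 2 ∂g.vol := by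
    rw [← real_inner_self_eq_norm_sq, ← integral_mul_eq_inner]
    refine integral_congr_ae ?_
    filter_upwards [Lp.coeFn_sub h f] with x h2
    rw [h2, Pi.sub_apply, sq]
  rw [h3, ← integral_const_mul, ← Real.norm_eq_abs]
  refine norm_integral_le_of_norm_le (((Lp.memLp h).sub (Lp.memLp f)).integrable_sq.const_mul _)
    (Eventually.of_forall fun x => ?_)
  have h4 := abs_sub_sub_mul_le hΦ hψ (f x) (h x)
  have h5 : χ x * Φ (h x) - χ x * Φ (f x) - χ x * ψ (f x) * (h x - f x) =
      χ x * (Φ (h x) - Φ (f x) - ψ (f x) * (h x - f x)) := by ring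
  rw [h5, norm_mul, mul_assoc]
  have hC0 : 0 ≤ C := (abs_nonneg _).trans (hC x)
  exact mul_le_mul (hC x) h4 (norm_nonneg _) hC0

theorem continuousWithinAt_functional (hχ : Measurable χ) (hC : ∀ x, |χ x| ≤ C)
    (hΦ : ∀ s, HasDerivAt Φ (ψ s) s) (hψ : LipschitzWith K ψ) (h0 : Φ 0 = 0) (h0' : ψ 0 = 0)
    {u : ℝ → Lp ℝ 2 g.vol} {t : ℝ} {S : Set ℝ} (hu : ContinuousWithinAt u S t) :
    ContinuousWithinAt (fun s => ∫ x, χ x * Φ (u s x) ∂g.vol) S t := by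
  have h1 : Tendsto (fun s => u s - u t) (𝓝[S] t) (𝓝 0) := by
    simpa using hu.tendsto.sub_const (u t)
  have h2 : Tendsto (fun s => (inner ℝ (memLp_weight hχ hC hψ h0' (u t)).toLp (u s - u t) : ℝ))
      (𝓝[S] t) (𝓝 0) := by
    simpa using (tendsto_const_nhds (x := (memLp_weight hχ hC hψ h0' (u t)).toLp)).inner h1
  have h3 : Tendsto (fun s => C * K * ‖u s - u t‖ ^ 2) (𝓝[S] t) (𝓝 0) := by
    simpa using (h1.norm.pow 2).const_mul (C * K)
  have h4 := squeeze_zero_norm (f := fun s => ∫ x, χ x * Φ (u s x) ∂g.vol -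
    ∫ x, χ x * Φ (u t x) ∂g.vol - inner ℝ (memLp_weight hχ hC hψ h0' (u t)).toLp (u s - u t))
    (fun s => abs_functional_sub_le hχ hC hΦ hψ h0 h0' (u t) (u s)) h3
  have h5 := (h4.add h2).add_const (∫ x, χ x * Φ (u t x) ∂g.vol)
  simp only [sub_add_cancel, zero_add] at h5
  exact h5

theorem hasDerivAt_functional (hχ : Measurable χ) (hC : ∀ x, |χ x| ≤ C)
    (hΦ : ∀ s, HasDerivAt Φ (ψ s) s) (hψ : LipschitzWith K ψ) (h0 : Φ 0 = 0) (h0' : ψ 0 = 0)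
    {u : ℝ → Lp ℝ 2 g.vol} {v : Lp ℝ 2 g.vol} {t : ℝ} (hu : HasDerivAt u v t) :
    HasDerivAt (fun s => ∫ x, χ x * Φ (u s x) ∂g.vol)
      (∫ x, v x * (χ x * ψ (u t x)) ∂g.vol) t := by
  set w := (memLp_weight hχ hC hψ h0' (u t)).toLp
  have hv : ∫ x, v x * (χ x * ψ (u t x)) ∂g.vol = inner ℝ w v := by
    rw [← integral_mul_eq_inner]
    refine integral_congr_ae ?_
    filter_upwards [MemLp.coeFn_toLp (memLp_weight hχ hC hψ h0' (u t))] with x h1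
    rw [h1, mul_comm]
  rw [hv]
  have h1 : HasDerivAt (fun s => (inner ℝ w (u s) : ℝ)) (inner ℝ w v) t := by
    simpa using (hasDerivAt_const t w).inner ℝ hu
  rw [hasDerivAt_iff_isLittleO] at h1 ⊢
  have h2 : (fun s => C * K * ‖u s - u t‖ ^ 2) =o[𝓝 t] fun s => s - t := by
    have hO : (fun s => u s - u t) =O[𝓝 t] fun s => s - t := hu.differentiableAt.isBigO_sub
    have h3 : (fun s => ‖u s - u t‖ ^ 2) =O[𝓝 t] fun s => (s - t) ^ 2 := hO.norm_left.pow 2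
    have h4 : (fun s : ℝ => (s - t) ^ 2) =o[𝓝 t] fun s => s - t := by
      have h5 : (fun s : ℝ => s - t) =o[𝓝 t] fun _ => (1 : ℝ) := by
        rw [Asymptotics.isLittleO_one_iff]
        have : Continuous fun s : ℝ => s - t := by fun_prop
        exact this.tendsto' _ _ (sub_self t)
      simpa [sq] using h5.mul_isBigO (Asymptotics.isBigO_refl (fun s : ℝ => s - t) (𝓝 t))
    exact (h3.trans_isLittleO h4).const_mul_left _
  have h3 : (fun s => ∫ x, χ x * Φ (u s x) ∂g.vol - ∫ x, χ x * Φ (u t x) ∂g.vol -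
      inner ℝ w (u s - u t)) =o[𝓝 t] fun s => s - t := by
    refine Asymptotics.IsBigO.trans_isLittleO (Asymptotics.IsBigO.of_bound 1
      (Eventually.of_forall fun s => ?_)) h2
    rw [one_mul]
    exact (abs_functional_sub_le hχ hC hΦ hψ h0 h0' (u t) (u s)).trans (le_abs_self _)
  refine (h3.add h1).congr_left fun s => ?_
  rw [inner_sub_right]
  ring

end Functional

/-! ### Contractivity of the heat flow -/

variable {f : Lp ℝ 2 g.vol} {u : ℝ → Lp ℝ 2 g.vol}

theorem IsHeatSolution.integral_comp_le (hu : g.IsHeatSolution f u) {Φ ψ k : ℝ → ℝ} {K : ℝ≥0}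
    (hΦ : ∀ s, HasDerivAt Φ (ψ s) s) (hψ : ∀ s, HasDerivAt ψ (k s) s) (hk : Continuous k)
    (hK : ∀ s, |k s| ≤ K) (hk0 : ∀ s, 0 ≤ k s) (h0 : Φ 0 = 0) (h0' : ψ 0 = 0) {t : ℝ}
    (ht : 0 ≤ t) : ∫ x, Φ (u t x) ∂g.vol ≤ ∫ x, Φ (f x) ∂g.vol := by
  have hL : LipschitzWith K ψ := lipschitzWith_of_nnnorm_deriv_le
    (fun s => (hψ s).differentiableAt) fun s => by rw [(hψ s).deriv]; exact hK s
  have hC : ∀ x : M, |(fun _ => (1 : ℝ)) x| ≤ 1 := fun _ => by simp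
  have hd : ∀ s, 0 < s → ∃ D ≤ 0, HasDerivAt (fun s => ∫ x, (1 : ℝ) * Φ (u s x) ∂g.vol) D s := by
    intro s hs
    obtain ⟨v, hv, hv'⟩ := hu.2.2 s hs
    refine ⟨_, ?_, hasDerivAt_functional (g := g) (χ := fun _ => 1) measurable_const hC hΦ hL h0 h0'
      hv'⟩
    obtain ⟨θ, hθ, q, hq, hqi⟩ := hv.1
    simp only [one_mul]
    rw [hv.integral_mul_comp hθ hq hqi hψ hk hK h0']
    have : 0 ≤ ∫ x, k (u s x) * q x ∂g.vol := by
      refine integral_nonneg_of_ae ?_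
      filter_upwards [hq.ae_nonneg] with x hx
      exact mul_nonneg (hk0 _) hx
    linarith
  have hanti : AntitoneOn (fun s => ∫ x, (1 : ℝ) * Φ (u s x) ∂g.vol) (Ici 0) := by
    refine antitoneOn_of_deriv_nonpos (convex_Ici 0) (fun s hs =>
      continuousWithinAt_functional measurable_const hC hΦ hL h0 h0' (hu.1 s hs)) ?_ ?_
    · intro s hs
      rw [interior_Ici] at hs
      obtain ⟨D, -, hD⟩ := hd s hs
      exact hD.differentiableAt.differentiableWithinAt
    · intro s hs
      rw [interior_Ici] at hs
      obtain ⟨D, hD0, hD⟩ := hd s hs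
      rwa [hD.deriv]
  have := hanti self_mem_Ici ht ht
  simpa only [one_mul, hu.2.1] using this

theorem IsHeatSolution.ae_le_zero (hu : g.IsHeatSolution f u) {Φ ψ k : ℝ → ℝ} {K : ℝ≥0}
    (hΦ : ∀ s, HasDerivAt Φ (ψ s) s) (hψ : ∀ s, HasDerivAt ψ (k s) s) (hk : Continuous k)
    (hK : ∀ s, |k s| ≤ K) (hk0 : ∀ s, 0 ≤ k s) (h0 : Φ 0 = 0) (h0' : ψ 0 = 0)
    (hΦ0 : ∀ s, 0 ≤ Φ s) (hf : ∀ᵐ x ∂g.vol, Φ (f x) = 0) {t : ℝ} (ht : 0 ≤ t) :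
    ∀ᵐ x ∂g.vol, Φ (u t x) = 0 := by
  have hL : LipschitzWith K ψ := lipschitzWith_of_nnnorm_deriv_le
    (fun s => (hψ s).differentiableAt) fun s => by rw [(hψ s).deriv]; exact hK s
  have h1 := hu.integral_comp_le hΦ hψ hk hK hk0 h0 h0' ht
  rw [integral_congr_ae hf, integral_zero] at h1
  have hi := integrable_functional (g := g) (χ := fun _ => 1) (C := 1) measurable_const
    (fun _ => by simp) hΦ hL h0 h0' (u t)
  simp only [one_mul] at hi
  have h2 := le_antisymm h1 (integral_nonneg fun x => hΦ0 _)
  exact (integral_eq_zero_iff_of_nonneg (fun x => hΦ0 _) hi).1 h2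

/-- The heat flow is contractive in the sup norm. -/
theorem IsHeatSolution.ae_abs_le (hu : g.IsHeatSolution f u) {L : ℝ} (hL : 0 ≤ L)
    (hf : ∀ᵐ x ∂g.vol, |f x| ≤ L) {t : ℝ} (ht : 0 ≤ t) : ∀ᵐ x ∂g.vol, |u t x| ≤ L := by
  set k : ℝ → ℝ := fun s => min 1 (max 0 (s - L))
  have hk : Continuous k := by fun_prop
  have hk0 : ∀ s, 0 ≤ k s := fun s => le_min zero_le_one (le_max_left _ _)
  have hK : ∀ s, |k s| ≤ (1 : ℝ≥0) := fun s => by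
    rw [abs_of_nonneg (hk0 s)]; exact min_le_left _ _
  have hkz : ∀ r ≤ L, k r = 0 := fun r hr => by
    simp only [k]
    rw [max_eq_left (by linarith), min_eq_right zero_le_one]
  have hkp : ∀ r, L < r → 0 < k r := fun r hr =>
    lt_min zero_lt_one (lt_max_of_lt_right (by linarith))
  set ψ := primitive k
  have hψ := hasDerivAt_primitive hk
  have hψc : Continuous ψ := continuous_primitive hk
  have hψz : ∀ r ≤ L, ψ r = 0 := fun r hr => primitive_eq_zero hL hkz hr
  have hψp : ∀ r, L < r → 0 < ψ r := fun r hr => by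
    have := primitive_lt hk hr hkp
    rwa [primitive_eq_zero hL hkz le_rfl] at this
  set Φ := primitive ψ
  have hΦ := hasDerivAt_primitive hψc
  have hΦz : ∀ r ≤ L, Φ r = 0 := fun r hr => primitive_eq_zero hL hψz hr
  have hΦp : ∀ r, L < r → 0 < Φ r := fun r hr => by
    have := primitive_lt hψc hr hψp
    rwa [primitive_eq_zero hL hψz le_rfl] at this
  have hΦ0 : ∀ s, 0 ≤ Φ s := fun s => by
    rcases le_or_gt s L with h | h
    · rw [hΦz s h]
    · exact (hΦp s h).le
  have h1 := hu.ae_le_zero hΦ hψ hk hK hk0 primitive_zero primitive_zero hΦ0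
    (by filter_upwards [hf] with x hx using hΦz _ (le_of_abs_le hx)) ht
  have hΦ' : ∀ s, HasDerivAt (fun s => Φ (-s)) (-ψ (-s)) s := fun s => by
    simpa [Function.comp_def] using (hΦ (-s)).scomp s (hasDerivAt_neg s)
  have hψ' : ∀ s, HasDerivAt (fun s => -ψ (-s)) (k (-s)) s := fun s => by
    have := ((hψ (-s)).scomp s (hasDerivAt_neg s)).neg
    simp only [smul_eq_mul, neg_mul, one_mul, neg_neg] at this
    exact this
  have h2 := hu.ae_le_zero hΦ' hψ' (hk.comp continuous_neg) (fun s => hK _) (fun s => hk0 _)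
    (by simp [Φ]) (by simp [ψ]) (fun s => hΦ0 _)
    (by filter_upwards [hf] with x hx using hΦz _ (by linarith [neg_le_of_abs_le hx])) ht
  filter_upwards [h1, h2] with x hx1 hx2
  rw [abs_le]
  constructor
  · by_contra! h
    exact (hΦp (-u t x) (by linarith)).ne' hx2
  · by_contra! h
    exact (hΦp _ h).ne' hx1

/-- The heat flow is symmetric. -/
theorem IsHeatSolution.inner_eq (hu : g.IsHeatSolution f u) {h : Lp ℝ 2 g.vol}
    {w : ℝ → Lp ℝ 2 g.vol} (hw : g.IsHeatSolution h w) {t : ℝ} (ht : 0 ≤ t) :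
    (inner ℝ (u t) h : ℝ) = inner ℝ f (w t) := by
  have hcont : ContinuousOn (fun s => (inner ℝ (u s) (w (t - s)) : ℝ)) (Icc 0 t) := by
    refine (hu.1.mono fun s hs => hs.1).inner (hw.1.comp (by fun_prop) fun s hs => ?_)
    exact sub_nonneg.2 hs.2
  have hder : ∀ s ∈ Ioo 0 t, HasDerivAt (fun s => (inner ℝ (u s) (w (t - s)) : ℝ)) 0 s := by
    intro s hs
    obtain ⟨v, hv, hv'⟩ := hu.2.2 s hs.1
    obtain ⟨y, hy, hy'⟩ := hw.2.2 (t - s) (sub_pos.2 hs.2)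
    have h1 : HasDerivAt (fun s => w (t - s)) (-y) s := by
      have := hy'.scomp s ((hasDerivAt_id s).const_sub t)
      simp only [neg_smul, one_smul] at this
      exact this
    have h2 := hv'.inner ℝ h1
    refine h2.congr_deriv ?_
    obtain ⟨θ, hθ, q, hq, hqi⟩ := hv.1
    obtain ⟨η, hη, r, hr, hri⟩ := hy.1
    obtain ⟨p, hp⟩ := exists_isPairing g θ η
    have e1 := (hv.integral_mul_eq (Lp.memLp (w (t - s))) hη hr hri hθ hp).2
    have e2 := (hy.integral_mul_eq (Lp.memLp (u s)) hθ hq hqi hη hp.symm).2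
    rw [integral_mul_eq_inner] at e1 e2
    rw [inner_neg_right, e1, real_inner_comm, e2]
    ring
  rcases ht.eq_or_lt with h0 | h0
  · subst h0
    rw [hu.2.1, hw.2.1]
  obtain ⟨s, -, hs⟩ := exists_hasDerivAt_eq_slope _ _ h0 hcont hder
  have h1 := (div_eq_zero_iff.1 hs.symm).resolve_right (by linarith)
  rw [sub_eq_zero, sub_self, sub_zero, hu.2.1, hw.2.1] at h1
  exact h1

end LRMetric

end

end

section

variable {ι : Type v} {M : Type u} [TopologicalSpace M] {d : ℕ} [NeZero d]

/-! ### Truncated powers -/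

/-- The truncation of `s` to `[-L, L]`. -/
def clamp (L s : ℝ) : ℝ := max (-L) (min s L)

/-- A `C¹` function with bounded derivative that agrees with `s ^ p` on `[-L, L]`. -/
def truncPow (L : ℝ) (p : ℕ) : ℝ → ℝ := primitive fun s => p * clamp L s ^ (p - 1)

section

variable {L : ℝ} {p : ℕ}

theorem continuous_clamp : Continuous (clamp L) := by unfold clamp; fun_prop

theorem abs_clamp_le (hL : 0 ≤ L) (s : ℝ) : |clamp L s| ≤ L :=
  abs_le.2 ⟨le_max_left _ _, max_le (by linarith) (min_le_right _ _)⟩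

theorem clamp_eq {s : ℝ} (hs : |s| ≤ L) : clamp L s = s := by
  rw [clamp, min_eq_left (abs_le.1 hs).2, max_eq_right (abs_le.1 hs).1]

theorem continuous_clampPow : Continuous fun s => (p : ℝ) * clamp L s ^ (p - 1) :=
  continuous_const.mul (continuous_clamp.pow _)

theorem hasDerivAt_truncPow (s : ℝ) : HasDerivAt (truncPow L p) (p * clamp L s ^ (p - 1)) s :=
  hasDerivAt_primitive continuous_clampPow s

theorem abs_clampPow_le (hL : 0 ≤ L) (s : ℝ) :
    |(p : ℝ) * clamp L s ^ (p - 1)| ≤ (p * L.toNNReal ^ (p - 1) : ℝ≥0) := by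
  rw [abs_mul, abs_pow, Nat.abs_cast]
  push_cast
  rw [Real.coe_toNNReal L hL]
  gcongr
  exact abs_clamp_le hL s

theorem lipschitzWith_truncPow (hL : 0 ≤ L) :
    LipschitzWith (p * L.toNNReal ^ (p - 1)) (truncPow L p) :=
  lipschitzWith_primitive continuous_clampPow (abs_clampPow_le hL)

@[simp] theorem truncPow_zero : truncPow L p 0 = 0 := primitive_zero

theorem abs_le_of_mem_uIcc {s r : ℝ} (hs : |s| ≤ L) (hr : r ∈ uIcc 0 s) : |r| ≤ L := by
  have := abs_sub_left_of_mem_uIcc hr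
  simp only [sub_zero] at this
  exact this.trans hs

theorem truncPow_eq (hp : 1 ≤ p) {s : ℝ} (hs : |s| ≤ L) : truncPow L p s = s ^ p := by
  have h : EqOn (fun r => (p : ℝ) * clamp L r ^ (p - 1)) (fun r => p * r ^ (p - 1)) (uIcc 0 s) :=
    fun r hr => by
      simp only
      rw [clamp_eq (abs_le_of_mem_uIcc hs hr)]
  rw [truncPow, primitive, intervalIntegral.integral_congr h, intervalIntegral.integral_const_mul,
    integral_pow]
  have h1 : ((p - 1 : ℕ) : ℝ) + 1 = p := by
    rw [Nat.cast_sub hp]; simp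
  have h2 : (p : ℝ) ≠ 0 := by positivity
  rw [h1, Nat.sub_add_cancel hp, zero_pow (by omega)]
  field_simp
  ring

theorem primitive_truncPow_eq (hp : 1 ≤ p) {s : ℝ} (hs : |s| ≤ L) :
    primitive (truncPow L (2 * p - 1)) s = s ^ (2 * p) / (2 * p) := by
  have h : EqOn (truncPow L (2 * p - 1)) (fun r => r ^ (2 * p - 1)) (uIcc 0 s) :=
    fun r hr => truncPow_eq (by omega) (abs_le_of_mem_uIcc hs hr)
  rw [primitive, intervalIntegral.integral_congr h, integral_pow]
  have h1 : ((2 * p - 1 : ℕ) : ℝ) + 1 = 2 * p := by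
    rw [Nat.cast_sub (by omega)]; push_cast; ring
  rw [h1, Nat.sub_add_cancel (by omega), zero_pow (by omega), sub_zero]

end

section

variable [MeasurableSpace M] [BorelSpace M] [Countable ι] {A : LipschitzAtlas ι M d}
  {g : LRMetric A}

namespace LRMetric

theorem IsPairing.integrable {θ η : OneForm A} {q q₁ q₂ : M → ℝ} (h : g.IsPairing θ η q)
    (h₁ : g.IsPairing θ θ q₁) (h₂ : g.IsPairing η η q₂) (i₁ : Integrable q₁ g.vol)
    (i₂ : Integrable q₂ g.vol) : Integrable q g.vol := by
  refine Integrable.mono' (i₁.add i₂) h.aemeasurable.aestronglyMeasurable ?_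
  filter_upwards [h.ae_sq_le h₁ h₂, h₁.ae_nonneg, h₂.ae_nonneg] with x hx h1 h2
  rw [Pi.add_apply, Real.norm_eq_abs]
  refine abs_le_of_sq_le_sq ?_ (by positivity)
  nlinarith [mul_nonneg h1 h2]

/-- The product of a Sobolev function and a Lipschitz cut-off function. -/
theorem integrable_pairing_mul {F η N q : M → ℝ} {Θ : OneForm A} {K : ℝ} (hF : MemLp F 2 g.vol)
    (hFm : Measurable F) (hp : g.IsPairing Θ Θ q) (hq : Integrable q g.vol) (hη : IsLocLip A η)
    (hηm : Measurable η) (hη1 : ∀ x, |η x| ≤ 1) (hN : g.IsPairing hη.diff hη.diff N)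
    (hNK : ∀ᵐ x ∂g.vol, N x ≤ K) {S : M → ℝ} (hS : g.IsPairing Θ hη.diff S) :
    g.IsPairing ((Θ.smul η hηm).add (hη.diff.smul F hFm)) ((Θ.smul η hηm).add (hη.diff.smul F hFm))
      (fun x => η x * (η x * q x) + F x * (η x * S x) + (η x * (F x * S x) + F x * (F x * N x))) ∧
    Integrable (fun x => η x * (η x * q x) + F x * (η x * S x) +
      (η x * (F x * S x) + F x * (F x * N x))) g.vol := by
  have h1 := (hp.smul_right hηm).smul_left hηm
  have h2 := (hS.smul_left hηm).smul_right hFm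
  have h3 := (hS.symm.smul_left hFm).smul_right hηm
  have h4 := (hN.smul_right hFm).smul_left hFm
  have hb : ∀ᵐ x ∂g.vol, ‖η x‖ ≤ 1 := Eventually.of_forall hη1
  have i1 : Integrable (fun x => η x * (η x * q x)) g.vol :=
    (hq.bdd_mul hηm.aestronglyMeasurable hb).bdd_mul hηm.aestronglyMeasurable hb
  have i4 : Integrable (fun x => F x * (F x * N x)) g.vol := by
    have : Integrable (fun x => F x ^ 2 * N x) g.vol := by
      refine hF.integrable_sq.mul_bdd (c := K) hN.aemeasurable.aestronglyMeasurable ?_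
      filter_upwards [hNK, hN.ae_nonneg] with x h5 h6
      rwa [Real.norm_of_nonneg h6]
    refine this.congr (Eventually.of_forall fun x => ?_)
    simp only
    ring
  have i2 := h2.integrable h1 h4 i1 i4
  have i3 := h3.integrable h4 h1 i4 i1
  exact ⟨(h1.add_right h2).add_left (h3.add_right h4), (i1.add i2).add (i3.add i4)⟩

theorem memLp_mul_bdd {F η : M → ℝ} (hF : MemLp F 2 g.vol) (hηm : Measurable η)
    (hη1 : ∀ x, |η x| ≤ 1) : MemLp (fun x => η x * F x) 2 g.vol := by
  refine hF.of_le (hηm.aestronglyMeasurable.mul hF.1) (Eventually.of_forall fun x => ?_)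
  rw [norm_mul]
  exact mul_le_of_le_one_left (norm_nonneg _) (hη1 x)

theorem neg_mul_integral_le {F Q R : M → ℝ} {p : ℝ} (hF : Integrable F g.vol)
    (hQ : Integrable Q g.vol) (hR : Integrable R g.vol)
    (h : ∀ᵐ x ∂g.vol, -p * F x ≤ -Q x + R x) :
    -p * ∫ x, F x ∂g.vol ≤ - ∫ x, Q x ∂g.vol + ∫ x, R x ∂g.vol := by
  have h1 := integral_mono_ae (hF.const_mul (-p)) (hQ.neg.add hR) h
  rw [integral_const_mul] at h1
  refine h1.trans (le_of_eq ?_)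
  rw [← integral_neg]
  exact integral_add hQ.neg hR

/-- Caccioppoli's inequality for powers of solutions. -/
theorem IsHalfLaplacian.caccioppoli {f v : Lp ℝ 2 g.vol} (h : g.IsHalfLaplacian f v) {L : ℝ}
    (hL : 0 ≤ L) (hf : ∀ᵐ x ∂g.vol, |f x| ≤ L) {p : ℕ} (hp : 1 ≤ p) {η N : M → ℝ} {K : ℝ}
    (hη : IsLocLip A η) (hηm : Measurable η) (hη1 : ∀ x, |η x| ≤ 1)
    (hN : g.IsPairing hη.diff hη.diff N) (hNK : ∀ᵐ x ∂g.vol, N x ≤ K) :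
    ∃ (Θ : OneForm A) (q : M → ℝ), IsDifferential (fun x => η x * truncPow L p (f x)) Θ ∧
      g.IsPairing Θ Θ q ∧ Integrable q g.vol ∧
      2 * p * ∫ x, v x * (η x ^ 2 * truncPow L (2 * p - 1) (f x)) ∂g.vol ≤
        - ∫ x, q x ∂g.vol + ∫ x, (f x ^ p) ^ 2 * N x ∂g.vol := by
  obtain ⟨θ, hθ, q₀, hq₀, hqi₀⟩ := h.1
  have hfm := measurable_coe f
  have hf2 : MemLp f 2 g.vol := Lp.memLp f
  obtain ⟨S, hS⟩ := exists_isPairing g θ hη.diff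
  -- the function `η f ^ p`
  have hG := lipschitzWith_truncPow (L := L) (p := p) hL
  have hGk : Continuous fun s => (p : ℝ) * clamp L s ^ (p - 1) := continuous_clampPow
  have hG2 := memLp_comp hf2 hfm hG truncPow_zero
  have hGm : Measurable fun x => truncPow L p (f x) := hG.continuous.measurable.comp hfm
  have hdG := hθ.comp (isLocInt_of_memLp g (by norm_num) hf2) hfm
    (hasDerivAt_truncPow (L := L) (p := p)) hGk (abs_clampPow_le hL)
  have hGkm : Measurable fun x => (p : ℝ) * clamp L (f x) ^ (p - 1) := hGk.measurable.comp hfm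
  have hGb : ∀ᵐ x ∂g.vol, ‖(p : ℝ) * clamp L (f x) ^ (p - 1)‖ ≤ (p * L.toNNReal ^ (p - 1) : ℝ≥0) :=
    Eventually.of_forall fun x => abs_clampPow_le hL _
  have hpG := (hq₀.smul_right hGkm).smul_left hGkm
  have hiG : Integrable (fun x => (p : ℝ) * clamp L (f x) ^ (p - 1) *
      ((p : ℝ) * clamp L (f x) ^ (p - 1) * q₀ x)) g.vol :=
    (hqi₀.bdd_mul hGkm.aestronglyMeasurable hGb).bdd_mul hGkm.aestronglyMeasurable hGb
  have hSG := hS.smul_left hGkm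
  have hdηG := hdG.mul_isLocLip (isLocInt_of_memLp g (by norm_num) hG2)
    (isLocInt_sq_of_memLp g hG2) hGm hη hηm hη1
  obtain ⟨hpη, hiη⟩ := integrable_pairing_mul hG2 hGm hpG hiG hη hηm hη1 hN hNK hSG
  refine ⟨_, _, hdηG, hpη, hiη, ?_⟩
  -- the test function `η² f ^ (2p-1)`
  set p' := 2 * p - 1 with hp'
  have hH := lipschitzWith_truncPow (L := L) (p := p') hL
  have hHk : Continuous fun s => (p' : ℝ) * clamp L s ^ (p' - 1) := continuous_clampPow
  have hH2 := memLp_comp hf2 hfm hH truncPow_zero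
  have hHm : Measurable fun x => truncPow L p' (f x) := hH.continuous.measurable.comp hfm
  have hdH := hθ.comp (isLocInt_of_memLp g (by norm_num) hf2) hfm
    (hasDerivAt_truncPow (L := L) (p := p')) hHk (abs_clampPow_le hL)
  have hHkm : Measurable fun x => (p' : ℝ) * clamp L (f x) ^ (p' - 1) := hHk.measurable.comp hfm
  have hHb : ∀ᵐ x ∂g.vol, ‖(p' : ℝ) * clamp L (f x) ^ (p' - 1)‖ ≤
      (p' * L.toNNReal ^ (p' - 1) : ℝ≥0) := Eventually.of_forall fun x => abs_clampPow_le hL _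
  have hpH := (hq₀.smul_right hHkm).smul_left hHkm
  have hiH : Integrable (fun x => (p' : ℝ) * clamp L (f x) ^ (p' - 1) *
      ((p' : ℝ) * clamp L (f x) ^ (p' - 1) * q₀ x)) g.vol :=
    (hqi₀.bdd_mul hHkm.aestronglyMeasurable hHb).bdd_mul hHkm.aestronglyMeasurable hHb
  have hSH := hS.smul_left hHkm
  have hdηH := hdH.mul_isLocLip (isLocInt_of_memLp g (by norm_num) hH2)
    (isLocInt_sq_of_memLp g hH2) hHm hη hηm hη1
  obtain ⟨hpηH, hiηH⟩ := integrable_pairing_mul hH2 hHm hpH hiH hη hηm hη1 hN hNK hSH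
  have hηH2 := memLp_mul_bdd hH2 hηm hη1
  have hηHm := hηm.mul hHm
  have hdηηH := hdηH.mul_isLocLip (isLocInt_of_memLp g (by norm_num) hηH2)
    (isLocInt_sq_of_memLp g hηH2) hηHm hη hηm hη1
  obtain ⟨S', hS'⟩ := exists_isPairing g
    (((θ.smul _ hHkm).smul η hηm).add (hη.diff.smul _ hHm)) hη.diff
  obtain ⟨hpηη, hiηη⟩ := integrable_pairing_mul hηH2 hηHm hpηH hiηH hη hηm hη1 hN hNK hS'
  have hθΘ := ((((hq₀.smul_right hHkm).smul_right hηm).add_right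
    (hS.smul_right hHm)).smul_right hηm).add_right (hS.smul_right hηHm)
  obtain ⟨hi, heq⟩ := h.integral_mul_eq (memLp_mul_bdd hηH2 hηm hη1) hdηηH hpηη hiηη hθ hθΘ
  have e1 : ∫ x, v x * (η x ^ 2 * truncPow L p' (f x)) ∂g.vol =
      ∫ x, v x * (η x * (η x * truncPow L p' (f x))) ∂g.vol := by
    congr 1; ext x; ring
  have iN : Integrable (fun x => (f x ^ p) ^ 2 * N x) g.vol := by
    have h5 : Integrable (fun x => truncPow L p (f x) ^ 2 * N x) g.vol := by
      refine hG2.integrable_sq.mul_bdd (c := K) hN.aemeasurable.aestronglyMeasurable ?_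
      filter_upwards [hNK, hN.ae_nonneg] with x h5 h6
      rwa [Real.norm_of_nonneg h6]
    refine h5.congr ?_
    filter_upwards [hf] with x hx
    rw [truncPow_eq hp hx]
  rw [e1, heq]
  have e2 : ∀ X : ℝ, 2 * (p : ℝ) * -(1 / 2 * X) = -p * X := fun X => by ring
  rw [e2]
  refine neg_mul_integral_le hi hiη iN ?_
  filter_upwards [hf, hq₀.ae_nonneg] with x hx hq0
  have hp1 : (p' : ℝ) = 2 * p - 1 := by rw [hp', Nat.cast_sub (by omega)]; push_cast; ring
  obtain ⟨r, rfl⟩ : ∃ r, p = r + 1 := ⟨p - 1, by omega⟩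
  have hp2 : p' = 2 * r + 1 := by omega
  simp only [Pi.mul_apply]
  rw [truncPow_eq hp hx, truncPow_eq (by omega) hx, clamp_eq hx, hp1]
  have hp3 : p' - 1 = 2 * r := by omega
  rw [hp3, hp2]
  have hr1 : r + 1 - 1 = r := by omega
  rw [hr1]
  push_cast
  have key : 0 ≤ ((r : ℝ) + 1) * r * (η x ^ 2 * (f x ^ r) ^ 2 * q₀ x) := by positivity
  have e3 : f x ^ (2 * r) = (f x ^ r) ^ 2 := by rw [mul_comm, pow_mul]
  have e4 : f x ^ (2 * r + 1) = (f x ^ r) ^ 2 * f x := by rw [pow_succ, e3]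
  rw [e4, e3, pow_succ (f x) r]
  nlinarith [key]

/-! ### The local super-Poincaré inequality in terms of real numbers -/

/-- The constant in front of the energy in the super-Poincaré inequality. -/
def energyConst (b : ℝ) (d : ℕ) : ℝ := 4 * b * Real.sqrt (b ^ d) ^ 2

/-- The constant in front of the square of the mean in the super-Poincaré inequality. -/
def massConst (b : ℝ) (d : ℕ) [NeZero d] : ℝ :=
  2 * (unitVolume d).toReal⁻¹ * Real.sqrt (b ^ d) ^ 3

theorem energyConst_pos {b : ℝ} (hb : 1 ≤ b) : 0 < energyConst b d := by
  have : 0 < b ^ d := by positivity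
  have := Real.sqrt_pos.2 this
  unfold energyConst
  positivity

theorem massConst_pos {b : ℝ} (hb : 1 ≤ b) : 0 < massConst b d := by
  have : 0 < b ^ d := by positivity
  have := Real.sqrt_pos.2 this
  have := ENNReal.toReal_pos (unitVolume_ne_zero (d := d)) unitVolume_ne_top
  unfold massConst
  positivity

variable [T2Space M] {c : ModelChart M d} {k : Set (Euc d)}

theorem superPoincare_real (hc : A.IsChart c) (hk : IsCompact k) (hkc : k ⊆ c.target)
    {b : ℝ} (hb : 1 ≤ b) (hq : g.IsQuasiEuclideanOn c b (c.invFun '' k)) {f : M → ℝ}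
    (hf : MemLp f 2 g.vol) (hf1 : Integrable f g.vol) (hf0 : ∀ x ∉ c.invFun '' k, f x = 0)
    {θ : OneForm A} (hd : IsDifferential f θ) {q : M → ℝ} (hp : g.IsPairing θ θ q)
    (hqi : Integrable q g.vol) {ε : ℝ} (hε : 0 < ε) :
    ∫ x, f x ^ 2 ∂g.vol ≤ energyConst b d * ε ^ 2 * ∫ x, q x ∂g.vol +
      massConst b d * (ε ^ d)⁻¹ * (∫ x, |f x| ∂g.vol) ^ 2 := by
  have h := superPoincare_chart hc hk hkc hb hq hf hf0 hd hp hqi hε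
  have h1 : ∫⁻ x, ‖f x‖ₑ ^ 2 ∂g.vol = ENNReal.ofReal (∫ x, f x ^ 2 ∂g.vol) := by
    rw [ofReal_integral_eq_lintegral_ofReal hf.integrable_sq
      (Eventually.of_forall fun x => sq_nonneg _)]
    refine lintegral_congr fun x => ?_
    rw [← ofReal_norm, ← ENNReal.ofReal_pow (norm_nonneg _), Real.norm_eq_abs, sq_abs]
  have h2 : ∫⁻ x, ‖q x‖ₑ ∂g.vol = ENNReal.ofReal (∫ x, q x ∂g.vol) := by
    rw [ofReal_integral_eq_lintegral_ofReal hqi hp.ae_nonneg]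
    refine lintegral_congr_ae ?_
    filter_upwards [hp.ae_nonneg] with x hx
    rw [Real.enorm_of_nonneg hx]
  have h3 : ∫⁻ x, ‖f x‖ₑ ∂g.vol = ENNReal.ofReal (∫ x, |f x| ∂g.vol) :=
    (ofReal_integral_norm_eq_lintegral_enorm hf1).symm
  have hq0 : 0 ≤ ∫ x, q x ∂g.vol := integral_nonneg_of_ae hp.ae_nonneg
  have hm0 : 0 ≤ ∫ x, |f x| ∂g.vol := integral_nonneg fun x => abs_nonneg _
  have hV := ENNReal.toReal_pos (unitVolume_ne_zero (d := d)) unitVolume_ne_top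
  have h4 : (unitVolume d)⁻¹ = ENNReal.ofReal (unitVolume d).toReal⁻¹ := by
    rw [ENNReal.ofReal_inv_of_pos hV, ENNReal.ofReal_toReal unitVolume_ne_top]
  have h5 : (2 : ℝ≥0∞) = ENNReal.ofReal 2 := by simp
  have hb0 : 0 ≤ b := by linarith
  have hs := Real.sqrt_nonneg (b ^ d)
  rw [h1, h2, h3, h4, h5, ← ENNReal.ofReal_mul hs, ← ENNReal.ofReal_mul hb0,
    ← ENNReal.ofReal_mul (by positivity), ← ENNReal.ofReal_mul (by positivity),
    ← ENNReal.ofReal_mul (by positivity), ← ENNReal.ofReal_mul hs,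
    ← ENNReal.ofReal_pow (by positivity), ← ENNReal.ofReal_mul (by positivity),
    ← ENNReal.ofReal_add (by positivity) (by positivity), ← ENNReal.ofReal_mul hs] at h
  have h6 := (ENNReal.ofReal_le_ofReal_iff (by positivity)).1 h
  refine h6.trans (le_of_eq ?_)
  unfold energyConst massConst
  ring

end LRMetric

end

end

section

variable {ι : Type v} {M : Type u} [TopologicalSpace M] {d : ℕ} [NeZero d]

/-! ### Local boundedness of solutions -/

theorem le_of_deriv_le {F : ℝ → ℝ} {t₀ t lam a : ℝ} (ht : t₀ ≤ t) (hF : ContinuousOn F (Ici t₀))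
    (h : ∀ s, t₀ < s → ∃ D, HasDerivAt F D s ∧ D ≤ -lam * (F s - a)) :
    F t ≤ a + Real.exp (-lam * (t - t₀)) * (F t₀ - a) := by
  have hd : ∀ s, t₀ < s → ∃ D ≤ 0,
      HasDerivAt (fun s => Real.exp (lam * (s - t₀)) * (F s - a)) D s := by
    intro s hs
    obtain ⟨D, hD, hD'⟩ := h s hs
    have h1 : HasDerivAt (fun s => Real.exp (lam * (s - t₀))) (Real.exp (lam * (s - t₀)) * lam) s := by
      have := (((hasDerivAt_id s).sub_const t₀).const_mul lam).exp
      simpa using this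
    refine ⟨_, ?_, h1.mul (hD.sub_const a)⟩
    have := Real.exp_pos (lam * (s - t₀))
    nlinarith
  have hanti : AntitoneOn (fun s => Real.exp (lam * (s - t₀)) * (F s - a)) (Ici t₀) := by
    refine antitoneOn_of_deriv_nonpos (convex_Ici t₀) ?_ ?_ ?_
    · exact (Continuous.continuousOn (by fun_prop)).mul (hF.sub continuousOn_const)
    · intro s hs
      rw [interior_Ici] at hs
      obtain ⟨D, -, hD⟩ := hd s hs
      exact hD.differentiableAt.differentiableWithinAt
    · intro s hs
      rw [interior_Ici] at hs
      obtain ⟨D, hD0, hD⟩ := hd s hs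
      rwa [hD.deriv]
  have h1 := hanti self_mem_Ici ht ht
  simp only [sub_self, mul_zero, Real.exp_zero, one_mul] at h1
  have h2 : Real.exp (-lam * (t - t₀)) * (Real.exp (lam * (t - t₀)) * (F t - a)) = F t - a := by
    rw [← mul_assoc, ← Real.exp_add]; simp
  have h3 := mul_le_mul_of_nonneg_left h1 (Real.exp_pos (-lam * (t - t₀))).le
  rw [h2] at h3
  linarith

/-- A Lipschitz cut-off function between concentric balls. -/
def cutoff (z₀ : Euc d) (ρ ρ₁ : ℝ) (z : Euc d) : ℝ := max 0 (min 1 ((ρ₁ - dist z z₀) / (ρ₁ - ρ)))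

section

variable {z₀ : Euc d} {ρ ρ₁ : ℝ}

theorem abs_cutoff_le (z : Euc d) : |cutoff z₀ ρ ρ₁ z| ≤ 1 := by
  rw [cutoff, abs_of_nonneg (le_max_left _ _)]
  exact max_le zero_le_one (min_le_left _ _)

theorem cutoff_eq_one (h : ρ < ρ₁) {z : Euc d} (hz : z ∈ Metric.closedBall z₀ ρ) :
    cutoff z₀ ρ ρ₁ z = 1 := by
  have h1 : 1 ≤ (ρ₁ - dist z z₀) / (ρ₁ - ρ) := by
    rw [le_div_iff₀ (by linarith)]
    have : dist z z₀ ≤ ρ := hz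
    linarith
  rw [cutoff, min_eq_left h1, max_eq_right zero_le_one]

theorem cutoff_eq_zero (h : ρ < ρ₁) {z : Euc d} (hz : z ∉ Metric.closedBall z₀ ρ₁) :
    cutoff z₀ ρ ρ₁ z = 0 := by
  have h1 : (ρ₁ - dist z z₀) / (ρ₁ - ρ) ≤ 0 := by
    refine div_nonpos_of_nonpos_of_nonneg ?_ (by linarith)
    have : ρ₁ < dist z z₀ := by simpa using hz
    linarith
  rw [cutoff, max_eq_left ((min_le_right _ _).trans h1)]

theorem lipschitzWith_cutoff (h : ρ < ρ₁) :
    LipschitzWith (ρ₁ - ρ).toNNReal⁻¹ (cutoff z₀ ρ ρ₁) := by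
  have hr : 0 < ρ₁ - ρ := by linarith
  have h1 : LipschitzWith (ρ₁ - ρ).toNNReal⁻¹ fun z : Euc d => (ρ₁ - dist z z₀) / (ρ₁ - ρ) := by
    refine LipschitzWith.of_dist_le_mul fun x y => ?_
    rw [Real.dist_eq, ← sub_div, abs_div, abs_of_pos hr, NNReal.coe_inv,
      Real.coe_toNNReal _ hr.le, div_eq_inv_mul]
    have : |ρ₁ - dist x z₀ - (ρ₁ - dist y z₀)| ≤ dist x y := by
      rw [sub_sub_sub_cancel_left, abs_sub_comm]
      exact abs_dist_sub_le x y z₀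
    gcongr
  have h2 : cutoff z₀ ρ ρ₁ = fun z => max (min ((ρ₁ - dist z z₀) / (ρ₁ - ρ)) 1) 0 := by
    funext z
    rw [cutoff, max_comm, min_comm]
  rw [h2]
  exact (h1.min_const 1).max_const 0

end

/-- The part of a chart domain that corresponds to a closed Euclidean ball. -/
def ModelChart.cball (c : ModelChart M d) (z₀ : Euc d) (r : ℝ) : Set M :=
  c.invFun '' (c.target ∩ Metric.closedBall z₀ r)

theorem ModelChart.cball_mono {c : ModelChart M d} {z₀ : Euc d} {r r' : ℝ} (h : r ≤ r') :
    c.cball z₀ r ⊆ c.cball z₀ r' :=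
  image_mono (inter_subset_inter_right _ (Metric.closedBall_subset_closedBall h))

section

variable [MeasurableSpace M] [BorelSpace M] [Countable ι] {A : LipschitzAtlas ι M d}
  {g : LRMetric A}

namespace LRMetric

theorem IsQuasiEuclideanOn.mono {c : ModelChart M d} {b : ℝ} {S S' : Set M}
    (h : g.IsQuasiEuclideanOn c b S) (hS : S' ⊆ S) : g.IsQuasiEuclideanOn c b S' := fun i => by
  filter_upwards [h i] with z hz hzS using hz (hS hzS)

variable [T2Space M] {c : ModelChart M d} {k : Set (Euc d)} {b : ℝ}

theorem vol_image_lt_top (hc : A.IsChart c) (hk : IsCompact k) (hkc : k ⊆ c.target)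
    (hb : 1 ≤ b) (hq : g.IsQuasiEuclideanOn c b (c.invFun '' k)) : g.vol (c.invFun '' k) < ⊤ :=
  (g.vol_image_bounds hc hb hkc hq hk.measurableSet le_rfl).2.trans_lt
    (ENNReal.mul_lt_top ENNReal.ofReal_lt_top hk.measure_lt_top)

theorem integrableOn_pow {f : Lp ℝ 2 g.vol} {L : ℝ} (hf : ∀ᵐ x ∂g.vol, |f x| ≤ L) {S : Set M}
    (hS : g.vol S < ⊤) (p : ℕ) : IntegrableOn (fun x => f x ^ p) S g.vol := by
  refine Measure.integrableOn_of_bounded (M := L ^ p) hS.ne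
    ((measurable_coe f).pow_const p).aestronglyMeasurable ?_
  filter_upwards [ae_restrict_of_ae hf] with x hx
  rw [norm_pow]
  exact pow_le_pow_left₀ (norm_nonneg _) hx p

theorem integrableOn_abs_pow {f : Lp ℝ 2 g.vol} {L : ℝ} (hf : ∀ᵐ x ∂g.vol, |f x| ≤ L) {S : Set M}
    (hS : g.vol S < ⊤) (p : ℕ) : IntegrableOn (fun x => |f x| ^ p) S g.vol := by
  have := (integrableOn_pow hf hS p).norm
  simpa only [IntegrableOn, norm_pow, Real.norm_eq_abs] using this

/-- The energy inequality for localized powers of solutions. -/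
theorem IsHeatSolution.exists_deriv_le {f : Lp ℝ 2 g.vol} {u : ℝ → Lp ℝ 2 g.vol}
    (hu : g.IsHeatSolution f u) {L : ℝ} (hL : 0 ≤ L) (hf : ∀ᵐ x ∂g.vol, |f x| ≤ L)
    (hc : A.IsChart c) (hk : IsCompact k) (hkc : k ⊆ c.target) (hb : 1 ≤ b)
    (hq : g.IsQuasiEuclideanOn c b (c.invFun '' k)) {φ : Euc d → ℝ} {K : ℝ≥0}
    (hφ : LipschitzWith K φ) (hφ0 : ∀ z ∈ c.target, z ∉ k → φ z = 0) (hφ1 : ∀ z, |φ z| ≤ 1)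
    {p : ℕ} (hp : 1 ≤ p) {t : ℝ} (ht : 0 < t) {ε : ℝ} (hε : 0 < ε) {m : ℝ}
    (hm : ∫ x in c.invFun '' k, |u t x| ^ p ∂g.vol ≤ m) :
    ∃ D, HasDerivAt (fun s => ∫ x, c.extend φ x ^ 2 * u s x ^ (2 * p) ∂g.vol) D t ∧
      D ≤ -(energyConst b d * ε ^ 2)⁻¹ * (∫ x, c.extend φ x ^ 2 * u t x ^ (2 * p) ∂g.vol -
          massConst b d * (ε ^ d)⁻¹ * m ^ 2) +
        b * (K : ℝ) ^ 2 * ∫ x in c.invFun '' k, u t x ^ (2 * p) ∂g.vol := by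
  set η := c.extend φ with hηdef
  have hη := isLocLip_extend hc hk hkc hφ hφ0
  have hηm : Measurable η := ModelChart.measurable_extend hφ.continuous
  have hη1 : ∀ x, |η x| ≤ 1 := fun x => by
    rw [hηdef, ModelChart.extend]
    by_cases hx : x ∈ c.source
    · rw [indicator_of_mem hx]; exact hφ1 _
    · rw [indicator_of_notMem hx]; simp
  have hη0 : ∀ x, x ∉ c.invFun '' k → η x = 0 := fun x hx => ModelChart.extend_eq_zero hφ0 hx
  have hcl := ModelChart.isClosed_image_inv hk hkc
  have hfin := vol_image_lt_top hc hk hkc hb hq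
  obtain ⟨N, hN⟩ := exists_isPairing g hη.diff hη.diff
  have hNle := ae_pairing_extend_le hc hk hkc hφ hφ0 (by linarith) hq hN
  have hNK : ∀ᵐ x ∂g.vol, N x ≤ b * (K : ℝ) ^ 2 := by
    filter_upwards [hNle] with x hx
    refine hx.trans (indicator_le_self' (fun _ _ => by positivity) x)
  have hut := hu.ae_abs_le hL hf ht.le
  obtain ⟨v, hv, hv'⟩ := hu.2.2 t ht
  have hH : LipschitzWith _ (truncPow L (2 * p - 1)) := lipschitzWith_truncPow hL
  have hχ : Measurable fun x => η x ^ 2 := hηm.pow_const 2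
  have hχ1 : ∀ x, |η x ^ 2| ≤ 1 := fun x => by rw [abs_pow]; exact pow_le_one₀ (abs_nonneg _) (hη1 x)
  have hder := (hasDerivAt_functional hχ hχ1
    (hasDerivAt_primitive hH.continuous) hH primitive_zero truncPow_zero hv').const_mul (2 * p : ℝ)
  have hp0 : (2 * p : ℝ) ≠ 0 := by positivity
  have heq : (fun s => ∫ x, η x ^ 2 * u s x ^ (2 * p) ∂g.vol) =ᶠ[𝓝 t]
      fun s => 2 * p * ∫ x, η x ^ 2 * primitive (truncPow L (2 * p - 1)) (u s x) ∂g.vol := by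
    filter_upwards [Ioi_mem_nhds ht] with s hs
    rw [← integral_const_mul]
    refine integral_congr_ae ?_
    filter_upwards [hu.ae_abs_le hL hf (le_of_lt hs)] with x hx
    rw [primitive_truncPow_eq hp hx]
    field_simp
  refine ⟨_, hder.congr_of_eventuallyEq heq, ?_⟩
  obtain ⟨Θ, q, hΘ, hpq, hqi, hle⟩ := hv.caccioppoli hL hut hp hη hηm hη1 hN hNK
  refine hle.trans ?_
  have hG := lipschitzWith_truncPow (L := L) (p := p) hL
  have hG2 := memLp_mul_bdd (memLp_comp (Lp.memLp (u t)) (measurable_coe (u t)) hG truncPow_zero)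
    hηm hη1
  have hW0 : ∀ x ∉ c.invFun '' k, η x * truncPow L p (u t x) = 0 := fun x hx => by
    rw [hη0 x hx, zero_mul]
  have hWabs : ∀ᵐ x ∂g.vol, |η x * truncPow L p (u t x)| ≤
      (c.invFun '' k).indicator (fun x => |u t x| ^ p) x := by
    filter_upwards [hut] with x hx
    by_cases hxk : x ∈ c.invFun '' k
    · rw [indicator_of_mem hxk, truncPow_eq hp hx, abs_mul, abs_pow]
      exact mul_le_of_le_one_left (by positivity) (hη1 x)
    · rw [indicator_of_notMem hxk, hW0 x hxk, abs_zero]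
  have hind : Integrable ((c.invFun '' k).indicator fun x => |u t x| ^ p) g.vol :=
    (integrable_indicator_iff hcl.measurableSet).2 (integrableOn_abs_pow hut hfin p)
  have hW1 : Integrable (fun x => η x * truncPow L p (u t x)) g.vol :=
    hind.mono' hG2.1 hWabs
  have hWm : ∫ x, |η x * truncPow L p (u t x)| ∂g.vol ≤ m := by
    refine (integral_mono_ae hW1.abs hind hWabs).trans ?_
    rwa [integral_indicator hcl.measurableSet]
  have hSP := superPoincare_real hc hk hkc hb hq hG2 hW1 hW0 hΘ hpq hqi hε
  have hFeq : ∫ x, (η x * truncPow L p (u t x)) ^ 2 ∂g.vol =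
      ∫ x, η x ^ 2 * u t x ^ (2 * p) ∂g.vol := by
    refine integral_congr_ae ?_
    filter_upwards [hut] with x hx
    rw [truncPow_eq hp hx, mul_pow, ← pow_mul, mul_comm p 2]
  rw [hFeq] at hSP
  have hm2 : (∫ x, |η x * truncPow L p (u t x)| ∂g.vol) ^ 2 ≤ m ^ 2 :=
    pow_le_pow_left₀ (integral_nonneg fun x => abs_nonneg _) hWm 2
  have hA := energyConst_pos (d := d) hb
  have hB := massConst_pos (d := d) hb
  have hNint : ∫ x, (u t x ^ p) ^ 2 * N x ∂g.vol ≤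
      b * (K : ℝ) ^ 2 * ∫ x in c.invFun '' k, u t x ^ (2 * p) ∂g.vol := by
    rw [← integral_const_mul, ← integral_indicator hcl.measurableSet]
    refine integral_mono_of_nonneg ?_ ?_ ?_
    · filter_upwards [hN.ae_nonneg] with x hx
      simp only [Pi.zero_apply]
      positivity
    · exact (integrable_indicator_iff hcl.measurableSet).2
        ((integrableOn_pow hut hfin _).const_mul _)
    · filter_upwards [hNle] with x hx
      have e : (u t x ^ p) ^ 2 = u t x ^ (2 * p) := by rw [← pow_mul, mul_comm p 2]
      have h0 : 0 ≤ (u t x ^ p) ^ 2 := sq_nonneg _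
      by_cases hxk : x ∈ c.invFun '' k
      · rw [indicator_of_mem hxk] at hx ⊢
        rw [← e, mul_comm]
        exact mul_le_mul_of_nonneg_right hx h0
      · rw [indicator_of_notMem hxk] at hx ⊢
        exact mul_nonpos_of_nonneg_of_nonpos h0 hx
  refine add_le_add ?_ hNint
  have hAε : 0 < energyConst b d * ε ^ 2 := by positivity
  have h7 : massConst b d * (ε ^ d)⁻¹ * (∫ x, |η x * truncPow L p (u t x)| ∂g.vol) ^ 2 ≤
      massConst b d * (ε ^ d)⁻¹ * m ^ 2 := by gcongr
  rw [neg_mul, neg_le_neg_iff, inv_mul_le_iff₀ hAε]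
  linarith

/-- Decay of localized powers of solutions. -/
theorem IsHeatSolution.setIntegral_pow_le {f : Lp ℝ 2 g.vol} {u : ℝ → Lp ℝ 2 g.vol}
    (hu : g.IsHeatSolution f u) {L : ℝ} (hL : 0 ≤ L) (hf : ∀ᵐ x ∂g.vol, |f x| ≤ L)
    (hc : A.IsChart c) (hb : 1 ≤ b) {z₀ : Euc d} {ρ ρ₁ : ℝ} (hρ : ρ < ρ₁)
    (hk : IsCompact (c.target ∩ Metric.closedBall z₀ ρ₁))
    (hq : g.IsQuasiEuclideanOn c b (c.cball z₀ ρ₁)) {p : ℕ} (hp : 1 ≤ p) {t₀ t : ℝ}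
    (ht₀ : 0 ≤ t₀) (ht : t₀ ≤ t) {ε : ℝ} (hε : 0 < ε) {m J : ℝ}
    (hm : ∀ s, t₀ ≤ s → ∫ x in c.cball z₀ ρ₁, |u s x| ^ p ∂g.vol ≤ m)
    (hJ : ∀ s, t₀ ≤ s → ∫ x in c.cball z₀ ρ₁, u s x ^ (2 * p) ∂g.vol ≤ J) :
    ∫ x in c.cball z₀ ρ, u t x ^ (2 * p) ∂g.vol ≤
      massConst b d * (ε ^ d)⁻¹ * m ^ 2 +
        energyConst b d * ε ^ 2 * (b * ((ρ₁ - ρ) ^ 2)⁻¹ * J) +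
        Real.exp (-(energyConst b d * ε ^ 2)⁻¹ * (t - t₀)) * J := by
  have hkc : c.target ∩ Metric.closedBall z₀ ρ₁ ⊆ c.target := inter_subset_left
  have hφ := lipschitzWith_cutoff (z₀ := z₀) hρ
  have hφ0 : ∀ z ∈ c.target, z ∉ c.target ∩ Metric.closedBall z₀ ρ₁ → cutoff z₀ ρ ρ₁ z = 0 :=
    fun z hz hzk => cutoff_eq_zero hρ fun h => hzk ⟨hz, h⟩
  set η := c.extend (cutoff z₀ ρ ρ₁) with hηdef
  have hηm : Measurable η := ModelChart.measurable_extend hφ.continuous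
  have hη1 : ∀ x, |η x| ≤ 1 := fun x => by
    rw [hηdef, ModelChart.extend]
    by_cases hx : x ∈ c.source
    · rw [indicator_of_mem hx]; exact abs_cutoff_le _
    · rw [indicator_of_notMem hx]; simp
  have hη0 : ∀ x, x ∉ c.cball z₀ ρ₁ → η x = 0 := fun x hx => ModelChart.extend_eq_zero hφ0 hx
  have hηone : ∀ x ∈ c.cball z₀ ρ, η x = 1 := by
    rintro _ ⟨z, hz, rfl⟩
    rw [hηdef, ModelChart.extend_inv hz.1]
    exact cutoff_eq_one hρ hz.2
  have hcl : MeasurableSet (c.cball z₀ ρ₁) := (ModelChart.isClosed_image_inv hk hkc).measurableSet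
  have hkρ : IsCompact (c.target ∩ Metric.closedBall z₀ ρ) := by
    have := hk.inter_right (Metric.isClosed_closedBall (x := z₀) (ε := ρ))
    rwa [inter_assoc, inter_eq_right.2 (Metric.closedBall_subset_closedBall hρ.le)] at this
  have hclρ : MeasurableSet (c.cball z₀ ρ) :=
    (ModelChart.isClosed_image_inv hkρ inter_subset_left).measurableSet
  have hfin : g.vol (c.cball z₀ ρ₁) < ⊤ := vol_image_lt_top hc hk hkc hb hq
  have hpos : ∀ (s : ℝ) x, 0 ≤ u s x ^ (2 * p) := fun s x => by
    rw [pow_mul]; positivity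
  set F : ℝ → ℝ := fun s => ∫ x, η x ^ 2 * u s x ^ (2 * p) ∂g.vol with hFdef
  have hη2 : ∀ x, η x ^ 2 ≤ 1 := fun x => by
    rw [← sq_abs]; exact pow_le_one₀ (abs_nonneg _) (hη1 x)
  have hind : ∀ s, 0 ≤ s → Integrable ((c.cball z₀ ρ₁).indicator fun x => u s x ^ (2 * p)) g.vol :=
    fun s hs => (integrable_indicator_iff hcl).2
      (integrableOn_pow (hu.ae_abs_le hL hf hs) hfin _)
  have hle : ∀ s x, η x ^ 2 * u s x ^ (2 * p) ≤
      (c.cball z₀ ρ₁).indicator (fun x => u s x ^ (2 * p)) x := fun s x => by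
    by_cases hx : x ∈ c.cball z₀ ρ₁
    · rw [indicator_of_mem hx]
      exact mul_le_of_le_one_left (hpos s x) (hη2 x)
    · rw [indicator_of_notMem hx, hη0 x hx]; simp
  have hFi : ∀ s, 0 ≤ s → Integrable (fun x => η x ^ 2 * u s x ^ (2 * p)) g.vol := fun s hs =>
    (hind s hs).mono' ((hηm.pow_const 2).mul ((measurable_coe (u s)).pow_const _)).aestronglyMeasurable
      (Eventually.of_forall fun x => by
        rw [Real.norm_of_nonneg (mul_nonneg (sq_nonneg _) (hpos s x))]
        exact hle s x)
  have hFJ : ∀ s, t₀ ≤ s → F s ≤ J := fun s hs => by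
    refine le_trans ?_ (hJ s hs)
    rw [← integral_indicator hcl]
    exact integral_mono (hFi s (ht₀.trans hs)) (hind s (ht₀.trans hs)) (hle s)
  have hFge : ∫ x in c.cball z₀ ρ, u t x ^ (2 * p) ∂g.vol ≤ F t := by
    rw [← integral_indicator hclρ]
    refine integral_mono_of_nonneg (Eventually.of_forall fun x =>
      indicator_nonneg (fun x _ => hpos t x) x) (hFi t (ht₀.trans ht))
      (Eventually.of_forall fun x => ?_)
    by_cases hx : x ∈ c.cball z₀ ρ
    · simp only [indicator_of_mem hx, hηone x hx, one_pow, one_mul, le_refl]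
    · simp only [indicator_of_notMem hx]
      exact mul_nonneg (sq_nonneg _) (hpos t x)
  have hH : LipschitzWith _ (truncPow L (2 * p - 1)) := lipschitzWith_truncPow hL
  have hp0 : (2 * p : ℝ) ≠ 0 := by positivity
  have hcont : ContinuousOn F (Ici t₀) := by
    have h1 : ContinuousOn (fun s => 2 * p * ∫ x, η x ^ 2 *
        primitive (truncPow L (2 * p - 1)) (u s x) ∂g.vol) (Ici t₀) := fun s hs =>
      (continuousWithinAt_functional (hηm.pow_const 2) (C := 1)
        (fun x => by rw [abs_of_nonneg (sq_nonneg _)]; exact hη2 x)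
        (hasDerivAt_primitive hH.continuous) hH primitive_zero truncPow_zero
        ((hu.1.mono (Ici_subset_Ici.2 ht₀)) s hs)).const_mul _
    refine h1.congr fun s hs => ?_
    rw [hFdef]
    simp only
    rw [← integral_const_mul]
    refine integral_congr_ae ?_
    filter_upwards [hu.ae_abs_le hL hf (ht₀.trans hs)] with x hx
    rw [primitive_truncPow_eq hp hx]
    field_simp
  have hA := energyConst_pos (d := d) hb
  have hB := massConst_pos (d := d) hb
  have hAε : 0 < energyConst b d * ε ^ 2 := by positivity
  have hr : 0 < ρ₁ - ρ := by linarith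
  have hJ0 : 0 ≤ J := (integral_nonneg fun x => hpos t₀ x).trans (hJ t₀ le_rfl)
  set a := massConst b d * (ε ^ d)⁻¹ * m ^ 2 +
        energyConst b d * ε ^ 2 * (b * ((ρ₁ - ρ) ^ 2)⁻¹ * J) with ha
  have ha0 : 0 ≤ a := by positivity
  have hgron := le_of_deriv_le (F := F) (lam := (energyConst b d * ε ^ 2)⁻¹) (a := a) ht hcont ?_
  · refine hFge.trans (hgron.trans ?_)
    have h1 := Real.exp_pos (-(energyConst b d * ε ^ 2)⁻¹ * (t - t₀))
    have h2 := hFJ t₀ le_rfl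
    have h3 : F t₀ - a ≤ J := by linarith
    have := mul_le_mul_of_nonneg_left h3 h1.le
    linarith
  · intro s hs
    obtain ⟨D, hD, hDle⟩ := hu.exists_deriv_le hL hf hc hk hkc hb hq hφ hφ0 abs_cutoff_le hp
      (ht₀.trans_lt hs) hε (hm s hs.le)
    refine ⟨D, hD, hDle.trans ?_⟩
    have hK : (((ρ₁ - ρ).toNNReal⁻¹ : ℝ≥0) : ℝ) ^ 2 = ((ρ₁ - ρ) ^ 2)⁻¹ := by
      rw [NNReal.coe_inv, Real.coe_toNNReal _ hr.le, inv_pow]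
    rw [hK]
    have h1 : b * ((ρ₁ - ρ) ^ 2)⁻¹ * ∫ x in c.invFun '' (c.target ∩ Metric.closedBall z₀ ρ₁),
        u s x ^ (2 * p) ∂g.vol ≤ b * ((ρ₁ - ρ) ^ 2)⁻¹ * J := by
      have := hJ s hs.le
      have hb0 : 0 ≤ b := by linarith
      gcongr
      exact this
    have h2 : -(energyConst b d * ε ^ 2)⁻¹ * (F s - a) =
        -(energyConst b d * ε ^ 2)⁻¹ * (F s - massConst b d * (ε ^ d)⁻¹ * m ^ 2) +
          b * ((ρ₁ - ρ) ^ 2)⁻¹ * J := by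
      rw [ha]; field_simp; ring
    rw [h2]
    exact add_le_add_right h1 _

end LRMetric

end

end

section

variable {ι : Type v} {M : Type u} [TopologicalSpace M] {d : ℕ} [NeZero d]

section

variable [MeasurableSpace M] [BorelSpace M] [Countable ι] {A : LipschitzAtlas ι M d}
  {g : LRMetric A}

namespace LRMetric

/-- The heat flow is contractive in `L¹`, locally. -/
theorem IsHeatSolution.setIntegral_abs_le (hex : ∀ f, ∃ u, g.IsHeatSolution f u)
    {f : Lp ℝ 2 g.vol} {u : ℝ → Lp ℝ 2 g.vol} (hu : g.IsHeatSolution f u)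
    (hf : Integrable f g.vol) {t : ℝ} (ht : 0 ≤ t) {B : Set M} (hB : MeasurableSet B)
    (hBfin : g.vol B < ⊤) : ∫ x in B, |u t x| ∂g.vol ≤ ∫ x, |f x| ∂g.vol := by
  set χ : M → ℝ := B.indicator fun x => SignType.sign (u t x) with hχdef
  have hsm : Measurable fun s : ℝ => ((SignType.sign s : SignType) : ℝ) := by
    have : (fun s : ℝ => ((SignType.sign s : SignType) : ℝ)) =
        (Ioi (0 : ℝ)).indicator (fun _ => (1 : ℝ)) - (Iio (0 : ℝ)).indicator fun _ => (1 : ℝ) := by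
      funext s
      rcases lt_trichotomy s 0 with h | h | h
      · simp [sign_neg h, indicator, h, not_lt.2 h.le]
      · simp [h]
      · simp [sign_pos h, indicator, h, not_lt.2 h.le]
    rw [this]
    exact (measurable_const.indicator measurableSet_Ioi).sub
      (measurable_const.indicator measurableSet_Iio)
  have hs1 : ∀ s : ℝ, |((SignType.sign s : SignType) : ℝ)| ≤ 1 := fun s => by
    rcases lt_trichotomy s 0 with h | h | h
    · simp [sign_neg h]
    · simp [h]
    · simp [sign_pos h]
  have hχm : Measurable χ := (hsm.comp (measurable_coe (u t))).indicator hB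
  have hχ1 : ∀ x, ‖χ x‖ ≤ B.indicator (fun _ => (1 : ℝ)) x := fun x => by
    by_cases hx : x ∈ B
    · simp only [χ, indicator_of_mem hx]; exact hs1 _
    · simp [χ, indicator_of_notMem hx]
  have hχ2 : MemLp χ 2 g.vol := by
    have h1 : MemLp (B.indicator fun _ : M => (1 : ℝ)) 2 g.vol :=
      memLp_indicator_const 2 hB 1 (Or.inr hBfin.ne)
    refine h1.of_le hχm.aestronglyMeasurable (Eventually.of_forall fun x => ?_)
    exact (hχ1 x).trans (le_abs_self _)
  obtain ⟨w, hw⟩ := hex hχ2.toLp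
  have hw1 := hw.ae_abs_le zero_le_one (by
    filter_upwards [MemLp.coeFn_toLp hχ2] with x hx
    rw [hx]
    exact (hχ1 x).trans (indicator_le_self' (fun _ _ => zero_le_one) x)) ht
  have h1 : ∫ x in B, |u t x| ∂g.vol = inner ℝ (u t) hχ2.toLp := by
    rw [← integral_mul_eq_inner, ← integral_indicator hB]
    refine integral_congr_ae ?_
    filter_upwards [MemLp.coeFn_toLp hχ2] with x hx
    rw [hx]
    by_cases hxB : x ∈ B
    · rw [indicator_of_mem hxB, hχdef, indicator_of_mem hxB, mul_comm, sign_mul_self]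
    · rw [indicator_of_notMem hxB, hχdef, indicator_of_notMem hxB, mul_zero]
  rw [h1, hu.inner_eq hw ht, ← integral_mul_eq_inner]
  refine integral_mono_ae ((Lp.memLp f).integrable_mul (Lp.memLp (w t))) hf.abs ?_
  filter_upwards [hw1] with x hx
  refine (le_abs_self _).trans ?_
  rw [abs_mul]
  exact mul_le_of_le_one_right (abs_nonneg _) hx

/-- The ratio of the scales in the iteration. -/
def scaleConst (b : ℝ) (d : ℕ) : ℝ :=
  Real.sqrt ((2 ^ (d + 1))⁻¹ / (energyConst b d * (4 * b + 2)))

/-- The constant of the reverse Hölder inequality. -/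
def holderConst (b : ℝ) (d : ℕ) [NeZero d] : ℝ := 2 * (massConst b d * (scaleConst b d ^ d)⁻¹)

theorem scaleConst_pos {b : ℝ} (hb : 1 ≤ b) : 0 < scaleConst b d := by
  have := energyConst_pos (d := d) hb
  refine Real.sqrt_pos.2 ?_
  positivity

theorem holderConst_pos {b : ℝ} (hb : 1 ≤ b) : 0 < holderConst b d := by
  have := massConst_pos (d := d) hb
  have := scaleConst_pos (d := d) hb
  unfold holderConst
  positivity

variable [T2Space M] {c : ModelChart M d} {b : ℝ}

theorem isCompact_inter_closedBall {z₀ : Euc d} {R ρ : ℝ}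
    (hk : IsCompact (c.target ∩ Metric.closedBall z₀ R)) (h : ρ ≤ R) :
    IsCompact (c.target ∩ Metric.closedBall z₀ ρ) := by
  have := hk.inter_right (Metric.isClosed_closedBall (x := z₀) (ε := ρ))
  rwa [inter_assoc, inter_eq_right.2 (Metric.closedBall_subset_closedBall h)] at this

/-- The reverse Hölder inequality for solutions. -/
theorem IsHeatSolution.reverse_holder {f : Lp ℝ 2 g.vol} {u : ℝ → Lp ℝ 2 g.vol}
    (hu : g.IsHeatSolution f u) {L : ℝ} (hL : 0 ≤ L) (hf : ∀ᵐ x ∂g.vol, |f x| ≤ L)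
    (hc : A.IsChart c) (hb : 1 ≤ b) {z₀ : Euc d} {R : ℝ}
    (hk : IsCompact (c.target ∩ Metric.closedBall z₀ R))
    (hq : g.IsQuasiEuclideanOn c b (c.cball z₀ R)) {p : ℕ} (hp : 1 ≤ p) {s : ℝ} (hs : 0 ≤ s) {m : ℝ}
    (hm : ∀ t, s ≤ t → ∫ x in c.cball z₀ R, |u t x| ^ p ∂g.vol ≤ m) {ρ : ℝ} (hρ : ρ < R) {t : ℝ}
    (ht : s + (R - ρ) ^ 2 ≤ t) :
    ∫ x in c.cball z₀ ρ, u t x ^ (2 * p) ∂g.vol ≤ holderConst b d * ((R - ρ) ^ d)⁻¹ * m ^ 2 := by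
  have hfin : g.vol (c.cball z₀ R) < ⊤ := vol_image_lt_top hc hk inter_subset_left hb hq
  have hmeas : ∀ ρ ≤ R, MeasurableSet (c.cball z₀ ρ) := fun ρ hρ =>
    (ModelChart.isClosed_image_inv (isCompact_inter_closedBall hk hρ) inter_subset_left).measurableSet
  have hpos : ∀ (s : ℝ) x, 0 ≤ u s x ^ (2 * p) := fun s x => by
    rw [pow_mul]; positivity
  set Lam := L ^ (2 * p) * (g.vol (c.cball z₀ R)).toReal with hLam
  have hLam0 : 0 ≤ Lam := by positivity
  have hbase : ∀ ρ ≤ R, ∀ t, 0 ≤ t → ∫ x in c.cball z₀ ρ, u t x ^ (2 * p) ∂g.vol ≤ Lam := by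
    intro ρ hρ t ht
    have h1 := hu.ae_abs_le hL hf ht
    calc ∫ x in c.cball z₀ ρ, u t x ^ (2 * p) ∂g.vol
        ≤ ∫ x in c.cball z₀ R, u t x ^ (2 * p) ∂g.vol :=
          setIntegral_mono_set (integrableOn_pow h1 hfin _)
            (Eventually.of_forall fun x => hpos t x) (ModelChart.cball_mono hρ).eventuallyLE
      _ ≤ ∫ x in c.cball z₀ R, L ^ (2 * p) ∂g.vol := by
          refine integral_mono_ae (integrableOn_pow h1 hfin _) (integrableOn_const hfin.ne) ?_
          filter_upwards [ae_restrict_of_ae h1] with x hx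
          refine (le_abs_self _).trans ?_
          rw [abs_pow]
          exact pow_le_pow_left₀ (abs_nonneg _) hx _
      _ = Lam := by
          rw [setIntegral_const, smul_eq_mul, mul_comm, hLam, measureReal_def]
  set κ := scaleConst b d with hκdef
  have hκ : 0 < κ := scaleConst_pos hb
  have hA := energyConst_pos (d := d) hb
  have hB := massConst_pos (d := d) hb
  have hC := holderConst_pos (d := d) hb
  set δ : ℝ := (2 ^ (d + 1))⁻¹ with hδ
  have hδ0 : 0 < δ := by positivity
  have hκδ : energyConst b d * (4 * b + 2) * κ ^ 2 = δ := by
    rw [hκdef, scaleConst, Real.sq_sqrt (by positivity)]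
    exact mul_div_cancel₀ _ (by positivity)
  have hm0 : ∀ ρ ≤ R, ∀ t, s ≤ t → ∫ x in c.cball z₀ ρ, |u t x| ^ p ∂g.vol ≤ m := by
    intro ρ hρ t ht
    refine le_trans ?_ (hm t ht)
    exact setIntegral_mono_set (integrableOn_abs_pow (hu.ae_abs_le hL hf (hs.trans ht)) hfin _)
      (Eventually.of_forall fun x => by positivity) (ModelChart.cball_mono hρ).eventuallyLE
  have key : ∀ n : ℕ, ∀ ρ < R, ∀ t, s + (R - ρ) ^ 2 ≤ t →
      ∫ x in c.cball z₀ ρ, u t x ^ (2 * p) ∂g.vol ≤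
        δ ^ n * Lam + holderConst b d * ((R - ρ) ^ d)⁻¹ * m ^ 2 := by
    intro n
    induction n with
    | zero =>
      intro ρ hρ t ht
      have h1 := hbase ρ hρ.le t (by nlinarith [sq_nonneg (R - ρ)])
      have hr : 0 < R - ρ := by linarith
      have : 0 ≤ holderConst b d * ((R - ρ) ^ d)⁻¹ * m ^ 2 := by positivity
      rw [pow_zero, one_mul]
      linarith
    | succ n ih =>
      intro ρ hρ t ht
      set γ := R - ρ with hγ
      have hγ0 : 0 < γ := by linarith
      set ρ₁ := (ρ + R) / 2 with hρ₁
      have h1 : ρ < ρ₁ := by rw [hρ₁]; linarith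
      have h2 : ρ₁ < R := by rw [hρ₁]; linarith
      have h3 : R - ρ₁ = γ / 2 := by rw [hρ₁, hγ]; ring
      have h4 : ρ₁ - ρ = γ / 2 := by rw [hρ₁, hγ]; ring
      set J := δ ^ n * Lam + holderConst b d * ((γ / 2) ^ d)⁻¹ * m ^ 2 with hJdef
      have hJ0 : 0 ≤ J := by positivity
      have hJ : ∀ τ, s + (γ / 2) ^ 2 ≤ τ →
          ∫ x in c.cball z₀ ρ₁, u τ x ^ (2 * p) ∂g.vol ≤ J := fun τ hτ => by
        have := ih ρ₁ h2 τ (by rw [h3]; exact hτ)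
        rwa [h3] at this
      have hst : 0 ≤ s + (γ / 2) ^ 2 := by positivity
      have h5 := hu.setIntegral_pow_le hL hf hc hb h1 (isCompact_inter_closedBall hk h2.le)
        (hq.mono (ModelChart.cball_mono h2.le)) hp hst (t := t) (by nlinarith [sq_nonneg γ])
        (ε := κ * γ) (by positivity) (fun τ hτ => hm0 ρ₁ h2.le τ (by nlinarith [sq_nonneg γ])) hJ
      refine h5.trans ?_
      rw [h4]
      have e1 : energyConst b d * (κ * γ) ^ 2 * (b * ((γ / 2) ^ 2)⁻¹ * J) =
          4 * b * energyConst b d * κ ^ 2 * J := by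
        field_simp
        ring
      have e2 : Real.exp (-(energyConst b d * (κ * γ) ^ 2)⁻¹ * (t - (s + (γ / 2) ^ 2))) ≤
          2 * energyConst b d * κ ^ 2 := by
        set y := energyConst b d * κ ^ 2 with hy
        have hy0 : 0 < y := by positivity
        have h6 : 1 / (2 * y) ≤ (energyConst b d * (κ * γ) ^ 2)⁻¹ * (t - (s + (γ / 2) ^ 2)) := by
          have h7 : γ ^ 2 / 2 ≤ t - (s + (γ / 2) ^ 2) := by nlinarith [sq_nonneg γ]
          have h8 : energyConst b d * (κ * γ) ^ 2 = y * γ ^ 2 := by rw [hy]; ring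
          rw [h8]
          calc 1 / (2 * y) = (y * γ ^ 2)⁻¹ * (γ ^ 2 / 2) := by field_simp
            _ ≤ _ := by gcongr
        have h9 : Real.exp (-(1 / (2 * y))) ≤ 2 * y := by
          rw [Real.exp_neg]
          have h10 : 1 / (2 * y) ≤ Real.exp (1 / (2 * y)) := by
            have := Real.add_one_le_exp (1 / (2 * y)); linarith
          calc (Real.exp (1 / (2 * y)))⁻¹ ≤ (1 / (2 * y))⁻¹ := by gcongr
            _ = 2 * y := by rw [one_div, inv_inv]
        have e5 : 2 * energyConst b d * κ ^ 2 = 2 * y := by rw [hy]; ring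
        rw [e5]
        refine le_trans (Real.exp_le_exp.2 ?_) h9
        linarith
      have e3 : massConst b d * ((κ * γ) ^ d)⁻¹ * m ^ 2 =
          holderConst b d / 2 * (γ ^ d)⁻¹ * m ^ 2 := by
        rw [holderConst, ← hκdef, mul_pow, mul_inv]
        ring
      have e4 : δ * (holderConst b d * ((γ / 2) ^ d)⁻¹ * m ^ 2) =
          holderConst b d / 2 * (γ ^ d)⁻¹ * m ^ 2 := by
        rw [hδ, div_pow, pow_succ]
        field_simp
      rw [e1, e3]
      have h11 := mul_le_mul_of_nonneg_right e2 hJ0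
      have h12 : 4 * b * energyConst b d * κ ^ 2 * J + 2 * energyConst b d * κ ^ 2 * J = δ * J := by
        rw [← hκδ]; ring
      have h13 : δ * J = δ ^ (n + 1) * Lam + holderConst b d / 2 * (γ ^ d)⁻¹ * m ^ 2 := by
        rw [hJdef, mul_add, e4]; ring
      linarith
  have hδ1 : δ < 1 := by
    rw [hδ]
    exact inv_lt_one_of_one_lt₀ (one_lt_pow₀ one_lt_two (by omega))
  have hlim : Tendsto (fun n : ℕ => δ ^ n * Lam + holderConst b d * ((R - ρ) ^ d)⁻¹ * m ^ 2) atTop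
      (𝓝 (holderConst b d * ((R - ρ) ^ d)⁻¹ * m ^ 2)) := by
    have := ((tendsto_pow_atTop_nhds_zero_of_lt_one hδ0.le hδ1).mul_const Lam).add_const
      (holderConst b d * ((R - ρ) ^ d)⁻¹ * m ^ 2)
    simpa using this
  exact ge_of_tendsto hlim (Eventually.of_forall fun n => key n ρ hρ t ht)

/-- Local boundedness of solutions with integrable initial values. -/
theorem IsHeatSolution.ae_abs_le_of_integral_le (hex : ∀ f, ∃ u, g.IsHeatSolution f u)
    {f : Lp ℝ 2 g.vol} {u : ℝ → Lp ℝ 2 g.vol}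
    (hu : g.IsHeatSolution f u) {L : ℝ} (hL : 0 ≤ L) (hf : ∀ᵐ x ∂g.vol, |f x| ≤ L)
    (hfi : Integrable f g.vol) {m : ℝ} (hm0 : 0 < m) (hm : ∫ x, |f x| ∂g.vol ≤ m)
    (hc : A.IsChart c) (hb : 1 ≤ b) {z₀ : Euc d} {r : ℝ} (hr : 0 < r)
    (hk : IsCompact (c.target ∩ Metric.closedBall z₀ (2 * r)))
    (hq : g.IsQuasiEuclideanOn c b (c.cball z₀ (2 * r))) {t : ℝ} (ht : r ^ 2 ≤ t) :
    ∀ᵐ x ∂g.vol, x ∈ c.cball z₀ r → |u t x| ≤ 4 ^ d * holderConst b d * (r ^ d)⁻¹ * m := by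
  have hfin : g.vol (c.cball z₀ (2 * r)) < ⊤ := vol_image_lt_top hc hk inter_subset_left hb hq
  have hmeas : ∀ ρ ≤ 2 * r, MeasurableSet (c.cball z₀ ρ) := fun ρ hρ =>
    (ModelChart.isClosed_image_inv (isCompact_inter_closedBall hk hρ) inter_subset_left).measurableSet
  have hC := holderConst_pos (d := d) hb
  set D := holderConst b d * (r ^ d)⁻¹ with hD
  have hD0 : 0 < D := by positivity
  set Y := 4 ^ d * D * m with hY
  have hY0 : 0 < Y := by positivity
  have key : ∀ k : ℕ, ∀ t, r ^ 2 * (1 - (1 / 2) ^ k) ≤ t →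
      ∫ x in c.cball z₀ (r * (1 + (1 / 2) ^ k)), |u t x| ^ (2 ^ k) ∂g.vol ≤
        Y ^ (2 ^ k) / (D * 2 ^ (d * (k + 2))) := by
    intro k
    induction k with
    | zero =>
      intro t ht
      have ht0 : 0 ≤ t := by simpa using ht
      have e1 : r * (1 + (1 / 2) ^ 0) = 2 * r := by ring
      rw [e1, pow_zero]
      simp only [pow_one]
      refine (hu.setIntegral_abs_le hex hfi ht0 (hmeas _ le_rfl) hfin).trans (hm.trans ?_)
      rw [le_div_iff₀ (by positivity), hY]
      have : (2 : ℝ) ^ (d * (0 + 2)) = 4 ^ d := by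
        rw [zero_add, mul_comm, pow_mul]; norm_num
      rw [this]
      exact le_of_eq (by ring)
    | succ k ih =>
      intro t ht
      have hh : (0 : ℝ) < (1 / 2) ^ k := by positivity
      have hh1 : ((1 : ℝ) / 2) ^ k ≤ 1 := pow_le_one₀ (by norm_num) (by norm_num)
      set h : ℝ := (1 / 2) ^ k with hhdef
      have e0 : ((1 : ℝ) / 2) ^ (k + 1) = h / 2 := by rw [pow_succ, hhdef]; ring
      rw [e0] at ht ⊢
      have hR : r * (1 + h) ≤ 2 * r := by nlinarith
      have hlt : r * (1 + h / 2) < r * (1 + h) := by nlinarith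
      have e1 : r * (1 + h) - r * (1 + h / 2) = r * (h / 2) := by ring
      have hp : 1 ≤ 2 ^ k := Nat.one_le_two_pow
      have h1 := hu.reverse_holder hL hf hc hb (isCompact_inter_closedBall hk hR)
        (hq.mono (ModelChart.cball_mono hR)) hp (s := r ^ 2 * (1 - h))
        (mul_nonneg (sq_nonneg _) (by linarith)) ih hlt (t := t) ?_
      · have e2 : ∀ x, u t x ^ (2 * 2 ^ k) = |u t x| ^ (2 ^ (k + 1)) := fun x => by
          rw [pow_succ, mul_comm (2 ^ k) 2, pow_mul, pow_mul, sq_abs]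
        simp only [e2] at h1
        refine h1.trans (le_of_eq ?_)
        rw [e1, div_pow, ← pow_mul, ← pow_succ, mul_pow, mul_inv, ← mul_assoc, ← hD]
        have e3 : ((h / 2) ^ d)⁻¹ = 2 ^ (d * (k + 1)) := by
          rw [← e0, one_div, inv_pow, inv_pow, inv_inv, ← pow_mul, mul_comm]
        rw [e3, mul_pow D]
        have e4 : ((2 : ℝ) ^ (d * (k + 2))) ^ 2 =
            2 ^ (d * (k + 1)) * 2 ^ (d * (k + 1 + 2)) := by
          rw [← pow_mul, ← pow_add]; congr 1; ring
        rw [e4]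
        field_simp
      · rw [e1]
        have : (r * (h / 2)) ^ 2 ≤ r ^ 2 * (h / 2) := by
          rw [mul_pow]
          have : (h / 2) ^ 2 ≤ h / 2 := by nlinarith
          gcongr
        nlinarith
  have hut := hu.ae_abs_le hL hf ((sq_nonneg r).trans ht)
  set E := c.cball z₀ r ∩ {x | Y < |u t x|} with hE
  have hEm : MeasurableSet E := (hmeas r (by linarith)).inter
    (measurableSet_lt measurable_const (measurable_coe (u t)).norm)
  have hEfin : g.vol E < ⊤ := (measure_mono (inter_subset_left.trans
    (ModelChart.cball_mono (by linarith)))).trans_lt hfin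
  have hbound : ∀ k : ℕ, (g.vol E).toReal ≤ D⁻¹ * (1 / 2) ^ k := by
    intro k
    have hh1 : ((1 : ℝ) / 2) ^ k ≤ 1 := pow_le_one₀ (by norm_num) (by norm_num)
    have hh0 : (0 : ℝ) < (1 / 2) ^ k := by positivity
    have h1 := key k t (le_trans (by nlinarith [sq_nonneg r]) ht)
    have hsub : c.cball z₀ (r * (1 + (1 / 2) ^ k)) ⊆ c.cball z₀ (2 * r) :=
      ModelChart.cball_mono (by nlinarith)
    have hfin' := (measure_mono hsub).trans_lt hfin
    have h2 : Y ^ (2 ^ k) * (g.vol E).toReal ≤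
        ∫ x in c.cball z₀ (r * (1 + (1 / 2) ^ k)), |u t x| ^ (2 ^ k) ∂g.vol := by
      calc Y ^ (2 ^ k) * (g.vol E).toReal = ∫ x in E, Y ^ (2 ^ k) ∂g.vol := by
            rw [setIntegral_const, smul_eq_mul, mul_comm, measureReal_def]
        _ ≤ ∫ x in E, |u t x| ^ (2 ^ k) ∂g.vol := by
            refine setIntegral_mono_on (integrableOn_const hEfin.ne)
              (integrableOn_abs_pow hut hEfin _) hEm fun x hx => ?_
            exact pow_le_pow_left₀ hY0.le (le_of_lt hx.2) _
        _ ≤ _ := by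
            refine setIntegral_mono_set (integrableOn_abs_pow hut hfin' _)
              (Eventually.of_forall fun x => by positivity) ?_
            exact (inter_subset_left.trans (ModelChart.cball_mono (by nlinarith))).eventuallyLE
    have h3 := h2.trans h1
    have hYk : 0 < Y ^ (2 ^ k) := by positivity
    rw [div_eq_mul_inv] at h3
    have h4 := le_of_mul_le_mul_left h3 hYk
    refine h4.trans ?_
    rw [mul_inv, one_div, inv_pow]
    gcongr
    · norm_num
    · have : 1 ≤ d := Nat.one_le_iff_ne_zero.2 (NeZero.ne d)
      nlinarith
  have hE0 : g.vol E = 0 := by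
    have h1 : Tendsto (fun k : ℕ => D⁻¹ * ((1 : ℝ) / 2) ^ k) atTop (𝓝 0) := by
      simpa using (tendsto_pow_atTop_nhds_zero_of_lt_one (by norm_num : (0 : ℝ) ≤ 1 / 2)
        (by norm_num)).const_mul D⁻¹
    have h2 := ge_of_tendsto h1 (Eventually.of_forall hbound)
    have h3 := le_antisymm h2 ENNReal.toReal_nonneg
    exact ((ENNReal.toReal_eq_zero_iff _).1 h3).resolve_right hEfin.ne
  have h5 : ∀ᵐ x ∂g.vol, x ∉ E := measure_eq_zero_iff_ae_notMem.1 hE0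
  filter_upwards [h5] with x hx hxr
  have h6 : ¬ (Y < |u t x|) := fun h => hx ⟨hxr, h⟩
  have e : 4 ^ d * holderConst b d * (r ^ d)⁻¹ * m = Y := by rw [hY, hD]; ring
  rw [e]
  exact not_lt.1 h6

end LRMetric

end

end

section

variable {ι : Type v} {M : Type u} [TopologicalSpace M] {d : ℕ} [NeZero d]

/-! ### Affine reparametrizations -/

section Affine

variable {α β a b a' b' : ℝ}

theorem measurableEmbedding_affine (hα : α ≠ 0) (β : ℝ) :
    MeasurableEmbedding fun t : ℝ => α * t + β :=
  ((Homeomorph.mulLeft₀ α hα).trans (Homeomorph.addRight β)).measurableEmbedding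

theorem map_affine (hα : α ≠ 0) (β : ℝ) : Measure.map (fun t : ℝ => α * t + β) volume =
    ENNReal.ofReal |α⁻¹| • (volume : Measure ℝ) := by
  have h1 : (fun t : ℝ => α * t + β) = (fun t => t + β) ∘ fun t => α * t := rfl
  rw [h1, ← Measure.map_map (by fun_prop) (by fun_prop), Real.map_volume_mul_left hα,
    Measure.map_smul, map_add_right_eq_self]

theorem map_restrict_affine (hα : α ≠ 0) (β : ℝ)
    (he : (fun t : ℝ => α * t + β) ⁻¹' Icc a b = Icc a' b') :
    Measure.map (fun t : ℝ => α * t + β) (volume.restrict (Icc a' b')) =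
      ENNReal.ofReal |α⁻¹| • (volume : Measure ℝ).restrict (Icc a b) := by
  rw [← he, ← (measurableEmbedding_affine hα β).restrict_map, map_affine hα, Measure.restrict_smul]

theorem ae_affine (hα : α ≠ 0) (he : (fun t : ℝ => α * t + β) ⁻¹' Icc a b = Icc a' b')
    {P : ℝ → Prop} (h : ∀ᵐ t ∂(volume.restrict (Icc a b)), P t) :
    ∀ᵐ t ∂(volume.restrict (Icc a' b')), P (α * t + β) := by
  have h1 : ∀ᵐ t ∂(Measure.map (fun t : ℝ => α * t + β) (volume.restrict (Icc a' b'))), P t := by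
    rw [map_restrict_affine hα β he]
    exact Measure.ae_smul_measure h _
  exact ae_of_ae_map (by fun_prop) h1

theorem lintegral_affine (hα : α ≠ 0) (he : (fun t : ℝ => α * t + β) ⁻¹' Icc a b = Icc a' b')
    (F : ℝ → ℝ≥0∞) : ∫⁻ t in Icc a' b', ENNReal.ofReal |α| * F (α * t + β) =
      ∫⁻ t in Icc a b, F t := by
  rw [lintegral_const_mul' _ _ ENNReal.ofReal_ne_top,
    ← (measurableEmbedding_affine hα β).lintegral_map, map_restrict_affine hα β he,
    lintegral_smul_measure, smul_eq_mul, ← mul_assoc, ← ENNReal.ofReal_mul (abs_nonneg _),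
    ← abs_mul, mul_inv_cancel₀ hα]
  simp

end Affine

section

variable [MeasurableSpace M] {A : LipschitzAtlas ι M d}

namespace LRMetric

variable (g : LRMetric A)

/-- A Lipschitz curve on `[a, b]` with speed `s` that is transversal to `B`. -/
structure IsCurve (B : Set M) (γ : ℝ → M) (s : ℝ → ℝ) (a b : ℝ) : Prop where
  continuousOn : ContinuousOn γ (Icc a b)
  lipschitz : ∀ (i : ι) (p q : ℝ), a ≤ p → p ≤ q → q ≤ b → MapsTo γ (Icc p q) (A.chart i).source →
    ∃ K : ℝ≥0, LipschitzOnWith K (fun t => (A.chart i).toFun (γ t)) (Icc p q)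
  avoids : ∀ᵐ t ∂(volume.restrict (Icc a b)), γ t ∉ B
  speed : ∀ i, ∀ᵐ t ∂(volume.restrict (Icc a b)), γ t ∈ (A.chart i).source →
    s t = Real.sqrt (bil (g.coeff i ((A.chart i).toFun (γ t)))
      (deriv (fun r => (A.chart i).toFun (γ r)) t) (deriv (fun r => (A.chart i).toFun (γ r)) t))

variable {g} {B : Set M} {γ γ' : ℝ → M} {s s' : ℝ → ℝ} {a b : ℝ}

theorem deriv_affine {F : ℝ → Euc d} (α β t : ℝ) :
    deriv (fun r => F (α * r + β)) t = α • deriv F (α * t + β) := by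
  have h1 := deriv_comp_mul_left α (fun r => F (r + β)) t
  rw [deriv_comp_add_const] at h1
  exact h1

theorem IsCurve.comp_affine (h : g.IsCurve B γ s a b) {α β a' b' : ℝ} (hα : α ≠ 0)
    (he : (fun t : ℝ => α * t + β) ⁻¹' Icc a b = Icc a' b') :
    g.IsCurve B (fun t => γ (α * t + β)) (fun t => |α| * s (α * t + β)) a' b' := by
  have hmaps : MapsTo (fun t : ℝ => α * t + β) (Icc a' b') (Icc a b) := fun t ht => by
    rw [← he] at ht; exact ht
  refine ⟨h.continuousOn.comp (by fun_prop) hmaps, fun i p q hp hpq hq hm => ?_,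
    ae_affine hα he h.avoids, fun i => ?_⟩
  · have himg : ∀ t ∈ uIcc (α * p + β) (α * q + β), ∃ r ∈ Icc p q, α * r + β = t := by
      intro t ht
      have hc : ContinuousOn (fun r : ℝ => α * r + β) (uIcc p q) := by fun_prop
      obtain ⟨r, hr, hr'⟩ := intermediate_value_uIcc hc ht
      rw [uIcc_of_le hpq] at hr
      exact ⟨r, hr, hr'⟩
    have hP := hmaps ⟨hp, hpq.trans hq⟩
    have hQ := hmaps ⟨hp.trans hpq, hq⟩
    obtain ⟨K, hK⟩ := h.lipschitz i (min (α * p + β) (α * q + β)) (max (α * p + β) (α * q + β))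
      (le_min hP.1 hQ.1) min_le_max (max_le hP.2 hQ.2) (by
        intro t ht
        obtain ⟨r, hr, rfl⟩ := himg t ht
        exact hm hr)
    refine ⟨K * ⟨|α|, abs_nonneg α⟩, ?_⟩
    have hL : LipschitzWith ⟨|α|, abs_nonneg α⟩ fun t : ℝ => α * t + β := by
      refine LipschitzWith.of_dist_le_mul fun x y => ?_
      rw [Real.dist_eq, Real.dist_eq, add_sub_add_right_eq_sub, ← mul_sub, abs_mul]
      rfl
    refine hK.comp (hL.lipschitzOnWith (s := Icc p q)) fun t ht => ?_
    rcases le_total α 0 with h0 | h0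
    · exact ⟨(min_le_right _ _).trans (by nlinarith [ht.2]),
        le_trans (by nlinarith [ht.1]) (le_max_left _ _)⟩
    · exact ⟨(min_le_left _ _).trans (by nlinarith [ht.1]),
        le_trans (by nlinarith [ht.2]) (le_max_right _ _)⟩
  · filter_upwards [ae_affine hα he (h.speed i)] with t ht hts
    rw [ht hts, deriv_affine (F := fun r => (A.chart i).toFun (γ r)), bil_smul_left,
      bil_smul_right, ← mul_assoc, Real.sqrt_mul (mul_self_nonneg α), Real.sqrt_mul_self_eq_abs]

theorem lintegral_speed_affine {α β a' b' : ℝ} (hα : α ≠ 0)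
    (he : (fun t : ℝ => α * t + β) ⁻¹' Icc a b = Icc a' b') :
    ∫⁻ t in Icc a' b', ENNReal.ofReal (|α| * s (α * t + β)) = ∫⁻ t in Icc a b, ENNReal.ofReal (s t) := by
  rw [← lintegral_affine hα he]
  simp only [ENNReal.ofReal_mul (abs_nonneg α)]

theorem IsCurve.distAvoiding_le_of_unit (h : g.IsCurve B γ s 0 1) :
    g.distAvoiding B (γ 0) (γ 1) ≤ ∫⁻ t in Icc (0 : ℝ) 1, ENNReal.ofReal (s t) := by
  refine iInf_le_of_le γ (iInf_le_of_le s (iInf_le _ ⟨⟨h.continuousOn, fun i a b h1 h2 h3 hm =>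
    h.lipschitz i a b h1 h2 h3 hm⟩, rfl, rfl, ?_, h.speed⟩))
  have := h.avoids
  rw [ae_restrict_iff' measurableSet_Icc, ae_iff] at this
  convert this using 2
  ext t
  simp [and_assoc]

theorem IsCurve.distAvoiding_le (h : g.IsCurve B γ s a b) (hab : a < b) :
    g.distAvoiding B (γ a) (γ b) ≤ ∫⁻ t in Icc a b, ENNReal.ofReal (s t) := by
  have hα : b - a ≠ 0 := by linarith
  have he : (fun t : ℝ => (b - a) * t + a) ⁻¹' Icc a b = Icc 0 1 := by
    ext t
    simp only [mem_preimage, mem_Icc]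
    constructor
    · rintro ⟨h1, h2⟩
      constructor <;> nlinarith
    · rintro ⟨h1, h2⟩
      constructor <;> nlinarith
  have h1 := (h.comp_affine hα he).distAvoiding_le_of_unit
  rw [lintegral_speed_affine hα he] at h1
  simpa using h1

theorem exists_isCurve_of_lt {x y : M} {l : ℝ≥0∞} (h : g.distAvoiding B x y < l) :
    ∃ γ s, g.IsCurve B γ s 0 1 ∧ γ 0 = x ∧ γ 1 = y ∧
      ∫⁻ t in Icc (0 : ℝ) 1, ENNReal.ofReal (s t) < l := by
  simp only [distAvoiding, iInf_lt_iff] at h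
  obtain ⟨γ, s, ⟨h1, h2, h3, h4, h5⟩, h6⟩ := h
  refine ⟨γ, s, ⟨h1.1, h1.2, ?_, h5⟩, h2, h3, h6⟩
  rw [ae_restrict_iff' measurableSet_Icc, ae_iff]
  convert h4 using 2
  ext t
  simp [and_assoc]

/-! ### The path distance is a pseudo-distance -/

theorem distAvoiding_symm (x y : M) : g.distAvoiding B x y = g.distAvoiding B y x := by
  have key : ∀ x y : M, g.distAvoiding B y x ≤ g.distAvoiding B x y := fun x y => by
    refine le_of_forall_gt fun l hl => ?_
    obtain ⟨γ, s, hγ, rfl, rfl, hlt⟩ := exists_isCurve_of_lt hl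
    have he : (fun t : ℝ => (-1) * t + 1) ⁻¹' Icc 0 1 = Icc 0 1 := by
      ext t
      simp only [mem_preimage, mem_Icc]
      constructor <;> rintro ⟨h1, h2⟩ <;> constructor <;> linarith
    have h1 := (hγ.comp_affine (by norm_num) he).distAvoiding_le_of_unit
    rw [lintegral_speed_affine (by norm_num) he] at h1
    refine lt_of_le_of_lt ?_ hlt
    simpa using h1
  exact le_antisymm (key y x) (key x y)

theorem lipschitzOnWith_Icc_of_Icc {F : ℝ → Euc d} {K : ℝ≥0} {p r q : ℝ}
    (h1 : LipschitzOnWith K F (Icc p r)) (h2 : LipschitzOnWith K F (Icc r q)) :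
    LipschitzOnWith K F (Icc p q) := by
  have key : ∀ x ∈ Icc p q, ∀ y ∈ Icc p q, x ≤ y → dist (F x) (F y) ≤ K * dist x y := by
    intro x hx y hy hxy
    rcases le_total y r with h | h
    · exact h1.dist_le_mul x ⟨hx.1, hxy.trans h⟩ y ⟨hy.1, h⟩
    rcases le_total r x with h' | h'
    · exact h2.dist_le_mul x ⟨h', hx.2⟩ y ⟨h, hy.2⟩
    have e1 := h1.dist_le_mul x ⟨hx.1, h'⟩ r ⟨hx.1.trans h', le_rfl⟩
    have e2 := h2.dist_le_mul r ⟨le_rfl, h.trans hy.2⟩ y ⟨h, hy.2⟩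
    have e3 := dist_triangle (F x) (F r) (F y)
    have e4 : dist x y = dist x r + dist r y := by
      rw [Real.dist_eq, Real.dist_eq, Real.dist_eq, abs_of_nonpos (by linarith),
        abs_of_nonpos (by linarith), abs_of_nonpos (by linarith)]
      ring
    rw [e4, mul_add]
    linarith
  refine LipschitzOnWith.of_dist_le_mul fun x hx y hy => ?_
  rcases le_total x y with h | h
  · exact key x hx y hy h
  · rw [dist_comm (F x), dist_comm x]
    exact key y hy x hx h

theorem IsCurve.concat {c : ℝ} (h : g.IsCurve B γ s a b) (h' : g.IsCurve B γ' s' b c)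
    (hab : a ≤ b) (hbc : b ≤ c) (he : γ b = γ' b) :
    g.IsCurve B (fun t => if t ≤ b then γ t else γ' t) (fun t => if t ≤ b then s t else s' t) a c ∧
      ∫⁻ t in Icc a c, ENNReal.ofReal (if t ≤ b then s t else s' t) =
        (∫⁻ t in Icc a b, ENNReal.ofReal (s t)) + ∫⁻ t in Icc b c, ENNReal.ofReal (s' t) := by
  set Γ : ℝ → M := fun t => if t ≤ b then γ t else γ' t with hΓ
  have hΓ1 : ∀ t, t ≤ b → Γ t = γ t := fun t ht => if_pos ht
  have hΓ2 : ∀ t, b ≤ t → Γ t = γ' t := fun t ht => by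
    rcases ht.eq_or_lt with rfl | h1
    · rw [hΓ1 _ le_rfl, he]
    · exact if_neg (not_le.2 h1)
  have hU : Icc a c = Icc a b ∪ Icc b c := (Icc_union_Icc_eq_Icc hab hbc).symm
  have hne : ∀ᵐ t : ℝ, t ≠ b := by
    rw [ae_iff]; simp
  have hsplit : ∀ {P : ℝ → Prop}, (∀ᵐ t ∂(volume.restrict (Icc a b)), P t) →
      (∀ᵐ t ∂(volume.restrict (Icc b c)), P t) → ∀ᵐ t ∂(volume.restrict (Icc a c)), P t := by
    intro P h1 h2
    rw [hU, ae_restrict_union_iff]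
    exact ⟨h1, h2⟩
  refine ⟨⟨?_, ?_, hsplit ?_ ?_, fun i => hsplit ?_ ?_⟩, ?_⟩
  · rw [hU]
    refine ContinuousOn.union_of_isClosed ?_ ?_ isClosed_Icc isClosed_Icc
    · exact h.continuousOn.congr fun t ht => hΓ1 t ht.2
    · exact h'.continuousOn.congr fun t ht => hΓ2 t ht.1
  · intro i p q hp hpq hq hm
    rcases le_total q b with hqb | hqb
    · obtain ⟨K, hK⟩ := h.lipschitz i p q hp hpq hqb fun t ht => by
        have := hm ht
        rwa [hΓ1 t (ht.2.trans hqb)] at this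
      refine ⟨K, fun x hx y hy => ?_⟩
      simp only [hΓ1 x (hx.2.trans hqb), hΓ1 y (hy.2.trans hqb)]
      exact hK hx hy
    rcases le_total b p with hbp | hbp
    · obtain ⟨K, hK⟩ := h'.lipschitz i p q hbp hpq hq fun t ht => by
        have := hm ht
        rwa [hΓ2 t (hbp.trans ht.1)] at this
      refine ⟨K, fun x hx y hy => ?_⟩
      simp only [hΓ2 x (hbp.trans hx.1), hΓ2 y (hbp.trans hy.1)]
      exact hK hx hy
    · obtain ⟨K, hK⟩ := h.lipschitz i p b hp hbp le_rfl fun t ht => by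
        have := hm ⟨ht.1, ht.2.trans hqb⟩
        rwa [hΓ1 t ht.2] at this
      obtain ⟨K', hK'⟩ := h'.lipschitz i b q le_rfl hqb hq fun t ht => by
        have := hm ⟨hbp.trans ht.1, ht.2⟩
        rwa [hΓ2 t ht.1] at this
      refine ⟨max K K', lipschitzOnWith_Icc_of_Icc (r := b) (fun x hx y hy => ?_)
        fun x hx y hy => ?_⟩
      · simp only [hΓ1 x hx.2, hΓ1 y hy.2]
        exact (hK.weaken (le_max_left K K')) hx hy
      · simp only [hΓ2 x hx.1, hΓ2 y hy.1]
        exact (hK'.weaken (le_max_right K K')) hx hy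
  · filter_upwards [h.avoids, ae_restrict_mem measurableSet_Icc] with t ht htm
    rwa [hΓ1 t htm.2]
  · filter_upwards [h'.avoids, ae_restrict_mem measurableSet_Icc] with t ht htm
    rwa [hΓ2 t htm.1]
  · filter_upwards [h.speed i, ae_restrict_mem measurableSet_Icc, ae_restrict_of_ae hne]
      with t ht htm htb hts
    have hlt : t < b := lt_of_le_of_ne htm.2 htb
    have hev : (fun r => (A.chart i).toFun (Γ r)) =ᶠ[𝓝 t] fun r => (A.chart i).toFun (γ r) := by
      filter_upwards [Iio_mem_nhds hlt] with r hr
      rw [hΓ1 r (le_of_lt hr)]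
    rw [hΓ1 t htm.2] at hts
    rw [if_pos htm.2, hev.deriv_eq, ht hts, hΓ1 t htm.2]
  · filter_upwards [h'.speed i, ae_restrict_mem measurableSet_Icc, ae_restrict_of_ae hne]
      with t ht htm htb hts
    have hlt : b < t := lt_of_le_of_ne htm.1 htb.symm
    have hev : (fun r => (A.chart i).toFun (Γ r)) =ᶠ[𝓝 t] fun r => (A.chart i).toFun (γ' r) := by
      filter_upwards [Ioi_mem_nhds hlt] with r hr
      rw [hΓ2 r (le_of_lt hr)]
    rw [hΓ2 t htm.1] at hts
    rw [if_neg (not_le.2 hlt), hev.deriv_eq, ht hts, hΓ2 t htm.1]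
  · have hd : Icc a c = Icc a b ∪ Ioc b c := (Icc_union_Ioc_eq_Icc hab hbc).symm
    rw [hd, lintegral_union measurableSet_Ioc
      (disjoint_left.2 fun t h1 h2 => absurd h1.2 (not_le.2 h2.1))]
    have e1 : ∫⁻ t in Icc b c, ENNReal.ofReal (s' t) = ∫⁻ t in Ioc b c, ENNReal.ofReal (s' t) :=
      setLIntegral_congr Ioc_ae_eq_Icc.symm
    rw [e1]
    congr 1
    · exact setLIntegral_congr_fun measurableSet_Icc fun t ht => by simp only [if_pos ht.2]
    · exact setLIntegral_congr_fun measurableSet_Ioc fun t ht => by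
        simp only [if_neg (not_le.2 ht.1)]

theorem distAvoiding_triangle (x y z : M) :
    g.distAvoiding B x z ≤ g.distAvoiding B x y + g.distAvoiding B y z := by
  refine ENNReal.le_of_forall_pos_le_add fun ε hε hfin => ?_
  have hε2 : (0 : ℝ≥0∞) < (ε / 2 : ℝ≥0) := by
    rw [ENNReal.coe_pos]; positivity
  have hf := ENNReal.add_lt_top.1 hfin
  obtain ⟨γ₁, s₁, h1, rfl, rfl, hl1⟩ := exists_isCurve_of_lt
    (ENNReal.lt_add_right hf.1.ne hε2.ne')
  obtain ⟨γ₂, s₂, h2, h20, rfl, hl2⟩ := exists_isCurve_of_lt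
    (ENNReal.lt_add_right hf.2.ne hε2.ne')
  have he : (fun t : ℝ => 1 * t + (-1)) ⁻¹' Icc 0 1 = Icc 1 2 := by
    ext t
    simp only [mem_preimage, mem_Icc]
    constructor <;> rintro ⟨h1, h2⟩ <;> constructor <;> linarith
  have h2' := h2.comp_affine one_ne_zero he
  obtain ⟨h3, h4⟩ := h1.concat h2' zero_le_one one_le_two (by simp [h20])
  have h5 := h3.distAvoiding_le two_pos
  rw [h4, lintegral_speed_affine one_ne_zero he] at h5
  have e1 : (if (2 : ℝ) ≤ 1 then γ₁ 2 else γ₂ (1 * 2 + -1)) = γ₂ 1 := by norm_num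
  simp only [zero_le_one, if_true] at h5
  rw [e1] at h5
  refine h5.trans ((add_le_add hl1.le hl2.le).trans (le_of_eq ?_))
  have e2 : (ε : ℝ≥0∞) = (ε / 2 : ℝ≥0) + (ε / 2 : ℝ≥0) := by
    rw [← ENNReal.coe_add, add_halves]
  rw [e2]
  ring

theorem distAvoiding_le_pathDist (hB : g.vol B = 0) (x y : M) :
    g.distAvoiding B x y ≤ g.pathDist x y :=
  le_iSup₂ (f := fun (B : Set M) (_ : g.vol B = 0) => g.distAvoiding B x y) B hB

theorem pathDist_symm (x y : M) : g.pathDist x y = g.pathDist y x := by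
  simp only [pathDist]
  exact iSup_congr fun B => iSup_congr fun _ => distAvoiding_symm x y

theorem pathDist_triangle (x y z : M) : g.pathDist x z ≤ g.pathDist x y + g.pathDist y z :=
  iSup₂_le fun _ hB => (distAvoiding_triangle x y z).trans
    (add_le_add (distAvoiding_le_pathDist hB x y) (distAvoiding_le_pathDist hB y z))

end LRMetric

end

end

section

variable {ι : Type v} {M : Type u} [TopologicalSpace M] {d : ℕ} [NeZero d]

/-! ### Segments in charts -/

/-- Almost all segments from a given point avoid a given null set. -/
theorem ae_ae_line_notMem {N : Set (Euc d)} (hN : volume N = 0) (z₀ : Euc d) :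
    ∀ᵐ w : Euc d, ∀ᵐ t ∂(volume.restrict (Icc (0 : ℝ) 1)), z₀ + t • (w - z₀) ∉ N := by
  set N' := toMeasurable volume N
  have hN' : volume N' = 0 := by rw [measure_toMeasurable, hN]
  have hNm : MeasurableSet N' := measurableSet_toMeasurable _ _
  have hmeas : MeasurableSet {x : Euc d × ℝ | z₀ + x.2 • (x.1 - z₀) ∉ N'} := by
    have : Continuous fun x : Euc d × ℝ => z₀ + x.2 • (x.1 - z₀) := by fun_prop
    exact (this.measurable hNm).compl
  have h : ∀ᵐ w : Euc d, ∀ᵐ t ∂(volume.restrict (Icc (0 : ℝ) 1)), z₀ + t • (w - z₀) ∉ N' := by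
    refine (Measure.ae_ae_comm (p := fun w t => z₀ + t • (w - z₀) ∉ N') hmeas).2 ?_
    have hne : ∀ᵐ t : ℝ, t ≠ 0 := by
      rw [ae_iff]; simp
    filter_upwards [ae_restrict_of_ae hne] with t ht
    have e : {w : Euc d | ¬ (z₀ + t • (w - z₀) ∉ N')} =
        (fun w => t • w) ⁻¹' ((fun y => y + (z₀ - t • z₀)) ⁻¹' N') := by
      ext w
      simp only [mem_ofPred_eq, not_not, mem_preimage]
      have : z₀ + t • (w - z₀) = t • w + (z₀ - t • z₀) := by rw [smul_sub]; abel
      rw [this]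
    rw [ae_iff, e, Measure.addHaar_preimage_smul _ ht, measure_preimage_add_right, hN', mul_zero]
  filter_upwards [h] with w hw
  filter_upwards [hw] with t ht hn using ht (subset_toMeasurable _ _ hn)

section

variable [MeasurableSpace M] [BorelSpace M] [Countable ι] {A : LipschitzAtlas ι M d}
  {g : LRMetric A} {c : ModelChart M d} {b : ℝ} {B : Set M}

open ModelChart

namespace LRMetric

/-- Almost everywhere, the matrices of the metric in a compatible chart, computed from the various
charts of the atlas, agree. -/
theorem ae_bil_transition_eq (g : LRMetric A) (hc : A.IsChart c) (i j : ι) :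
    ∀ᵐ z ∂(volume.restrict (overlap c (A.chart i))), z ∈ overlap c (A.chart j) → ∀ ξ : Euc d,
      bil (g.coeff j (transition c (A.chart j) z)) (fderiv ℝ (transition c (A.chart j)) z ξ)
        (fderiv ℝ (transition c (A.chart j)) z ξ) =
      bil (g.coeff i (transition c (A.chart i) z)) (fderiv ℝ (transition c (A.chart i)) z ξ)
        (fderiv ℝ (transition c (A.chart i)) z ξ) := by
  have h1 := (g.compat i j).and (A.compatible i j).ae_differentiableAt
  rw [ae_restrict_iff' (isModelSet_overlap _ _).measurableSet] at h1
  have h2 := (hc.compatible i).ae_transition (ae_restrict_of_ae h1)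
  filter_upwards [h2, (hc.compatible i).ae_differentiableAt,
    ae_mem_interior_overlap c (A.chart i)] with z hz hzd hzi hzj ξ
  have hzo := interior_subset hzi
  have hzij : transition c (A.chart i) z ∈ overlap (A.chart i) (A.chart j) :=
    ⟨(transition_mem hzo).1, by rw [mem_preimage, inv_transition hzo]; exact hzj.2⟩
  obtain ⟨h3, h4⟩ := hz hzij
  have hev : transition c (A.chart j) =ᶠ[𝓝 z]
      transition (A.chart i) (A.chart j) ∘ transition c (A.chart i) := by
    filter_upwards [mem_interior_iff_mem_nhds.1 hzi] with w hw
    rw [Function.comp, transition, transition, inv_transition hw]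
  rw [hev.fderiv_eq, fderiv_comp _ h4 hzd, ← h3, hev.eq_of_nhds]
  rfl

theorem ae_distAvoiding_le (hc : A.IsChart c) {V : Set (Euc d)} (hVc : V ⊆ c.target)
    (hq : g.IsQuasiEuclideanOn c b (c.invFun '' V)) (hB : g.vol B = 0) (z₀ : Euc d) :
    ∀ᵐ w : Euc d, segment ℝ z₀ w ⊆ V →
      g.distAvoiding B (c.invFun z₀) (c.invFun w) ≤ ENNReal.ofReal (Real.sqrt b * ‖w - z₀‖) := by
  choose I hI using A.cover
  set τ : ι → Euc d → Euc d := fun i => transition c (A.chart i) with hτ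
  set Q : ι → Euc d → Euc d → ℝ := fun i z ξ =>
    bil (g.coeff i (τ i z)) (fderiv ℝ (τ i) z ξ) (fderiv ℝ (τ i) z ξ) with hQ
  have hgood : ∀ᵐ z ∂(volume.restrict c.target), c.invFun z ∉ B ∧ ∀ i, z ∈ overlap c (A.chart i) →
      (DifferentiableAt ℝ (τ i) z ∧ (c.invFun z ∈ c.invFun '' V → ∀ ξ, Q i z ξ ≤ b * ‖ξ‖ ^ 2) ∧
        ∀ j, z ∈ overlap c (A.chart j) → ∀ ξ, Q j z ξ = Q i z ξ) := by
    refine (g.ae_chart_of_ae_vol hc (measure_eq_zero_iff_ae_notMem.1 hB)).and (ae_all_iff.2 fun i => ?_)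
    refine ae_restrict_of_ae ?_
    rw [← ae_restrict_iff' (isModelSet_overlap _ _).measurableSet]
    filter_upwards [(hc.compatible i).ae_differentiableAt, hq i,
      ae_all_iff.2 fun j => g.ae_bil_transition_eq hc i j] with z h1 h2 h3
    exact ⟨h1, fun hz ξ => (h2 hz ξ).2, h3⟩
  rw [ae_restrict_iff' c.isModelSet_target.measurableSet, ae_iff] at hgood
  filter_upwards [ae_ae_line_notMem hgood z₀] with w hw hseg
  set ξ := w - z₀ with hξ
  set z : ℝ → Euc d := fun t => z₀ + t • ξ with hz
  have hzV : ∀ t ∈ Icc (0 : ℝ) 1, z t ∈ V := fun t ht => hseg (by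
    rw [segment_eq_image']; exact ⟨t, ht, rfl⟩)
  have hzL : LipschitzWith ‖ξ‖₊ z := by
    refine LipschitzWith.of_dist_le_mul fun x y => ?_
    rw [dist_eq_norm, hz]
    simp only
    rw [add_sub_add_left_eq_sub, ← sub_smul, norm_smul, mul_comm, Real.dist_eq, Real.norm_eq_abs]
    rfl
  have hzd : ∀ t, HasDerivAt z ξ t := fun t => by
    have := ((hasDerivAt_id t).smul_const ξ).const_add z₀
    rw [one_smul] at this
    exact this
  have hae : ∀ᵐ t ∂(volume.restrict (Icc (0 : ℝ) 1)), t ∈ Icc (0 : ℝ) 1 ∧ (c.invFun (z t) ∉ B ∧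
      ∀ i, z t ∈ overlap c (A.chart i) →
      (DifferentiableAt ℝ (τ i) (z t) ∧ (∀ ξ, Q i (z t) ξ ≤ b * ‖ξ‖ ^ 2) ∧
        ∀ j, z t ∈ overlap c (A.chart j) → ∀ ξ, Q j (z t) ξ = Q i (z t) ξ)) := by
    filter_upwards [hw, ae_restrict_mem measurableSet_Icc] with t ht htm
    simp only [Classical.not_imp, not_and, not_not] at ht
    obtain ⟨h1, h2⟩ := ht (hVc (hzV t htm))
    refine ⟨htm, h1, fun i hi => ?_⟩
    obtain ⟨h3, h4, h5⟩ := h2 i hi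
    exact ⟨h3, h4 ⟨_, hzV t htm, rfl⟩, h5⟩
  set γ : ℝ → M := fun t => c.invFun (z t) with hγ
  set s : ℝ → ℝ := fun t => Real.sqrt (Q (I (γ t)) (z t) ξ) with hs
  have hcurve : g.IsCurve B γ s 0 1 := by
    refine ⟨?_, fun i p q hp hpq hq' hm => ?_, ?_, fun i => ?_⟩
    · exact c.continuousOn_invFun.comp hzL.continuous.continuousOn fun t ht => hVc (hzV t ht)
    · have hsub : z '' Icc p q ⊆ overlap c (A.chart i) := by
        rintro _ ⟨t, ht, rfl⟩
        exact ⟨hVc (hzV t ⟨hp.trans ht.1, ht.2.trans hq'⟩), hm ht⟩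
      obtain ⟨K, hK⟩ := LocallyLipschitzOn.exists_lipschitzOnWith_of_compact
        (isCompact_Icc.image hzL.continuous) ((hc i).1.mono hsub)
      exact ⟨K * ‖ξ‖₊, hK.comp (hzL.lipschitzOnWith (s := Icc p q)) (mapsTo_image _ _)⟩
    · filter_upwards [hae] with t ht using ht.2.1
    · filter_upwards [hae] with t hta hts
      obtain ⟨htm, -, ht⟩ := hta
      have hzo : z t ∈ overlap c (A.chart i) := ⟨hVc (hzV t htm), hts⟩
      have hzI : z t ∈ overlap c (A.chart (I (γ t))) := ⟨hVc (hzV t htm), hI _⟩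
      obtain ⟨h1, -, h3⟩ := ht i hzo
      have hder : deriv (fun r => (A.chart i).toFun (γ r)) t = fderiv ℝ (τ i) (z t) ξ :=
        (h1.hasFDerivAt.comp_hasDerivAt t (hzd t)).deriv
      rw [hder, hs]
      simp only
      rw [h3 _ hzI]
      rfl
  have h1 := hcurve.distAvoiding_le_of_unit
  have e0 : γ 0 = c.invFun z₀ := by simp [hγ, hz]
  have e1 : γ 1 = c.invFun w := by simp [hγ, hz, hξ]
  rw [e0, e1] at h1
  refine h1.trans ?_
  calc ∫⁻ t in Icc (0 : ℝ) 1, ENNReal.ofReal (s t)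
      ≤ ∫⁻ _ in Icc (0 : ℝ) 1, ENNReal.ofReal (Real.sqrt b * ‖ξ‖) := by
        refine lintegral_mono_ae ?_
        filter_upwards [hae] with t hta
        obtain ⟨htm, -, ht⟩ := hta
        refine ENNReal.ofReal_le_ofReal ?_
        obtain ⟨-, h2, -⟩ := ht (I (γ t)) ⟨hVc (hzV t htm), hI _⟩
        refine (Real.sqrt_le_sqrt (h2 ξ)).trans (le_of_eq ?_)
        rw [Real.sqrt_mul' _ (sq_nonneg _), Real.sqrt_sq (norm_nonneg _)]
    _ = _ := by simp

/-- The path distance is at most the Euclidean one in a quasi-Euclidean chart. -/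
theorem pathDist_le_of_segment (hc : A.IsChart c) {V : Set (Euc d)} (hV : IsModelSet V)
    (hVc : V ⊆ c.target) (hq : g.IsQuasiEuclideanOn c b (c.invFun '' V)) {z₀ z₁ : Euc d}
    (hseg : segment ℝ z₀ z₁ ⊆ V) :
    g.pathDist (c.invFun z₀) (c.invFun z₁) ≤ ENNReal.ofReal (Real.sqrt b * ‖z₁ - z₀‖) := by
  refine iSup₂_le fun B hB => ?_
  have hK : IsCompact (segment ℝ z₀ z₁) := by
    rw [segment_eq_image']
    exact isCompact_Icc.image (by fun_prop)
  obtain ⟨H, hH, hVH, -, δ, hδ, hδV⟩ := hV.exists_cthickening hK hseg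
  have hz₁ : z₁ ∈ V := hseg (right_mem_segment ℝ z₀ z₁)
  have hz₀ : z₀ ∈ V := hseg (left_mem_segment ℝ z₀ z₁)
  have key : ∀ η ∈ Ioc 0 δ, g.distAvoiding B (c.invFun z₀) (c.invFun z₁) ≤
      ENNReal.ofReal (Real.sqrt b * (‖z₁ - z₀‖ + 2 * η)) := by
    intro η hη
    have hpos := (hV.inter_open (Metric.isOpen_ball (x := z₁) (ε := η))).volume_pos
      ⟨z₁, hz₁, Metric.mem_ball_self hη.1⟩
    have hae := (ae_distAvoiding_le hc hVc hq hB z₀).and (ae_distAvoiding_le hc hVc hq hB z₁)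
    have hex : ∃ w ∈ V ∩ Metric.ball z₁ η, (segment ℝ z₀ w ⊆ V →
      g.distAvoiding B (c.invFun z₀) (c.invFun w) ≤ ENNReal.ofReal (Real.sqrt b * ‖w - z₀‖)) ∧
      (segment ℝ z₁ w ⊆ V →
      g.distAvoiding B (c.invFun z₁) (c.invFun w) ≤ ENNReal.ofReal (Real.sqrt b * ‖w - z₁‖)) := by
      by_contra! hcon
      refine hpos (measure_mono_null (fun w hw => ?_) (ae_iff.1 hae))
      intro h
      obtain ⟨h1, h2⟩ := hcon w hw h.1
      exact absurd (h.2 h1) (not_le.2 h2)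
    obtain ⟨w, ⟨hwV, hwb⟩, hw1, hw2⟩ := hex
    have hwn : ‖w - z₁‖ < η := by rwa [← dist_eq_norm]
    have hs1 : segment ℝ z₀ w ⊆ V := by
      intro y hy
      have hyH := hH.convex.segment_subset (hVH hz₀) (hVH hwV) hy
      rw [segment_eq_image'] at hy
      obtain ⟨t, ht, rfl⟩ := hy
      refine hδV ⟨?_, hyH⟩
      refine Metric.mem_cthickening_of_dist_le _ (z₀ + t • (z₁ - z₀)) δ _ ?_ ?_
      · rw [segment_eq_image']; exact ⟨t, ht, rfl⟩
      · rw [dist_eq_norm, add_sub_add_left_eq_sub, ← smul_sub, sub_sub_sub_cancel_right, norm_smul,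
          Real.norm_of_nonneg ht.1]
        have := mul_le_mul ht.2 hwn.le (norm_nonneg _) zero_le_one
        linarith [hη.2]
    have hs2 : segment ℝ z₁ w ⊆ V := by
      intro y hy
      have hyH := hH.convex.segment_subset (hVH hz₁) (hVH hwV) hy
      rw [segment_eq_image'] at hy
      obtain ⟨t, ht, rfl⟩ := hy
      refine hδV ⟨?_, hyH⟩
      refine Metric.mem_cthickening_of_dist_le _ z₁ δ _ (right_mem_segment ℝ z₀ z₁) ?_
      rw [dist_eq_norm, add_sub_cancel_left, norm_smul, Real.norm_of_nonneg ht.1]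
      have := mul_le_mul ht.2 hwn.le (norm_nonneg _) zero_le_one
      linarith [hη.2]
    refine (distAvoiding_triangle _ (c.invFun w) _).trans ?_
    rw [distAvoiding_symm (c.invFun w)]
    refine (add_le_add (hw1 hs1) (hw2 hs2)).trans ?_
    have hb0 := Real.sqrt_nonneg b
    rw [← ENNReal.ofReal_add (by positivity) (by positivity)]
    refine ENNReal.ofReal_le_ofReal ?_
    rw [← mul_add]
    refine mul_le_mul_of_nonneg_left ?_ hb0
    have : ‖w - z₀‖ ≤ ‖w - z₁‖ + ‖z₁ - z₀‖ := norm_sub_le_norm_sub_add_norm_sub _ _ _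
    linarith
  have hcont : Continuous fun η : ℝ => ENNReal.ofReal (Real.sqrt b * (‖z₁ - z₀‖ + 2 * η)) :=
    ENNReal.continuous_ofReal.comp (by fun_prop)
  have hlim : Tendsto (fun η : ℝ => ENNReal.ofReal (Real.sqrt b * (‖z₁ - z₀‖ + 2 * η))) (𝓝[>] 0)
      (𝓝 (ENNReal.ofReal (Real.sqrt b * ‖z₁ - z₀‖))) :=
    (hcont.tendsto' 0 _ (by simp)).mono_left nhdsWithin_le_nhds
  refine ge_of_tendsto hlim ?_
  filter_upwards [Ioc_mem_nhdsGT hδ] with η hη using key η hη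

end LRMetric

end

end

section

variable {ι : Type v} {M : Type u} [TopologicalSpace M] {d : ℕ} [NeZero d]

/-! ### The topology of the path distance -/

/-- The displacement of a Lipschitz curve is at most the integral of its speed. -/
theorem ofReal_norm_sub_le_lintegral {y : ℝ → Euc d} {K : ℝ≥0} {p q : ℝ} (hpq : p ≤ q)
    (hL : LipschitzOnWith K y (Icc p q)) {σ : ℝ → ℝ}
    (h : ∀ᵐ t ∂(volume.restrict (Icc p q)), ‖deriv y t‖ ≤ σ t) :
    ENNReal.ofReal ‖y q - y p‖ ≤ ∫⁻ t in Icc p q, ENNReal.ofReal (σ t) := by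
  set e := y q - y p with he
  rcases eq_or_ne e 0 with h0 | h0
  · simp [h0]
  have hpos : 0 < ‖e‖ := norm_pos_iff.2 h0
  have hlin : LipschitzWith ‖innerSL ℝ e‖₊ (fun v : Euc d => inner ℝ e v) :=
    (innerSL ℝ e).lipschitz
  have hac : AbsolutelyContinuousOnInterval (fun t => inner ℝ e (y t)) p q :=
    (hlin.comp_lipschitzOnWith (by rwa [uIcc_of_le hpq])).absolutelyContinuousOnInterval
  have hint := hac.integral_deriv_eq_sub
  have hinti := hac.intervalIntegrable_deriv
  rw [intervalIntegrable_iff_integrableOn_Icc_of_le hpq] at hinti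
  rw [intervalIntegral.integral_of_le hpq, ← integral_Icc_eq_integral_Ioc, ← inner_sub_right, ← he,
    real_inner_self_eq_norm_sq] at hint
  have hd : ∀ᵐ t ∂(volume.restrict (Icc p q)), deriv (fun t => inner ℝ e (y t)) t ≤ ‖e‖ * σ t := by
    have h1 : ∀ᵐ t ∂(volume.restrict (Icc p q)), t ∈ Ioo p q := by
      rw [restrict_Ioo_eq_restrict_Icc.symm]
      exact ae_restrict_mem measurableSet_Ioo
    filter_upwards [h, h1, ae_restrict_of_ae hL.ae_differentiableWithinAt_of_mem] with t ht htm hdt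
    have hda : DifferentiableAt ℝ y t :=
      (hdt (Ioo_subset_Icc_self htm)).differentiableAt (Icc_mem_nhds htm.1 htm.2)
    have : HasDerivAt (fun t => inner ℝ e (y t)) (inner ℝ e (deriv y t)) t :=
      (innerSL ℝ e).hasFDerivAt.comp_hasDerivAt t hda.hasDerivAt
    rw [this.deriv]
    exact (real_inner_le_norm _ _).trans (mul_le_mul_of_nonneg_left ht hpos.le)
  have h2 : ENNReal.ofReal (‖e‖ ^ 2) ≤ ENNReal.ofReal ‖e‖ * ∫⁻ t in Icc p q, ENNReal.ofReal (σ t) := by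
    rw [← hint, integral_eq_lintegral_pos_part_sub_lintegral_neg_part hinti]
    refine (ENNReal.ofReal_le_ofReal (sub_le_self _ ENNReal.toReal_nonneg)).trans ?_
    refine ENNReal.ofReal_toReal_le.trans ?_
    rw [← lintegral_const_mul' _ _ ENNReal.ofReal_ne_top]
    refine lintegral_mono_ae ?_
    filter_upwards [hd] with t ht
    rw [← ENNReal.ofReal_mul hpos.le]
    exact ENNReal.ofReal_le_ofReal ht
  rw [sq, ENNReal.ofReal_mul hpos.le] at h2
  exact (ENNReal.mul_le_mul_iff_right (ENNReal.ofReal_pos.2 hpos).ne' ENNReal.ofReal_ne_top).1 h2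

/-- Small balls of model sets are convex and compact. -/
theorem IsModelSet.exists_closedBall {T : Set (Euc d)} (hT : IsModelSet T) {z₀ : Euc d}
    (hz : z₀ ∈ T) : ∃ δ > 0, ∀ ρ ≤ δ, Convex ℝ (T ∩ Metric.closedBall z₀ ρ) ∧
      IsCompact (T ∩ Metric.closedBall z₀ ρ) := by
  obtain ⟨O, H, hO, hH, rfl⟩ := isModelSet_iff.1 hT
  obtain ⟨δ, hδ, hs⟩ := Metric.nhds_basis_closedBall.mem_iff.1 (hO.mem_nhds hz.1)
  refine ⟨δ, hδ, fun ρ hρ => ?_⟩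
  have : O ∩ H ∩ Metric.closedBall z₀ ρ = H ∩ Metric.closedBall z₀ ρ := by
    rw [inter_assoc]
    exact inter_eq_right.2 (inter_subset_right.trans
      ((Metric.closedBall_subset_closedBall hρ).trans hs))
  rw [this]
  exact ⟨hH.convex.inter (convex_closedBall _ _),
    (isCompact_closedBall _ _).inter_left hH.isClosed⟩

namespace ModelChart

variable {c : ModelChart M d}

theorem exists_image_closedBall_subset {x : M} (hx : x ∈ c.source) {U : Set M} (hU : U ∈ 𝓝 x) :
    ∃ δ > 0, c.invFun '' (c.target ∩ Metric.closedBall (c.toFun x) δ) ⊆ U := by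
  have hz : c.toFun x ∈ c.target := c.map_source hx
  have hxi : c.invFun (c.toFun x) = x := c.left_inv hx
  have h1 : c.invFun ⁻¹' U ∈ 𝓝[c.target] (c.toFun x) :=
    c.continuousOn_invFun _ hz (by rwa [hxi])
  obtain ⟨δ, hδ, hs⟩ := (nhdsWithin_hasBasis Metric.nhds_basis_closedBall c.target).mem_iff.1 h1
  refine ⟨δ, hδ, ?_⟩
  rintro _ ⟨z, hz, rfl⟩
  exact hs ⟨hz.2, hz.1⟩

end ModelChart

section

variable [MeasurableSpace M] [BorelSpace M] [Countable ι] {A : LipschitzAtlas ι M d}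
  {g : LRMetric A} {c : ModelChart M d} {b : ℝ} {B : Set M}

open ModelChart

namespace LRMetric

/-- Near a given point the path distance is bounded by the Euclidean distance in a chart. -/
theorem exists_pathDist_le (g : LRMetric A) (x : M) :
    ∃ i, ∃ K δ : ℝ, 0 ≤ K ∧ 0 < δ ∧ x ∈ (A.chart i).source ∧
      ∀ z ∈ (A.chart i).target ∩ Metric.closedBall ((A.chart i).toFun x) δ,
        g.pathDist x ((A.chart i).invFun z) ≤ ENNReal.ofReal (K * ‖z - (A.chart i).toFun x‖) := by
  obtain ⟨i, hi⟩ := A.cover x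
  obtain ⟨lam, -, hlam⟩ := g.elliptic i
  have hz : (A.chart i).toFun x ∈ (A.chart i).target := (A.chart i).map_source hi
  obtain ⟨δ, hδ, hconv⟩ := (A.chart i).isModelSet_target.exists_closedBall hz
  refine ⟨i, √lam, δ, Real.sqrt_nonneg _, hδ, hi, fun z hzz => ?_⟩
  have := pathDist_le_of_segment (g := g) (A.isChart_chart i) (A.chart i).isModelSet_target
    subset_rfl (g.isQuasiEuclideanOn_chart i hlam _)
    (((hconv δ le_rfl).1.segment_subset ⟨hz, Metric.mem_closedBall_self hδ.le⟩ hzz).trans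
      inter_subset_left)
  rwa [show (A.chart i).invFun ((A.chart i).toFun x) = x from (A.chart i).left_inv hi] at this

theorem ball_mem_nhds (g : LRMetric A) (x : M) {r : ℝ} (hr : 0 < r) : g.ball x r ∈ 𝓝 x := by
  obtain ⟨i, K, δ, hK, hδ, hi, h⟩ := g.exists_pathDist_le x
  have hη : 0 < min δ (r / (K + 1)) := lt_min hδ (by positivity)
  refine mem_of_superset ((isOpen_image_inv (c := A.chart i)
    (Metric.isOpen_ball (x := (A.chart i).toFun x) (ε := min δ (r / (K + 1))))).mem_nhds
      ⟨(A.chart i).toFun x, ⟨(A.chart i).map_source hi, Metric.mem_ball_self hη⟩,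
        (A.chart i).left_inv hi⟩) ?_
  rintro _ ⟨z, ⟨hz, hzb⟩, rfl⟩
  rw [mem_ball_iff_norm] at hzb
  refine (h z ⟨hz, mem_closedBall_iff_norm.2 (hzb.le.trans (min_le_left _ _))⟩).trans_lt ?_
  refine (ENNReal.ofReal_lt_ofReal_iff hr).2 ?_
  have h1 : ‖z - (A.chart i).toFun x‖ < r / (K + 1) := hzb.trans_le (min_le_right _ _)
  rw [lt_div_iff₀ (by positivity)] at h1
  nlinarith [norm_nonneg (z - (A.chart i).toFun x)]

theorem mem_ball_self (g : LRMetric A) (x : M) {r : ℝ} (hr : 0 < r) : x ∈ g.ball x r :=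
  mem_of_mem_nhds (g.ball_mem_nhds x hr)

theorem ball_subset_ball_of_pathDist_le {x y : M} {r δ : ℝ} (h : g.pathDist x y ≤ ENNReal.ofReal δ)
    (hδ : 0 ≤ δ) (hδr : δ ≤ r) : g.ball y (r - δ) ⊆ g.ball x r := by
  intro z hz
  have hz' : g.pathDist y z < ENNReal.ofReal (r - δ) := hz
  refine (pathDist_triangle x y z).trans_lt ?_
  refine (ENNReal.add_lt_add_of_le_of_lt (ne_top_of_le_ne_top ENNReal.ofReal_ne_top h) h
    hz').trans_le ?_
  rw [← ENNReal.ofReal_add hδ (sub_nonneg.2 hδr), add_sub_cancel]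

theorem isOpen_ball (g : LRMetric A) (x : M) (r : ℝ) : IsOpen (g.ball x r) := by
  rw [isOpen_iff_mem_nhds]
  intro y hy
  have hy' : g.pathDist x y < ENNReal.ofReal r := hy
  have hlt : (g.pathDist x y).toReal < r := by
    have hr : 0 < r := ENNReal.ofReal_pos.1 (bot_lt_of_lt hy')
    exact (ENNReal.lt_ofReal_iff_toReal_lt hy'.ne_top).1 hy'
  exact mem_of_superset (g.ball_mem_nhds y (sub_pos.2 hlt))
    (ball_subset_ball_of_pathDist_le (ENNReal.ofReal_toReal hy'.ne_top).ge
      ENNReal.toReal_nonneg hlt.le)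

variable [T2Space M]

/-- The topology of the path distance is the original one. -/
theorem exists_ball_subset (g : LRMetric A) {x : M} {U : Set M} (hU : U ∈ 𝓝 x) :
    ∃ r > 0, g.ball x r ⊆ U := by
  obtain ⟨i, hi⟩ := A.cover x
  obtain ⟨lam, hlam1, hlam⟩ := g.elliptic i
  set c := A.chart i with hc
  set z₀ := c.toFun x with hz₀
  have hz : z₀ ∈ c.target := c.map_source hi
  obtain ⟨δ, hδ, hconv⟩ := c.isModelSet_target.exists_closedBall hz
  obtain ⟨δ', hδ', hsub⟩ := exists_image_closedBall_subset (c := c) hi hU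
  set l := min δ δ' with hl
  have hl0 : 0 < l := lt_min hδ hδ'
  have hlam0 : 0 < lam := by linarith
  have hsl : 0 < √lam := Real.sqrt_pos.2 hlam0
  refine ⟨l / √lam, by positivity, fun y hy => ?_⟩
  set F := c.invFun '' (c.target ∩ Metric.closedBall z₀ l) with hF
  have hFc : IsClosed F := isClosed_image_inv (hconv l (min_le_left _ _)).2 inter_subset_left
  suffices y ∈ F from hsub (image_mono (inter_subset_inter_right _
    (Metric.closedBall_subset_closedBall (min_le_right _ _))) this)
  set B : Set M := {w | ¬ (w ∈ c.source → ∀ ξ : Euc d,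
    lam⁻¹ * ‖ξ‖ ^ 2 ≤ bil (g.coeff i (c.toFun w)) ξ ξ)} with hB
  have hB0 : g.vol B = 0 := by
    refine ae_iff.1 (g.ae_vol_of_ae_chart (A.isChart_chart i) ?_)
    filter_upwards [hlam, ae_restrict_mem c.isModelSet_target.measurableSet] with z h1 h2 ξ
    rw [show c.toFun (c.invFun z) = z from c.right_inv h2]
    exact (h1 ξ).1
  obtain ⟨γ, s, hγ, h0, h1, hlt⟩ := exists_isCurve_of_lt
    ((distAvoiding_le_pathDist hB0 x y).trans_lt hy)
  have key : Icc (0 : ℝ) 1 ⊆ {t | γ t ∈ F} := by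
    refine IsClosed.Icc_subset_of_forall_mem_nhdsGT_of_Icc_subset ?_ ?_ fun t ht hIcc => ?_
    · have := hγ.continuousOn.preimage_isClosed_of_isClosed isClosed_Icc hFc
      rwa [inter_comm] at this
    · rw [mem_ofPred_eq, h0]
      exact ⟨z₀, ⟨hz, Metric.mem_closedBall_self hl0.le⟩, c.left_inv hi⟩
    · have hFs : F ⊆ c.source := by
        rintro _ ⟨z, hz, rfl⟩
        exact c.map_target hz.1
      have hms : MapsTo γ (Icc 0 t) c.source := fun r hr => hFs (hIcc hr)
      obtain ⟨K, hK⟩ := hγ.lipschitz i 0 t le_rfl ht.1 ht.2.le hms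
      have hIcc01 : Icc 0 t ⊆ Icc (0 : ℝ) 1 := Icc_subset_Icc_right ht.2.le
      have hbd := ofReal_norm_sub_le_lintegral (σ := fun r => √lam * s r) ht.1 hK (by
        filter_upwards [ae_restrict_of_ae_restrict_of_subset hIcc01 hγ.avoids,
          ae_restrict_of_ae_restrict_of_subset hIcc01 (hγ.speed i),
          ae_restrict_mem measurableSet_Icc] with r hr1 hr2 hr3
        rw [hB, mem_ofPred_eq, not_not] at hr1
        rw [hr2 (hms hr3), ← Real.sqrt_mul hlam0.le]
        refine Real.le_sqrt_of_sq_le ?_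
        have := hr1 (hms hr3) (deriv (fun r => c.toFun (γ r)) r)
        rwa [inv_mul_le_iff₀ hlam0] at this)
      have hnorm : ‖c.toFun (γ t) - z₀‖ < l := by
        rw [h0] at hbd
        refine (ENNReal.ofReal_lt_ofReal_iff hl0).1 (hbd.trans_lt ?_)
        calc ∫⁻ r in Icc 0 t, ENNReal.ofReal (√lam * s r)
            ≤ ∫⁻ r in Icc (0 : ℝ) 1, ENNReal.ofReal (√lam * s r) :=
              lintegral_mono_set hIcc01
          _ = ENNReal.ofReal √lam * ∫⁻ r in Icc (0 : ℝ) 1, ENNReal.ofReal (s r) := by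
              simp only [ENNReal.ofReal_mul hsl.le]
              rw [lintegral_const_mul' _ _ ENNReal.ofReal_ne_top]
          _ < ENNReal.ofReal √lam * ENNReal.ofReal (l / √lam) :=
              ENNReal.mul_lt_mul_right (ENNReal.ofReal_pos.2 hsl).ne' ENNReal.ofReal_ne_top hlt
          _ = ENNReal.ofReal l := by
              rw [← ENNReal.ofReal_mul hsl.le, mul_div_cancel₀ _ hsl.ne']
      have hW : c.invFun '' (c.target ∩ Metric.ball z₀ l) ∈ 𝓝 (γ t) := by
        refine (isOpen_image_inv (c := c) Metric.isOpen_ball).mem_nhds ?_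
        have hts := hms ⟨ht.1, le_rfl⟩
        exact ⟨c.toFun (γ t), ⟨c.map_source hts, mem_ball_iff_norm.2 hnorm⟩, c.left_inv hts⟩
      have hnw := hγ.continuousOn t ⟨ht.1, ht.2.le⟩ hW
      have hle : 𝓝[>] t ≤ 𝓝[Icc 0 1] t := by
        refine nhdsWithin_le_of_mem (mem_of_superset (Ioc_mem_nhdsGT ht.2) ?_)
        exact fun r hr => ⟨ht.1.trans hr.1.le, hr.2⟩
      refine mem_of_superset (hle hnw) fun r hr => ?_
      exact image_mono (inter_subset_inter_right _ Metric.ball_subset_closedBall) hr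
  have := key (right_mem_Icc.2 zero_le_one)
  rwa [mem_ofPred_eq, h1] at this

end LRMetric

end

end

section

variable {ι : Type v} {M : Type u} [TopologicalSpace M] {d : ℕ} [NeZero d]

/-! ### The Euclidean radius -/

section

variable [MeasurableSpace M] [BorelSpace M] [Countable ι] {A : LipschitzAtlas ι M d}
  {g : LRMetric A} {c : ModelChart M d} {b : ℝ}

open ModelChart

namespace LRMetric

theorem IsEuclideanRadius.sub {x y : M} {r δ : ℝ} (h : g.IsEuclideanRadius x b r)
    (hxy : g.pathDist x y ≤ ENNReal.ofReal δ) (hδ : 0 ≤ δ) (hδr : δ < r) :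
    g.IsEuclideanRadius y b (r - δ) := by
  obtain ⟨-, hcomp, c, hc, -, hsub, hq⟩ := h
  have hb := ball_subset_ball_of_pathDist_le hxy hδ hδr.le
  exact ⟨sub_pos.2 hδr, hcomp.of_isClosed_subset isClosed_closure (closure_mono hb), c, hc,
    hsub (hb (g.mem_ball_self y (sub_pos.2 hδr))), hb.trans hsub, hq.mono hb⟩

theorem euclideanRadius_le_add (g : LRMetric A) (b : ℝ) (x y : M) :
    g.euclideanRadius x b ≤ g.euclideanRadius y b + g.pathDist x y := by
  rcases eq_or_ne (g.pathDist x y) ⊤ with htop | htop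
  · simp [htop]
  refine iSup₂_le fun r hr => ?_
  set δ := (g.pathDist x y).toReal with hδ
  have hδ' : ENNReal.ofReal δ = g.pathDist x y := ENNReal.ofReal_toReal htop
  have hδ0 : 0 ≤ δ := ENNReal.toReal_nonneg
  rcases le_or_gt r δ with h | h
  · exact (ENNReal.ofReal_le_ofReal h).trans (hδ'.le.trans le_add_self)
  · rw [← hδ', ← sub_add_cancel r δ, ENNReal.ofReal_add (sub_nonneg.2 h.le) hδ0]
    exact add_le_add (le_iSup₂_of_le (f := fun r (_ : g.IsEuclideanRadius y b r) => ENNReal.ofReal r)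
      (r - δ) (hr.sub hδ'.ge hδ0 h) le_rfl) le_rfl

theorem radius_le (g : LRMetric A) (b : ℝ) {ε₁ ε₂ : ℝ} (hε₂ : 0 < ε₂) (x : M) :
    g.radius b ε₁ ε₂ x ≤ ENNReal.ofReal (ε₁ / ε₂) := by
  rw [ENNReal.ofReal_div_of_pos hε₂]
  exact ENNReal.div_le_div_right (min_le_right _ _) _

theorem radius_ne_top (g : LRMetric A) (b : ℝ) {ε₁ ε₂ : ℝ} (hε₂ : 0 < ε₂) (x : M) :
    g.radius b ε₁ ε₂ x ≠ ⊤ :=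
  ne_top_of_le_ne_top ENNReal.ofReal_ne_top (g.radius_le b hε₂ x)

theorem radius_le_add (g : LRMetric A) (b : ℝ) {ε₁ ε₂ : ℝ} (hε₂ : 0 < ε₂) (x y : M) :
    g.radius b ε₁ ε₂ x ≤ g.radius b ε₁ ε₂ y + ENNReal.ofReal (1 / ε₂) * g.pathDist x y := by
  have h1 : min (g.euclideanRadius x b) (ENNReal.ofReal ε₁) ≤
      min (g.euclideanRadius y b) (ENNReal.ofReal ε₁) + g.pathDist x y := by
    rw [← min_add_add_right]
    exact min_le_min (g.euclideanRadius_le_add b x y) le_self_add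
  rw [ENNReal.ofReal_div_of_pos hε₂, ENNReal.ofReal_one, one_div, mul_comm, ← div_eq_mul_inv,
    radius, radius, ← ENNReal.add_div]
  exact ENNReal.div_le_div_right h1 _

/-- The rescaled Euclidean radius is Lipschitz for the path distance. -/
theorem edist_radius_le (g : LRMetric A) (b : ℝ) {ε₁ ε₂ : ℝ} (hε₂ : 0 < ε₂) (x y : M) :
    edist (g.radius b ε₁ ε₂ x).toReal (g.radius b ε₁ ε₂ y).toReal ≤
      ENNReal.ofReal (1 / ε₂) * g.pathDist x y := by
  have h1 := g.radius_le_add b (ε₁ := ε₁) hε₂ x y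
  have h2 := g.radius_le_add b (ε₁ := ε₁) hε₂ y x
  rw [pathDist_symm y x] at h2
  have hx := g.radius_ne_top b (ε₁ := ε₁) hε₂ x
  have hy := g.radius_ne_top b (ε₁ := ε₁) hε₂ y
  rcases eq_or_ne (ENNReal.ofReal (1 / ε₂) * g.pathDist x y) ⊤ with htop | htop
  · rw [htop]; exact le_top
  rw [edist_dist, Real.dist_eq]
  refine ENNReal.ofReal_le_of_le_toReal (abs_sub_le_iff.2 ⟨?_, ?_⟩)
  · have := ENNReal.toReal_mono (ENNReal.add_ne_top.2 ⟨hy, htop⟩) h1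
    rw [ENNReal.toReal_add hy htop] at this
    linarith
  · have := ENNReal.toReal_mono (ENNReal.add_ne_top.2 ⟨hx, htop⟩) h2
    rw [ENNReal.toReal_add hx htop] at this
    linarith

/-- Around `x` in a quasi-Euclidean ball, the image of the chart contains a definite ball of the
Euclidean space or of the half-space. -/
theorem exists_isModelSpace_of_ball_subset {x : M} {r : ℝ} (hr : 0 < r)
    (hcomp : IsCompact (closure (g.ball x r))) (hc : A.IsChart c) (hsub : g.ball x r ⊆ c.source)
    (hq : g.IsQuasiEuclideanOn c b (g.ball x r)) :
    ∃ H : Set (Euc d), IsModelSpace H ∧ c.target ⊆ H ∧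
      ∀ z ∈ H, √b * ‖z - c.toFun x‖ ≤ r / 2 → z ∈ c.target ∧ c.invFun z ∈ g.ball x r := by
  have hx : x ∈ c.source := hsub (g.mem_ball_self x hr)
  set z₀ := c.toFun x with hz₀
  have hz₀t : z₀ ∈ c.target := c.map_source hx
  have hxi : c.invFun z₀ = x := c.left_inv hx
  obtain ⟨O, H, hO, hH, hT⟩ := isModelSet_iff.1 c.isModelSet_target
  obtain ⟨O', hO', hO'e⟩ := continuousOn_iff'.1 c.continuousOn_invFun _ (g.isOpen_ball x r)
  refine ⟨H, hH, hT ▸ inter_subset_right, fun z hz hzr => ?_⟩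
  set V : Set (Euc d) := c.toFun '' g.ball x r with hV
  have hVm : IsModelSet V := isModelSet_image (g.isOpen_ball x r) hsub
  have hVt : V ⊆ c.target := by
    rintro _ ⟨y, hy, rfl⟩
    exact c.map_source (hsub hy)
  have hVi : c.invFun '' V = g.ball x r := by
    rw [hV, image_image]
    ext y
    constructor
    · rintro ⟨w, hw, rfl⟩
      exact mem_of_eq_of_mem (c.left_inv (hsub hw)) hw
    · exact fun hy => ⟨y, hy, c.left_inv (hsub hy)⟩
  have hVO : V = O' ∩ O ∩ H := by
    rw [inter_assoc, ← hT, ← hO'e]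
    ext w
    constructor
    · intro hw
      exact ⟨hVi.subset ⟨w, hw, rfl⟩, hVt hw⟩
    · rintro ⟨h1, h2⟩
      exact ⟨c.invFun w, h1, c.right_inv h2⟩
  set ζ : ℝ → Euc d := fun s => z₀ + s • (z - z₀) with hζ
  have hζc : Continuous ζ := by fun_prop
  have hζH : ∀ s ∈ Icc (0 : ℝ) 1, ζ s ∈ H := fun s hs =>
    hH.convex.segment_subset (hT ▸ hz₀t : z₀ ∈ O ∩ H).2 hz (by
      rw [segment_eq_image']; exact ⟨s, hs, rfl⟩)
  suffices hall : ∀ s ∈ Icc (0 : ℝ) 1, ζ s ∈ V by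
    have h1 := hall 1 (right_mem_Icc.2 zero_le_one)
    rw [show ζ 1 = z by simp [hζ]] at h1
    exact ⟨hVt h1, hVi.subset ⟨z, h1, rfl⟩⟩
  by_contra! hex
  set N : Set ℝ := Icc 0 1 ∩ ζ ⁻¹' (O' ∩ O)ᶜ with hN
  have hNc : IsCompact N := isCompact_Icc.inter_right ((hO'.inter hO).isClosed_compl.preimage hζc)
  have hNV : ∀ s ∈ Icc (0 : ℝ) 1, s ∈ N ↔ ζ s ∉ V := fun s hs => by
    simp only [hN, mem_inter_iff, hs, true_and, mem_preimage, mem_compl_iff, hVO, hζH s hs,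
      and_true]
  obtain ⟨s₁, hs₁, hs₁V⟩ := hex
  obtain ⟨s, hsN, hsmin⟩ := hNc.exists_isLeast ⟨s₁, (hNV s₁ hs₁).2 hs₁V⟩
  have hsI : s ∈ Icc (0 : ℝ) 1 := hsN.1
  have hsV : ζ s ∉ V := (hNV s hsI).1 hsN
  have hz₀V : z₀ ∈ V := ⟨x, g.mem_ball_self x hr, rfl⟩
  have hs0 : 0 < s := by
    refine lt_of_le_of_ne hsI.1 fun h => hsV ?_
    rw [← h]
    simpa [hζ] using hz₀V
  have hlt : ∀ s' ∈ Ico 0 s, ζ s' ∈ V := fun s' hs' => by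
    by_contra h
    exact absurd (hsmin ((hNV s' ⟨hs'.1, hs'.2.le.trans hsI.2⟩).2 h)) (not_le.2 hs'.2)
  have hdist : ∀ s' ∈ Ico 0 s, g.pathDist x (c.invFun (ζ s')) ≤ ENNReal.ofReal (r / 2) := by
    intro s' hs'
    have hseg : segment ℝ z₀ (ζ s') ⊆ V := by
      rw [segment_eq_image']
      rintro _ ⟨τ, hτ, rfl⟩
      have : z₀ + τ • (ζ s' - z₀) = ζ (τ * s') := by
        simp only [hζ, add_sub_cancel_left, smul_smul]
      change z₀ + τ • (ζ s' - z₀) ∈ V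
      rw [this]
      exact hlt _ ⟨mul_nonneg hτ.1 hs'.1, (mul_le_of_le_one_left hs'.1 hτ.2).trans_lt hs'.2⟩
    have h1 := pathDist_le_of_segment hc hVm hVt (hVi ▸ hq) hseg
    rw [hxi] at h1
    refine h1.trans (ENNReal.ofReal_le_ofReal (le_trans ?_ hzr))
    refine mul_le_mul_of_nonneg_left ?_ (Real.sqrt_nonneg _)
    simp only [hζ, add_sub_cancel_left, norm_smul, Real.norm_of_nonneg hs'.1]
    exact mul_le_of_le_one_left (norm_nonneg _) (hs'.2.le.trans hsI.2)
  have hIco : ∀ᶠ s' in 𝓝[<] s, s' ∈ Ico 0 s := Ico_mem_nhdsLT hs0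
  have hcl : ∀ᶠ s' in 𝓝[<] s, c.invFun (ζ s') ∈ closure (g.ball x r) := by
    filter_upwards [hIco] with s' hs'
    exact subset_closure (hVi.subset ⟨_, hlt s' hs', rfl⟩)
  obtain ⟨y, -, hy⟩ := hcomp.exists_mapClusterPt_of_frequently hcl.frequently
  have hyb : y ∈ g.ball x r := by
    have h1 := (hy.frequently (g.ball_mem_nhds y (show 0 < r / 4 by positivity))).and_eventually hIco
    obtain ⟨s', h2, h3⟩ := h1.exists
    have h4 : g.pathDist y (c.invFun (ζ s')) < ENNReal.ofReal (r / 4) := h2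
    have h5 : g.pathDist x y ≤ ENNReal.ofReal (r / 2) + ENNReal.ofReal (r / 4) := by
      refine (pathDist_triangle x (c.invFun (ζ s')) y).trans (add_le_add (hdist s' h3) ?_)
      rw [pathDist_symm]
      exact h4.le
    refine h5.trans_lt ?_
    rw [← ENNReal.ofReal_add (by positivity) (by positivity)]
    exact (ENNReal.ofReal_lt_ofReal_iff hr).2 (by linarith)
  have hcy : ContinuousAt c.toFun y :=
    c.continuousOn_toFun.continuousAt (c.open_source.mem_nhds (hsub hyb))
  have h1 : MapClusterPt (c.toFun y) (𝓝[<] s) (c.toFun ∘ fun s' => c.invFun (ζ s')) :=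
    hy.continuousAt_comp hcy
  have h2 : Tendsto (c.toFun ∘ fun s' => c.invFun (ζ s')) (𝓝[<] s) (𝓝 (ζ s)) := by
    refine ((hζc.tendsto s).mono_left nhdsWithin_le_nhds).congr' ?_
    filter_upwards [hIco] with s' hs'
    exact (c.right_inv (hVt (hlt s' hs'))).symm
  have h3 : c.toFun y = ζ s := by
    by_contra hne
    have hd := disjoint_nhds_nhds.2 hne
    have h4 : NeBot (𝓝 (c.toFun y) ⊓ 𝓝 (ζ s)) := NeBot.mono h1 (inf_le_inf_left _ h2)
    exact h4.ne hd.eq_bot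
  exact hsV (h3 ▸ ⟨y, hyb, rfl⟩)

variable [T2Space M]

theorem euclideanRadius_pos (hc : A.IsChart c) {x : M} (hx : x ∈ c.source)
    (hq : g.IsQuasiEuclideanOn c b c.source) : 0 < g.euclideanRadius x b := by
  have hz : c.toFun x ∈ c.target := c.map_source hx
  obtain ⟨δ, hδ, hconv⟩ := c.isModelSet_target.exists_closedBall hz
  have hk := (hconv δ le_rfl).2
  have hU : c.invFun '' (c.target ∩ Metric.ball (c.toFun x) δ) ∈ 𝓝 x :=
    (isOpen_image_inv Metric.isOpen_ball).mem_nhds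
      ⟨c.toFun x, ⟨hz, Metric.mem_ball_self hδ⟩, c.left_inv hx⟩
  obtain ⟨r, hr, hsub⟩ := g.exists_ball_subset hU
  have hsub' : g.ball x r ⊆ c.invFun '' (c.target ∩ Metric.closedBall (c.toFun x) δ) :=
    hsub.trans (image_mono (inter_subset_inter_right _ Metric.ball_subset_closedBall))
  have hsrc : g.ball x r ⊆ c.source := by
    refine hsub'.trans ?_
    rintro _ ⟨z, hz, rfl⟩
    exact c.map_target hz.1
  refine lt_of_lt_of_le (ENNReal.ofReal_pos.2 hr) (le_iSup₂_of_le r ⟨hr, ?_, c, hc, hx, hsrc,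
    hq.mono hsrc⟩ le_rfl)
  exact (hk.image_of_continuousOn (c.continuousOn_invFun.mono inter_subset_left)).of_isClosed_subset
    isClosed_closure (closure_minimal hsub' (isClosed_image_inv hk inter_subset_left))

theorem radius_pos (hc : A.IsChart c) {x : M} (hx : x ∈ c.source)
    (hq : g.IsQuasiEuclideanOn c b c.source) {ε₁ ε₂ : ℝ} (hε₁ : 0 < ε₁) :
    0 < g.radius b ε₁ ε₂ x :=
  ENNReal.div_pos (lt_min (euclideanRadius_pos hc hx hq) (ENNReal.ofReal_pos.2 hε₁)).ne'
    ENNReal.ofReal_ne_top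

/-! ### The heat kernel bound -/

/-- The constant in the heat kernel bound. -/
def kernelConst (b : ℝ) (d : ℕ) [NeZero d] : ℝ := 4 ^ d * holderConst b d * (4 * √b) ^ d

theorem kernelConst_pos (hb : 1 ≤ b) : 0 < kernelConst b d := by
  have := holderConst_pos (d := d) hb
  have h1 : 0 < √b := Real.sqrt_pos.2 (by linarith)
  unfold kernelConst
  positivity

theorem IsEuclideanRadius.kernel_le {x : M} {r : ℝ} (h : g.IsEuclideanRadius x b r) (hb : 1 ≤ b)
    {p : ℝ → M → M → ℝ} (hp : g.IsHeatKernel p) {σ t : ℝ} (hσ : 0 < σ) (hσr : σ ≤ r)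
    (ht : σ ^ 2 ≤ t) (y : M) : p t x y ≤ kernelConst b d * (σ ^ d)⁻¹ := by
  obtain ⟨hr, hcomp, c, hc, hx, hsub, hq⟩ := h
  have hsb : 1 ≤ √b := Real.one_le_sqrt.2 hb
  have ht0 : 0 < t := (pow_pos hσ 2).trans_le ht
  set ρ := σ / (4 * √b) with hρ
  have hρ0 : 0 < ρ := by positivity
  have hρσ : ρ ≤ σ := div_le_self hσ.le (by linarith)
  have hρt : ρ ^ 2 ≤ t := (pow_le_pow_left₀ hρ0.le hρσ 2).trans ht
  have hρb : √b * (2 * ρ) = σ / 2 := by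
    rw [hρ]; field_simp; ring
  set C := 4 ^ d * holderConst b d * (ρ ^ d)⁻¹ with hC
  have hCe : kernelConst b d * (σ ^ d)⁻¹ = C := by
    rw [hC, kernelConst, hρ, div_pow, inv_div]
    field_simp
  rw [hCe]
  set z₀ := c.toFun x with hz₀
  have hz₀t : z₀ ∈ c.target := c.map_source hx
  obtain ⟨H, hH, hTH, hin⟩ := exists_isModelSpace_of_ball_subset hr hcomp hc hsub hq
  have hin' : ∀ z ∈ H ∩ Metric.closedBall z₀ (2 * ρ), z ∈ c.target ∧ c.invFun z ∈ g.ball x r := by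
    intro z hz
    refine hin z hz.1 ?_
    have h1 := mul_le_mul_of_nonneg_left (mem_closedBall_iff_norm.1 hz.2) (Real.sqrt_nonneg b)
    linarith
  have hTe : c.target ∩ Metric.closedBall z₀ (2 * ρ) = H ∩ Metric.closedBall z₀ (2 * ρ) :=
    Subset.antisymm (inter_subset_inter_left _ hTH) fun z hz => ⟨(hin' z hz).1, hz.2⟩
  have hk : IsCompact (c.target ∩ Metric.closedBall z₀ (2 * ρ)) := by
    rw [hTe]
    exact (isCompact_closedBall _ _).inter_left hH.isClosed
  have hq' : g.IsQuasiEuclideanOn c b (c.cball z₀ (2 * ρ)) := by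
    refine hq.mono ?_
    rintro _ ⟨z, hz, rfl⟩
    exact (hin' z (hTe ▸ hz)).2
  by_contra! hlt
  obtain ⟨a, hCa, hap⟩ := exists_between hlt
  have hcont : Continuous fun w : M × M => p t w.1 w.2 := by
    have : Continuous fun w : M × M => ((t, w) : ℝ × M × M) := by fun_prop
    exact hp.1.comp_continuous this fun w => ⟨ht0, mem_univ _⟩
  have hnhds : {w : M × M | a < p t w.1 w.2} ∈ 𝓝 (x, y) :=
    (isOpen_lt continuous_const hcont).mem_nhds hap
  rw [nhds_prod_eq, mem_prod_iff] at hnhds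
  obtain ⟨U, hU, W, hW, hUW⟩ := hnhds
  have := g.isLocallyFiniteMeasure_vol
  have := g.isOpenPosMeasure_vol
  obtain ⟨W₁, hW₁, hW₁f⟩ := g.vol.finiteAt_nhds y
  obtain ⟨W₂, hW₂, hW₂o, hyW₂⟩ := mem_nhds_iff.1 (inter_mem hW hW₁)
  have hfin : g.vol W₂ ≠ ⊤ :=
    ((measure_mono (hW₂.trans inter_subset_right)).trans_lt hW₁f).ne
  have hpos : 0 < g.vol.real W₂ :=
    ENNReal.toReal_pos (hW₂o.measure_pos _ ⟨y, hyW₂⟩).ne' hfin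
  set f : Lp ℝ 2 g.vol := indicatorConstLp 2 hW₂o.measurableSet hfin (1 : ℝ) with hf
  have hfe : f =ᵐ[g.vol] W₂.indicator fun _ => (1 : ℝ) := indicatorConstLp_coeFn
  have hind : Integrable (W₂.indicator fun _ => (1 : ℝ)) g.vol :=
    (integrable_indicator_iff hW₂o.measurableSet).2 (integrableOn_const hfin)
  obtain ⟨u, hu, hrep⟩ := hp.2 f
  have hbound := hu.ae_abs_le_of_integral_le (fun f => (hp.2 f).imp fun u hu => hu.1)
    zero_le_one (by
      filter_upwards [hfe] with w hw
      rw [hw]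
      by_cases hmem : w ∈ W₂ <;> simp [hmem]) (hind.congr hfe.symm) hpos (by
      rw [integral_congr_ae (g := W₂.indicator fun _ => (1 : ℝ)) (by
        filter_upwards [hfe] with w hw
        rw [hw]
        by_cases hmem : w ∈ W₂ <;> simp [hmem]), integral_indicator hW₂o.measurableSet]
      simp) hc hb hρ0 hk hq' hρt
  have hball : c.invFun '' (c.target ∩ Metric.ball z₀ ρ) ∈ 𝓝 x :=
    (isOpen_image_inv Metric.isOpen_ball).mem_nhds
      ⟨z₀, ⟨hz₀t, Metric.mem_ball_self hρ0⟩, c.left_inv hx⟩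
  have hmeas := Measure.measure_pos_of_mem_nhds g.vol (inter_mem hU hball)
  obtain ⟨x', ⟨hx'U, hx'b⟩, hx'1, hx'i, hx'2⟩ : ∃ x' ∈ U ∩ c.invFun '' (c.target ∩ Metric.ball z₀ ρ),
      (x' ∈ c.cball z₀ ρ → |u t x'| ≤ C * g.vol.real W₂) ∧
      Integrable (fun y => p t x' y * f y) g.vol ∧ u t x' = ∫ y, p t x' y * f y ∂g.vol := by
    by_contra! hcon
    refine hmeas.ne' (measure_mono_null (fun x' hx' => ?_)
      (ae_iff.1 (hbound.and (hrep t ht0))))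
    intro h1
    exact hcon x' hx' h1.1 h1.2.1 h1.2.2
  have h1 := hx'1 (image_mono (inter_subset_inter_right _ Metric.ball_subset_closedBall) hx'b)
  have h2 : ∫ y, p t x' y * f y ∂g.vol = ∫ y in W₂, p t x' y ∂g.vol := by
    rw [← integral_indicator hW₂o.measurableSet]
    refine integral_congr_ae ?_
    filter_upwards [hfe] with w hw
    rw [hw]
    by_cases hmem : w ∈ W₂ <;> simp [hmem]
  have h3 : IntegrableOn (fun y => p t x' y) W₂ g.vol := by
    refine (integrable_indicator_iff hW₂o.measurableSet).1 (hx'i.congr ?_)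
    filter_upwards [hfe] with w hw
    rw [hw]
    by_cases hmem : w ∈ W₂ <;> simp [hmem]
  have h4 : a * g.vol.real W₂ ≤ ∫ y in W₂, p t x' y ∂g.vol := by
    have := setIntegral_mono_on (integrableOn_const hfin (C := a)) h3 hW₂o.measurableSet
      fun w hw => (show a < p t x' w from hUW (show (x', w) ∈ U ×ˢ W from
        ⟨hx'U, (hW₂ hw).1⟩)).le
    rwa [setIntegral_const, smul_eq_mul, mul_comm] at this
  rw [hx'2, h2] at h1
  have h5 := (h4.trans (le_abs_self _)).trans h1
  exact absurd (le_of_mul_le_mul_right h5 hpos) (not_le.2 hCa)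

theorem IsHeatKernel.ofReal_le {p : ℝ → M → M → ℝ} (hp : g.IsHeatKernel p) (hb : 1 ≤ b)
    {ε₁ ε₂ : ℝ} (hε₂ : 1 < ε₂) (x y : M) {t : ℝ} (ht : 0 < t) :
    ENNReal.ofReal (p t x y) ≤ ENNReal.ofReal (kernelConst b d) *
      (min (ENNReal.ofReal t) (g.radius b ε₁ ε₂ x ^ 2)) ^ (-((d : ℝ) / 2)) := by
  have hd : (0 : ℝ) < d := Nat.cast_pos.2 (NeZero.pos d)
  have hC : 0 < kernelConst b d := kernelConst_pos hb
  set R := g.radius b ε₁ ε₂ x with hR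
  rcases eq_or_ne R 0 with h0 | h0
  · rw [h0, zero_pow two_ne_zero, min_eq_right zero_le, ENNReal.zero_rpow_of_neg (by linarith),
      ENNReal.mul_top (ENNReal.ofReal_pos.2 hC).ne']
    exact le_top
  have htop : R ≠ ⊤ := g.radius_ne_top b (by linarith) x
  have hRr : 0 < R.toReal := ENNReal.toReal_pos h0 htop
  have hlt : R < g.euclideanRadius x b := by
    have h1 : R * ENNReal.ofReal ε₂ ≤ g.euclideanRadius x b := by
      rw [hR, radius, ENNReal.div_mul_cancel (ENNReal.ofReal_pos.2 (by linarith)).ne'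
        ENNReal.ofReal_ne_top]
      exact min_le_left _ _
    refine lt_of_lt_of_le ?_ h1
    rw [← ENNReal.ofReal_toReal htop, ← ENNReal.ofReal_mul hRr.le]
    exact (ENNReal.ofReal_lt_ofReal_iff (by positivity)).2 (by nlinarith)
  simp only [euclideanRadius, lt_iSup_iff] at hlt
  obtain ⟨r, hr, hRlt⟩ := hlt
  have hRlt' : R.toReal < r := (ENNReal.lt_ofReal_iff_toReal_lt htop).1 hRlt
  set σ := min (√t) R.toReal with hσ
  have hσ0 : 0 < σ := lt_min (Real.sqrt_pos.2 ht) hRr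
  have hσt : σ ^ 2 ≤ t := by
    calc σ ^ 2 ≤ (√t) ^ 2 := pow_le_pow_left₀ hσ0.le (min_le_left _ _) 2
      _ = t := Real.sq_sqrt ht.le
  have hmin : min (ENNReal.ofReal t) (R ^ 2) = ENNReal.ofReal (σ ^ 2) := by
    rw [← ENNReal.ofReal_toReal htop, ← ENNReal.ofReal_pow hRr.le, ← ENNReal.ofReal_min]
    congr 1
    rcases le_total (√t) R.toReal with h | h
    · have h1 := pow_le_pow_left₀ (Real.sqrt_nonneg t) h 2
      rw [Real.sq_sqrt ht.le] at h1
      rw [hσ, min_eq_left h, Real.sq_sqrt ht.le, min_eq_left h1]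
    · have h1 := pow_le_pow_left₀ hRr.le h 2
      rw [Real.sq_sqrt ht.le] at h1
      rw [hσ, min_eq_right h, min_eq_right h1]
  have hpow : ENNReal.ofReal (σ ^ 2) ^ (-((d : ℝ) / 2)) = ENNReal.ofReal (σ ^ d)⁻¹ := by
    rw [ENNReal.ofReal_rpow_of_pos (by positivity), Real.rpow_neg (by positivity),
      ← Real.rpow_natCast σ 2, ← Real.rpow_mul hσ0.le, ← Real.rpow_natCast σ d]
    congr 3
    push_cast
    ring
  rw [hmin, hpow, ← ENNReal.ofReal_mul hC.le]
  exact ENNReal.ofReal_le_ofReal (hr.kernel_le hb hp hσ0 ((min_le_right _ _).trans hRlt'.le) hσt y)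

end LRMetric

end

end

end LipRiem

end

theorem theorem3 (d : ℕ) [NeZero d] (b : ℝ) (hb : 1 < b) :
    ∃ C : ℝ, 0 < C ∧
      ∀ (M : Type u) [TopologicalSpace M] [T2Space M] [SecondCountableTopology M]
        [ConnectedSpace M] [MeasurableSpace M] [BorelSpace M]
        (ι : Type v) [Countable ι] (A : LipRiem.LipschitzAtlas ι M d) (g : LipRiem.LRMetric A)
        (ε₁ ε₂ : ℝ), 0 < ε₁ → 1 < ε₂ →
        -- `R` is bounded
        (∀ x, g.radius b ε₁ ε₂ x ≤ ENNReal.ofReal (ε₁ / ε₂)) ∧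
        -- `R` is Lipschitz with constant `1 / ε₂` for the path distance
        (∀ x y, edist (g.radius b ε₁ ε₂ x).toReal (g.radius b ε₁ ε₂ y).toReal ≤
          ENNReal.ofReal (1 / ε₂) * g.pathDist x y) ∧
        -- `R x` is positive as soon as some chart around `x` is `b`-close to Euclidean
        (∀ x, (∃ c : LipRiem.ModelChart M d, A.IsChart c ∧ x ∈ c.source ∧
            g.IsQuasiEuclideanOn c b c.source) → 0 < g.radius b ε₁ ε₂ x) ∧
        -- the heat kernel bound; `0 ^ (-d/2) = ∞` where `R x = 0`
        ∀ p : ℝ → M → M → ℝ, g.IsHeatKernel p → ∀ (x y : M) (t : ℝ), 0 < t →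
          ENNReal.ofReal (p t x y) ≤ ENNReal.ofReal C *
            (min (ENNReal.ofReal t) (g.radius b ε₁ ε₂ x ^ 2)) ^ (-((d : ℝ) / 2)) := by
  have hC := LipRiem.LRMetric.kernelConst_pos (d := d) hb.le
  refine ⟨LipRiem.LRMetric.kernelConst b d, hC, ?_⟩
  intro M _ _ _ _ _ _ ι _ A g ε₁ ε₂ hε₁ hε₂
  have hε₂0 : 0 < ε₂ := one_pos.trans hε₂
  refine ⟨g.radius_le b hε₂0, g.edist_radius_le b hε₂0, ?_, ?_⟩
  · rintro x ⟨c, hc, hx, hq⟩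
    exact LipRiem.LRMetric.radius_pos hc hx hq hε₁
  · exact fun p hp x y t ht => hp.ofReal_le hb.le hε₂ x y ht
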